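/- Fix $d\ge 0$ and write $\mathcal P_2(S)$ for the probability measures on $S$ with finite second moment, $\mathcal W_2$ for the Wasserstein distance and $[\theta]$ for the law of a random variable $\theta$. Let $T>0$ and let $b(x,y,\nu)\in\mathbb R^d$, $\sigma(x,\mu)\in\mathbb R^{d\times d}$, $f(x,y,z,\nu)\in\mathbb R$, $g(x,\mu)\in\mathbb R$ be defined for $x,z\in\mathbb R^d$, $y\in\mathbb R$, $\mu\in\mathcal P_2(\mathbb R^d)$, $\nu\in\mathcal P_2(\mathbb R^d\times\mathbb R)$; put $a=\sigma\sigma^\dagger$. Let $\alpha\ge 1$, and let $\mathcal U:[0,T]\times\mathbb R^d\times\mathcal P_2(\mathbb R^d)\to\mathbb R$. **Assumptions.** (H0) $b,\sigma,f,g$ are $\Lambda$-Lipschitz in all variables (with $\mathcal W_2$ for measures), and $|\sigma|\le\Lambda$. (H1) $\mathcal U$ is a classical solution of the master equation: with $\nu_t$ the image of $\mu$ under $v\mapsto(v,\mathcal U(t,v,\mu))$, for $t\in[0,T)$, $$\partial_t\mathcal U+b(x,\mathcal U,\nu_t)\cdot\partial_x\mathcal U+\tfrac12\mathrm{Tr}[\partial^2_{xx}\mathcal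 U\,a(x,\mu)]+f(x,\mathcal U,\sigma^\dagger(x,\mu)\partial_x\mathcal U,\nu_t)+\int\partial_\mu\mathcal U(t,x,\mu)(v)\cdot b(v,\mathcal U(t,v,\mu),\nu_t)\,d\mu(v)+\int\tfrac12\mathrm{Tr}[\partial_v\partial_\mu\mathcal U(t,x,\mu)(v)a(v,\mu)]\,d\mu(v)=0,$$ and $\mathcal U(T,\cdot)=g$. Here $\partial_\mu\mathcal U$ is the Lions derivative (obtained from Fréchet differentiability of the lifting $X\mapsto \mathcal U(t,x,[X])$ on $L^2$), $v\mapsto\partial_\mu\mathcal U(t,x,\mu)(v)$ is differentiable, $\mathcal U,\partial_x\mathcal U,\partial^2_{xx}\mathcal U$ are jointly continuous on $[0,T]\times\mathbb R^d\times\mathcal P_2(\mathbb R^d)$, $\partial_t\mathcal U$ is so on $[0,T)\times\mathbb R^d\times\mathcal P_2(\mathbb R^d)$, and $\partial_\mu\mathcal U,\partial_v\partial_\mu\mathcal U$ are continuous at all $(t,x,\mu,v)$ with $v\in\mathrm{supp}\,\mu$. Moreover, for all arguments, with $\|\mu\|_2=(\int|v|^2d\mu)^{1/2}$: $|\mathcal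 U(t,x,\mu)-\mathcal U(t,x,\mu')|+|\partial_x\mathcal U(t,x,\mu)-\partial_x\mathcal U(t,x,\mu')|\le\Lambda\mathcal W_2(\mu,\mu')$; $|\partial_x\mathcal U|+\|\partial_\mu\mathcal U(t,x,\mu)(\cdot)\|_{L^2(\mu)}\le\Lambda$; $|\partial^2_{xx}\mathcal U|+\|\partial_v\partial_\mu\mathcal U(t,x,\mu)(\cdot)\|_{L^2(\mu)}\le\Lambda$; $|\partial^2_{xx}\mathcal U(t,x,\mu)-\partial^2_{xx}\mathcal U(t,x',\mu)|\le\Lambda|x-x'|$; $|\mathcal U(t+h,x,\mu)-\mathcal U(t,x,\mu)|+|\partial_x\mathcal U(t+h,x,\mu)-\partial_x\mathcal U(t,x,\mu)|\le\Lambda h^{1/2}(1+|x|+\|\mu\|_2)$ for $h\in[0,T)$, $t\in[0,T-h]$; $|\partial_v\partial_\mu\mathcal U(t,x,\mu)(v)-\partial_v\partial_\mu\mathcal U(t,x,\mu)(v')|\le\Lambda\{1+|v|^{2\alpha}+|v'|^{2\alpha}+\|\mu\|_2^{2\alpha}\}^{1/2}|v-v'|$. (H2) Either $\alpha=1$, or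 $g$ and $f(\cdot,0,0,[\cdot,0])$ are bounded. **Algorithm.** Let $N,J\ge1$, $\delta=T/N$, $r_k=k\delta$, and let $\pi=\{0=t_0<\dots<t_n=T\}$ be a grid containing all $r_k$, $t_{j_k}=r_k$, $h_i=t_{i+1}-t_i$, $|\pi|=\max_i h_i$. Let $\xi^{|\pi|}\sim\mu^{|\pi|}=\sum_{\ell=1}^Mp_\ell\delta_{x^\ell}$ with all $p_\ell>0$, and let $\varpi_0,\dots,\varpi_{n-1}$ be i.i.d., independent of $\xi^{|\pi|}$, taking finitely many values, bounded by $\Lambda$, centred, with identity covariance (quantized normalized Brownian increments); $\Delta\bar W_i=h_i^{1/2}\varpi_i$. The samples of $(\xi^{|\pi|},\varpi_0,\dots,\varpi_{n-1})$ form a family of trees with roots $x^1,\dots,x^M$; $\mathbb E_{t_i}$ is the conditional expectation given $\xi^{|\pi|},\varpi_0,\dots,\varpi_{i-1}$. The local solver on $[r_k,r_{k+1}]$ with input process $\bar{\mathfrak X}$, terminal value $\eta$ and driver $\phi$ returns $(\bar X,\bar Y,\bar Z)$ with $\bar Y_{r_{k+1}}=\eta$, $\bar Z_{r_{k+1}}=0$,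 $\bar X_{r_k}=\bar{\mathfrak X}_{r_k}$ and, for $j_k\le i<j_{k+1}$, $$\bar Y_{t_i}=\mathbb E_{t_i}\big[\bar Y_{t_{i+1}}+h_i\phi(\bar{\mathfrak X}_{t_i},\bar Y_{t_i},\bar Z_{t_i},[\bar{\mathfrak X}_{t_i},\bar Y_{t_i}])\big],\qquad \bar Z_{t_i}=\mathbb E_{t_i}\big[h_i^{-1}\Delta\bar W_i\,\bar Y_{t_{i+1}}\big],$$ $$\bar X_{t_{i+1}}=\bar X_{t_i}+h_ib(\bar X_{t_i},\bar Y_{t_i},[\bar X_{t_i},\bar Y_{t_i}])+\sigma(\bar X_{t_i},[\bar X_{t_i}])\Delta\bar W_i .$$ The solver is defined by $\mathrm{Sol}_N(\xi)=g(\xi,[\xi])$ and, for $k<N$: let $\bar X^{k,0}$ be the forward output of the local solver with input $\xi$, terminal value $0$ and driver $0$; for $1\le j\le J$ let $(\bar X^{k,j},\bar Y^{k,j},\bar Z^{k,j})$ be the output of the local solver with input $\bar X^{k,j-1}$, terminal value $\mathrm{Sol}_{k+1}(\bar X^{k,j-1}_{r_{k+1}})$ and driver $f$; put $\mathrm{Sol}_k(\xi)=\bar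 Y^{k,J}_{r_k}$. **Theorem.** There are constants $C_\Lambda,c_\Lambda>0$ and a continuous non-decreasing $\mathfrak B:\mathbb R_+\to\mathbb R_+$ with $\mathfrak B(0)=0$, depending only on $\Lambda$, $\alpha$ and $d$, and for all $T,b,\sigma,f,g,\mathcal U$ satisfying (H0), (H1), (H2) a constant $C>0$ which does not depend on the discretization ($N$, $J$, $\pi$, the law of the $\varpi_i$, $\mu^{|\pi|}$) such that the following holds whenever $\bar\delta:=C_\Lambda\delta<\min(c_\Lambda,1)$ and, for some $\beta>0$ with $\beta\ge\mathfrak B(\bar\delta)$, $$(J-1)\big(\Lambda\bar\delta^J+e^{\beta\bar\delta}C|\pi|^{1/2}\big)\frac{e^{\beta C_\Lambda T}}{e^{\beta\bar\delta}-1}\le1 .$$ The algorithm $\mathrm{Sol}_0(\xi^{|\pi|})$ is well posed and its output is constant, equal to a number $y^\ell$, on the tree rooted at $x^\ell$, for each $\ell$. For all $x\in\mathbb R^d$, $\mu\in\mathcal P_2(\mathbb R^d)$ and all $\bar\ell$ with $|x^{\bar\ell}-x|=\min_\ell|x^\ell-x|$, $$|\mathcal U(0,x,\mu)-y^{\bar\ell}|\le\mathcal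 E_1+\mathcal E_2,\qquad |\mathcal U(0,x,\mu)-\mathcal U(0,x^{\bar\ell},\mu^{|\pi|})|\le\mathcal E_1:=C\big(\min_\ell|x^\ell-x|+\mathcal W_2(\mu^{|\pi|},\mu)\big),$$ where $\mathcal E_2:=|y^{\bar\ell}-\mathcal U(0,x^{\bar\ell},\mu^{|\pi|})|$ satisfies: * if $g$ and $f(\cdot,0,0,[\cdot,0])$ are bounded, $\ \mathcal E_2\le C\big((C\delta)^{J-1}+|\pi|^{1/2}\delta^{-1}(1+|x^{\bar\ell}|+\|\xi^{|\pi|}\|_{2\alpha}^{\alpha})\big)$; * if $\alpha=1$, $\ \mathcal E_2\le C\big((C\delta)^{J-1}+|\pi|^{1/2}\delta^{-1}\big)\big(1+|x^{\bar\ell}|+\|\xi^{|\pi|}\|_{2}\big)$. -/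

import Mathlib

open MeasureTheory Set
open scoped ENNReal

namespace MKV

noncomputable section

/-! ### Spaces, square-integrable laws and the Wasserstein distance -/

/-- The state space `ℝ^d` with its Euclidean norm. -/
abbrev E (d : ℕ) : Type := EuclideanSpace ℝ (Fin d)

/-- The space `ℝ^d × ℝ` of pairs `(x, y)` with its Euclidean norm. -/
abbrev EY (d : ℕ) : Type := WithLp 2 (E d × ℝ)

/-- The point `(x, y)` of `ℝ^d × ℝ`. -/
def pair {d : ℕ} (x : E d) (y : ℝ) : EY d := WithLp.toLp 2 (x, y)

/-- `μ ∈ 𝒫₂(S)`: a probability measure with a finite moment of order two. -/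
structure IsP2 {S : Type} [NormedAddCommGroup S] [MeasurableSpace S] (μ : Measure S) : Prop where
  prob : IsProbabilityMeasure μ
  moment : ∫⁻ x, ‖x‖ₑ ^ 2 ∂μ < ∞

/-- The Wasserstein distance `𝒲₂(μ, ν)`: infimum over the couplings of `μ` and `ν`. -/
def W2 {S : Type} [NormedAddCommGroup S] [MeasurableSpace S] (μ ν : Measure S) : ℝ :=
  ((⨅ π ∈ {π : Measure (S × S) | π.map Prod.fst = μ ∧ π.map Prod.snd = ν},
    ∫⁻ p, ‖p.1 - p.2‖ₑ ^ 2 ∂π) ^ (1 / 2 : ℝ)).toReal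

/-- `‖ξ‖₂` for a random vector `ξ ∼ μ`. -/
def m2 {d : ℕ} (μ : Measure (E d)) : ℝ := (eLpNorm (fun x : E d => x) 2 μ).toReal

/-! ### The coefficients -/

/-- The coefficients `b, σ, f, g`. Only their values at measures in `𝒫₂` are relevant; measures on
`EY d` play the role of the joint law of `(X, Y)`. -/
structure Coeffs (d : ℕ) where
  b : E d → ℝ → Measure (EY d) → E d
  σ : E d → Measure (E d) → (E d →L[ℝ] E d)
  f : E d → ℝ → E d → Measure (EY d) → ℝ
  g : E d → Measure (E d) → ℝ

/-- The coefficients are `Λ`-Lipschitz continuous in all the variables and `σ` is bounded by `Λ`. -/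
structure H0 {d : ℕ} (Λ : ℝ) (c : Coeffs d) : Prop where
  lip_b : ∀ x x' y y' ν ν', IsP2 ν → IsP2 ν' →
    ‖c.b x y ν - c.b x' y' ν'‖ ≤ Λ * (‖x - x'‖ + |y - y'| + W2 ν ν')
  lip_σ : ∀ x x' μ μ', IsP2 μ → IsP2 μ' →
    ‖c.σ x μ - c.σ x' μ'‖ ≤ Λ * (‖x - x'‖ + W2 μ μ')
  lip_f : ∀ x x' y y' z z' ν ν', IsP2 ν → IsP2 ν' →
    |c.f x y z ν - c.f x' y' z' ν'| ≤ Λ * (‖x - x'‖ + |y - y'| + ‖z - z'‖ + W2 ν ν')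
  lip_g : ∀ x x' μ μ', IsP2 μ → IsP2 μ' →
    |c.g x μ - c.g x' μ'| ≤ Λ * (‖x - x'‖ + W2 μ μ')
  bdd_σ : ∀ x μ, IsP2 μ → ‖c.σ x μ‖ ≤ Λ

/-- `g` and `f(·, 0, 0, [·, 0])` are bounded. -/
def BoundedData {d : ℕ} (c : Coeffs d) : Prop :=
  ∃ K : ℝ, (∀ x μ, IsP2 μ → |c.g x μ| ≤ K) ∧
    ∀ x μ, IsP2 μ → |c.f x 0 0 (μ.map fun v => pair v 0)| ≤ K

/-! ### Derivatives in the measure argument and classical solutions -/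

/-- The lifting of `u : 𝒫₂(ℝ^d) → ℝ` to the square-integrable random vectors on the atomless
probability space `[0, 1]`, `X ↦ u([X])`. -/
def lift {d : ℕ} (u : Measure (E d) → ℝ)
    (X : Lp (E d) 2 (volume : Measure unitInterval)) : ℝ :=
  u ((volume : Measure unitInterval).map X)

/-- `D` is the Lions derivative of `u`: the lifting of `u` is Fréchet differentiable at every `X`,
and its derivative at `X` is represented by the random vector `D [X] (X)`. -/
def IsLionsDeriv {d : ℕ} (u : Measure (E d) → ℝ) (D : Measure (E d) → E d → E d) : Prop :=
  ∀ X : Lp (E d) 2 (volume : Measure unitInterval),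
    MemLp (D ((volume : Measure unitInterval).map X)) 2 ((volume : Measure unitInterval).map X) ∧
    ∃ L : Lp (E d) 2 (volume : Measure unitInterval) →L[ℝ] ℝ,
      HasFDerivAt (lift u) L X ∧
      ∀ Y : Lp (E d) 2 (volume : Measure unitInterval),
        L Y = ∫ s, inner ℝ (D ((volume : Measure unitInterval).map X) (X s)) (Y s)

/-- Candidates for the derivatives of `𝒰`: `∂_t 𝒰`, `∂_x 𝒰` (gradient), `∂²_{xx} 𝒰` (Hessian),
`∂_μ 𝒰(t, x, μ)(v)` and `∂_v ∂_μ 𝒰(t, x, μ)(v)`. -/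
structure Derivs (d : ℕ) where
  dt : ℝ → E d → Measure (E d) → ℝ
  dx : ℝ → E d → Measure (E d) → E d
  dxx : ℝ → E d → Measure (E d) → (E d →L[ℝ] E d)
  dμ : ℝ → E d → Measure (E d) → E d → E d
  dvdμ : ℝ → E d → Measure (E d) → E d → (E d →L[ℝ] E d)

/-- Joint continuity of `F(t, x, μ)` on `I × ℝ^d × 𝒫₂(ℝ^d)`. -/
def JointCont {d : ℕ} {V : Type} [NormedAddCommGroup V] (I : Set ℝ)
    (F : ℝ → E d → Measure (E d) → V) : Prop :=
  ∀ t ∈ I, ∀ x μ, IsP2 μ → ∀ ε > 0, ∃ η > 0, ∀ t' ∈ I, ∀ x' μ', IsP2 μ' →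
    |t' - t| < η → ‖x' - x‖ < η → W2 μ' μ < η → ‖F t' x' μ' - F t x μ‖ < ε

/-- Joint continuity of `F(t, x, μ)(v)` at every point `(t, x, μ, v)` of
`I × ℝ^d × 𝒫₂(ℝ^d) × ℝ^d` such that `v` is in the support of `μ`. -/
def JointContSupp {d : ℕ} {V : Type} [NormedAddCommGroup V] (I : Set ℝ)
    (F : ℝ → E d → Measure (E d) → E d → V) : Prop :=
  ∀ t ∈ I, ∀ x μ, IsP2 μ → ∀ v ∈ μ.support, ∀ ε > 0, ∃ η > 0,
    ∀ t' ∈ I, ∀ x' μ', IsP2 μ' → ∀ v',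
      |t' - t| < η → ‖x' - x‖ < η → W2 μ' μ < η → ‖v' - v‖ < η →
        ‖F t' x' μ' v' - F t x μ v‖ < ε

/-- The trace of an endomorphism of `ℝ^d`. -/
def tr {d : ℕ} (A : E d →L[ℝ] E d) : ℝ := LinearMap.trace ℝ (E d) (A : E d →ₗ[ℝ] E d)

/-- `a = σ σ†`. -/
def Coeffs.a {d : ℕ} (c : Coeffs d) (x : E d) (μ : Measure (E d)) : E d →L[ℝ] E d :=
  (c.σ x μ).comp (ContinuousLinearMap.adjoint (c.σ x μ))

/-- The image `ν` of `μ` by `x ↦ (x, 𝒰(t, x, μ))`. -/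
def imageLaw {d : ℕ} (U : ℝ → E d → Measure (E d) → ℝ) (t : ℝ) (μ : Measure (E d)) :
    Measure (EY d) :=
  μ.map fun x => pair x (U t x μ)

/-- `U` is a classical solution, with derivatives `D`, of the master equation
`∂_t U + b·∂_x U + ½ Tr[∂²_{xx} U a] + f + ∫ ∂_μ U(v)·b dμ(v) + ∫ ½ Tr[∂_v ∂_μ U(v) a] dμ(v) = 0`
on `[0, T)`, with terminal condition `g` at time `T`. -/
structure IsClassicalSolution {d : ℕ} (T : ℝ) (c : Coeffs d)
    (U : ℝ → E d → Measure (E d) → ℝ) (D : Derivs d) : Prop where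
  hasDeriv_t : ∀ t ∈ Ico 0 T, ∀ x μ, IsP2 μ →
    HasDerivWithinAt (fun s => U s x μ) (D.dt t x μ) (Icc 0 T) t
  hasDeriv_x : ∀ t ∈ Icc 0 T, ∀ x μ, IsP2 μ →
    HasGradientAt (fun x' => U t x' μ) (D.dx t x μ) x
  hasDeriv_xx : ∀ t ∈ Icc 0 T, ∀ x μ, IsP2 μ →
    HasFDerivAt (fun x' => D.dx t x' μ) (D.dxx t x μ) x
  hasDeriv_μ : ∀ t ∈ Icc 0 T, ∀ x, IsLionsDeriv (fun μ => U t x μ) (fun μ => D.dμ t x μ)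
  hasDeriv_v : ∀ t ∈ Icc 0 T, ∀ x μ, IsP2 μ → ∀ v,
    HasFDerivAt (fun v' => D.dμ t x μ v') (D.dvdμ t x μ v) v
  cont : JointCont (Icc 0 T) U
  cont_t : JointCont (Ico 0 T) D.dt
  cont_x : JointCont (Icc 0 T) D.dx
  cont_xx : JointCont (Icc 0 T) D.dxx
  cont_μ : JointContSupp (Icc 0 T) D.dμ
  cont_v : JointContSupp (Icc 0 T) D.dvdμ
  pde : ∀ t ∈ Ico 0 T, ∀ x μ, IsP2 μ →
    D.dt t x μ
      + inner ℝ (c.b x (U t x μ) (imageLaw U t μ)) (D.dx t x μ)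
      + (1 / 2) * tr ((D.dxx t x μ).comp (c.a x μ))
      + c.f x (U t x μ) (ContinuousLinearMap.adjoint (c.σ x μ) (D.dx t x μ)) (imageLaw U t μ)
      + (∫ v, inner ℝ (D.dμ t x μ v) (c.b v (U t v μ) (imageLaw U t μ)) ∂μ)
      + (∫ v, (1 / 2) * tr ((D.dvdμ t x μ v).comp (c.a v μ)) ∂μ) = 0
  terminal : ∀ x μ, IsP2 μ → U T x μ = c.g x μ

/-- The regularity assumptions on the decoupling field `U`. -/
structure H1 {d : ℕ} (Λ α T : ℝ) (c : Coeffs d)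
    (U : ℝ → E d → Measure (E d) → ℝ) (D : Derivs d) : Prop where
  classical : IsClassicalSolution T c U D
  lip_μ : ∀ t ∈ Icc 0 T, ∀ x μ μ', IsP2 μ → IsP2 μ' →
    |U t x μ - U t x μ'| + ‖D.dx t x μ - D.dx t x μ'‖ ≤ Λ * W2 μ μ'
  bdd_first : ∀ t ∈ Icc 0 T, ∀ x μ, IsP2 μ →
    ‖D.dx t x μ‖ₑ + eLpNorm (D.dμ t x μ) 2 μ ≤ ENNReal.ofReal Λ
  bdd_second : ∀ t ∈ Icc 0 T, ∀ x μ, IsP2 μ →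
    ‖D.dxx t x μ‖ₑ + eLpNorm (D.dvdμ t x μ) 2 μ ≤ ENNReal.ofReal Λ
  lip_xx : ∀ t ∈ Icc 0 T, ∀ x x' μ, IsP2 μ →
    ‖D.dxx t x μ - D.dxx t x' μ‖ ≤ Λ * ‖x - x'‖
  holder_t : ∀ h ∈ Ico 0 T, ∀ t ∈ Icc 0 (T - h), ∀ x μ, IsP2 μ →
    |U (t + h) x μ - U t x μ| + ‖D.dx (t + h) x μ - D.dx t x μ‖
      ≤ Λ * h ^ (1 / 2 : ℝ) * (1 + ‖x‖ + m2 μ)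
  lip_v : ∀ t ∈ Icc 0 T, ∀ x μ, IsP2 μ → ∀ v v',
    ‖D.dvdμ t x μ v - D.dvdμ t x μ v'‖
      ≤ Λ * (1 + ‖v‖ ^ (2 * α) + ‖v'‖ ^ (2 * α) + m2 μ ^ (2 * α)) ^ (1 / 2 : ℝ) * ‖v - v'‖

/-! ### The discretization: time grid, quantized increments, initial law -/

/-- A time grid `0 = t_0 < ⋯ < t_n = T` which contains the equidistant grid
`r_k = k T / N`, `k = 0, …, N`; the index of `r_k` in the grid is `j k`. -/
structure Grid (T : ℝ) (N : ℕ) where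
  n : ℕ
  t : ℕ → ℝ
  j : ℕ → ℕ
  t_zero : t 0 = 0
  t_last : t n = T
  t_lt : ∀ i < n, t i < t (i + 1)
  j_le : ∀ k ≤ N, j k ≤ n
  t_j : ∀ k ≤ N, t (j k) = k * (T / N)

/-- `h_i = t_{i+1} - t_i`. -/
def Grid.h {T : ℝ} {N : ℕ} (π : Grid T N) (i : ℕ) : ℝ := π.t (i + 1) - π.t i

/-- `|π| = max_{i < n} h_i`. -/
def Grid.mesh {T : ℝ} {N : ℕ} (π : Grid T N) : ℝ := ⨆ i : Fin π.n, π.h i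

/-- The common law `∑_a q_a δ_{w_a}` of the quantized and normalized Brownian increments `ϖ_i`:
finitely many values, bounded by `Λ`, centered, with the identity as covariance matrix. -/
structure Quantization (d : ℕ) (Λ : ℝ) where
  m : ℕ
  w : Fin m → E d
  q : Fin m → ℝ
  q_pos : ∀ a, 0 < q a
  q_sum : ∑ a, q a = 1
  bdd : ∀ a, ‖w a‖ ≤ Λ
  centered : ∑ a, q a • w a = 0
  covariance : ∀ r s : Fin d, ∑ a, q a * (w a r * w a s) = if r = s then 1 else 0

/-- A finitely supported initial law `μ^{|π|} = ∑_ℓ p_ℓ δ_{x_ℓ}`. -/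
structure InitialLaw (d : ℕ) where
  M : ℕ
  x : Fin M → E d
  p : Fin M → ℝ
  p_pos : ∀ l, 0 < p l
  p_sum : ∑ l, p l = 1

/-- The measure `∑_ℓ p_ℓ δ_{x_ℓ}`. -/
def InitialLaw.measure {d : ℕ} (ξ : InitialLaw d) : Measure (E d) :=
  ∑ l, ENNReal.ofReal (ξ.p l) • Measure.dirac (ξ.x l)

/-- `‖ξ‖_r`, the `L^r` norm of a random vector with law `∑_ℓ p_ℓ δ_{x_ℓ}`. -/
def InitialLaw.norm {d : ℕ} (ξ : InitialLaw d) (r : ℝ) : ℝ :=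
  (∑ l, ξ.p l * ‖ξ.x l‖ ^ r) ^ (1 / r)

/-! ### The forest of trees on which the algorithm runs -/

section Scheme

variable {d : ℕ} {T : ℝ} {N : ℕ} {Λ : ℝ}
  (π : Grid T N) (Q : Quantization d Λ) (ξ₀ : InitialLaw d)

/-- The sample space generated by the initial condition and by `ϖ_0, …, ϖ_{n-1}`: a sample
`(ℓ, a)` is a branch of the tree rooted at `x_ℓ`, along which `ϖ_i = w_{a_i}`. -/
abbrev Sample : Type := Fin ξ₀.M × (Fin π.n → Fin Q.m)

/-- The probability of a sample: `ξ, ϖ_0, …, ϖ_{n-1}` are independent. -/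
def prob (ω : Sample π Q ξ₀) : ℝ := ξ₀.p ω.1 * ∏ i, Q.q (ω.2 i)

/-- The law of a random variable on the sample space. -/
def law {S : Type} [MeasurableSpace S] (V : Sample π Q ξ₀ → S) : Measure S :=
  ∑ ω, ENNReal.ofReal (prob π Q ξ₀ ω) • Measure.dirac (V ω)

/-- The conditional expectation `𝔼_{t_i}` given `ξ, ϖ_0, …, ϖ_{i-1}`. -/
def condE {S : Type} [AddCommGroup S] [Module ℝ S] (i : ℕ) (V : Sample π Q ξ₀ → S) :
    Sample π Q ξ₀ → S := fun ω =>
  ∑ a : Fin π.n → Fin Q.m,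
    (∏ s, Q.q (a s)) • V (ω.1, fun s => if (s : ℕ) < i then ω.2 s else a s)

/-- The discretized Brownian increment `ΔW̄_i = h_i^{1/2} ϖ_i` (for `i < n`). -/
def dW (i : ℕ) (ω : Sample π Q ξ₀) : E d :=
  if hi : i < π.n then (π.h i) ^ (1 / 2 : ℝ) • Q.w (ω.2 ⟨i, hi⟩) else 0

/-- `(X, Y, Z)`, indexed by the points of the grid in `[r_k, r_{k+1}]`, is the output of the local
solver on `[r_k, r_{k+1}]` with input the forward process `X'`, the terminal condition `η` and the
driver `f`: a backward sweep, implicit in `Y`, followed by an explicit Euler scheme for `X`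
started from `X'_{r_k}`. -/
structure IsLocalOutput (c : Coeffs d) (k : ℕ) (X' : ℕ → Sample π Q ξ₀ → E d)
    (η : Sample π Q ξ₀ → ℝ) (f : E d → ℝ → E d → Measure (EY d) → ℝ)
    (X : ℕ → Sample π Q ξ₀ → E d) (Y : ℕ → Sample π Q ξ₀ → ℝ)
    (Z : ℕ → Sample π Q ξ₀ → E d) : Prop where
  Y_last : Y (π.j (k + 1)) = η
  Z_last : Z (π.j (k + 1)) = 0
  Y_step : ∀ i, π.j k ≤ i → i < π.j (k + 1) →
    Y i = condE π Q ξ₀ i fun ω => Y (i + 1) ω +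
      π.h i * f (X' i ω) (Y i ω) (Z i ω) (law π Q ξ₀ fun ω' => pair (X' i ω') (Y i ω'))
  Z_step : ∀ i, π.j k ≤ i → i < π.j (k + 1) →
    Z i = condE π Q ξ₀ i fun ω => (Y (i + 1) ω / π.h i) • dW π Q ξ₀ i ω
  X_first : X (π.j k) = X' (π.j k)
  X_step : ∀ i, π.j k ≤ i → i < π.j (k + 1) → ∀ ω,
    X (i + 1) ω = X i ω
      + π.h i • c.b (X i ω) (Y i ω) (law π Q ξ₀ fun ω' => pair (X i ω') (Y i ω'))
      + c.σ (X i ω) (law π Q ξ₀ (X i)) (dW π Q ξ₀ i ω)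

/-- `IsSolverOutput c J k ξ y`: the solver at level `k` with `J` Picard iterations returns `y` when
it is called with the initial condition `ξ` at time `r_k`. At level `N` it returns `g(ξ, [ξ])`.
At level `k < N` it is initialized with the forward component `X⁰` of the local solver run with
zero terminal condition and zero driver; the `j`-th Picard iteration calls the solver at level
`k + 1` with `X^{j-1}_{r_{k+1}}`, and then the local solver with input `X^{j-1}`, the value just
obtained as terminal condition, and the driver `f`; the returned value is `Y^J_{r_k}`. -/
inductive IsSolverOutput (c : Coeffs d) (J : ℕ) :
    ℕ → (Sample π Q ξ₀ → E d) → (Sample π Q ξ₀ → ℝ) → Prop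
  | last (ξ : Sample π Q ξ₀ → E d) :
      IsSolverOutput c J N ξ fun ω => c.g (ξ ω) (law π Q ξ₀ ξ)
  | level (k : ℕ) (hk : k < N) (ξ : Sample π Q ξ₀ → E d)
      (X : ℕ → ℕ → Sample π Q ξ₀ → E d) (Y : ℕ → ℕ → Sample π Q ξ₀ → ℝ)
      (Z : ℕ → ℕ → Sample π Q ξ₀ → E d)
      (init : IsLocalOutput π Q ξ₀ c k (fun _ => ξ) 0 (fun _ _ _ _ => 0) (X 0) (Y 0) (Z 0))
      (call : ∀ i < J, IsSolverOutput c J (k + 1) (X i (π.j (k + 1))) (Y (i + 1) (π.j (k + 1))))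
      (picard : ∀ i < J, IsLocalOutput π Q ξ₀ c k (X i) (Y (i + 1) (π.j (k + 1))) c.f
        (X (i + 1)) (Y (i + 1)) (Z (i + 1))) :
      IsSolverOutput c J k ξ (Y J (π.j k))

end Scheme

end

end MKV

open MKV

namespace MKV

/-! The error of the algorithm is measured along the forest, as the distance between the computed
backward component and the decoupling field `U` taken along the computed forward component. Four
mechanisms control it.

Consistency. For a fixed value w of the noise, the Euler position X + s b + √s σ w is smooth in s >
0, and the law at time s is carried by finitely many moving points. Hence U can be differentiated
along the step by an ordinary chain rule (`IsClassicalSolution.hasDerivAt_flow`), without stochastic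
calculus. The derivative contains terms of size 1/√s; after averaging over the noise, centring
removes their leading part and the identity covariance turns the next one into the trace terms of
the master equation (`Quantization.ito_correction`). Substituting that equation leaves a one-step
error h·O(√h) plus h times the discrepancy of the drift (`EulerStep.abs_expansion_le`). In the same
way the weight ΔW̄/h recovers σ†∂ₓU up to O(√h) (`EulerStep.norm_Z_expansion_le`).

Stability. Bessel's inequality (`bessel`) bounds the conditional mean and the Z-term together, so a
backward step multiplies L² norms by 1 + O(h). On a period of length δ, a Picard iteration contracts
the gap between Y and U by a factor O(δ), starting from the zero guess, whose gap is the size of U.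
Thus one period turns an error e into (1 + O(δ)) e + O(δ√|π|) + O(δ)^J, up to moments
(`IsPeriod.picard_error_le`). Summation over the T/δ periods gives O(√|π|) + O(δ)^(J-1).

Pointwise values. Every L² estimate is proved for weights w (`Wt`) which dominate the probability
and are invariant under later conditional expectations. Domination absorbs the mean-field terms. The
weights `condW` add to the probability the conditional probability on a branch, so that at time 0
the L² bound contains a bound at each root.

Moments. The consistency errors grow with X. If α = 1, the second moments grow by 1 + O(δ) per
period provided that terminal values have linear growth, and this follows from the error bound of
the next level as long as the latter is at most one (`solver_error_linear`); when the Picard error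
is too large for this, N and J are bounded and a crude estimate suffices. If the data are bounded, Y
is uniformly bounded (`solver_supN_le`), moments of order 2α are propagated by an exponential
argument (`IsStep.qm_sq_le`), and U is bounded up to O(√|π|) (`n2_field_le_of_dataBound`);
`solver_error_bounded` combines these.

Well-posedness holds because the implicit backward step is a contraction for small h
(`existsUnique_implicit`). -/

/-! ### Weighted quadratic means on a finite set -/

/-- The quadratic seminorm `(∑ p V²)^{1/2}` with weights `p`. -/
noncomputable def n2 {Θ : Type} [Fintype Θ] (p V : Θ → ℝ) : ℝ := √(∑ θ, p θ * V θ ^ 2)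

section n2
variable {Θ : Type} [Fintype Θ] {p V W : Θ → ℝ}

lemma n2_nonneg : 0 ≤ n2 p V := Real.sqrt_nonneg _

lemma n2_sq (hp : ∀ θ, 0 ≤ p θ) : n2 p V ^ 2 = ∑ θ, p θ * V θ ^ 2 :=
  Real.sq_sqrt (Finset.sum_nonneg fun θ _ => mul_nonneg (hp θ) (sq_nonneg _))

lemma n2_mono (hp : ∀ θ, 0 ≤ p θ) (h : ∀ θ, |V θ| ≤ W θ) : n2 p V ≤ n2 p W := by
  refine Real.sqrt_le_sqrt (Finset.sum_le_sum fun θ _ => mul_le_mul_of_nonneg_left ?_ (hp θ))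
  exact sq_le_sq' (by linarith [neg_abs_le (V θ), h θ]) (le_trans (le_abs_self _) (h θ))

/-- Passes from the probability to the larger weights of `Wt`. -/
lemma n2_mono_weight {q : Θ → ℝ} (h : ∀ θ, p θ ≤ q θ) : n2 p V ≤ n2 q V :=
  Real.sqrt_le_sqrt (Finset.sum_le_sum fun θ _ => mul_le_mul_of_nonneg_right (h θ) (sq_nonneg _))

/-- Scaling the coordinates by √p gives a Euclidean norm, from which the triangle and Cauchy–Schwarz
inequalities are inherited. -/
lemma n2_eq_norm (hp : ∀ θ, 0 ≤ p θ) :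
    n2 p V = ‖(WithLp.toLp 2 fun θ => √(p θ) * V θ : EuclideanSpace ℝ Θ)‖ := by
  rw [EuclideanSpace.norm_eq, n2]
  congr 1
  refine Finset.sum_congr rfl fun θ _ => ?_
  simp [mul_pow, Real.sq_sqrt (hp θ)]

lemma n2_add_le (hp : ∀ θ, 0 ≤ p θ) : n2 p (fun θ => V θ + W θ) ≤ n2 p V + n2 p W := by
  rw [n2_eq_norm hp, n2_eq_norm hp, n2_eq_norm hp]
  refine le_trans (le_of_eq ?_) (norm_add_le _ _)
  congr 1
  ext θ
  simp [mul_add]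

lemma n2_le_add (hp : ∀ θ, 0 ≤ p θ) {F : Θ → ℝ} (h : ∀ θ, |F θ| ≤ V θ + W θ) :
    n2 p F ≤ n2 p V + n2 p W :=
  (n2_mono hp h).trans (n2_add_le hp)

lemma n2_const_mul (c : ℝ) (hc : 0 ≤ c) : n2 p (fun θ => c * V θ) = c * n2 p V := by
  unfold n2
  rw [← Real.sqrt_sq hc, ← Real.sqrt_mul (sq_nonneg c), Finset.mul_sum, Real.sqrt_sq hc]
  congr 1
  exact Finset.sum_congr rfl fun θ _ => by ring

lemma n2_const (c : ℝ) (hc : 0 ≤ c) : n2 p (fun _ => c) = c * √(∑ θ, p θ) := by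
  have : n2 p (fun _ => (1 : ℝ)) = √(∑ θ, p θ) := by simp [n2]
  rw [← this, ← n2_const_mul c hc]
  simp

lemma n2_const_prob (h1 : ∑ θ, p θ = 1) (c : ℝ) (hc : 0 ≤ c) : n2 p (fun _ => c) = c := by
  rw [n2_const c hc, h1]; simp

lemma abs_sum_mul_le_n2 (hp : ∀ θ, 0 ≤ p θ) :
    |∑ θ, p θ * (V θ * W θ)| ≤ n2 p V * n2 p W := by
  rw [n2_eq_norm hp, n2_eq_norm hp]
  refine le_trans (le_of_eq ?_) (abs_real_inner_le_norm _ _)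
  congr 1
  rw [PiLp.inner_apply]
  refine Finset.sum_congr rfl fun θ _ => ?_
  simp only [RCLike.inner_apply, conj_trivial]
  linear_combination -(V θ * W θ) * Real.mul_self_sqrt (hp θ)

lemma sum_mul_le_n2 (hp : ∀ θ, 0 ≤ p θ) (h1 : ∑ θ, p θ = 1) : ∑ θ, p θ * V θ ≤ n2 p V := by
  have := abs_sum_mul_le_n2 (p := p) (V := V) (W := fun _ => 1) hp
  rw [n2_const_prob h1 1 zero_le_one] at this
  simpa using (le_abs_self _).trans this

lemma n2_abs : n2 p (fun θ => |V θ|) = n2 p V := by simp [n2]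

end n2

/-! ### Finitely supported laws -/

/-- The law `∑ p_θ δ_{V_θ}`. -/
noncomputable def flaw {Θ S : Type} [Fintype Θ] [MeasurableSpace S] (p : Θ → ℝ) (V : Θ → S) :
    Measure S := ∑ θ, ENNReal.ofReal (p θ) • Measure.dirac (V θ)

/-- Probability weights on a finite set. -/
structure FProb {Θ : Type} [Fintype Θ] (p : Θ → ℝ) : Prop where
  nonneg : ∀ θ, 0 ≤ p θ
  sum : ∑ θ, p θ = 1

section flaw
variable {Θ S S' : Type} [Fintype Θ] {p : Θ → ℝ}

lemma flaw_isProbabilityMeasure [MeasurableSpace S] (hp : FProb p) (V : Θ → S) :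
    IsProbabilityMeasure (flaw p V) := by
  constructor
  simp only [flaw, Measure.coe_finsetSum, Finset.sum_apply, Measure.smul_apply, measure_univ,
    smul_eq_mul, mul_one]
  rw [← ENNReal.ofReal_sum_of_nonneg fun θ _ => hp.nonneg θ, hp.sum, ENNReal.ofReal_one]

lemma flaw_map [MeasurableSpace S] [MeasurableSpace S'] (V : Θ → S) {f : S → S'}
    (hf : Measurable f) : (flaw p V).map f = flaw p fun θ => f (V θ) := by
  unfold flaw
  rw [← Measure.mapₗ_apply_of_measurable hf, map_sum]
  refine Finset.sum_congr rfl fun θ _ => ?_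
  rw [Measure.mapₗ_apply_of_measurable hf, Measure.map_smul, Measure.map_dirac' hf]

lemma lintegral_flaw [MeasurableSpace S] [MeasurableSingletonClass S] (V : Θ → S) (f : S → ℝ≥0∞) :
    ∫⁻ x, f x ∂(flaw p V) = ∑ θ, ENNReal.ofReal (p θ) * f (V θ) := by
  simp [flaw, lintegral_smul_measure]

lemma integral_flaw {F : Type} [NormedAddCommGroup F] [NormedSpace ℝ F] [CompleteSpace F]
    [MeasurableSpace S]
    [MeasurableSingletonClass S] (hp : FProb p) (V : Θ → S) (f : S → F) :
    ∫ x, f x ∂(flaw p V) = ∑ θ, p θ • f (V θ) := by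
  unfold flaw
  rw [integral_finsetSum_measure]
  · refine Finset.sum_congr rfl fun θ _ => ?_
    rw [integral_smul_measure, integral_dirac, ENNReal.toReal_ofReal (hp.nonneg θ)]
  · intro θ _
    refine Integrable.smul_measure ?_ ENNReal.ofReal_ne_top
    exact integrable_dirac (by simp)

lemma eLpNorm_flaw {F : Type} [NormedAddCommGroup F] [MeasurableSpace S]
    [MeasurableSingletonClass S] (hp : FProb p) (V : Θ → S) (f : S → F) :
    eLpNorm f 2 (flaw p V) = ENNReal.ofReal (n2 p fun θ => ‖f (V θ)‖) := by
  rw [eLpNorm_eq_lintegral_rpow_enorm_toReal (by simp) (by simp), lintegral_flaw]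
  simp only [ENNReal.toReal_ofNat, ENNReal.rpow_ofNat]
  have : ∀ θ, ENNReal.ofReal (p θ) * ‖f (V θ)‖ₑ ^ 2
      = ENNReal.ofReal (p θ * ‖f (V θ)‖ ^ 2) := by
    intro θ
    rw [ENNReal.ofReal_mul (hp.nonneg θ), ENNReal.ofReal_pow (norm_nonneg _), ofReal_norm]
  simp_rw [this]
  rw [← ENNReal.ofReal_sum_of_nonneg fun θ _ => mul_nonneg (hp.nonneg θ) (sq_nonneg _), n2,
    Real.sqrt_eq_rpow, ENNReal.ofReal_rpow_of_nonneg _ (by norm_num)]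
  exact Finset.sum_nonneg fun θ _ => mul_nonneg (hp.nonneg θ) (sq_nonneg _)

lemma isP2_flaw [NormedAddCommGroup S] [MeasurableSpace S] [MeasurableSingletonClass S]
    (hp : FProb p) (V : Θ → S) : IsP2 (flaw p V) := by
  refine ⟨flaw_isProbabilityMeasure hp V, ?_⟩
  rw [lintegral_flaw]
  exact ENNReal.sum_lt_top.2 fun θ _ => ENNReal.mul_lt_top ENNReal.ofReal_lt_top
    (by simp)

lemma m2_flaw {d : ℕ} (hp : FProb p) (V : Θ → E d) : m2 (flaw p V) = n2 p fun θ => ‖V θ‖ := by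
  rw [m2, eLpNorm_flaw hp, ENNReal.toReal_ofReal n2_nonneg]

/-- Two variables on the same index set are coupled by pairing their values. All mean-field terms
below are estimated through this coupling. -/
lemma W2_flaw_le [NormedAddCommGroup S] [MeasurableSpace S] [MeasurableSingletonClass S]
    (hp : FProb p) (V V' : Θ → S) : W2 (flaw p V) (flaw p V') ≤ n2 p fun θ => ‖V θ - V' θ‖ := by
  have key : (⨅ π ∈ {π : Measure (S × S) | π.map Prod.fst = flaw p V ∧
      π.map Prod.snd = flaw p V'}, ∫⁻ q, ‖q.1 - q.2‖ₑ ^ 2 ∂π)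
      ≤ ∑ θ, ENNReal.ofReal (p θ) * ‖V θ - V' θ‖ₑ ^ 2 := by
    refine iInf₂_le_of_le (flaw p fun θ => (V θ, V' θ)) ?_ ?_
    · exact ⟨flaw_map _ measurable_fst, flaw_map _ measurable_snd⟩
    · rw [lintegral_flaw]
  have e2 : (∑ θ, ENNReal.ofReal (p θ) * ‖V θ - V' θ‖ₑ ^ 2) ^ (1 / 2 : ℝ)
      = ENNReal.ofReal (n2 p fun θ => ‖V θ - V' θ‖) := by
    have := eLpNorm_flaw (F := S) hp (fun θ => V θ - V' θ) id
    rw [eLpNorm_eq_lintegral_rpow_enorm_toReal (by simp) (by simp), lintegral_flaw] at this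
    simpa using this
  unfold W2
  refine (ENNReal.toReal_mono ?_ (ENNReal.rpow_le_rpow key (by norm_num))).trans ?_
  · rw [e2]; exact ENNReal.ofReal_ne_top
  · rw [e2, ENNReal.toReal_ofReal n2_nonneg]

lemma W2_nonneg [NormedAddCommGroup S] [MeasurableSpace S] (μ ν : Measure S) : 0 ≤ W2 μ ν :=
  ENNReal.toReal_nonneg

end flaw

section pair
variable {d : ℕ}

lemma continuous_pair : Continuous fun q : E d × ℝ => pair q.1 q.2 :=
  WithLp.prod_continuous_toLp 2 _ _

lemma norm_pair_sub_le (x x' : E d) (y y' : ℝ) : ‖pair x y - pair x' y'‖ ≤ ‖x - x'‖ + |y - y'| := by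
  have h : pair x y - pair x' y' = pair (x - x') (y - y') := rfl
  have h2 : ‖pair (x - x') (y - y')‖ = √(‖x - x'‖ ^ 2 + ‖y - y'‖ ^ 2) :=
    WithLp.prod_norm_eq_of_L2 _
  rw [h, h2, Real.norm_eq_abs]
  exact Real.sqrt_le_iff.2 ⟨by positivity, by nlinarith [norm_nonneg (x - x'), abs_nonneg (y - y')]⟩

lemma W2_pair_le {Θ : Type} [Fintype Θ] {p : Θ → ℝ} (hp : FProb p) (X X' : Θ → E d)
    (Y Y' : Θ → ℝ) :
    W2 (flaw p fun θ => pair (X θ) (Y θ)) (flaw p fun θ => pair (X' θ) (Y' θ)) ≤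
      n2 p (fun θ => ‖X θ - X' θ‖) + n2 p (fun θ => Y θ - Y' θ) := by
  refine (W2_flaw_le hp _ _).trans ?_
  rw [← n2_abs (V := fun θ => Y θ - Y' θ)]
  refine n2_le_add hp.nonneg fun θ => ?_
  rw [abs_norm]
  exact norm_pair_sub_le _ _ _ _

end pair

end MKV

namespace MKV

/-! ### Differentiation along a flow of finitely supported laws -/

section lift
variable {d : ℕ} {Θ : Type} [Fintype Θ] {p : Θ → ℝ}

/-- The interval is atomless, so some measurable map `τ` from it to `Θ` has law `p`. Composition
with `τ` is a linear embedding into L² which respects laws and integrals; it transports Lions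
derivatives, defined on L², to finitely supported laws. -/
lemma exists_lp_representation (hp : FProb p) :
    ∃ ι : (Θ → E d) →L[ℝ] Lp (E d) 2 (volume : Measure unitInterval),
      (∀ W, (volume : Measure unitInterval).map (ι W) = flaw p W) ∧
      ∀ W W' : Θ → E d, ∀ G : E d → E d,
        ∫ s, inner ℝ (G (ι W s)) (ι W' s) = ∑ θ, p θ * inner ℝ (G (W θ)) (W' θ) := by
  let : MeasurableSpace Θ := ⊤
  have : DiscreteMeasurableSpace Θ := ⟨fun _ => trivial⟩
  have : Nonempty Θ := by
    by_contra h
    have := not_nonempty_iff.1 h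
    simpa using hp.sum
  have := flaw_isProbabilityMeasure hp (id : Θ → Θ)
  obtain ⟨τ, hτ, hmap⟩ := (flaw p (id : Θ → Θ)).exists_measurable_map_eq
  have hmem : ∀ W : Θ → E d, MemLp (fun s => W (τ s)) 2 (volume : Measure unitInterval) := by
    intro W
    refine MemLp.of_bound ((measurable_from_top.comp hτ).aestronglyMeasurable) (∑ θ, ‖W θ‖) ?_
    refine Filter.Eventually.of_forall fun s => ?_
    exact Finset.single_le_sum (f := fun θ => ‖W θ‖) (fun _ _ => norm_nonneg _)
      (Finset.mem_univ _)
  let ι₀ : (Θ → E d) →ₗ[ℝ] Lp (E d) 2 (volume : Measure unitInterval) :=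
    { toFun := fun W => (hmem W).toLp _
      map_add' := fun W W' => rfl
      map_smul' := fun a W => rfl }
  have hι : ∀ W, (ι₀ W : unitInterval → E d) =ᵐ[volume] fun s => W (τ s) :=
    fun W => MemLp.coeFn_toLp (hmem W)
  refine ⟨LinearMap.toContinuousLinearMap ι₀, fun W => ?_, fun W W' G => ?_⟩
  · rw [LinearMap.coe_toContinuousLinearMap', Measure.map_congr (hι W)]
    have : (fun s => W (τ s)) = W ∘ τ := rfl
    rw [this, ← Measure.map_map measurable_from_top hτ, hmap, flaw_map _ measurable_from_top]
    rfl
  · rw [LinearMap.coe_toContinuousLinearMap']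
    have h1 : ∫ s, inner ℝ (G (ι₀ W s)) (ι₀ W' s)
        = ∫ s, (fun θ => inner ℝ (G (W θ)) (W' θ)) (τ s) := by
      refine integral_congr_ae ?_
      filter_upwards [hι W, hι W'] with s h h'
      rw [h, h']
    rw [h1, ← integral_map (f := fun θ => inner ℝ (G (W θ)) (W' θ)) hτ.aemeasurable
      measurable_from_top.aestronglyMeasurable, hmap, integral_flaw hp]
    rfl

/-- The Fréchet derivative of the lifting, composed with the linear embedding of the curve of
points. -/
lemma IsLionsDeriv.hasDerivAt_flaw (hp : FProb p) {u : Measure (E d) → ℝ}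
    {G : Measure (E d) → E d → E d} (hu : IsLionsDeriv u G) {V : ℝ → Θ → E d} {V' : Θ → E d}
    {r : ℝ} (hV : ∀ θ, HasDerivAt (fun s => V s θ) (V' θ) r) :
    HasDerivAt (fun s => u (flaw p (V s)))
      (∑ θ, p θ * inner ℝ (G (flaw p (V r)) (V r θ)) (V' θ)) r := by
  obtain ⟨ι, hlaw, hint⟩ := exists_lp_representation (d := d) hp
  obtain ⟨-, ℓ, hℓ, hrep⟩ := hu (ι (V r))
  have hV' : HasDerivAt V V' r := hasDerivAt_pi.2 hV
  have h1 : HasDerivAt (fun s => ι (V s)) (ι V') r := ι.hasFDerivAt.comp_hasDerivAt r hV'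
  have h2 := hℓ.comp_hasDerivAt r h1
  rw [hrep, hlaw, hint] at h2
  refine h2.congr_of_eventuallyEq (Filter.Eventually.of_forall fun s => ?_)
  simp only [Function.comp_apply, lift, hlaw]

end lift

section chain
variable {d : ℕ} {T : ℝ} {c : Coeffs d} {U : ℝ → E d → Measure (E d) → ℝ} {D : Derivs d}

open Filter Topology Asymptotics

/-- The position and the law move together with time, so the derivative in time at fixed arguments
is not enough. The mean value inequality in time is applied at the moved arguments, where joint
continuity keeps `D.dt` close to its value at the base point. -/
lemma IsClassicalSolution.hasDerivAt_time (hU : IsClassicalSolution T c U D) {r₀ : ℝ}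
    (hr : r₀ ∈ Ioo 0 T) {x : ℝ → E d} {μ : ℝ → Measure (E d)} (hμ : ∀ r, IsP2 (μ r))
    (hx : ContinuousAt x r₀) (hW : Tendsto (fun r => W2 (μ r) (μ r₀)) (𝓝 r₀) (𝓝 0)) :
    HasDerivAt (fun r => U r (x r) (μ r) - U r₀ (x r) (μ r)) (D.dt r₀ (x r₀) (μ r₀)) r₀ := by
  rw [hasDerivAt_iff_isLittleO, isLittleO_iff]
  intro ε hε
  obtain ⟨η, hη, H⟩ := hU.cont_t r₀ ⟨hr.1.le, hr.2⟩ (x r₀) (μ r₀) (hμ _) ε hε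
  have e1 : ∀ᶠ r in 𝓝 r₀, |r - r₀| < η := by
    have := Metric.ball_mem_nhds r₀ hη
    filter_upwards [this] with r h
    simpa [Real.dist_eq] using h
  have e2 : ∀ᶠ r in 𝓝 r₀, ‖x r - x r₀‖ < η := by
    filter_upwards [hx (Metric.ball_mem_nhds _ hη)] with r h
    simpa [dist_eq_norm] using h
  have e3 : ∀ᶠ r in 𝓝 r₀, W2 (μ r) (μ r₀) < η := hW.eventually (gt_mem_nhds hη)
  filter_upwards [e1, e2, e3, isOpen_Ioo.mem_nhds hr] with r h1 h2 h3 h4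
  have hsub : uIcc r₀ r ⊆ Ioo 0 T := (ordConnected_Ioo).uIcc_subset hr h4
  have hd : ∀ ρ ∈ uIcc r₀ r, HasDerivWithinAt
      (fun ρ => U ρ (x r) (μ r) - ρ * D.dt r₀ (x r₀) (μ r₀))
      (D.dt ρ (x r) (μ r) - 1 * D.dt r₀ (x r₀) (μ r₀)) (uIcc r₀ r) ρ := by
    intro ρ hρ
    have hρ' := hsub hρ
    have := (hU.hasDeriv_t ρ ⟨hρ'.1.le, hρ'.2⟩ (x r) (μ r) (hμ r)).hasDerivAt
      (Icc_mem_nhds hρ'.1 hρ'.2)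
    exact (this.sub ((hasDerivAt_id ρ).mul_const _)).hasDerivWithinAt
  have hb : ∀ ρ ∈ uIcc r₀ r, ‖D.dt ρ (x r) (μ r) - 1 * D.dt r₀ (x r₀) (μ r₀)‖ ≤ ε := by
    intro ρ hρ
    have hρ' := hsub hρ
    rw [one_mul]
    refine (H ρ ⟨hρ'.1.le, hρ'.2⟩ (x r) (μ r) (hμ r) ?_ h2 h3).le
    exact lt_of_le_of_lt (abs_sub_left_of_mem_uIcc hρ) h1
  have := (convex_uIcc r₀ r).norm_image_sub_le_of_norm_hasDerivWithin_le hd hb left_mem_uIcc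
    right_mem_uIcc
  refine le_trans (le_of_eq ?_) this
  congr 1
  simp only [smul_eq_mul]
  ring

/-- Same mechanism in the space variable: the mean value inequality on a ball at the moved law, with
the gradient controlled by joint continuity. -/
lemma IsClassicalSolution.hasDerivAt_space (hU : IsClassicalSolution T c U D) {r₀ : ℝ}
    (hr : r₀ ∈ Ioo 0 T) {x : ℝ → E d} {v : E d} {μ : ℝ → Measure (E d)} (hμ : ∀ r, IsP2 (μ r))
    (hx : HasDerivAt x v r₀) (hW : Tendsto (fun r => W2 (μ r) (μ r₀)) (𝓝 r₀) (𝓝 0)) :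
    HasDerivAt (fun r => U r₀ (x r) (μ r) - U r₀ (x r₀) (μ r))
      (inner ℝ (D.dx r₀ (x r₀) (μ r₀)) v) r₀ := by
  have hr' : r₀ ∈ Icc 0 T := ⟨hr.1.le, hr.2.le⟩
  set g := D.dx r₀ (x r₀) (μ r₀) with hg
  have key : (fun r => U r₀ (x r) (μ r) - U r₀ (x r₀) (μ r) - inner ℝ g (x r - x r₀))
      =o[𝓝 r₀] fun r => x r - x r₀ := by
    rw [isLittleO_iff]
    intro ε hε
    obtain ⟨η, hη, H⟩ := hU.cont_x r₀ hr' (x r₀) (μ r₀) (hμ _) ε hε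
    have e2 : ∀ᶠ r in 𝓝 r₀, x r ∈ Metric.ball (x r₀) η :=
      hx.continuousAt (Metric.ball_mem_nhds _ hη)
    have e3 : ∀ᶠ r in 𝓝 r₀, W2 (μ r) (μ r₀) < η := hW.eventually (gt_mem_nhds hη)
    filter_upwards [e2, e3] with r h2 h3
    have hd : ∀ y ∈ Metric.ball (x r₀) η, HasFDerivWithinAt
        (fun y => U r₀ y (μ r) - innerSL ℝ g y)
        (InnerProductSpace.toDual ℝ _ (D.dx r₀ y (μ r)) - innerSL ℝ g)
          (Metric.ball (x r₀) η) y := by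
      intro y _
      have := (hU.hasDeriv_x r₀ hr' y (μ r) (hμ r)).hasFDerivAt
      exact (this.sub (innerSL ℝ g).hasFDerivAt).hasFDerivWithinAt
    have hb : ∀ y ∈ Metric.ball (x r₀) η,
        ‖InnerProductSpace.toDual ℝ _ (D.dx r₀ y (μ r)) - innerSL ℝ g‖ ≤ ε := by
      intro y hy
      have e : InnerProductSpace.toDual ℝ _ (D.dx r₀ y (μ r)) - innerSL ℝ g
          = InnerProductSpace.toDual ℝ (E d) (D.dx r₀ y (μ r) - g) := by
        ext z; simp
      rw [e, LinearIsometryEquiv.norm_map]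
      refine (H r₀ hr' y (μ r) (hμ r) (by simpa using hη) ?_ h3).le
      simpa [dist_eq_norm] using hy
    have := (convex_ball (x r₀) η).norm_image_sub_le_of_norm_hasFDerivWithin_le hd hb
      (Metric.mem_ball_self hη) h2
    refine le_trans (le_of_eq ?_) this
    congr 1
    simp only [innerSL_apply_apply, inner_sub_right]
    ring
  have h0 : HasDerivAt
      (fun r => U r₀ (x r) (μ r) - U r₀ (x r₀) (μ r) - inner ℝ g (x r - x r₀)) 0 r₀ := by
    rw [hasDerivAt_iff_isLittleO]
    have := key.trans_isBigO hx.isBigO_sub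
    simpa using this
  have h1 : HasDerivAt (fun r => inner ℝ g (x r - x r₀)) (inner ℝ g v) r₀ :=
    (innerSL ℝ g).hasFDerivAt.comp_hasDerivAt r₀ (hx.sub_const (x r₀))
  have := h0.add h1
  simp only [zero_add] at this
  refine this.congr_of_eventuallyEq (Filter.Eventually.of_forall fun r => ?_)
  simp

variable {Θ : Type} [Fintype Θ] {p : Θ → ℝ}

lemma n2_continuous : Continuous fun V : Θ → ℝ => n2 p V := by
  unfold n2; fun_prop

lemma tendsto_W2_flaw (hp : FProb p) {V : ℝ → Θ → E d} {r : ℝ} {s : Set ℝ}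
    (hV : ∀ θ, ContinuousWithinAt (fun s => V s θ) s r) :
    Tendsto (fun s => W2 (flaw p (V s)) (flaw p (V r))) (𝓝[s] r) (𝓝 0) := by
  have h : ContinuousWithinAt (fun s => n2 p fun θ => ‖V s θ - V r θ‖) s r := by
    refine n2_continuous.continuousAt.comp_continuousWithinAt ?_
    exact continuousWithinAt_pi.2 fun θ => ((hV θ).sub continuousWithinAt_const).norm
  have h' : Tendsto (fun s => n2 p fun θ => ‖V s θ - V r θ‖) (𝓝[s] r) (𝓝 0) := by
    have := h.tendsto
    simpa [n2] using this
  exact squeeze_zero (fun s => W2_nonneg _ _) (fun s => W2_flaw_le hp _ _) h'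

/-- The increment is telescoped into a change of time, of position and of law. The first two use
joint continuity of the derivatives; the last one takes place at fixed time and position and only
needs the Lions derivative. -/
lemma IsClassicalSolution.hasDerivAt_flow (hU : IsClassicalSolution T c U D) (hp : FProb p)
    {r₀ : ℝ} (hr : r₀ ∈ Ioo 0 T) {x : ℝ → E d} {v : E d} {V : ℝ → Θ → E d} {V' : Θ → E d}
    (hx : HasDerivAt x v r₀) (hV : ∀ θ, HasDerivAt (fun s => V s θ) (V' θ) r₀) :
    HasDerivAt (fun r => U r (x r) (flaw p (V r)))
      (D.dt r₀ (x r₀) (flaw p (V r₀)) + inner ℝ (D.dx r₀ (x r₀) (flaw p (V r₀))) v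
        + ∑ θ, p θ * inner ℝ (D.dμ r₀ (x r₀) (flaw p (V r₀)) (V r₀ θ)) (V' θ)) r₀ := by
  have hμ : ∀ r, IsP2 (flaw p (V r)) := fun r => isP2_flaw hp _
  have hW : Tendsto (fun r => W2 (flaw p (V r)) (flaw p (V r₀))) (𝓝 r₀) (𝓝 0) := by
    have := tendsto_W2_flaw hp (s := univ) fun θ => (hV θ).continuousAt.continuousWithinAt
    simpa [nhdsWithin_univ] using this
  have h1 := hU.hasDerivAt_time hr hμ hx.continuousAt hW
  have h2 := hU.hasDerivAt_space hr hμ hx hW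
  have h3 := (hU.hasDeriv_μ r₀ ⟨hr.1.le, hr.2.le⟩ (x r₀)).hasDerivAt_flaw hp hV
  refine ((h1.add h2).add h3).congr_of_eventuallyEq (Filter.Eventually.of_forall fun r => ?_)
  simp only [Pi.add_apply]
  ring

lemma IsClassicalSolution.continuousOn_flow (hU : IsClassicalSolution T c U D) (hp : FProb p)
    {s : Set ℝ} (hs : s ⊆ Icc 0 T) {x : ℝ → E d} {V : ℝ → Θ → E d}
    (hx : ContinuousOn x s) (hV : ∀ θ, ContinuousOn (fun s => V s θ) s) :
    ContinuousOn (fun r => U r (x r) (flaw p (V r))) s := by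
  intro r hr
  rw [ContinuousWithinAt, Metric.tendsto_nhds]
  intro ε hε
  obtain ⟨η, hη, H⟩ := hU.cont r (hs hr) (x r) (flaw p (V r)) (isP2_flaw hp _) ε hε
  have e1 : ∀ᶠ r' in 𝓝[s] r, r' ∈ Metric.ball r η :=
    nhdsWithin_le_nhds (Metric.ball_mem_nhds _ hη)
  have e2 : ∀ᶠ r' in 𝓝[s] r, x r' ∈ Metric.ball (x r) η := hx r hr (Metric.ball_mem_nhds _ hη)
  have e3 := (tendsto_W2_flaw hp fun θ => hV θ r hr).eventually (gt_mem_nhds hη)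
  filter_upwards [e1, e2, e3, self_mem_nhdsWithin] with r' h1 h2 h3 h4
  exact H r' (hs h4) (x r') _ (isP2_flaw hp _) h1 (by simpa [dist_eq_norm] using h2) h3

end chain

end MKV

namespace MKV

/-! ### Quantized Gaussian increments -/

section noise
variable {d : ℕ} {Λ L : ℝ}

lemma Quantization.fprob (Q : Quantization d Λ) : FProb Q.q := ⟨fun a => (Q.q_pos a).le, Q.q_sum⟩

lemma Quantization.sum_inner (Q : Quantization d Λ) (u : E d) :
    ∑ a, Q.q a * inner ℝ u (Q.w a) = 0 := by
  have h := congrArg (inner ℝ u) Q.centered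
  rw [_root_.inner_sum, inner_zero_right] at h
  simpa [inner_smul_right] using h

lemma Quantization.sum_inner_mul_inner (Q : Quantization d Λ) (u v : E d) :
    ∑ a, Q.q a * (inner ℝ u (Q.w a) * inner ℝ v (Q.w a)) = inner ℝ u v := by
  have h : ∀ a, Q.q a * (inner ℝ u (Q.w a) * inner ℝ v (Q.w a))
      = ∑ r, ∑ s, (u r * v s) * (Q.q a * (Q.w a r * Q.w a s)) := by
    intro a
    simp only [PiLp.inner_apply, RCLike.inner_apply, conj_trivial]
    rw [Finset.sum_mul_sum, Finset.mul_sum]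
    simp_rw [Finset.mul_sum]
    exact Finset.sum_congr rfl fun r _ => Finset.sum_congr rfl fun s _ => by ring
  simp_rw [h]
  rw [Finset.sum_comm]
  simp_rw [fun r => Finset.sum_comm (s := (Finset.univ : Finset (Fin Q.m)))
    (t := (Finset.univ : Finset (Fin d)))
      (f := fun a s => (u r * v s) * (Q.q a * (Q.w a r * Q.w a s))),
    ← Finset.mul_sum, Q.covariance]
  simp [PiLp.inner_apply, mul_comm]

lemma tr_eq_sum (M : E d →L[ℝ] E d) :
    tr M = ∑ r, inner ℝ (EuclideanSpace.basisFun (Fin d) ℝ r)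
      (M (EuclideanSpace.basisFun (Fin d) ℝ r)) := by
  rw [tr, LinearMap.trace_eq_sum_inner _ (EuclideanSpace.basisFun (Fin d) ℝ)]
  rfl

lemma Quantization.sum_inner_apply (Q : Quantization d Λ) (M : E d →L[ℝ] E d) :
    ∑ a, Q.q a * inner ℝ (M (Q.w a)) (Q.w a) = tr M := by
  have h : ∀ a, Q.q a * inner ℝ (M (Q.w a)) (Q.w a) = ∑ r, Q.q a *
      (inner ℝ (EuclideanSpace.basisFun (Fin d) ℝ r) (Q.w a) *
      inner ℝ (ContinuousLinearMap.adjoint M (EuclideanSpace.basisFun (Fin d) ℝ r)) (Q.w a)) := by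
    intro a
    rw [← (EuclideanSpace.basisFun (Fin d) ℝ).sum_inner_mul_inner, Finset.mul_sum]
    refine Finset.sum_congr rfl fun r _ => ?_
    rw [ContinuousLinearMap.adjoint_inner_left, real_inner_comm (M (Q.w a))]
    ring
  simp_rw [h]
  rw [Finset.sum_comm]
  simp_rw [Q.sum_inner_mul_inner, tr_eq_sum, ContinuousLinearMap.adjoint_inner_right]
  exact Finset.sum_congr rfl fun r _ => real_inner_comm _ _

lemma abs_tr_le (M : E d →L[ℝ] E d) : |tr M| ≤ d * ‖M‖ := by
  rw [tr_eq_sum]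
  refine (Finset.abs_sum_le_sum_abs _ _).trans ?_
  have : ∀ r ∈ (Finset.univ : Finset (Fin d)), |inner ℝ (EuclideanSpace.basisFun (Fin d) ℝ r)
      (M (EuclideanSpace.basisFun (Fin d) ℝ r))| ≤ ‖M‖ := by
    intro r _
    refine (abs_real_inner_le_norm _ _).trans ?_
    refine (mul_le_mul_of_nonneg_left (M.le_opNorm _) (norm_nonneg _)).trans ?_
    simp
  refine (Finset.sum_le_sum this).trans ?_
  simp

lemma tr_sub (M N : E d →L[ℝ] E d) : tr (M - N) = tr M - tr N := by
  simp [tr]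

/-- The average is the trace of S†MS, and cyclicity of the trace moves S† to the right. -/
lemma Quantization.sum_inner_comp (Q : Quantization d Λ) (M S : E d →L[ℝ] E d) :
    ∑ a, Q.q a * inner ℝ (M (S (Q.w a))) (S (Q.w a))
      = tr (M.comp (S.comp (ContinuousLinearMap.adjoint S))) := by
  have h := Q.sum_inner_apply ((ContinuousLinearMap.adjoint S).comp (M.comp S))
  simp only [ContinuousLinearMap.comp_apply, ContinuousLinearMap.adjoint_inner_left] at h
  rw [h, tr, tr]
  have := LinearMap.trace_comp_comm' (R := ℝ) ((ContinuousLinearMap.adjoint S : E d →L[ℝ] E d) :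
    E d →ₗ[ℝ] E d) ((M.comp S : E d →L[ℝ] E d) : E d →ₗ[ℝ] E d)
  exact this.symm

/-- Mean value inequality for `G` minus its linearization, on the ball of radius ‖y‖. A Lipschitz
bound near `x₀` suffices, which matters for ∂ᵥ∂_μU since its Lipschitz constant grows with the
point. -/
lemma norm_taylor_le {G : E d → E d} {G' : E d → E d →L[ℝ] E d} (hG : ∀ v, HasFDerivAt G (G' v) v)
    {x₀ : E d} {K r : ℝ} (hK : 0 ≤ K) (hLip : ∀ y, ‖y‖ ≤ r → ‖G' (x₀ + y) - G' x₀‖ ≤ K * ‖y‖)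
    {y : E d} (hy : ‖y‖ ≤ r) : ‖G (x₀ + y) - G x₀ - G' x₀ y‖ ≤ K * ‖y‖ ^ 2 := by
  have h := (convex_closedBall x₀ ‖y‖).norm_image_sub_le_of_norm_hasFDerivWithin_le'
    (f := G) (f' := G') (φ := G' x₀) (C := K * ‖y‖) (x := x₀) (y := x₀ + y)
    (fun z _ => (hG z).hasFDerivWithinAt) ?_ (Metric.mem_closedBall_self (norm_nonneg _))
    (by simp)
  · simp only [add_sub_cancel_left] at h
    linarith [h, sq ‖y‖]
  · intro z hz
    have hz' : ‖z - x₀‖ ≤ ‖y‖ := by simpa [dist_eq_norm] using hz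
    have := hLip (z - x₀) (hz'.trans hy)
    rw [add_sub_cancel] at this
    exact this.trans (mul_le_mul_of_nonneg_left hz' hK)

lemma norm_comp_adjoint_sub_le (S S' : E d →L[ℝ] E d) (hS : ‖S‖ ≤ L) (hS' : ‖S'‖ ≤ L) :
    ‖S.comp (ContinuousLinearMap.adjoint S) - S'.comp (ContinuousLinearMap.adjoint S')‖
      ≤ 2 * L * ‖S - S'‖ := by
  have e : S.comp (ContinuousLinearMap.adjoint S) - S'.comp (ContinuousLinearMap.adjoint S')
      = (S - S').comp (ContinuousLinearMap.adjoint S)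
        + S'.comp (ContinuousLinearMap.adjoint (S - S')) := by
    rw [map_sub]; ext x; simp
  rw [e]
  refine (norm_add_le _ _).trans ?_
  have h1 := ContinuousLinearMap.opNorm_comp_le (S - S') (ContinuousLinearMap.adjoint S)
  have h2 := ContinuousLinearMap.opNorm_comp_le S' (ContinuousLinearMap.adjoint (S - S'))
  rw [LinearIsometryEquiv.norm_map] at h1 h2
  nlinarith [norm_nonneg (S - S'), mul_le_mul_of_nonneg_left hS (norm_nonneg (S - S')),
    mul_le_mul_of_nonneg_right hS' (norm_nonneg (S - S'))]

/-- The second order term in the expansion along a quantized increment. -/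
lemma Quantization.ito_correction (Q : Quantization d Λ) (hL : 1 ≤ L) (hw : ∀ a, ‖Q.w a‖ ≤ L)
    {G : E d → E d} {G' : E d → E d →L[ℝ] E d} (hG : ∀ v, HasFDerivAt G (G' v) v)
    {x₀ : E d} {S : E d →L[ℝ] E d} (hS : ‖S‖ ≤ L) {ρ K : ℝ} (hρ : 0 < ρ) (hK : 0 ≤ K)
    (hLip : ∀ y, ‖y‖ ≤ ρ * L ^ 2 → ‖G' (x₀ + y) - G' x₀‖ ≤ K * ‖y‖)
    (A : Fin Q.m → E d →L[ℝ] E d) :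
    |∑ a, Q.q a * (inner ℝ (G (x₀ + ρ • S (Q.w a))) ((1 / (2 * ρ)) • S (Q.w a))
        - (1 / 2) * tr ((G' (x₀ + ρ • S (Q.w a))).comp (A a)))|
      ≤ (1 + d) * L ^ 6 * (ρ * K) + d * ∑ a, Q.q a * (‖G' (x₀ + ρ • S (Q.w a))‖ *
          ‖S.comp (ContinuousLinearMap.adjoint S) - A a‖) := by
  set B := S.comp (ContinuousLinearMap.adjoint S) with hB
  have hL0 : 0 ≤ L := by linarith
  have hSw : ∀ a, ‖S (Q.w a)‖ ≤ L ^ 2 := fun a => by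
    refine (S.le_opNorm _).trans ?_
    rw [sq]
    exact mul_le_mul hS (hw a) (norm_nonneg _) hL0
  have hy : ∀ a, ‖ρ • S (Q.w a)‖ ≤ ρ * L ^ 2 := fun a => by
    rw [norm_smul, Real.norm_of_nonneg hρ.le]
    exact mul_le_mul_of_nonneg_left (hSw a) hρ.le
  have hBn : ‖B‖ ≤ L ^ 2 := by
    refine (ContinuousLinearMap.opNorm_comp_le _ _).trans ?_
    rw [LinearIsometryEquiv.norm_map, sq]
    exact mul_le_mul hS hS (norm_nonneg _) hL0
  set R : Fin Q.m → E d := fun a => G (x₀ + ρ • S (Q.w a)) - G x₀ - G' x₀ (ρ • S (Q.w a)) with hR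
  have hRn : ∀ a, ‖R a‖ ≤ K * (ρ * L ^ 2) ^ 2 := fun a =>
    (norm_taylor_le hG hK hLip (hy a)).trans
      (mul_le_mul_of_nonneg_left (pow_le_pow_left₀ (norm_nonneg _) (hy a) 2) hK)
  -- Expansion of `G` at `x₀`: the constant term averages to zero by centring, the linear one
  -- averages to ½ tr(G'(x₀) S S†), and what remains is of order ρ or measures the distance between
  -- S S† and `A`.
  have hdec : ∀ a, Q.q a * (inner ℝ (G (x₀ + ρ • S (Q.w a))) ((1 / (2 * ρ)) • S (Q.w a))
        - (1 / 2) * tr ((G' (x₀ + ρ • S (Q.w a))).comp (A a)))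
      = (1 / (2 * ρ)) * (Q.q a * inner ℝ (ContinuousLinearMap.adjoint S (G x₀)) (Q.w a))
        + ((1 / 2) * (Q.q a * inner ℝ (G' x₀ (S (Q.w a))) (S (Q.w a)))
          - Q.q a * ((1 / 2) * tr ((G' x₀).comp B)))
        + Q.q a * ((1 / (2 * ρ)) * inner ℝ (R a) (S (Q.w a))
          + (1 / 2) * tr ((G' x₀ - G' (x₀ + ρ • S (Q.w a))).comp B)
          + (1 / 2) * tr ((G' (x₀ + ρ • S (Q.w a))).comp (B - A a))) := by
    intro a
    have e : G (x₀ + ρ • S (Q.w a)) = G x₀ + ρ • G' x₀ (S (Q.w a)) + R a := by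
      simp only [hR, map_smul]; abel
    conv_lhs => rw [e]
    rw [inner_smul_right, inner_add_left, inner_add_left, inner_smul_left,
      ContinuousLinearMap.adjoint_inner_left, ContinuousLinearMap.sub_comp,
      ContinuousLinearMap.comp_sub, tr_sub, tr_sub]
    simp only [conj_trivial]
    field_simp
    ring
  simp_rw [hdec]
  rw [Finset.sum_add_distrib, Finset.sum_add_distrib, Finset.sum_sub_distrib, ← Finset.mul_sum,
    ← Finset.mul_sum, Q.sum_inner, Q.sum_inner_comp, ← Finset.sum_mul, Q.q_sum, ← hB]
  rw [mul_zero, one_mul, sub_self, zero_add, zero_add]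
  refine (Finset.abs_sum_le_sum_abs _ _).trans ?_
  have hterm : ∀ a ∈ Finset.univ, |Q.q a * ((1 / (2 * ρ)) * inner ℝ (R a) (S (Q.w a))
          + (1 / 2) * tr ((G' x₀ - G' (x₀ + ρ • S (Q.w a))).comp B)
          + (1 / 2) * tr ((G' (x₀ + ρ • S (Q.w a))).comp (B - A a)))|
      ≤ Q.q a * ((1 + d) * L ^ 6 * (ρ * K)) + d * (Q.q a * (‖G' (x₀ + ρ • S (Q.w a))‖ *
          ‖B - A a‖)) := by
    intro a _
    have hq := (Q.q_pos a).le
    rw [abs_mul, abs_of_nonneg hq]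
    -- The Taylor remainder is O(ρ²) and is divided by 2ρ; L⁶ comes from (L²)² in the remainder and
    -- L² in ‖S w‖.
    have t1 : |(1 / (2 * ρ)) * inner ℝ (R a) (S (Q.w a))| ≤ L ^ 6 * (ρ * K) := by
      rw [abs_mul, abs_of_pos (by positivity)]
      have : |inner ℝ (R a) (S (Q.w a))| ≤ (K * (ρ * L ^ 2) ^ 2) * L ^ 2 :=
        (abs_real_inner_le_norm _ _).trans
          (mul_le_mul (hRn a) (hSw a) (norm_nonneg _) (by positivity))
      calc (1 / (2 * ρ)) * |inner ℝ (R a) (S (Q.w a))|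
          ≤ (1 / (2 * ρ)) * ((K * (ρ * L ^ 2) ^ 2) * L ^ 2) := by gcongr
        _ = (1 / 2) * (L ^ 6 * (ρ * K)) := by field_simp
        _ ≤ L ^ 6 * (ρ * K) := by
          have : 0 ≤ L ^ 6 * (ρ * K) := by positivity
          linarith
    have t2 : |(1 / 2) * tr ((G' x₀ - G' (x₀ + ρ • S (Q.w a))).comp B)|
        ≤ d * L ^ 6 * (ρ * K) := by
      rw [abs_mul, abs_of_pos (by norm_num : (0 : ℝ) < 1 / 2)]
      have h1 : ‖G' x₀ - G' (x₀ + ρ • S (Q.w a))‖ ≤ K * (ρ * L ^ 2) := by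
        rw [norm_sub_rev]
        exact (hLip _ (hy a)).trans (mul_le_mul_of_nonneg_left (hy a) hK)
      have h2 : ‖(G' x₀ - G' (x₀ + ρ • S (Q.w a))).comp B‖ ≤ (K * (ρ * L ^ 2)) * L ^ 2 :=
        (ContinuousLinearMap.opNorm_comp_le _ _).trans
          (mul_le_mul h1 hBn (norm_nonneg _) (by positivity))
      have h3 := (abs_tr_le ((G' x₀ - G' (x₀ + ρ • S (Q.w a))).comp B)).trans
        (mul_le_mul_of_nonneg_left h2 (Nat.cast_nonneg d))
      have h4 : L ^ 4 ≤ L ^ 6 := pow_le_pow_right₀ hL (by norm_num)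
      have h5 : (d : ℝ) * ((ρ * K) * L ^ 4) ≤ d * ((ρ * K) * L ^ 6) := by gcongr
      have h6 : 0 ≤ (d : ℝ) * ((ρ * K) * L ^ 4) := by positivity
      linarith
    have t3 : |(1 / 2) * tr ((G' (x₀ + ρ • S (Q.w a))).comp (B - A a))|
        ≤ d * (‖G' (x₀ + ρ • S (Q.w a))‖ * ‖B - A a‖) := by
      rw [abs_mul, abs_of_pos (by norm_num : (0 : ℝ) < 1 / 2)]
      have h3 := (abs_tr_le ((G' (x₀ + ρ • S (Q.w a))).comp (B - A a))).trans
        (mul_le_mul_of_nonneg_left (ContinuousLinearMap.opNorm_comp_le _ _) (Nat.cast_nonneg d))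
      have : 0 ≤ (d : ℝ) * (‖G' (x₀ + ρ • S (Q.w a))‖ * ‖B - A a‖) := by positivity
      linarith
    have := (abs_add_le _ _).trans (add_le_add ((abs_add_le _ _).trans (add_le_add t1 t2)) t3)
    calc _ ≤ Q.q a * (L ^ 6 * (ρ * K) + d * L ^ 6 * (ρ * K)
          + d * (‖G' (x₀ + ρ • S (Q.w a))‖ * ‖B - A a‖)) := mul_le_mul_of_nonneg_left this hq
      _ = _ := by ring
  refine (Finset.sum_le_sum hterm).trans (le_of_eq ?_)
  rw [Finset.sum_add_distrib, ← Finset.sum_mul, Q.q_sum, ← Finset.mul_sum, one_mul]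

end noise

end MKV

namespace MKV

/-! ### Regularity of the decoupling field -/

section reg
variable {d : ℕ} {α T L : ℝ} {c : Coeffs d} {U : ℝ → E d → Measure (E d) → ℝ} {D : Derivs d}

lemma m2_nonneg (μ : Measure (E d)) : 0 ≤ m2 μ := ENNReal.toReal_nonneg

lemma toReal_le_of_add_le {a b : ℝ≥0∞} (hL : 0 ≤ L) (h : a + b ≤ ENNReal.ofReal L) :
    a.toReal ≤ L ∧ b.toReal ≤ L := by
  constructor
  · exact ENNReal.toReal_le_of_le_ofReal hL (le_self_add.trans h)
  · exact ENNReal.toReal_le_of_le_ofReal hL (le_add_self.trans h)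

lemma H1.norm_dx_le (h1 : H1 L α T c U D) (hL : 0 ≤ L) {t : ℝ} (ht : t ∈ Icc 0 T) (x : E d)
    {μ : Measure (E d)} (hμ : IsP2 μ) : ‖D.dx t x μ‖ ≤ L := by
  simpa using (toReal_le_of_add_le hL (h1.bdd_first t ht x μ hμ)).1

lemma H1.norm_dxx_le (h1 : H1 L α T c U D) (hL : 0 ≤ L) {t : ℝ} (ht : t ∈ Icc 0 T) (x : E d)
    {μ : Measure (E d)} (hμ : IsP2 μ) : ‖D.dxx t x μ‖ ≤ L := by
  simpa using (toReal_le_of_add_le hL (h1.bdd_second t ht x μ hμ)).1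

lemma H1.n2_dμ_le (h1 : H1 L α T c U D) (hL : 0 ≤ L) {t : ℝ} (ht : t ∈ Icc 0 T) (x : E d)
    {Θ : Type} [Fintype Θ] {p : Θ → ℝ} (hp : FProb p) (V : Θ → E d) :
    n2 p (fun θ => ‖D.dμ t x (flaw p V) (V θ)‖) ≤ L := by
  have := (toReal_le_of_add_le hL (h1.bdd_first t ht x _ (isP2_flaw hp V))).2
  rwa [eLpNorm_flaw hp, ENNReal.toReal_ofReal n2_nonneg] at this

lemma H1.n2_dvdμ_le (h1 : H1 L α T c U D) (hL : 0 ≤ L) {t : ℝ} (ht : t ∈ Icc 0 T) (x : E d)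
    {Θ : Type} [Fintype Θ] {p : Θ → ℝ} (hp : FProb p) (V : Θ → E d) :
    n2 p (fun θ => ‖D.dvdμ t x (flaw p V) (V θ)‖) ≤ L := by
  have := (toReal_le_of_add_le hL (h1.bdd_second t ht x _ (isP2_flaw hp V))).2
  rwa [eLpNorm_flaw hp, ENNReal.toReal_ofReal n2_nonneg] at this

lemma H1.lip_x (h1 : H1 L α T c U D) (hL : 0 ≤ L) {t : ℝ} (ht : t ∈ Icc 0 T) (x x' : E d)
    {μ : Measure (E d)} (hμ : IsP2 μ) : |U t x μ - U t x' μ| ≤ L * ‖x - x'‖ := by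
  refine convex_univ.norm_image_sub_le_of_norm_hasFDerivWithin_le (f := fun y => U t y μ)
    (fun y _ => (h1.classical.hasDeriv_x t ht y μ hμ).hasFDerivAt.hasFDerivWithinAt)
    (fun y _ => ?_) (mem_univ _) (mem_univ _)
  rw [LinearIsometryEquiv.norm_map]
  exact h1.norm_dx_le hL ht y hμ

lemma H1.dx_lip_x (h1 : H1 L α T c U D) (hL : 0 ≤ L) {t : ℝ} (ht : t ∈ Icc 0 T) (x x' : E d)
    {μ : Measure (E d)} (hμ : IsP2 μ) : ‖D.dx t x μ - D.dx t x' μ‖ ≤ L * ‖x - x'‖ :=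
  convex_univ.norm_image_sub_le_of_norm_hasFDerivWithin_le (f := fun y => D.dx t y μ)
    (fun y _ => (h1.classical.hasDeriv_xx t ht y μ hμ).hasFDerivWithinAt)
    (fun y _ => h1.norm_dxx_le hL ht y hμ) (mem_univ _) (mem_univ _)

/-- The assumption excludes an increment equal to T. Two half increments cover all cases, at the
price of a factor 2. -/
lemma H1.holder_time (h1 : H1 L α T c U D) (hT : 0 < T) (hL : 0 ≤ L) {t t' : ℝ} (ht : 0 ≤ t)
    (htt : t ≤ t') (ht' : t' ≤ T) (x : E d) {μ : Measure (E d)} (hμ : IsP2 μ) :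
    |U t' x μ - U t x μ| + ‖D.dx t' x μ - D.dx t x μ‖
      ≤ 2 * L * √(t' - t) * (1 + ‖x‖ + m2 μ) := by
  have hh : (t' - t) / 2 ∈ Ico 0 T := ⟨by linarith, by linarith⟩
  have a1 := h1.holder_t _ hh t ⟨ht, by linarith⟩ x μ hμ
  have a2 := h1.holder_t _ hh (t + (t' - t) / 2) ⟨by linarith, by linarith⟩ x μ hμ
  have e : t + (t' - t) / 2 + (t' - t) / 2 = t' := by ring
  rw [e] at a2
  rw [← Real.sqrt_eq_rpow] at a1 a2
  have hs : √((t' - t) / 2) ≤ √(t' - t) := Real.sqrt_le_sqrt (by linarith)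
  have hm : 0 ≤ L * (1 + ‖x‖ + m2 μ) := by
    have := m2_nonneg μ
    positivity
  have b1 := abs_sub_le (U t' x μ) (U (t + (t' - t) / 2) x μ) (U t x μ)
  have b2 := norm_sub_le_norm_sub_add_norm_sub (D.dx t' x μ) (D.dx (t + (t' - t) / 2) x μ)
    (D.dx t x μ)
  nlinarith [mul_le_mul_of_nonneg_left hs hm]

lemma H1.U_sub_le (h1 : H1 L α T c U D) (hL : 0 ≤ L) {t : ℝ} (ht : t ∈ Icc 0 T) (x x' : E d)
    {μ μ' : Measure (E d)} (hμ : IsP2 μ) (hμ' : IsP2 μ') :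
    |U t x μ - U t x' μ'| ≤ L * ‖x - x'‖ + L * W2 μ μ' := by
  have a := h1.lip_x hL ht x x' hμ
  have b := h1.lip_μ t ht x' μ μ' hμ hμ'
  have := abs_sub_le (U t x μ) (U t x' μ) (U t x' μ')
  linarith [norm_nonneg (D.dx t x' μ - D.dx t x' μ')]

lemma H1.dx_sub_le (h1 : H1 L α T c U D) (hL : 0 ≤ L) {t : ℝ} (ht : t ∈ Icc 0 T) (x x' : E d)
    {μ μ' : Measure (E d)} (hμ : IsP2 μ) (hμ' : IsP2 μ') :
    ‖D.dx t x μ - D.dx t x' μ'‖ ≤ L * ‖x - x'‖ + L * W2 μ μ' := by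
  have a := h1.dx_lip_x hL ht x x' hμ
  have b := h1.lip_μ t ht x' μ μ' hμ hμ'
  have := norm_sub_le_norm_sub_add_norm_sub (D.dx t x μ) (D.dx t x' μ) (D.dx t x' μ')
  linarith [abs_nonneg (U t x' μ - U t x' μ')]

lemma H1.measurable_U (h1 : H1 L α T c U D) {t : ℝ} (ht : t ∈ Icc 0 T)
    {μ : Measure (E d)} (hμ : IsP2 μ) : Measurable fun x => U t x μ := by
  refine Continuous.measurable ?_
  exact continuous_iff_continuousAt.2 fun x =>
    (h1.classical.hasDeriv_x t ht x μ hμ).hasFDerivAt.continuousAt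

lemma H1.imageLaw_flaw (h1 : H1 L α T c U D) {t : ℝ} (ht : t ∈ Icc 0 T)
    {Θ : Type} [Fintype Θ] {p : Θ → ℝ} (hp : FProb p) (V : Θ → E d) :
    imageLaw U t (flaw p V) = flaw p fun θ => pair (V θ) (U t (V θ) (flaw p V)) := by
  rw [imageLaw, flaw_map]
  exact continuous_pair.measurable.comp
    (measurable_id.prodMk (h1.measurable_U ht (isP2_flaw hp V)))

end reg

/-! ### One step of the Euler scheme on a finite probability space -/

section prod
variable {Ω A S : Type} [Fintype Ω] [Fintype A] {p : Ω → ℝ} {q : A → ℝ}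

/-- Product weights. -/
def prodW (p : Ω → ℝ) (q : A → ℝ) : Ω × A → ℝ := fun θ => p θ.1 * q θ.2

lemma FProb.prodW (hp : FProb p) (hq : FProb q) : FProb (prodW p q) := by
  refine ⟨fun θ => mul_nonneg (hp.nonneg _) (hq.nonneg _), ?_⟩
  simp only [MKV.prodW, Fintype.sum_prod_type]
  simp_rw [← Finset.mul_sum, hq.sum, mul_one, hp.sum]

lemma n2_prodW_fst (hq : FProb q) (V : Ω → ℝ) : n2 (prodW p q) (fun θ => V θ.1) = n2 p V := by
  unfold n2 prodW
  congr 1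
  rw [Fintype.sum_prod_type]
  refine Finset.sum_congr rfl fun ω _ => ?_
  simp only
  rw [← Finset.sum_mul, ← Finset.mul_sum, hq.sum, mul_one]

lemma flaw_prodW_fst [MeasurableSpace S] (hp : FProb p) (hq : FProb q) (V : Ω → S) :
    flaw (prodW p q) (fun θ => V θ.1) = flaw p V := by
  unfold flaw prodW
  rw [Fintype.sum_prod_type]
  refine Finset.sum_congr rfl fun ω _ => ?_
  simp only
  rw [← Finset.sum_smul]
  congr 1
  simp_rw [ENNReal.ofReal_mul (hp.nonneg ω)]
  rw [← Finset.mul_sum, ← ENNReal.ofReal_sum_of_nonneg fun a _ => hq.nonneg a, hq.sum,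
    ENNReal.ofReal_one, mul_one]

end prod

/-- The data of one step of the Euler scheme: a random starting point `X`, a random drift `b` and
the law of the noise. -/
structure EulerStep {d : ℕ} (Λ : ℝ) (Ω : Type) [Fintype Ω] where
  p : Ω → ℝ
  hp : FProb p
  X : Ω → E d
  b : Ω → E d
  Q : Quantization d Λ

namespace EulerStep
variable {d : ℕ} {Λ α T L R : ℝ} {c : Coeffs d} {U : ℝ → E d → Measure (E d) → ℝ} {D : Derivs d}
  {Ω : Type} [Fintype Ω] (k : EulerStep (d := d) Λ Ω)

/-- The law of the starting point. -/
noncomputable def law₀ : Measure (E d) := flaw k.p k.X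

/-- The weights of the pairs (sample, noise). -/
def pq : Ω × Fin k.Q.m → ℝ := prodW k.p k.Q.q

/-- The diffusion coefficient at the starting point. -/
noncomputable def S (c : Coeffs d) (ω : Ω) : E d →L[ℝ] E d := c.σ (k.X ω) k.law₀

/-- The position after a time `s`. -/
noncomputable def pos (c : Coeffs d) (s : ℝ) (θ : Ω × Fin k.Q.m) : E d :=
  k.X θ.1 + s • k.b θ.1 + √s • k.S c θ.1 (k.Q.w θ.2)

/-- The law of the position after a time `s`. -/
noncomputable def lawAt (c : Coeffs d) (s : ℝ) : Measure (E d) := flaw k.pq (k.pos c s)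

/-- The size of the data. -/
noncomputable def G (R : ℝ) (ω : Ω) : ℝ :=
  R + ‖k.X ω‖ + ‖k.b ω‖ + n2 k.p (fun ω => ‖k.X ω‖) + n2 k.p fun ω => ‖k.b ω‖

lemma fprob_pq : FProb k.pq := k.hp.prodW k.Q.fprob

lemma isP2_law₀ : IsP2 k.law₀ := isP2_flaw k.hp _

lemma isP2_lawAt (s : ℝ) : IsP2 (k.lawAt c s) := isP2_flaw k.fprob_pq _

lemma law₀_eq : k.law₀ = flaw k.pq (fun θ => k.X θ.1) :=
  (flaw_prodW_fst k.hp k.Q.fprob k.X).symm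

lemma pos_zero (θ : Ω × Fin k.Q.m) : k.pos c 0 θ = k.X θ.1 := by simp [pos]

lemma lawAt_zero : k.lawAt c 0 = k.law₀ := by
  rw [lawAt, law₀_eq]; congr 1; funext θ; exact k.pos_zero θ

lemma n2_fst (V : Ω → ℝ) : n2 k.pq (fun θ => V θ.1) = n2 k.p V := n2_prodW_fst k.Q.fprob V

variable {k} (hw : ∀ a, ‖k.Q.w a‖ ≤ L) (hL : 1 ≤ L) (hR : 1 ≤ R) (h0 : H0 L c)

lemma le_G (ω : Ω) : R ≤ k.G R ω := by
  have := norm_nonneg (k.X ω)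
  have := norm_nonneg (k.b ω)
  have := n2_nonneg (p := k.p) (V := fun ω => ‖k.X ω‖)
  have := n2_nonneg (p := k.p) (V := fun ω => ‖k.b ω‖)
  unfold G; linarith

include h0 in
lemma norm_S_le (ω : Ω) : ‖k.S c ω‖ ≤ L := h0.bdd_σ _ _ k.isP2_law₀

include hw hL h0 in
lemma norm_Sw_le (θ : Ω × Fin k.Q.m) : ‖k.S c θ.1 (k.Q.w θ.2)‖ ≤ L ^ 2 := by
  refine ((k.S c θ.1).le_opNorm _).trans ?_
  rw [sq]
  exact mul_le_mul (norm_S_le h0 _) (hw _) (norm_nonneg _) (by linarith)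

include hw hL h0 in
lemma norm_pos_sub_le' {s : ℝ} (hs : 0 ≤ s) (hs1 : s ≤ 1) (θ : Ω × Fin k.Q.m) :
    ‖k.pos c s θ - k.X θ.1‖ ≤ √s * L ^ 2 * (1 + ‖k.b θ.1‖) := by
  -- For s ≤ 1 the displacement due to the drift is also of order √s.
  have hss : s ≤ √s := Real.le_sqrt_of_sq_le (by nlinarith)
  have e : k.pos c s θ - k.X θ.1 = s • k.b θ.1 + √s • k.S c θ.1 (k.Q.w θ.2) := by
    simp only [pos]; abel
  rw [e]
  refine (norm_add_le _ _).trans ?_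
  rw [norm_smul, norm_smul, Real.norm_of_nonneg hs, Real.norm_of_nonneg (Real.sqrt_nonneg s)]
  have h1 := mul_le_mul_of_nonneg_left (norm_Sw_le hw hL h0 θ) (Real.sqrt_nonneg s)
  have h2 := mul_le_mul_of_nonneg_right hss (norm_nonneg (k.b θ.1))
  have h3 : √s * ‖k.b θ.1‖ * 1 ≤ √s * ‖k.b θ.1‖ * L ^ 2 := by
    have : 1 ≤ L ^ 2 := one_le_pow₀ hL
    gcongr
  nlinarith

include hw hL h0 hR in
lemma norm_pos_sub_le {s : ℝ} (hs : 0 ≤ s) (hs1 : s ≤ 1) (θ : Ω × Fin k.Q.m) :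
    ‖k.pos c s θ - k.X θ.1‖ ≤ √s * L ^ 2 * k.G R θ.1 := by
  refine (norm_pos_sub_le' hw hL h0 hs hs1 θ).trans ?_
  refine mul_le_mul_of_nonneg_left ?_ (by positivity)
  have := n2_nonneg (p := k.p) (V := fun ω => ‖k.X ω‖)
  have := n2_nonneg (p := k.p) (V := fun ω => ‖k.b ω‖)
  have := norm_nonneg (k.X θ.1)
  unfold G; linarith

include hw hL h0 hR in
lemma n2_pos_sub_le {s : ℝ} (hs : 0 ≤ s) (hs1 : s ≤ 1) (ω : Ω) :
    n2 k.pq (fun θ => ‖k.pos c s θ - k.X θ.1‖) ≤ √s * L ^ 2 * k.G R ω := by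
  have h := n2_mono (p := k.pq) (V := fun θ => ‖k.pos c s θ - k.X θ.1‖)
    (W := fun θ => (fun ω => √s * L ^ 2 * (1 + ‖k.b ω‖)) θ.1) k.fprob_pq.nonneg
    (fun θ => by rw [abs_norm]; exact norm_pos_sub_le' hw hL h0 hs hs1 θ)
  rw [k.n2_fst fun ω => √s * L ^ 2 * (1 + ‖k.b ω‖), n2_const_mul _ (by positivity)] at h
  refine h.trans (mul_le_mul_of_nonneg_left ?_ (by positivity))
  refine (n2_add_le k.hp.nonneg).trans ?_
  rw [n2_const_prob k.hp.sum 1 zero_le_one]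
  have := n2_nonneg (p := k.p) (V := fun ω => ‖k.X ω‖)
  have := norm_nonneg (k.X ω)
  have := norm_nonneg (k.b ω)
  unfold G; linarith

-- `G` contains the quadratic means of the data, so that a global quantity is bounded by its value
-- at any single `ω`.
include hw hL h0 hR in
lemma W2_lawAt_le {s : ℝ} (hs : 0 ≤ s) (hs1 : s ≤ 1) (ω : Ω) :
    W2 (k.lawAt c s) k.law₀ ≤ √s * L ^ 2 * k.G R ω := by
  rw [law₀_eq]
  exact (W2_flaw_le k.fprob_pq _ _).trans (n2_pos_sub_le hw hL hR h0 hs hs1 ω)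

include hw hL h0 hR in
lemma m2_lawAt_le {s : ℝ} (hs : 0 ≤ s) (hs1 : s ≤ 1) (ω : Ω) :
    m2 (k.lawAt c s) ≤ L ^ 2 * k.G R ω := by
  rw [lawAt, m2_flaw k.fprob_pq]
  have h := n2_le_add (p := k.pq) (F := fun θ => ‖k.pos c s θ‖) (V := fun θ => ‖k.X θ.1‖)
    (W := fun θ => ‖k.pos c s θ - k.X θ.1‖) k.fprob_pq.nonneg
    (fun θ => by rw [abs_norm]; exact norm_le_norm_add_norm_sub' _ _)
  rw [k.n2_fst fun ω => ‖k.X ω‖] at h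
  have h2 := n2_mono (p := k.pq) (V := fun θ => ‖k.pos c s θ - k.X θ.1‖)
    (W := fun θ => (fun ω => L ^ 2 * (1 + ‖k.b ω‖)) θ.1) k.fprob_pq.nonneg
    (fun θ => by
      rw [abs_norm]
      refine (norm_pos_sub_le' hw hL h0 hs hs1 θ).trans ?_
      have : √s ≤ 1 := Real.sqrt_le_one.2 hs1
      have h3 : √s * L ^ 2 ≤ 1 * L ^ 2 := by gcongr
      rw [one_mul] at h3
      exact mul_le_mul_of_nonneg_right h3 (by positivity))
  rw [k.n2_fst fun ω => L ^ 2 * (1 + ‖k.b ω‖), n2_const_mul _ (by positivity)] at h2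
  have h4 : n2 k.p (fun ω => 1 + ‖k.b ω‖) ≤ 1 + n2 k.p (fun ω => ‖k.b ω‖) := by
    refine (n2_add_le k.hp.nonneg).trans ?_
    rw [n2_const_prob k.hp.sum 1 zero_le_one]
  have h5 : 1 ≤ L ^ 2 := one_le_pow₀ hL
  have h6 := n2_nonneg (p := k.p) (V := fun ω => ‖k.X ω‖)
  have := norm_nonneg (k.X ω)
  have := norm_nonneg (k.b ω)
  have h7 : n2 k.p (fun ω => ‖k.X ω‖) ≤ L ^ 2 * n2 k.p (fun ω => ‖k.X ω‖) := by nlinarith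
  have h8 : L ^ 2 * n2 k.p (fun ω => 1 + ‖k.b ω‖) ≤ L ^ 2 * (1 + n2 k.p (fun ω => ‖k.b ω‖)) := by
    gcongr
  have h9 : L ^ 2 * (n2 k.p (fun ω => ‖k.X ω‖) + (1 + n2 k.p (fun ω => ‖k.b ω‖)))
      ≤ L ^ 2 * k.G R ω := by
    refine mul_le_mul_of_nonneg_left ?_ (by positivity)
    unfold G; linarith
  linarith

include hR in
lemma one_add_le_G (ω : Ω) : 1 + ‖k.X ω‖ + m2 k.law₀ ≤ k.G R ω := by
  rw [law₀, m2_flaw k.hp]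
  have := norm_nonneg (k.b ω)
  have := n2_nonneg (p := k.p) (V := fun ω => ‖k.b ω‖)
  unfold G; linarith

variable (h1 : H1 L α T c U D) (hT : 0 < T)

include hw hL h0 hR h1 hT in
/-- Regularity of `U` and `∂_x U` along one step. -/
lemma U_dx_pos_sub_le {t s : ℝ} (ht : 0 ≤ t) (hs : 0 ≤ s) (hs1 : s ≤ 1) (hts : t + s ≤ T)
    (θ : Ω × Fin k.Q.m) :
    |U (t + s) (k.pos c s θ) (k.lawAt c s) - U t (k.X θ.1) k.law₀| ≤ 4 * L ^ 3 * √s * k.G R θ.1 ∧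
    ‖D.dx (t + s) (k.pos c s θ) (k.lawAt c s) - D.dx t (k.X θ.1) k.law₀‖
      ≤ 4 * L ^ 3 * √s * k.G R θ.1 := by
  have hL0 : 0 ≤ L := by linarith
  have hts' : t + s ∈ Icc 0 T := ⟨by linarith, hts⟩
  have a := h1.U_sub_le hL0 hts' (k.pos c s θ) (k.X θ.1) (k.isP2_lawAt (c := c) s) k.isP2_law₀
  have a' := h1.dx_sub_le hL0 hts' (k.pos c s θ) (k.X θ.1) (k.isP2_lawAt (c := c) s) k.isP2_law₀
  have b := h1.holder_time hT hL0 ht (by linarith : t ≤ t + s) hts (k.X θ.1) k.isP2_law₀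
  rw [add_sub_cancel_left] at b
  have e1 := mul_le_mul_of_nonneg_left (norm_pos_sub_le hw hL hR h0 hs hs1 θ) hL0
  have e2 := mul_le_mul_of_nonneg_left (W2_lawAt_le hw hL hR h0 hs hs1 θ.1) hL0
  have e3 := mul_le_mul_of_nonneg_left (one_add_le_G (k := k) hR θ.1)
    (by positivity : 0 ≤ 2 * L * √s)
  have hG : 0 ≤ k.G R θ.1 := le_trans (by linarith) (le_G (k := k) θ.1)
  have e4 : 2 * L * √s * k.G R θ.1 ≤ 2 * L ^ 3 * √s * k.G R θ.1 := by
    have : L ≤ L ^ 3 := le_self_pow₀ hL (by norm_num)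
    gcongr
  have n1 := abs_nonneg (U (t + s) (k.X θ.1) k.law₀ - U t (k.X θ.1) k.law₀)
  have n2 := norm_nonneg (D.dx (t + s) (k.X θ.1) k.law₀ - D.dx t (k.X θ.1) k.law₀)
  constructor
  · have := abs_sub_le (U (t + s) (k.pos c s θ) (k.lawAt c s)) (U (t + s) (k.X θ.1) k.law₀)
      (U t (k.X θ.1) k.law₀)
    nlinarith
  · have := norm_sub_le_norm_sub_add_norm_sub (D.dx (t + s) (k.pos c s θ) (k.lawAt c s))
      (D.dx (t + s) (k.X θ.1) k.law₀) (D.dx t (k.X θ.1) k.law₀)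
    nlinarith

end EulerStep

end MKV

namespace MKV

/-! ### Variation of the coefficients and of the decoupling field along one Euler step. -/

namespace EulerStep
variable {d : ℕ} {Λ α T L R : ℝ} {c : Coeffs d} {U : ℝ → E d → Measure (E d) → ℝ} {D : Derivs d}
  {Ω : Type} [Fintype Ω] (k : EulerStep (d := d) Λ Ω)

/-- The drift along the decoupling field after a time `s`. -/
noncomputable def driftAt (c : Coeffs d) (U : ℝ → E d → Measure (E d) → ℝ) (t s : ℝ)
    (θ : Ω × Fin k.Q.m) : E d :=
  c.b (k.pos c s θ) (U (t + s) (k.pos c s θ) (k.lawAt c s)) (imageLaw U (t + s) (k.lawAt c s))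

/-- The drift along the decoupling field at the starting point. -/
noncomputable def drift₀ (c : Coeffs d) (U : ℝ → E d → Measure (E d) → ℝ) (t : ℝ) (ω : Ω) : E d :=
  c.b (k.X ω) (U t (k.X ω) k.law₀) (imageLaw U t k.law₀)

/-- The driver along the decoupling field after a time `s`. -/
noncomputable def driverAt (c : Coeffs d) (U : ℝ → E d → Measure (E d) → ℝ) (D : Derivs d)
    (t s : ℝ) (θ : Ω × Fin k.Q.m) : ℝ :=
  c.f (k.pos c s θ) (U (t + s) (k.pos c s θ) (k.lawAt c s))
    (ContinuousLinearMap.adjoint (c.σ (k.pos c s θ) (k.lawAt c s))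
      (D.dx (t + s) (k.pos c s θ) (k.lawAt c s))) (imageLaw U (t + s) (k.lawAt c s))

/-- The rotated gradient of the decoupling field at the starting point. -/
noncomputable def Z₀ (c : Coeffs d) (D : Derivs d) (t : ℝ) (ω : Ω) : E d :=
  ContinuousLinearMap.adjoint (k.S c ω) (D.dx t (k.X ω) k.law₀)

/-- The driver along the decoupling field at the starting point. -/
noncomputable def driver₀ (c : Coeffs d) (U : ℝ → E d → Measure (E d) → ℝ) (D : Derivs d)
    (t : ℝ) (ω : Ω) : ℝ :=
  c.f (k.X ω) (U t (k.X ω) k.law₀) (k.Z₀ c D t ω) (imageLaw U t k.law₀)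

variable {k} (hw : ∀ a, ‖k.Q.w a‖ ≤ L) (hL : 1 ≤ L) (hR : 1 ≤ R) (h0 : H0 L c)
  (h1 : H1 L α T c U D) (hT : 0 < T)

include hR in
lemma G_nonneg (ω : Ω) : 0 ≤ k.G R ω := le_trans (by linarith) (le_G (k := k) ω)

lemma n2_G_nonneg : 0 ≤ n2 k.p (k.G R) := n2_nonneg

include h1 in
lemma imageLaw_law₀ {t : ℝ} (ht : t ∈ Icc 0 T) :
    imageLaw U t k.law₀ = flaw k.p fun ω => pair (k.X ω) (U t (k.X ω) k.law₀) :=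
  h1.imageLaw_flaw ht k.hp _

include h1 in
lemma imageLaw_lawAt {t : ℝ} (ht : t ∈ Icc 0 T) (s : ℝ) :
    imageLaw U t (k.lawAt c s)
      = flaw k.pq fun θ => pair (k.pos c s θ) (U t (k.pos c s θ) (k.lawAt c s)) :=
  h1.imageLaw_flaw ht k.fprob_pq _

include h1 in
lemma isP2_imageLaw_law₀ {t : ℝ} (ht : t ∈ Icc 0 T) : IsP2 (imageLaw U t k.law₀) := by
  rw [imageLaw_law₀ h1 ht]; exact isP2_flaw k.hp _

include h1 in
lemma isP2_imageLaw_lawAt {t : ℝ} (ht : t ∈ Icc 0 T) (s : ℝ) :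
    IsP2 (imageLaw U t (k.lawAt c s)) := by
  rw [imageLaw_lawAt h1 ht]; exact isP2_flaw k.fprob_pq _

include hw hL h0 hR h1 hT in
lemma W2_imageLaw_le {t s : ℝ} (ht : 0 ≤ t) (hs : 0 ≤ s) (hs1 : s ≤ 1) (hts : t + s ≤ T) :
    W2 (imageLaw U (t + s) (k.lawAt c s)) (imageLaw U t k.law₀)
      ≤ 5 * L ^ 3 * √s * n2 k.p (k.G R) := by
  rw [imageLaw_lawAt h1 ⟨by linarith, hts⟩, imageLaw_law₀ h1 ⟨ht, by linarith⟩,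
    ← flaw_prodW_fst k.hp k.Q.fprob fun ω => pair (k.X ω) (U t (k.X ω) k.law₀)]
  refine (W2_pair_le k.fprob_pq _ _ _ _).trans ?_
  have e1 := n2_mono (p := k.pq) (V := fun θ => ‖k.pos c s θ - k.X θ.1‖)
    (W := fun θ => (fun ω => √s * L ^ 2 * k.G R ω) θ.1) k.fprob_pq.nonneg
    (fun θ => by rw [abs_norm]; exact norm_pos_sub_le hw hL hR h0 hs hs1 θ)
  have e2 := n2_mono (p := k.pq)
    (V := fun θ => U (t + s) (k.pos c s θ) (k.lawAt c s) - U t (k.X θ.1) k.law₀)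
    (W := fun θ => (fun ω => 4 * L ^ 3 * √s * k.G R ω) θ.1) k.fprob_pq.nonneg
    (fun θ => (U_dx_pos_sub_le hw hL hR h0 h1 hT ht hs hs1 hts θ).1)
  rw [k.n2_fst fun ω => √s * L ^ 2 * k.G R ω, n2_const_mul _ (by positivity)] at e1
  rw [k.n2_fst fun ω => 4 * L ^ 3 * √s * k.G R ω, n2_const_mul _ (by positivity)] at e2
  have h : √s * L ^ 2 * n2 k.p (k.G R) ≤ √s * L ^ 3 * n2 k.p (k.G R) := by
    have : 0 ≤ n2 k.p (k.G R) := n2_nonneg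
    have : L ^ 2 ≤ L ^ 3 := pow_le_pow_right₀ hL (by norm_num)
    gcongr
  have e1' : n2 k.pq (fun θ => ‖k.pos c s θ - k.X θ.1‖) ≤ √s * L ^ 2 * n2 k.p (k.G R) := e1
  have e2' : n2 k.pq (fun θ => U (t + s) (k.pos c s θ) (k.lawAt c s) - U t (k.X θ.1) k.law₀)
    ≤ 4 * L ^ 3 * √s * n2 k.p (k.G R) := e2
  calc _ ≤ _ := add_le_add e1' e2'
    _ ≤ _ := by linarith

include hw hL h0 hR h1 hT in
lemma norm_driftAt_sub_le {t s : ℝ} (ht : 0 ≤ t) (hs : 0 ≤ s) (hs1 : s ≤ 1) (hts : t + s ≤ T)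
    (θ : Ω × Fin k.Q.m) : ‖k.driftAt c U t s θ - k.drift₀ c U t θ.1‖
      ≤ 5 * L ^ 4 * √s * (k.G R θ.1 + n2 k.p (k.G R)) := by
  have h := h0.lip_b (k.pos c s θ) (k.X θ.1) (U (t + s) (k.pos c s θ) (k.lawAt c s))
    (U t (k.X θ.1) k.law₀) _ _ (isP2_imageLaw_lawAt (k := k) h1 ⟨by linarith, hts⟩ s)
    (isP2_imageLaw_law₀ (k := k) h1 (t := t) ⟨ht, by linarith⟩)
  have a1 := norm_pos_sub_le hw hL hR h0 hs hs1 θ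
  have a2 := (U_dx_pos_sub_le hw hL hR h0 h1 hT ht hs hs1 hts θ).1
  have a3 := W2_imageLaw_le hw hL hR h0 h1 hT ht hs hs1 hts
  refine h.trans ?_
  have hG := G_nonneg (k := k) hR θ.1
  have h' : √s * L ^ 2 * k.G R θ.1 ≤ √s * L ^ 3 * k.G R θ.1 := by
    have : L ^ 2 ≤ L ^ 3 := pow_le_pow_right₀ hL (by norm_num)
    gcongr
  have hb : ‖k.pos c s θ - k.X θ.1‖ + |U (t + s) (k.pos c s θ) (k.lawAt c s)
      - U t (k.X θ.1) k.law₀| + W2 (imageLaw U (t + s) (k.lawAt c s)) (imageLaw U t k.law₀)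
      ≤ 5 * L ^ 3 * √s * (k.G R θ.1 + n2 k.p (k.G R)) := by linarith
  calc _ ≤ _ := mul_le_mul_of_nonneg_left hb (by linarith)
    _ = _ := by ring

include hw hL h0 hR in
lemma norm_σ_pos_sub_le {s : ℝ} (hs : 0 ≤ s) (hs1 : s ≤ 1) (θ : Ω × Fin k.Q.m) :
    ‖c.σ (k.pos c s θ) (k.lawAt c s) - k.S c θ.1‖ ≤ 2 * L ^ 3 * √s * k.G R θ.1 := by
  refine (h0.lip_σ _ _ _ _ (k.isP2_lawAt s) k.isP2_law₀).trans ?_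
  have a1 := norm_pos_sub_le hw hL hR h0 hs hs1 θ
  have a2 := W2_lawAt_le hw hL hR h0 hs hs1 θ.1
  calc _ ≤ L * (√s * L ^ 2 * k.G R θ.1 + √s * L ^ 2 * k.G R θ.1) :=
        mul_le_mul_of_nonneg_left (add_le_add a1 a2) (by linarith)
    _ = _ := by ring

include hw hL h0 hR h1 hT in
lemma abs_driverAt_sub_le {t s : ℝ} (ht : 0 ≤ t) (hs : 0 ≤ s) (hs1 : s ≤ 1) (hts : t + s ≤ T)
    (θ : Ω × Fin k.Q.m) : |k.driverAt c U D t s θ - k.driver₀ c U D t θ.1|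
      ≤ 11 * L ^ 5 * √s * (k.G R θ.1 + n2 k.p (k.G R)) := by
  have hL0 : 0 ≤ L := by linarith
  have hG := G_nonneg (k := k) hR θ.1
  have hN := n2_G_nonneg (k := k) (R := R)
  set z := ContinuousLinearMap.adjoint (c.σ (k.pos c s θ) (k.lawAt c s))
      (D.dx (t + s) (k.pos c s θ) (k.lawAt c s)) with hz
  have h := h0.lip_f (k.pos c s θ) (k.X θ.1) (U (t + s) (k.pos c s θ) (k.lawAt c s))
    (U t (k.X θ.1) k.law₀) z (k.Z₀ c D t θ.1) _ _
    (isP2_imageLaw_lawAt (k := k) h1 ⟨by linarith, hts⟩ s)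
    (isP2_imageLaw_law₀ (k := k) h1 (t := t) ⟨ht, by linarith⟩)
  have a1 := norm_pos_sub_le hw hL hR h0 hs hs1 θ
  obtain ⟨a2, a4⟩ := U_dx_pos_sub_le hw hL hR h0 h1 hT ht hs hs1 hts θ
  have a3 := W2_imageLaw_le hw hL hR h0 h1 hT ht hs hs1 hts
  have hzz : ‖z - k.Z₀ c D t θ.1‖ ≤ 6 * L ^ 4 * √s * k.G R θ.1 := by
    have e : z - k.Z₀ c D t θ.1
        = ContinuousLinearMap.adjoint (c.σ (k.pos c s θ) (k.lawAt c s) - k.S c θ.1)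
            (D.dx (t + s) (k.pos c s θ) (k.lawAt c s))
          + ContinuousLinearMap.adjoint (k.S c θ.1)
            (D.dx (t + s) (k.pos c s θ) (k.lawAt c s) - D.dx t (k.X θ.1) k.law₀) := by
      simp only [hz, Z₀, map_sub, sub_apply]; abel
    rw [e]
    refine (norm_add_le _ _).trans ?_
    have u1 := ContinuousLinearMap.le_opNorm (ContinuousLinearMap.adjoint
      (c.σ (k.pos c s θ) (k.lawAt c s) - k.S c θ.1)) (D.dx (t + s) (k.pos c s θ) (k.lawAt c s))
    have u2 := ContinuousLinearMap.le_opNorm (ContinuousLinearMap.adjoint (k.S c θ.1))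
      (D.dx (t + s) (k.pos c s θ) (k.lawAt c s) - D.dx t (k.X θ.1) k.law₀)
    rw [LinearIsometryEquiv.norm_map] at u1 u2
    have v1 := mul_le_mul (norm_σ_pos_sub_le hw hL hR h0 hs hs1 θ)
      (h1.norm_dx_le hL0 ⟨by linarith, hts⟩ (k.pos c s θ) (k.isP2_lawAt (c := c) s))
      (norm_nonneg _) (by positivity)
    have v2 := mul_le_mul (norm_S_le (k := k) h0 θ.1) a4 (norm_nonneg _) hL0
    calc _ ≤ _ := add_le_add (u1.trans v1) (u2.trans v2)
      _ = _ := by ring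
  refine h.trans ?_
  have h' : √s * L ^ 2 * k.G R θ.1 ≤ √s * L ^ 4 * k.G R θ.1 := by
    have : L ^ 2 ≤ L ^ 4 := pow_le_pow_right₀ hL (by norm_num)
    gcongr
  have h'' : 4 * L ^ 3 * √s * k.G R θ.1 ≤ 4 * L ^ 4 * √s * k.G R θ.1 := by
    have : L ^ 3 ≤ L ^ 4 := pow_le_pow_right₀ hL (by norm_num)
    gcongr
  have h''' : 5 * L ^ 3 * √s * n2 k.p (k.G R) ≤ 11 * L ^ 4 * √s * n2 k.p (k.G R) := by
    have : L ^ 3 ≤ L ^ 4 := pow_le_pow_right₀ hL (by norm_num)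
    gcongr; norm_num
  have hb : ‖k.pos c s θ - k.X θ.1‖ + |U (t + s) (k.pos c s θ) (k.lawAt c s)
      - U t (k.X θ.1) k.law₀| + ‖z - k.Z₀ c D t θ.1‖
      + W2 (imageLaw U (t + s) (k.lawAt c s)) (imageLaw U t k.law₀)
      ≤ 11 * L ^ 4 * √s * (k.G R θ.1 + n2 k.p (k.G R)) := by linarith
  calc _ ≤ _ := mul_le_mul_of_nonneg_left hb hL0
    _ = _ := by ring

/-! #### The derivative of the decoupling field along the step -/

/-- Differentiability fails at s = 0, since the noise contributes a velocity of size 1/√s. Averaging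
over the noise removes this singularity later. -/
lemma hasDerivAt_pos {s : ℝ} (hs : 0 < s) (t : ℝ) (θ : Ω × Fin k.Q.m) :
    HasDerivAt (fun r => k.pos c (r - t) θ)
      (k.b θ.1 + (1 / (2 * √s)) • k.S c θ.1 (k.Q.w θ.2)) (t + s) := by
  have e : t + s - t = s := by ring
  have h1 : HasDerivAt (fun r : ℝ => r - t) 1 (t + s) := (hasDerivAt_id _).sub_const t
  have h2 : HasDerivAt (fun r : ℝ => √(r - t)) (1 / (2 * √s) * 1) (t + s) := by
    refine HasDerivAt.comp (h₂ := Real.sqrt) (t + s) ?_ h1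
    rw [e]; exact Real.hasDerivAt_sqrt hs.ne'
  have h3 := ((h1.smul_const (k.b θ.1)).const_add (k.X θ.1)).add
    (h2.smul_const (k.S c θ.1 (k.Q.w θ.2)))
  exact h3.congr_deriv (by rw [one_smul, mul_one])

/-- The second order term of the generator. -/
noncomputable def corr (k : EulerStep (d := d) Λ Ω) (c : Coeffs d) (s : ℝ) (v : E d)
    (M : E d →L[ℝ] E d) (θ : Ω × Fin k.Q.m) : ℝ :=
  inner ℝ v ((1 / (2 * √s)) • k.S c θ.1 (k.Q.w θ.2))
    - (1 / 2) * tr (M.comp (c.a (k.pos c s θ) (k.lawAt c s)))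

include h1 in
/-- The derivative in time of the decoupling field along the step, after substitution of the master
equation. -/
lemma hasDerivAt_U_pos {t s : ℝ} (ht : 0 ≤ t) (hs : 0 < s) (hts : t + s < T)
    (θ : Ω × Fin k.Q.m) :
    HasDerivAt (fun r => U r (k.pos c (r - t) θ) (k.lawAt c (r - t)))
      (inner ℝ (D.dx (t + s) (k.pos c s θ) (k.lawAt c s)) (k.b θ.1 - k.driftAt c U t s θ)
        - k.driverAt c U D t s θ
        + k.corr c s (D.dx (t + s) (k.pos c s θ) (k.lawAt c s))
            (D.dxx (t + s) (k.pos c s θ) (k.lawAt c s)) θ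
        + ∑ θ', k.pq θ' * inner ℝ
            (D.dμ (t + s) (k.pos c s θ) (k.lawAt c s) (k.pos c s θ'))
            (k.b θ'.1 - k.driftAt c U t s θ')
        + ∑ θ', k.pq θ' * k.corr c s (D.dμ (t + s) (k.pos c s θ) (k.lawAt c s) (k.pos c s θ'))
            (D.dvdμ (t + s) (k.pos c s θ) (k.lawAt c s) (k.pos c s θ')) θ') (t + s) := by
  have e : t + s - t = s := by ring
  have h := h1.classical.hasDerivAt_flow k.fprob_pq (r₀ := t + s) ⟨by linarith, hts⟩
    (x := fun r => k.pos c (r - t) θ) (V := fun r => k.pos c (r - t))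
    (V' := fun θ' => k.b θ'.1 + (1 / (2 * √s)) • k.S c θ'.1 (k.Q.w θ'.2))
    (hasDerivAt_pos hs t θ) (fun θ' => hasDerivAt_pos hs t θ')
  simp only [e] at h
  -- The master equation at the moved point eliminates ∂ₜU. Its integrals are finite sums, so its
  -- drift and trace terms can be paired with those of the chain rule, leaving drift gaps and the
  -- terms `corr`.
  have pde := h1.classical.pde (t + s) ⟨by linarith, hts⟩ (k.pos c s θ) (k.lawAt c s)
    (k.isP2_lawAt s)
  rw [show (∫ v, inner ℝ (D.dμ (t + s) (k.pos c s θ) (k.lawAt c s) v)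
      (c.b v (U (t + s) v (k.lawAt c s)) (imageLaw U (t + s) (k.lawAt c s))) ∂(k.lawAt c s))
      = ∑ θ', k.pq θ' * inner ℝ
            (D.dμ (t + s) (k.pos c s θ) (k.lawAt c s) (k.pos c s θ')) (k.driftAt c U t s θ')
      from integral_flaw k.fprob_pq _ _,
    show (∫ v, (1 / 2) * tr ((D.dvdμ (t + s) (k.pos c s θ) (k.lawAt c s) v).comp
      (c.a v (k.lawAt c s))) ∂(k.lawAt c s))
      = ∑ θ', k.pq θ' * ((1 / 2) * tr ((D.dvdμ (t + s) (k.pos c s θ) (k.lawAt c s)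
        (k.pos c s θ')).comp (c.a (k.pos c s θ') (k.lawAt c s))))
      from integral_flaw k.fprob_pq _ _] at pde
  refine h.congr_deriv ?_
  have s1 : ∑ θ', k.pq θ' * inner ℝ (D.dμ (t + s) (k.pos c s θ) (k.lawAt c s) (k.pos c s θ'))
        (k.b θ'.1 + (1 / (2 * √s)) • k.S c θ'.1 (k.Q.w θ'.2))
      = ∑ θ', k.pq θ' * inner ℝ
            (D.dμ (t + s) (k.pos c s θ) (k.lawAt c s) (k.pos c s θ'))
            (k.b θ'.1 - k.driftAt c U t s θ')
        + ∑ θ', k.pq θ' * k.corr c s (D.dμ (t + s) (k.pos c s θ) (k.lawAt c s) (k.pos c s θ'))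
            (D.dvdμ (t + s) (k.pos c s θ) (k.lawAt c s) (k.pos c s θ')) θ'
        + ∑ θ', k.pq θ' * inner ℝ
            (D.dμ (t + s) (k.pos c s θ) (k.lawAt c s) (k.pos c s θ')) (k.driftAt c U t s θ')
        + ∑ θ', k.pq θ' * ((1 / 2) * tr ((D.dvdμ (t + s) (k.pos c s θ) (k.lawAt c s)
        (k.pos c s θ')).comp (c.a (k.pos c s θ') (k.lawAt c s)))) := by
    rw [← Finset.sum_add_distrib, ← Finset.sum_add_distrib, ← Finset.sum_add_distrib]
    refine Finset.sum_congr rfl fun θ' _ => ?_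
    rw [corr, inner_add_right, inner_sub_right]
    ring
  change D.dt (t + s) (k.pos c s θ) (k.lawAt c s) + inner ℝ (D.dx (t + s) (k.pos c s θ)
    (k.lawAt c s)) _ + ∑ θ', k.pq θ' * inner ℝ (D.dμ (t + s) (k.pos c s θ) (k.lawAt c s)
    (k.pos c s θ')) (k.b θ'.1 + (1 / (2 * √s)) • k.S c θ'.1 (k.Q.w θ'.2)) = _
  rw [s1, inner_add_right, inner_sub_right, corr]
  have e2 : inner ℝ (c.b (k.pos c s θ) (U (t + s) (k.pos c s θ) (k.lawAt c s))
      (imageLaw U (t + s) (k.lawAt c s))) (D.dx (t + s) (k.pos c s θ) (k.lawAt c s))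
      = inner ℝ (D.dx (t + s) (k.pos c s θ) (k.lawAt c s)) (k.driftAt c U t s θ) :=
    real_inner_comm _ _
  rw [e2] at pde
  have e3 : k.driverAt c U D t s θ = c.f (k.pos c s θ) (U (t + s) (k.pos c s θ) (k.lawAt c s))
    (ContinuousLinearMap.adjoint (c.σ (k.pos c s θ) (k.lawAt c s))
      (D.dx (t + s) (k.pos c s θ) (k.lawAt c s))) (imageLaw U (t + s) (k.lawAt c s)) := rfl
  rw [e3]
  linarith

end EulerStep

end MKV

namespace MKV

/-! ### One-step weak expansion of the decoupling field. -/

namespace EulerStep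
variable {d : ℕ} {Λ α T L R : ℝ} {c : Coeffs d} {U : ℝ → E d → Measure (E d) → ℝ} {D : Derivs d}
  {Ω : Type} [Fintype Ω] {k : EulerStep (d := d) Λ Ω}
  (hw : ∀ a, ‖k.Q.w a‖ ≤ L) (hL : 1 ≤ L) (hR : 1 ≤ R) (h0 : H0 L c)
  (h1 : H1 L α T c U D) (hT : 0 < T)

include h0 in
lemma norm_a_sub_le {s : ℝ} (θ : Ω × Fin k.Q.m) :
    ‖(k.S c θ.1).comp (ContinuousLinearMap.adjoint (k.S c θ.1))
      - c.a (k.pos c s θ) (k.lawAt c s)‖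
      ≤ 2 * L * ‖c.σ (k.pos c s θ) (k.lawAt c s) - k.S c θ.1‖ := by
  rw [norm_sub_rev (c.σ _ _)]
  exact norm_comp_adjoint_sub_le _ _ (norm_S_le h0 _) (h0.bdd_σ _ _ (k.isP2_lawAt s))

include hw hL h0 hR in
lemma norm_a_sub_le' {s : ℝ} (hs : 0 ≤ s) (hs1 : s ≤ 1) (θ : Ω × Fin k.Q.m) :
    ‖(k.S c θ.1).comp (ContinuousLinearMap.adjoint (k.S c θ.1))
      - c.a (k.pos c s θ) (k.lawAt c s)‖ ≤ 4 * L ^ 4 * √s * k.G R θ.1 := by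
  refine (norm_a_sub_le h0 θ).trans ?_
  have := mul_le_mul_of_nonneg_left (norm_σ_pos_sub_le hw hL hR h0 hs hs1 θ)
    (by linarith : 0 ≤ 2 * L)
  linarith

-- `Quantization.ito_correction` applied to ∂ₓU, whose derivative is globally Lipschitz in x. The
-- base point of the expansion is X + s b: it contains the drift but not the noise.
include hw hL h0 hR h1 in
lemma abs_sum_corr_x_le {t s : ℝ} (ht : 0 ≤ t) (hs : 0 < s) (hs1 : s ≤ 1) (hts : t + s ≤ T)
    (ω : Ω) :
    |∑ a, k.Q.q a * k.corr c s (D.dx (t + s) (k.pos c s (ω, a)) (k.lawAt c s))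
      (D.dxx (t + s) (k.pos c s (ω, a)) (k.lawAt c s)) (ω, a)|
      ≤ 5 * (1 + d) * L ^ 7 * √s * k.G R ω := by
  have hL0 : 0 ≤ L := by linarith
  have hts' : t + s ∈ Icc 0 T := ⟨by linarith, hts⟩
  have hs' : 0 < √s := Real.sqrt_pos.2 hs
  have hG := G_nonneg (k := k) hR ω
  have h := k.Q.ito_correction hL hw (G := fun v => D.dx (t + s) v (k.lawAt c s))
    (G' := fun v => D.dxx (t + s) v (k.lawAt c s))
    (fun v => h1.classical.hasDeriv_xx (t + s) hts' v _ (k.isP2_lawAt s))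
    (x₀ := k.X ω + s • k.b ω) (norm_S_le (k := k) h0 ω) hs' hL0
    (fun y _ => by
      have := h1.lip_xx (t + s) hts' (k.X ω + s • k.b ω + y) (k.X ω + s • k.b ω) (k.lawAt c s)
        (k.isP2_lawAt s)
      simpa using this)
    (fun a => c.a (k.pos c s (ω, a)) (k.lawAt c s))
  refine h.trans ?_
  have hsum : ∑ a, k.Q.q a * (‖D.dxx (t + s) (k.X ω + s • k.b ω + √s • (k.S c ω) (k.Q.w a))
      (k.lawAt c s)‖ * ‖(k.S c ω).comp (ContinuousLinearMap.adjoint (k.S c ω))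
        - c.a (k.pos c s (ω, a)) (k.lawAt c s)‖) ≤ L * (4 * L ^ 4 * √s * k.G R ω) := by
    have : ∀ a ∈ Finset.univ, k.Q.q a * (‖D.dxx (t + s) (k.X ω + s • k.b ω
        + √s • (k.S c ω) (k.Q.w a)) (k.lawAt c s)‖ *
        ‖(k.S c ω).comp (ContinuousLinearMap.adjoint (k.S c ω))
        - c.a (k.pos c s (ω, a)) (k.lawAt c s)‖)
        ≤ k.Q.q a * (L * (4 * L ^ 4 * √s * k.G R ω)) := by
      intro a _
      refine mul_le_mul_of_nonneg_left ?_ (k.Q.q_pos a).le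
      exact mul_le_mul (h1.norm_dxx_le hL0 hts' _ (k.isP2_lawAt s))
        (norm_a_sub_le' hw hL hR h0 hs.le hs1 (ω, a)) (norm_nonneg _) hL0
    refine (Finset.sum_le_sum this).trans ?_
    rw [← Finset.sum_mul, k.Q.q_sum, one_mul]
  have hsum' := mul_le_mul_of_nonneg_left hsum (Nat.cast_nonneg (α := ℝ) d)
  have e1 : (1 + (d : ℝ)) * L ^ 6 * (√s * L) ≤ (1 + d) * L ^ 7 * √s * k.G R ω := by
    have := le_G (k := k) (R := R) ω
    calc (1 + (d : ℝ)) * L ^ 6 * (√s * L) = (1 + d) * L ^ 7 * √s * 1 := by ring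
      _ ≤ _ := by gcongr; linarith
  have e2 : (d : ℝ) * (L * (4 * L ^ 4 * √s * k.G R ω)) ≤ (1 + d) * (4 * L ^ 7 * √s * k.G R ω) := by
    calc (d : ℝ) * (L * (4 * L ^ 4 * √s * k.G R ω)) = d * (4 * L ^ 5 * √s * k.G R ω) := by ring
      _ ≤ (1 + d) * (4 * L ^ 7 * √s * k.G R ω) := by
        have : L ^ 5 ≤ L ^ 7 := pow_le_pow_right₀ hL (by norm_num)
        gcongr
        linarith
  linarith

-- This is where the exponent α enters. Both points and the mean of the law are bounded by B = L²G ≥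
-- 1, so the bracket in the assumption is at most 4B^(2α).
include hw hL h0 hR h1 in
lemma dvdμ_lip {t s : ℝ} (hα : 0 ≤ α) (ht : 0 ≤ t) (hs : 0 ≤ s) (hs1 : s ≤ 1) (hts : t + s ≤ T)
    (x : E d)
    (ω : Ω) (y : E d) (hy : ‖y‖ ≤ √s * L ^ 2) :
    ‖D.dvdμ (t + s) x (k.lawAt c s) (k.X ω + s • k.b ω + y)
      - D.dvdμ (t + s) x (k.lawAt c s) (k.X ω + s • k.b ω)‖
      ≤ 2 * L * (L ^ 2) ^ α * k.G R ω ^ α * ‖y‖ := by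
  have hL0 : 0 ≤ L := by linarith
  have hts' : t + s ∈ Icc 0 T := ⟨by linarith, hts⟩
  have hG := G_nonneg (k := k) hR ω
  have h := h1.lip_v (t + s) hts' x _ (k.isP2_lawAt (c := c) s) (k.X ω + s • k.b ω + y)
    (k.X ω + s • k.b ω)
  rw [add_sub_cancel_left] at h
  refine h.trans (mul_le_mul_of_nonneg_right ?_ (norm_nonneg _))
  have hL2 : 1 ≤ L ^ 2 := one_le_pow₀ hL
  set B := L ^ 2 * k.G R ω with hB
  have hB1 : 1 ≤ B := by
    have := le_G (k := k) (R := R) ω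
    nlinarith
  have hs2 : √s ≤ 1 := Real.sqrt_le_one.2 hs1
  have hx0 : ‖k.X ω + s • k.b ω‖ ≤ ‖k.X ω‖ + ‖k.b ω‖ := by
    refine (norm_add_le _ _).trans ?_
    rw [norm_smul, Real.norm_of_nonneg hs]
    nlinarith [norm_nonneg (k.b ω)]
  have hG' : ‖k.X ω‖ + ‖k.b ω‖ + 1 ≤ k.G R ω := by
    have := n2_nonneg (p := k.p) (V := fun ω => ‖k.X ω‖)
    have := n2_nonneg (p := k.p) (V := fun ω => ‖k.b ω‖)
    unfold G; linarith
  have hv' : ‖k.X ω + s • k.b ω‖ ≤ B := by nlinarith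
  have hv : ‖k.X ω + s • k.b ω + y‖ ≤ B := by
    refine (norm_add_le _ _).trans ?_
    have : √s * L ^ 2 ≤ 1 * L ^ 2 := by gcongr
    have e : L ^ 2 * (‖k.X ω‖ + ‖k.b ω‖ + 1) ≤ B := by rw [hB]; gcongr
    nlinarith [norm_nonneg (k.X ω), norm_nonneg (k.b ω)]
  have hm : m2 (k.lawAt c s) ≤ B := m2_lawAt_le hw hL hR h0 hs hs1 ω
  have p1 := Real.rpow_le_rpow (norm_nonneg _) hv (by linarith : 0 ≤ 2 * α)
  have p2 := Real.rpow_le_rpow (norm_nonneg _) hv' (by linarith : 0 ≤ 2 * α)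
  have p3 := Real.rpow_le_rpow (m2_nonneg _) hm (by linarith : 0 ≤ 2 * α)
  have p4 := Real.one_le_rpow hB1 (by linarith : 0 ≤ 2 * α)
  have hsq : (4 * B ^ (2 * α)) = (2 * B ^ α) ^ 2 := by
    rw [mul_pow, ← Real.rpow_natCast (B ^ α) 2, ← Real.rpow_mul (by linarith)]
    norm_num [mul_comm]
  have : (1 + ‖k.X ω + s • k.b ω + y‖ ^ (2 * α) + ‖k.X ω + s • k.b ω‖ ^ (2 * α)
      + m2 (k.lawAt c s) ^ (2 * α)) ^ (1 / 2 : ℝ) ≤ 2 * B ^ α := by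
    rw [← Real.sqrt_eq_rpow, Real.sqrt_le_left (by positivity), ← hsq]
    linarith
  calc _ ≤ L * (2 * B ^ α) := mul_le_mul_of_nonneg_left this hL0
    _ = _ := by rw [hB, Real.mul_rpow (by positivity) hG]; ring

-- The noise is averaged first, at fixed `ω`, by `Quantization.ito_correction`, and then `ω`. The
-- variation of a is paired with ∂ᵥ∂_μU by Cauchy–Schwarz, because only the L² norm of the latter is
-- bounded. The mean of G^α left by the Taylor remainder is the reason why moments of order 2α are
-- needed.
include hw hL h0 hR h1 in
lemma abs_sum_corr_μ_le {t s : ℝ} (hα : 0 ≤ α) (ht : 0 ≤ t) (hs : 0 < s) (hs1 : s ≤ 1)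
    (hts : t + s ≤ T) (x : E d) :
    |∑ θ, k.pq θ * k.corr c s (D.dμ (t + s) x (k.lawAt c s) (k.pos c s θ))
      (D.dvdμ (t + s) x (k.lawAt c s) (k.pos c s θ)) θ|
      ≤ (1 + d) * L ^ 6 * √s * (2 * L * (L ^ 2) ^ α * ∑ ω, k.p ω * k.G R ω ^ α)
        + 4 * d * L ^ 5 * √s * n2 k.p (k.G R) := by
  have hL0 : 0 ≤ L := by linarith
  have hts' : t + s ∈ Icc 0 T := ⟨by linarith, hts⟩
  have hs' : 0 < √s := Real.sqrt_pos.2 hs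
  have hG := G_nonneg (k := k) hR
  have h : ∀ ω, |∑ a, k.Q.q a * k.corr c s (D.dμ (t + s) x (k.lawAt c s) (k.pos c s (ω, a)))
      (D.dvdμ (t + s) x (k.lawAt c s) (k.pos c s (ω, a))) (ω, a)| ≤
      (1 + d) * L ^ 6 * (√s * (2 * L * (L ^ 2) ^ α * k.G R ω ^ α)) + d * ∑ a, k.Q.q a *
        (‖D.dvdμ (t + s) x (k.lawAt c s) (k.pos c s (ω, a))‖ *
          ‖(k.S c ω).comp (ContinuousLinearMap.adjoint (k.S c ω))
            - c.a (k.pos c s (ω, a)) (k.lawAt c s)‖) := fun ω =>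
    k.Q.ito_correction hL hw (G := fun v => D.dμ (t + s) x (k.lawAt c s) v)
      (G' := fun v => D.dvdμ (t + s) x (k.lawAt c s) v)
      (fun v => h1.classical.hasDeriv_v (t + s) hts' x _ (k.isP2_lawAt s) v)
      (x₀ := k.X ω + s • k.b ω) (norm_S_le (k := k) h0 ω) hs'
      (mul_nonneg (by positivity) (Real.rpow_nonneg (hG ω) _))
      (fun y hy => dvdμ_lip hw hL hR h0 h1 hα ht hs.le hs1 hts x ω y hy)
      (fun a => c.a (k.pos c s (ω, a)) (k.lawAt c s))
  have e : ∑ θ, k.pq θ * k.corr c s (D.dμ (t + s) x (k.lawAt c s) (k.pos c s θ))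
      (D.dvdμ (t + s) x (k.lawAt c s) (k.pos c s θ)) θ
      = ∑ ω, k.p ω * ∑ a, k.Q.q a * k.corr c s (D.dμ (t + s) x (k.lawAt c s)
        (k.pos c s (ω, a))) (D.dvdμ (t + s) x (k.lawAt c s) (k.pos c s (ω, a))) (ω, a) := by
    rw [Fintype.sum_prod_type]
    refine Finset.sum_congr rfl fun ω _ => ?_
    rw [Finset.mul_sum]
    exact Finset.sum_congr rfl fun a _ => by simp only [pq, prodW]; ring
  rw [e]
  refine (Finset.abs_sum_le_sum_abs _ _).trans ?_
  have h' : ∀ ω ∈ Finset.univ, |k.p ω * ∑ a, k.Q.q a * k.corr c s (D.dμ (t + s) x (k.lawAt c s)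
        (k.pos c s (ω, a))) (D.dvdμ (t + s) x (k.lawAt c s) (k.pos c s (ω, a))) (ω, a)|
      ≤ (1 + d) * L ^ 6 * √s * (2 * L * (L ^ 2) ^ α) * (k.p ω * k.G R ω ^ α)
        + d * ∑ a, k.pq (ω, a) *
        (‖D.dvdμ (t + s) x (k.lawAt c s) (k.pos c s (ω, a))‖ *
          ‖(k.S c ω).comp (ContinuousLinearMap.adjoint (k.S c ω))
            - c.a (k.pos c s (ω, a)) (k.lawAt c s)‖) := by
    intro ω _
    rw [abs_mul, abs_of_nonneg (k.hp.nonneg ω)]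
    refine (mul_le_mul_of_nonneg_left (h ω) (k.hp.nonneg ω)).trans (le_of_eq ?_)
    rw [mul_add, ← mul_assoc (k.p ω) (d : ℝ), mul_comm (k.p ω) (d : ℝ), mul_assoc (d : ℝ),
      Finset.mul_sum]
    congr 1
    · ring
    · congr 1
      exact Finset.sum_congr rfl fun a _ => by simp only [pq, prodW]; ring
  refine (Finset.sum_le_sum h').trans ?_
  rw [Finset.sum_add_distrib, ← Finset.mul_sum, ← Finset.mul_sum,
    ← Fintype.sum_prod_type' (f := fun ω a => k.pq (ω, a) *
        (‖D.dvdμ (t + s) x (k.lawAt c s) (k.pos c s (ω, a))‖ *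
          ‖(k.S c ω).comp (ContinuousLinearMap.adjoint (k.S c ω))
            - c.a (k.pos c s (ω, a)) (k.lawAt c s)‖))]
  have cs := (le_abs_self _).trans (abs_sum_mul_le_n2 (p := k.pq)
      (V := fun θ => ‖D.dvdμ (t + s) x (k.lawAt c s) (k.pos c s θ)‖)
    (W := fun θ => ‖(k.S c θ.1).comp (ContinuousLinearMap.adjoint (k.S c θ.1))
            - c.a (k.pos c s θ) (k.lawAt c s)‖) k.fprob_pq.nonneg)
  have n1 := h1.n2_dvdμ_le hL0 hts' x k.fprob_pq (k.pos c s)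
  have n2' : n2 k.pq (fun θ => ‖(k.S c θ.1).comp (ContinuousLinearMap.adjoint (k.S c θ.1))
            - c.a (k.pos c s θ) (k.lawAt c s)‖) ≤ 4 * L ^ 4 * √s * n2 k.p (k.G R) := by
    have := n2_mono (p := k.pq) (V := fun θ => ‖(k.S c θ.1).comp
        (ContinuousLinearMap.adjoint (k.S c θ.1)) - c.a (k.pos c s θ) (k.lawAt c s)‖)
      (W := fun θ => (fun ω => 4 * L ^ 4 * √s * k.G R ω) θ.1) k.fprob_pq.nonneg
      (fun θ => by rw [abs_norm]; exact norm_a_sub_le' hw hL hR h0 hs.le hs1 θ)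
    rwa [k.n2_fst fun ω => 4 * L ^ 4 * √s * k.G R ω, n2_const_mul _ (by positivity)] at this
  have cs' := cs.trans (mul_le_mul n1 n2' n2_nonneg hL0)
  have := mul_le_mul_of_nonneg_left cs' (Nat.cast_nonneg (α := ℝ) d)
  have e5 : (d : ℝ) * (L * (4 * L ^ 4 * √s * n2 k.p (k.G R)))
    = 4 * d * L ^ 5 * √s * n2 k.p (k.G R) := by ring
  rw [e5] at this
  refine add_le_add (le_of_eq (by ring)) this

/-- The constant of the local expansion. -/
noncomputable def itoC (d : ℕ) (L α : ℝ) : ℝ := 100 * (1 + d) * L ^ 7 * (1 + (L ^ 2) ^ α)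

variable (R) in
/-- The size of the data in the local expansion. -/
noncomputable def H (k : EulerStep (d := d) Λ Ω) (α : ℝ) (ω : Ω) : ℝ :=
  k.G R ω + n2 k.p (k.G R) + ∑ ω, k.p ω * k.G R ω ^ α

include hw hL h0 hR h1 hT in
/-- The bound on the time derivative of the decoupling field along one step. -/
lemma abs_sum_deriv_le {t s : ℝ} (hα : 0 ≤ α) (ht : 0 ≤ t) (hs : 0 < s) (hs1 : s ≤ 1)
    (hts : t + s ≤ T) (ω : Ω) :
    |∑ a, k.Q.q a * (inner ℝ (D.dx (t + s) (k.pos c s (ω, a)) (k.lawAt c s))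
            (k.b ω - k.driftAt c U t s (ω, a))
        - k.driverAt c U D t s (ω, a)
        + k.corr c s (D.dx (t + s) (k.pos c s (ω, a)) (k.lawAt c s))
            (D.dxx (t + s) (k.pos c s (ω, a)) (k.lawAt c s)) (ω, a)
        + ∑ θ', k.pq θ' * inner ℝ
            (D.dμ (t + s) (k.pos c s (ω, a)) (k.lawAt c s) (k.pos c s θ'))
            (k.b θ'.1 - k.driftAt c U t s θ')
        + ∑ θ', k.pq θ' * k.corr c s
            (D.dμ (t + s) (k.pos c s (ω, a)) (k.lawAt c s) (k.pos c s θ'))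
            (D.dvdμ (t + s) (k.pos c s (ω, a)) (k.lawAt c s) (k.pos c s θ')) θ')
      + k.driver₀ c U D t ω|
    ≤ L * (‖k.b ω - k.drift₀ c U t ω‖ + n2 k.p fun ω => ‖k.b ω - k.drift₀ c U t ω‖)
      + itoC d L α * √s * H R k α ω := by
  have hL0 : 0 ≤ L := by linarith
  have hts' : t + s ∈ Icc 0 T := ⟨by linarith, hts⟩
  have hG := G_nonneg (k := k) hR
  have hN := n2_G_nonneg (k := k) (R := R)
  have hS : 0 ≤ ∑ ω, k.p ω * k.G R ω ^ α := Finset.sum_nonneg fun ω _ =>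
    mul_nonneg (k.hp.nonneg ω) (Real.rpow_nonneg (hG ω) _)
  set SG := ∑ ω, k.p ω * k.G R ω ^ α with hSG
  set N := n2 k.p (k.G R) with hNd
  set g : Ω → ℝ := fun ω => ‖k.b ω - k.drift₀ c U t ω‖ with hg
  have hgap : ∀ θ : Ω × Fin k.Q.m, ‖k.b θ.1 - k.driftAt c U t s θ‖
      ≤ g θ.1 + 5 * L ^ 4 * √s * (k.G R θ.1 + N) := by
    intro θ
    have h1' := norm_driftAt_sub_le hw hL hR h0 h1 hT ht hs.le hs1 hts θ
    rw [norm_sub_rev] at h1'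
    exact (norm_sub_le_norm_sub_add_norm_sub _ (k.drift₀ c U t θ.1) _).trans
      (add_le_add le_rfl h1')
  -- The correction in x is small only after averaging over the noise. All the other terms,
  -- including the correction in μ, which is already averaged over `θ'`, are bounded for each noise
  -- value.
  set cx : Fin k.Q.m → ℝ := fun a =>
    k.corr c s (D.dx (t + s) (k.pos c s (ω, a)) (k.lawAt c s))
            (D.dxx (t + s) (k.pos c s (ω, a)) (k.lawAt c s)) (ω, a) with hcx
  set rest : Fin k.Q.m → ℝ := fun a =>
    inner ℝ (D.dx (t + s) (k.pos c s (ω, a)) (k.lawAt c s)) (k.b ω - k.driftAt c U t s (ω, a))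
    - (k.driverAt c U D t s (ω, a) - k.driver₀ c U D t ω)
    + ∑ θ', k.pq θ' * inner ℝ (D.dμ (t + s) (k.pos c s (ω, a)) (k.lawAt c s) (k.pos c s θ'))
            (k.b θ'.1 - k.driftAt c U t s θ')
    + ∑ θ', k.pq θ' * k.corr c s
            (D.dμ (t + s) (k.pos c s (ω, a)) (k.lawAt c s) (k.pos c s θ'))
            (D.dvdμ (t + s) (k.pos c s (ω, a)) (k.lawAt c s) (k.pos c s θ')) θ' with hrest
  have hsplit : ∑ a, k.Q.q a * (inner ℝ (D.dx (t + s) (k.pos c s (ω, a)) (k.lawAt c s))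
            (k.b ω - k.driftAt c U t s (ω, a))
        - k.driverAt c U D t s (ω, a) + cx a
        + ∑ θ', k.pq θ' * inner ℝ
            (D.dμ (t + s) (k.pos c s (ω, a)) (k.lawAt c s) (k.pos c s θ'))
            (k.b θ'.1 - k.driftAt c U t s θ')
        + ∑ θ', k.pq θ' * k.corr c s
            (D.dμ (t + s) (k.pos c s (ω, a)) (k.lawAt c s) (k.pos c s θ'))
            (D.dvdμ (t + s) (k.pos c s (ω, a)) (k.lawAt c s) (k.pos c s θ')) θ')
      + k.driver₀ c U D t ω = ∑ a, k.Q.q a * cx a + ∑ a, k.Q.q a * rest a := by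
    have : k.driver₀ c U D t ω = ∑ a, k.Q.q a * k.driver₀ c U D t ω := by
      rw [← Finset.sum_mul, k.Q.q_sum, one_mul]
    conv_lhs => rw [this]
    rw [← Finset.sum_add_distrib, ← Finset.sum_add_distrib]
    refine Finset.sum_congr rfl fun a _ => ?_
    simp only [hrest]; ring
  rw [hsplit]
  have b1 := abs_sum_corr_x_le hw hL hR h0 h1 ht hs hs1 hts ω
  have b2 : ∀ a, |rest a| ≤ L * (g ω + n2 k.p g) + 10 * L ^ 5 * √s * (k.G R ω + N)
      + 11 * L ^ 5 * √s * (k.G R ω + N) + 10 * L ^ 5 * √s * N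
      + ((1 + d) * L ^ 6 * √s * (2 * L * (L ^ 2) ^ α * SG) + 4 * d * L ^ 5 * √s * N) := by
    intro a
    have r1 : |inner ℝ (D.dx (t + s) (k.pos c s (ω, a)) (k.lawAt c s))
        (k.b ω - k.driftAt c U t s (ω, a))| ≤ L * (g ω + 5 * L ^ 4 * √s * (k.G R ω + N)) :=
      (abs_real_inner_le_norm _ _).trans
        (mul_le_mul (h1.norm_dx_le hL0 hts' _ (k.isP2_lawAt s)) (hgap (ω, a)) (norm_nonneg _) hL0)
    have r2 := abs_driverAt_sub_le hw hL hR h0 h1 hT ht hs.le hs1 hts (ω, a)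
    have r3 : |∑ θ', k.pq θ' * inner ℝ (D.dμ (t + s) (k.pos c s (ω, a)) (k.lawAt c s)
        (k.pos c s θ')) (k.b θ'.1 - k.driftAt c U t s θ')|
        ≤ L * (n2 k.p g + 10 * L ^ 4 * √s * N) := by
      refine (Finset.abs_sum_le_sum_abs _ _).trans ?_
      have : ∀ θ' ∈ Finset.univ, |k.pq θ' * inner ℝ (D.dμ (t + s) (k.pos c s (ω, a))
          (k.lawAt c s) (k.pos c s θ')) (k.b θ'.1 - k.driftAt c U t s θ')|
          ≤ k.pq θ' * (‖D.dμ (t + s) (k.pos c s (ω, a)) (k.lawAt c s) (k.pos c s θ')‖ *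
            ‖k.b θ'.1 - k.driftAt c U t s θ'‖) := by
        intro θ' _
        rw [abs_mul, abs_of_nonneg (k.fprob_pq.nonneg θ')]
        exact mul_le_mul_of_nonneg_left (abs_real_inner_le_norm _ _) (k.fprob_pq.nonneg θ')
      refine (Finset.sum_le_sum this).trans ((le_abs_self _).trans
        ((abs_sum_mul_le_n2 k.fprob_pq.nonneg).trans ?_))
      have n1 := h1.n2_dμ_le hL0 hts' (k.pos c s (ω, a)) k.fprob_pq (k.pos c s)
      have n2' := n2_mono (p := k.pq) (V := fun θ => ‖k.b θ.1 - k.driftAt c U t s θ‖)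
        (W := fun θ => (fun ω => g ω + 5 * L ^ 4 * √s * (k.G R ω + N)) θ.1) k.fprob_pq.nonneg
        (fun θ => by rw [abs_norm]; exact hgap θ)
      rw [k.n2_fst fun ω => g ω + 5 * L ^ 4 * √s * (k.G R ω + N)] at n2'
      have n3 : n2 k.p (fun ω => g ω + 5 * L ^ 4 * √s * (k.G R ω + N))
          ≤ n2 k.p g + 5 * L ^ 4 * √s * (N + N) := by
        refine (n2_add_le k.hp.nonneg).trans ?_
        rw [n2_const_mul _ (by positivity)]
        have := n2_add_le (p := k.p) (V := k.G R) (W := fun _ => N) k.hp.nonneg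
        rw [n2_const_prob k.hp.sum N hN] at this
        gcongr
      refine mul_le_mul n1 ((n2'.trans n3).trans (le_of_eq (by ring))) n2_nonneg hL0
    have r4 := abs_sum_corr_μ_le hw hL hR h0 h1 hα ht hs hs1 hts (k.pos c s (ω, a))
    have tri : |rest a| ≤ L * (g ω + 5 * L ^ 4 * √s * (k.G R ω + N))
        + 11 * L ^ 5 * √s * (k.G R ω + N) + L * (n2 k.p g + 10 * L ^ 4 * √s * N)
        + ((1 + d) * L ^ 6 * √s * (2 * L * (L ^ 2) ^ α * SG) + 4 * d * L ^ 5 * √s * N) :=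
      (abs_add_le _ _).trans (add_le_add ((abs_add_le _ _).trans (add_le_add
        ((abs_sub _ _).trans (add_le_add r1 r2)) r3)) r4)
    have : 0 ≤ L ^ 5 * √s * (k.G R ω + N) := by
      have := hG ω
      positivity
    linarith
  have b3 : |∑ a, k.Q.q a * rest a| ≤ L * (g ω + n2 k.p g) + 10 * L ^ 5 * √s * (k.G R ω + N)
      + 11 * L ^ 5 * √s * (k.G R ω + N) + 10 * L ^ 5 * √s * N
      + ((1 + d) * L ^ 6 * √s * (2 * L * (L ^ 2) ^ α * SG) + 4 * d * L ^ 5 * √s * N) := by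
    refine (Finset.abs_sum_le_sum_abs _ _).trans ?_
    have : ∀ a ∈ Finset.univ, |k.Q.q a * rest a| ≤ k.Q.q a * (L * (g ω + n2 k.p g)
      + 10 * L ^ 5 * √s * (k.G R ω + N)
      + 11 * L ^ 5 * √s * (k.G R ω + N) + 10 * L ^ 5 * √s * N
      + ((1 + d) * L ^ 6 * √s * (2 * L * (L ^ 2) ^ α * SG) + 4 * d * L ^ 5 * √s * N)) := by
      intro a _
      rw [abs_mul, abs_of_pos (k.Q.q_pos a)]
      exact mul_le_mul_of_nonneg_left (b2 a) (k.Q.q_pos a).le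
    refine (Finset.sum_le_sum this).trans ?_
    rw [← Finset.sum_mul, k.Q.q_sum, one_mul]
  refine ((abs_add_le _ _).trans (add_le_add b1 b3)).trans ?_
  have hG0 := hG ω
  set Gω := k.G R ω with hGω
  set M := (L ^ 2) ^ α with hM
  have hM0 : 0 ≤ M := Real.rpow_nonneg (by positivity) _
  have hH : H R k α ω = Gω + N + SG := rfl
  rw [hH]
  have h57 : L ^ 5 ≤ L ^ 7 := pow_le_pow_right₀ hL (by norm_num)
  have q1 : L ^ 5 * √s * Gω ≤ (1 + d) * L ^ 7 * √s * Gω := by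
    calc L ^ 5 * √s * Gω = 1 * L ^ 5 * √s * Gω := by ring
      _ ≤ (1 + d) * L ^ 7 * √s * Gω := by gcongr; simp
  have q2 : L ^ 5 * √s * N ≤ (1 + d) * L ^ 7 * √s * N := by
    calc L ^ 5 * √s * N = 1 * L ^ 5 * √s * N := by ring
      _ ≤ (1 + d) * L ^ 7 * √s * N := by gcongr; simp
  have q3 : d * L ^ 5 * √s * N ≤ (1 + d) * L ^ 7 * √s * N := by
    gcongr; linarith
  have q4 : 0 ≤ (1 + d) * L ^ 7 * √s * M * SG := by positivity
  have q5 : 0 ≤ (1 + d) * L ^ 7 * √s * M * Gω := by positivity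
  have q6 : 0 ≤ (1 + d) * L ^ 7 * √s * M * N := by positivity
  have q7 : 0 ≤ (1 + d) * L ^ 7 * √s * SG := by positivity
  have q8 : 0 ≤ (1 + d) * L ^ 7 * √s * Gω := by positivity
  have q9 : 0 ≤ (1 + d) * L ^ 7 * √s * N := by positivity
  have e6 : itoC d L α * √s * (Gω + N + SG) = 100 * ((1 + d) * L ^ 7 * √s * Gω)
    + 100 * ((1 + d) * L ^ 7 * √s * N) + 100 * ((1 + d) * L ^ 7 * √s * SG)
    + 100 * ((1 + d) * L ^ 7 * √s * M * Gω) + 100 * ((1 + d) * L ^ 7 * √s * M * N)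
    + 100 * ((1 + d) * L ^ 7 * √s * M * SG) := by rw [itoC]; ring
  have e7 : (1 + d) * L ^ 6 * √s * (2 * L * M * SG) = 2 * ((1 + d) * L ^ 7 * √s * M * SG) := by
    ring
  rw [e6, e7]
  linarith

include hw hL h0 hR h1 hT in
/-- The local weak expansion of the decoupling field. -/
lemma abs_expansion_le {t h : ℝ} (hα : 0 ≤ α) (ht : 0 ≤ t) (hh : 0 < h) (hh1 : h ≤ 1)
    (hth : t + h ≤ T) (ω : Ω) :
    |∑ a, k.Q.q a * U (t + h) (k.pos c h (ω, a)) (k.lawAt c h) - U t (k.X ω) k.law₀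
      + h * k.driver₀ c U D t ω|
    ≤ h * (L * (‖k.b ω - k.drift₀ c U t ω‖ + n2 k.p fun ω => ‖k.b ω - k.drift₀ c U t ω‖))
      + h * (itoC d L α * √h * H R k α ω) := by
  set ψ : ℝ → ℝ := fun r => ∑ a, k.Q.q a * U r (k.pos c (r - t) (ω, a)) (k.lawAt c (r - t))
    with hψ
  have hpc : ∀ θ, ContinuousOn (fun r => k.pos c (r - t) θ) (Icc t (t + h)) := fun θ => by
    have : Continuous fun r => k.pos c (r - t) θ := by unfold pos; fun_prop
    exact this.continuousOn
  have hcont : ContinuousOn ψ (Icc t (t + h)) := by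
    refine continuousOn_finsetSum _ fun a _ => continuousOn_const.mul ?_
    exact h1.classical.continuousOn_flow k.fprob_pq
      (Icc_subset_Icc ht hth) (hpc (ω, a)) hpc
  have hder : ∀ r ∈ Ioo t (t + h), HasDerivAt ψ _ r := fun r hr => by
    have : t + (r - t) = r := by ring
    have hh := HasDerivAt.fun_sum (u := Finset.univ) fun a _ =>
      (hasDerivAt_U_pos (k := k) (c := c) h1 ht (s := r - t) (by linarith [hr.1])
        (by linarith [hr.2]) (ω, a)).const_mul (k.Q.q a)
    rw [this] at hh
    exact hh
  -- The derivative exists only inside the interval, individual paths being singular at its left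
  -- end. Continuity up to the ends and the mean value theorem reduce the increment to the averaged
  -- derivative at one interior time.
  obtain ⟨r, hr, hrr⟩ := exists_hasDerivAt_eq_slope ψ _ (by linarith) hcont hder
  have hs : 0 < r - t := by linarith [hr.1]
  have hsh : r - t ≤ h := by linarith [hr.2]
  have est := abs_sum_deriv_le hw hL hR h0 h1 hT hα ht hs (hsh.trans hh1) (by linarith) ω
  have er : t + (r - t) = r := by ring
  rw [er] at est
  rw [hrr] at est
  have e1 : ψ (t + h) = ∑ a, k.Q.q a * U (t + h) (k.pos c h (ω, a)) (k.lawAt c h) := by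
    simp only [hψ, add_sub_cancel_left]
  have e2 : ψ t = U t (k.X ω) k.law₀ := by
    simp only [hψ, sub_self, k.pos_zero, k.lawAt_zero]
    rw [← Finset.sum_mul, k.Q.q_sum, one_mul]
  rw [e1, e2, add_sub_cancel_left] at est
  set A := ∑ a, k.Q.q a * U (t + h) (k.pos c h (ω, a)) (k.lawAt c h) - U t (k.X ω) k.law₀
  have e3 : A + h * k.driver₀ c U D t ω = h * (A / h + k.driver₀ c U D t ω) := by field_simp
  rw [e3, abs_mul, abs_of_pos hh, ← mul_add]
  refine mul_le_mul_of_nonneg_left (est.trans ?_) hh.le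
  have hG := G_nonneg (k := k) hR
  have : 0 ≤ H R k α ω := add_nonneg (add_nonneg (hG ω) n2_nonneg)
    (Finset.sum_nonneg fun ω _ => mul_nonneg (k.hp.nonneg ω) (Real.rpow_nonneg (hG ω) _))
  have hC : 0 ≤ itoC d L α := by
    have : 0 ≤ (L ^ 2) ^ α := Real.rpow_nonneg (by positivity) _
    have : 0 ≤ L := by linarith
    unfold itoC; positivity
  have := Real.sqrt_le_sqrt hsh
  gcongr

include hw hL h0 hR h1 hT in
/-- The martingale representation term of the decoupling field over one step. -/
lemma norm_Z_expansion_le {t h : ℝ} (ht : 0 ≤ t) (hh : 0 < h) (hh1 : h ≤ 1)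
    (hth : t + h ≤ T) (ω : Ω) :
    ‖∑ a, (k.Q.q a * (U (t + h) (k.pos c h (ω, a)) (k.lawAt c h) / √h)) • k.Q.w a
      - k.Z₀ c D t ω‖ ≤ 7 * L ^ 7 * √h * k.G R ω := by
  have hL0 : 0 ≤ L := by linarith
  have hth' : t + h ∈ Icc 0 T := ⟨by linarith, hth⟩
  have hs : 0 < √h := Real.sqrt_pos.2 hh
  have hG := G_nonneg (k := k) hR ω
  set μ := k.lawAt c h with hμ
  have hμP : IsP2 μ := k.isP2_lawAt h
  set x₀ := k.X ω + h • k.b ω with hx₀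
  set S := k.S c ω with hS
  set V := D.dx (t + h) x₀ μ with hV
  -- First-order Taylor remainder of U at `x₀`, quadratic in the increment, hence O(√h) after
  -- division by √h. Weighted by w, the constant term vanishes by centring and the linear term gives
  -- S†∂ₓU by the identity covariance.
  set ρ : Fin k.Q.m → ℝ := fun a => U (t + h) (k.pos c h (ω, a)) μ - U (t + h) x₀ μ
    - inner ℝ V (√h • S (k.Q.w a)) with hρ
  have hSw := fun a => norm_Sw_le hw hL h0 (ω, a)
  have hρb : ∀ a, |ρ a| ≤ L * (√h * L ^ 2) ^ 2 := by
    intro a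
    have hy : ‖√h • S (k.Q.w a)‖ ≤ √h * L ^ 2 := by
      rw [norm_smul, Real.norm_of_nonneg hs.le]
      exact mul_le_mul_of_nonneg_left (hSw a) hs.le
    have := (convex_closedBall x₀ (√h * L ^ 2)).norm_image_sub_le_of_norm_hasFDerivWithin_le'
      (f := fun y => U (t + h) y μ) (f' := fun y => InnerProductSpace.toDual ℝ _ (D.dx (t + h) y μ))
      (φ := InnerProductSpace.toDual ℝ _ V) (C := L * (√h * L ^ 2)) (x := x₀)
      (y := x₀ + √h • S (k.Q.w a))
      (fun y _ => (h1.classical.hasDeriv_x (t + h) hth' y μ hμP).hasFDerivAt.hasFDerivWithinAt)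
      (fun y hy => by
        rw [← map_sub, LinearIsometryEquiv.norm_map]
        refine (h1.dx_lip_x hL0 hth' y x₀ hμP).trans ?_
        have : ‖y - x₀‖ ≤ √h * L ^ 2 := by simpa [dist_eq_norm] using hy
        gcongr)
      (Metric.mem_closedBall_self (by positivity))
      (by simpa using hy)
    rw [add_sub_cancel_left, InnerProductSpace.toDual_apply_apply] at this
    have h2 : |ρ a| ≤ L * (√h * L ^ 2) * ‖√h • S (k.Q.w a)‖ := this
    refine h2.trans ?_
    calc _ ≤ L * (√h * L ^ 2) * (√h * L ^ 2) := by gcongr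
      _ = _ := by ring
  have e1 : ∑ a, (k.Q.q a * (U (t + h) (k.pos c h (ω, a)) μ / √h)) • k.Q.w a
      = ∑ a, (k.Q.q a * (ρ a / √h)) • k.Q.w a + ContinuousLinearMap.adjoint S V := by
    have hadj : ContinuousLinearMap.adjoint S V
        = ∑ a, (k.Q.q a * inner ℝ (ContinuousLinearMap.adjoint S V) (k.Q.w a)) • k.Q.w a := by
      refine ext_inner_left ℝ fun v => ?_
      rw [_root_.inner_sum, ← k.Q.sum_inner_mul_inner]
      refine Finset.sum_congr rfl fun a _ => ?_
      rw [inner_smul_right]; ring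
    have hz : ∑ a, (k.Q.q a * (U (t + h) x₀ μ / √h)) • k.Q.w a = 0 := by
      have := congrArg (fun v => (U (t + h) x₀ μ / √h) • v) k.Q.centered
      simp only [smul_zero, Finset.smul_sum, smul_smul] at this
      rw [← this]
      exact Finset.sum_congr rfl fun a _ => by rw [mul_comm]
    rw [hadj, ← add_zero (∑ a, (k.Q.q a * (ρ a / √h)) • k.Q.w a), ← hz, ← Finset.sum_add_distrib,
      ← Finset.sum_add_distrib]
    refine Finset.sum_congr rfl fun a _ => ?_
    rw [← add_smul, ← add_smul]
    congr 1
    simp only [hρ]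
    rw [ContinuousLinearMap.adjoint_inner_left, inner_smul_right]
    field_simp
    ring
  rw [e1]
  have e2 : ∑ a, (k.Q.q a * (ρ a / √h)) • k.Q.w a + ContinuousLinearMap.adjoint S V
      - k.Z₀ c D t ω = ∑ a, (k.Q.q a * (ρ a / √h)) • k.Q.w a
        + ContinuousLinearMap.adjoint S (V - D.dx t (k.X ω) k.law₀) := by
    rw [Z₀, map_sub]; abel
  rw [e2]
  refine (norm_add_le _ _).trans ?_
  have p1 : ‖∑ a, (k.Q.q a * (ρ a / √h)) • k.Q.w a‖ ≤ L ^ 6 * √h := by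
    refine (norm_sum_le _ _).trans ?_
    have : ∀ a ∈ Finset.univ, ‖(k.Q.q a * (ρ a / √h)) • k.Q.w a‖ ≤ k.Q.q a * (L ^ 6 * √h) := by
      intro a _
      rw [norm_smul, Real.norm_eq_abs, abs_mul, abs_div, abs_of_pos (k.Q.q_pos a), abs_of_pos hs,
        mul_assoc]
      refine mul_le_mul_of_nonneg_left ?_ (k.Q.q_pos a).le
      calc |ρ a| / √h * ‖k.Q.w a‖ ≤ (L * (√h * L ^ 2) ^ 2) / √h * L := by
            gcongr
            · exact hρb a
            · exact hw a
        _ = L ^ 6 * √h := by field_simp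
    refine (Finset.sum_le_sum this).trans ?_
    rw [← Finset.sum_mul, k.Q.q_sum, one_mul]
  have p2 : ‖V - D.dx t (k.X ω) k.law₀‖ ≤ 5 * L ^ 3 * √h * k.G R ω := by
    have a := h1.dx_sub_le hL0 hth' x₀ (k.X ω) hμP k.isP2_law₀
    have b := h1.holder_time hT hL0 ht (by linarith : t ≤ t + h) hth (k.X ω) k.isP2_law₀
    rw [add_sub_cancel_left] at b
    have a2 := W2_lawAt_le hw hL hR h0 hh.le hh1 ω
    have a3 : ‖x₀ - k.X ω‖ ≤ √h * L ^ 2 * k.G R ω := by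
      rw [hx₀, add_sub_cancel_left, norm_smul, Real.norm_of_nonneg hh.le]
      have hhs : h ≤ √h := Real.le_sqrt_of_sq_le (by nlinarith)
      have hb : ‖k.b ω‖ ≤ k.G R ω := by
        have := n2_nonneg (p := k.p) (V := fun ω => ‖k.X ω‖)
        have := n2_nonneg (p := k.p) (V := fun ω => ‖k.b ω‖)
        have := norm_nonneg (k.X ω)
        unfold G; linarith
      have hL2 : 1 ≤ L ^ 2 := one_le_pow₀ hL
      calc h * ‖k.b ω‖ ≤ √h * k.G R ω := by gcongr
        _ = √h * 1 * k.G R ω := by ring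
        _ ≤ _ := by gcongr
    have e3 := mul_le_mul_of_nonneg_left (one_add_le_G (k := k) hR ω)
      (by positivity : 0 ≤ 2 * L * √h)
    have e4 : 2 * L * √h * k.G R ω ≤ 2 * L ^ 3 * √h * k.G R ω := by
      have : L ≤ L ^ 3 := le_self_pow₀ hL (by norm_num)
      gcongr
    have a2' := mul_le_mul_of_nonneg_left a2 hL0
    have a3' := mul_le_mul_of_nonneg_left a3 hL0
    have := norm_sub_le_norm_sub_add_norm_sub V (D.dx (t + h) (k.X ω) k.law₀)
      (D.dx t (k.X ω) k.law₀)
    have := abs_nonneg (U (t + h) (k.X ω) k.law₀ - U t (k.X ω) k.law₀)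
    have : 0 ≤ L ^ 3 * √h * k.G R ω := by positivity
    nlinarith
  have p3 : ‖ContinuousLinearMap.adjoint S (V - D.dx t (k.X ω) k.law₀)‖
      ≤ L * (5 * L ^ 3 * √h * k.G R ω) := by
    refine (ContinuousLinearMap.le_opNorm _ _).trans ?_
    rw [LinearIsometryEquiv.norm_map]
    exact mul_le_mul (norm_S_le (k := k) h0 ω) p2 (norm_nonneg _) hL0
  refine (add_le_add p1 p3).trans ?_
  have l1 : L ^ 6 * √h ≤ L ^ 7 * √h * k.G R ω := by
    have := le_G (k := k) (R := R) ω
    have h67 : L ^ 6 ≤ L ^ 7 := pow_le_pow_right₀ hL (by norm_num)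
    calc L ^ 6 * √h = L ^ 6 * √h * 1 := by ring
      _ ≤ L ^ 7 * √h * k.G R ω := by gcongr; linarith
  have l2 : L * (5 * L ^ 3 * √h * k.G R ω) ≤ 5 * L ^ 7 * √h * k.G R ω := by
    have h47 : L ^ 4 ≤ L ^ 7 := pow_le_pow_right₀ hL (by norm_num)
    calc L * (5 * L ^ 3 * √h * k.G R ω) = 5 * L ^ 4 * √h * k.G R ω := by ring
      _ ≤ _ := by gcongr
  have : 0 ≤ L ^ 7 * √h * k.G R ω := by positivity
  linarith

end EulerStep

end MKV

namespace MKV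

/-! ### Conditional expectations on the forest -/

section path
variable {d : ℕ} {Λ : ℝ} (Q : Quantization d Λ) {n : ℕ}

/-- The weight of a branch. -/
def pw (a : Fin n → Fin Q.m) : ℝ := ∏ s, Q.q (a s)

/-- The branch which follows `a` before time `i` and `a'` afterwards. -/
def mix {m : ℕ} (i : ℕ) (a a' : Fin n → Fin m) : Fin n → Fin m :=
  fun s => if (s : ℕ) < i then a s else a' s

lemma mix_mix_left {m : ℕ} {i k : ℕ} (h : i ≤ k) (a a' a'' : Fin n → Fin m) :
    mix k (mix i a a') a'' = mix i a (mix k a' a'') := by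
  funext s
  simp only [mix]
  split_ifs <;> first | rfl | omega

lemma pw_nonneg (a : Fin n → Fin Q.m) : 0 ≤ pw Q a := Finset.prod_nonneg fun _ _ => (Q.q_pos _).le

lemma sum_pw_mul (i : Fin n) (g : Fin Q.m → ℝ) :
    ∑ a : Fin n → Fin Q.m, pw Q a * g (a i) = ∑ b, Q.q b * g b := by
  have h := Finset.prod_univ_sum (fun _ : Fin n => (Finset.univ : Finset (Fin Q.m)))
    (fun s b => Q.q b * if s = i then g b else 1)
  rw [Fintype.piFinset_univ] at h
  have h1 : ∀ a : Fin n → Fin Q.m, pw Q a * g (a i)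
      = ∏ s, (Q.q (a s) * if s = i then g (a s) else 1) := by
    intro a
    rw [Finset.prod_mul_distrib, pw]
    congr 1
    simp
  simp_rw [h1]
  rw [← h]
  rw [Finset.prod_eq_single i]
  · simp
  · intro s _ hs
    simp [hs, Q.q_sum]
  · simp

lemma sum_pw : ∑ a : Fin n → Fin Q.m, pw Q a = 1 := by
  have h := Finset.prod_univ_sum (fun _ : Fin n => (Finset.univ : Finset (Fin Q.m)))
    (fun _ b => Q.q b)
  rw [Fintype.piFinset_univ] at h
  simp only [Q.q_sum, Finset.prod_const_one] at h
  exact h.symm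

lemma sum_pw_smul {S : Type} [AddCommGroup S] [Module ℝ S] (i : Fin n) (g : Fin Q.m → S) :
    ∑ a : Fin n → Fin Q.m, pw Q a • g (a i) = ∑ b, Q.q b • g b := by
  have h1 : ∀ a : Fin n → Fin Q.m, pw Q a • g (a i)
      = ∑ b, (pw Q a * if a i = b then 1 else 0) • g b := by
    intro a
    simp
  simp_rw [h1]
  rw [Finset.sum_comm]
  refine Finset.sum_congr rfl fun b _ => ?_
  rw [← Finset.sum_smul, sum_pw_mul Q i fun b' => if b' = b then 1 else 0]
  simp

/-- Exchanging the tails of two branches permutes the factors of the product of their weights. -/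
lemma pw_mix_mul (i : ℕ) (a a' : Fin n → Fin Q.m) :
    pw Q (mix i a a') * pw Q (mix i a' a) = pw Q a * pw Q a' := by
  simp only [pw, ← Finset.prod_mul_distrib]
  refine Finset.prod_congr rfl fun s _ => ?_
  simp only [mix]
  split_ifs
  · rfl
  · ring

/-- Independence of past and future: exchanging tails is a weight-preserving involution on pairs of
branches, so a mixed branch has the law of a single one. The tower property and the invariance of
the mean follow. -/
lemma sum_sum_mix {S : Type} [AddCommGroup S] [Module ℝ S] (i : ℕ) (F : (Fin n → Fin Q.m) → S) :
    ∑ a, ∑ a', (pw Q a * pw Q a') • F (mix i a a') = ∑ a, pw Q a • F a := by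
  rw [← Fintype.sum_prod_type' (f := fun a a' => (pw Q a * pw Q a') • F (mix i a a'))]
  let e : ((Fin n → Fin Q.m) × (Fin n → Fin Q.m)) ≃ ((Fin n → Fin Q.m) × (Fin n → Fin Q.m)) :=
    { toFun := fun x => (mix i x.1 x.2, mix i x.2 x.1)
      invFun := fun x => (mix i x.1 x.2, mix i x.2 x.1)
      left_inv := fun x => by
        ext s <;> simp only [mix] <;> split_ifs <;> rfl
      right_inv := fun x => by
        ext s <;> simp only [mix] <;> split_ifs <;> rfl }
  have h : ∀ x : (Fin n → Fin Q.m) × (Fin n → Fin Q.m), (pw Q x.1 * pw Q x.2) • F (mix i x.1 x.2)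
      = (fun y : (Fin n → Fin Q.m) × (Fin n → Fin Q.m) => (pw Q y.1 * pw Q y.2) • F y.1) (e x) :=
    fun x => by
      change _ = (pw Q (mix i x.1 x.2) * pw Q (mix i x.2 x.1)) • F (mix i x.1 x.2)
      rw [pw_mix_mul]
  rw [Fintype.sum_congr _ _ h, Equiv.sum_comp e fun y : (Fin n → Fin Q.m) × (Fin n → Fin Q.m) =>
    (pw Q y.1 * pw Q y.2) • F y.1, Fintype.sum_prod_type]
  refine Finset.sum_congr rfl fun a _ => ?_
  simp only
  rw [← Finset.sum_smul, ← Finset.mul_sum, sum_pw, mul_one]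

end path

section tree
variable {d : ℕ} {T : ℝ} {N : ℕ} {Λ : ℝ} {π : Grid T N} {Q : Quantization d Λ}
  {ξ₀ : InitialLaw d} {S : Type} [AddCommGroup S] [Module ℝ S]

lemma condE_apply (i : ℕ) (V : Sample π Q ξ₀ → S) (ω : Sample π Q ξ₀) :
    condE π Q ξ₀ i V ω = ∑ a, pw Q a • V (ω.1, mix i ω.2 a) := rfl

lemma prob_eq (ω : Sample π Q ξ₀) : prob π Q ξ₀ ω = ξ₀.p ω.1 * pw Q ω.2 := rfl

variable (π Q ξ₀) in
lemma fprob_prob : FProb (prob π Q ξ₀) := by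
  refine ⟨fun ω => mul_nonneg (ξ₀.p_pos _).le (pw_nonneg Q _), ?_⟩
  simp only [prob_eq, Fintype.sum_prod_type]
  simp_rw [← Finset.mul_sum, sum_pw, mul_one, ξ₀.p_sum]

/-- `V` depends on the root and on the increments before time `i` only. -/
def Adapted (i : ℕ) {X : Type} (V : Sample π Q ξ₀ → X) : Prop :=
  ∀ ω ω' : Sample π Q ξ₀, ω.1 = ω'.1 → (∀ s : Fin π.n, (s : ℕ) < i → ω.2 s = ω'.2 s) → V ω = V ω'

lemma Adapted.apply_mix {i : ℕ} {X : Type} {V : Sample π Q ξ₀ → X} (hV : Adapted i V)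
    (ω : Sample π Q ξ₀) (a : Fin π.n → Fin Q.m) : V (ω.1, mix i ω.2 a) = V ω :=
  hV _ _ rfl fun s hs => by simp [mix, hs]

lemma Adapted.comp {i : ℕ} {X Y : Type} {V : Sample π Q ξ₀ → X} (hV : Adapted i V) (f : X → Y) :
    Adapted i fun ω => f (V ω) := fun ω ω' h1 h2 => congrArg f (hV ω ω' h1 h2)

lemma Adapted.comp₂ {i : ℕ} {X Y W : Type} {V : Sample π Q ξ₀ → X} {V' : Sample π Q ξ₀ → Y}
    (hV : Adapted i V) (hV' : Adapted i V') (f : X → Y → W) :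
    Adapted i fun ω => f (V ω) (V' ω) := fun ω ω' h1 h2 => by
  simp only [hV ω ω' h1 h2, hV' ω ω' h1 h2]

lemma adapted_condE (i : ℕ) (V : Sample π Q ξ₀ → S) : Adapted i (condE π Q ξ₀ i V) := by
  intro ω ω' h1 h2
  rw [condE_apply, condE_apply, h1]
  refine Finset.sum_congr rfl fun a _ => ?_
  congr 3
  funext s
  simp only [mix]
  split_ifs with hs
  · exact h2 s hs
  · rfl

lemma condE_const (i : ℕ) (x : S) : condE π Q ξ₀ i (fun _ => x) = fun _ => x := by
  funext ω
  rw [condE_apply, ← Finset.sum_smul, sum_pw, one_smul]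

lemma condE_add (i : ℕ) (V W : Sample π Q ξ₀ → S) :
    condE π Q ξ₀ i (fun ω => V ω + W ω)
      = fun ω => condE π Q ξ₀ i V ω + condE π Q ξ₀ i W ω := by
  funext ω
  simp only [condE_apply, smul_add, Finset.sum_add_distrib]

lemma condE_sub (i : ℕ) (V W : Sample π Q ξ₀ → S) :
    condE π Q ξ₀ i (fun ω => V ω - W ω)
      = fun ω => condE π Q ξ₀ i V ω - condE π Q ξ₀ i W ω := by
  funext ω
  simp only [condE_apply, smul_sub, Finset.sum_sub_distrib]

lemma condE_smul_adapted {i : ℕ} {f : Sample π Q ξ₀ → ℝ} (hf : Adapted i f)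
    (V : Sample π Q ξ₀ → S) :
    condE π Q ξ₀ i (fun ω => f ω • V ω) = fun ω => f ω • condE π Q ξ₀ i V ω := by
  funext ω
  simp only [condE_apply, Finset.smul_sum, hf.apply_mix]
  exact Finset.sum_congr rfl fun a _ => smul_comm _ _ _

lemma condE_mul_adapted {i : ℕ} {f : Sample π Q ξ₀ → ℝ} (hf : Adapted i f)
    (V : Sample π Q ξ₀ → ℝ) :
    condE π Q ξ₀ i (fun ω => f ω * V ω) = fun ω => f ω * condE π Q ξ₀ i V ω :=
  condE_smul_adapted hf V

lemma condE_of_adapted {i : ℕ} {V : Sample π Q ξ₀ → S} (hV : Adapted i V) :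
    condE π Q ξ₀ i V = V := by
  funext ω
  simp only [condE_apply, hV.apply_mix]
  rw [← Finset.sum_smul, sum_pw, one_smul]

lemma condE_inner_adapted {i : ℕ} {u : Sample π Q ξ₀ → E d} (hu : Adapted i u)
    (V : Sample π Q ξ₀ → E d) :
    condE π Q ξ₀ i (fun ω => inner ℝ (u ω) (V ω))
      = fun ω => inner ℝ (u ω) (condE π Q ξ₀ i V ω) := by
  funext ω
  simp only [condE_apply, hu.apply_mix, _root_.inner_sum, inner_smul_right, smul_eq_mul]

lemma condE_mono (i : ℕ) {V W : Sample π Q ξ₀ → ℝ} (h : ∀ ω, V ω ≤ W ω) (ω : Sample π Q ξ₀) :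
    condE π Q ξ₀ i V ω ≤ condE π Q ξ₀ i W ω :=
  Finset.sum_le_sum fun a _ => mul_le_mul_of_nonneg_left (h _) (pw_nonneg Q a)

lemma condE_condE {i k : ℕ} (h : i ≤ k) (V : Sample π Q ξ₀ → S) :
    condE π Q ξ₀ i (condE π Q ξ₀ k V) = condE π Q ξ₀ i V := by
  funext ω
  rw [condE_apply]
  simp only [condE_apply, mix_mix_left h, Finset.smul_sum, smul_smul]
  exact sum_sum_mix Q k fun a => V (ω.1, mix i ω.2 a)

lemma sum_prob_condE (i : ℕ) (V : Sample π Q ξ₀ → ℝ) :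
    ∑ ω, prob π Q ξ₀ ω * condE π Q ξ₀ i V ω = ∑ ω, prob π Q ξ₀ ω * V ω := by
  simp only [prob_eq, Fintype.sum_prod_type]
  refine Finset.sum_congr rfl fun l _ => ?_
  simp only [mul_assoc]
  rw [← Finset.mul_sum, ← Finset.mul_sum]
  congr 1
  have := sum_sum_mix Q i fun a => V (l, a)
  simp only [smul_eq_mul] at this
  rw [← this]
  refine Finset.sum_congr rfl fun a _ => ?_
  rw [condE_apply, Finset.mul_sum]
  exact Finset.sum_congr rfl fun a' _ => by rw [smul_eq_mul, mul_assoc]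

/-- Reduces a conditional expectation on the forest to an average over one noise value, the setting
of `EulerStep`. -/
lemma condE_noise {i : ℕ} (hi : i < π.n) {F : Sample π Q ξ₀ → Fin Q.m → S}
    (hF : Adapted i F) (ω : Sample π Q ξ₀) :
    condE π Q ξ₀ i (fun ω => F ω (ω.2 ⟨i, hi⟩)) ω = ∑ b, Q.q b • F ω b := by
  simp only [condE_apply, hF.apply_mix]
  rw [← sum_pw_smul Q ⟨i, hi⟩]
  simp [mix]

lemma flaw_apply {Θ S : Type} [Fintype Θ] [MeasurableSpace S] {p : Θ → ℝ} (hp : FProb p)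
    (V : Θ → S) {B : Set S} (hB : MeasurableSet B) :
    flaw p V B = ENNReal.ofReal (∑ θ, p θ * B.indicator 1 (V θ)) := by
  simp only [flaw, Measure.coe_finsetSum, Finset.sum_apply, Measure.smul_apply, smul_eq_mul,
    Measure.dirac_apply' _ hB]
  rw [ENNReal.ofReal_sum_of_nonneg]
  · refine Finset.sum_congr rfl fun θ _ => ?_
    by_cases h : V θ ∈ B <;> simp [h]
  · intro θ _
    refine mul_nonneg (hp.nonneg θ) ?_
    by_cases h : V θ ∈ B <;> simp [h]

/-- The increment at time `i` is independent of adapted data, so it may be replaced by a fresh noise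
on a product space. -/
lemma law_noise {S : Type} [MeasurableSpace S] {i : ℕ} (hi : i < π.n)
    {F : Sample π Q ξ₀ → Fin Q.m → S}
    (hF : Adapted i F) :
    law π Q ξ₀ (fun ω => F ω (ω.2 ⟨i, hi⟩))
      = flaw (prodW (prob π Q ξ₀) Q.q) fun θ => F θ.1 θ.2 := by
  ext B hB
  change flaw (prob π Q ξ₀) (fun ω => F ω (ω.2 ⟨i, hi⟩)) B = _
  rw [flaw_apply (fprob_prob π Q ξ₀) _ hB, flaw_apply ((fprob_prob π Q ξ₀).prodW Q.fprob) _ hB]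
  congr 1
  rw [← sum_prob_condE i]
  refine Eq.trans ?_ (Fintype.sum_prod_type (α₁ := Sample π Q ξ₀) (α₂ := Fin Q.m) _).symm
  refine Finset.sum_congr rfl fun ω _ => ?_
  rw [condE_noise hi (F := fun ω b => B.indicator (1 : S → ℝ) (F ω b))
    (hF.comp fun g b => B.indicator (1 : S → ℝ) (g b)), Finset.mul_sum]
  exact Finset.sum_congr rfl fun b _ => by simp only [prodW, smul_eq_mul]; ring

/-! ### Weights which are compatible with the filtration -/

/-- Weights on the forest which dominate the probability and are invariant under the conditional
expectations from time `i` on. -/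
structure Wt (i : ℕ) (w : Sample π Q ξ₀ → ℝ) : Prop where
  ge : ∀ ω, prob π Q ξ₀ ω ≤ w ω
  sum_le : ∑ ω, w ω ≤ 2
  inv : ∀ k, i ≤ k → ∀ V : Sample π Q ξ₀ → ℝ, ∑ ω, w ω * condE π Q ξ₀ k V ω = ∑ ω, w ω * V ω

lemma Wt.nonneg {i : ℕ} {w : Sample π Q ξ₀ → ℝ} (hw : Wt i w) (ω : Sample π Q ξ₀) : 0 ≤ w ω :=
  ((fprob_prob π Q ξ₀).nonneg ω).trans (hw.ge ω)

lemma Wt.mono {i k : ℕ} (h : i ≤ k) {w : Sample π Q ξ₀ → ℝ} (hw : Wt i w) : Wt k w :=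
  ⟨hw.ge, hw.sum_le, fun l hl => hw.inv l (h.trans hl)⟩

lemma Wt.n2_prob_le {i : ℕ} {w : Sample π Q ξ₀ → ℝ} (hw : Wt i w) (V : Sample π Q ξ₀ → ℝ) :
    n2 (prob π Q ξ₀) V ≤ n2 w V := n2_mono_weight hw.ge

lemma Wt.n2_const_le {i : ℕ} {w : Sample π Q ξ₀ → ℝ} (hw : Wt i w) {x : ℝ} (hx : 0 ≤ x) :
    n2 w (fun _ => x) ≤ 2 * x := by
  rw [n2_const x hx, mul_comm]
  refine mul_le_mul_of_nonneg_right ?_ hx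
  exact Real.sqrt_le_iff.2 ⟨by norm_num, hw.sum_le.trans (by norm_num)⟩

lemma wt_prob (i : ℕ) : Wt i (prob π Q ξ₀) :=
  ⟨fun _ => le_rfl, by rw [(fprob_prob π Q ξ₀).sum]; norm_num, fun k _ V => sum_prob_condE k V⟩

/-- The sum of the probability and of the conditional probability at time `i` on the branch `ω₀`. -/
noncomputable def condW (i : ℕ) (ω₀ : Sample π Q ξ₀) : Sample π Q ξ₀ → ℝ := fun ω =>
  prob π Q ξ₀ ω + condE π Q ξ₀ i (fun ω' => if ω' = ω then (1 : ℝ) else 0) ω₀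

lemma sum_condW (i : ℕ) (ω₀ : Sample π Q ξ₀) (V : Sample π Q ξ₀ → ℝ) :
    ∑ ω, condW i ω₀ ω * V ω = ∑ ω, prob π Q ξ₀ ω * V ω + condE π Q ξ₀ i V ω₀ := by
  simp only [condW, add_mul, Finset.sum_add_distrib]
  congr 1
  simp only [condE_apply, Finset.sum_mul]
  rw [Finset.sum_comm]
  refine Finset.sum_congr rfl fun a _ => ?_
  simp [mul_ite]

/-- Invariance of the conditional part is the tower property, which is why it is required only from
time `i` on. -/
lemma wt_condW (i : ℕ) (ω₀ : Sample π Q ξ₀) : Wt i (condW i ω₀) := by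
  refine ⟨fun ω => ?_, ?_, fun k hk V => ?_⟩
  · refine le_add_of_nonneg_right ?_
    rw [condE_apply]
    refine Finset.sum_nonneg fun a _ => mul_nonneg (pw_nonneg Q a) ?_
    split_ifs <;> norm_num
  · have := sum_condW i ω₀ fun _ => (1 : ℝ)
    rw [condE_const] at this
    simp only [mul_one, (fprob_prob π Q ξ₀).sum] at this
    rw [this]; norm_num
  · rw [sum_condW, sum_condW, sum_prob_condE, condE_condE hk]

lemma n2_condW_sq {i : ℕ} (ω₀ : Sample π Q ξ₀) {V : Sample π Q ξ₀ → ℝ} (hV : Adapted i V) :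
    n2 (condW i ω₀) V ^ 2 = n2 (prob π Q ξ₀) V ^ 2 + V ω₀ ^ 2 := by
  rw [n2_sq (wt_condW i ω₀).nonneg, n2_sq (fprob_prob π Q ξ₀).nonneg, sum_condW,
    condE_of_adapted (hV.comp fun x => x ^ 2)]

/-- The conditional mean of the square of an adapted variable is its square on the branch, so the
weighted L² norm contains the pointwise value. This converts the L² analysis into estimates at the
roots. -/
lemma abs_le_n2_condW {i : ℕ} (ω₀ : Sample π Q ξ₀) {V : Sample π Q ξ₀ → ℝ} (hV : Adapted i V) :
    |V ω₀| ≤ n2 (condW i ω₀) V := by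
  refine abs_le_of_sq_le_sq ?_ n2_nonneg
  rw [n2_condW_sq ω₀ hV]
  linarith [sq_nonneg (n2 (prob π Q ξ₀) V)]

lemma n2_condW_le {i : ℕ} (ω₀ : Sample π Q ξ₀) {V : Sample π Q ξ₀ → ℝ} (hV : Adapted i V) :
    n2 (condW i ω₀) V ≤ n2 (prob π Q ξ₀) V + |V ω₀| := by
  refine le_of_sq_le_sq ?_ (add_nonneg n2_nonneg (abs_nonneg _))
  rw [n2_condW_sq ω₀ hV]
  nlinarith [sq_abs (V ω₀), n2_nonneg (p := prob π Q ξ₀) (V := V), abs_nonneg (V ω₀)]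

/-! ### The increments -/

variable {L : ℝ}

lemma dW_eq {i : ℕ} (hi : i < π.n) (ω : Sample π Q ξ₀) :
    dW π Q ξ₀ i ω = √(π.h i) • Q.w (ω.2 ⟨i, hi⟩) := by
  rw [dW, dif_pos hi, Real.sqrt_eq_rpow]

lemma adapted_dW (i : ℕ) : Adapted (i + 1) (dW π Q ξ₀ i) := by
  intro ω ω' _ h2
  by_cases hi : i < π.n
  · rw [dW_eq hi, dW_eq hi, h2 ⟨i, hi⟩ (Nat.lt_succ_self i)]
  · rw [dW, dW, dif_neg hi, dif_neg hi]

lemma norm_dW_le (hQ : ∀ a, ‖Q.w a‖ ≤ L) {i : ℕ} (hi : i < π.n) (ω : Sample π Q ξ₀) :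
    ‖dW π Q ξ₀ i ω‖ ≤ L * √(π.h i) := by
  rw [dW_eq hi, norm_smul, Real.norm_of_nonneg (Real.sqrt_nonneg _), mul_comm]
  exact mul_le_mul_of_nonneg_right (hQ _) (Real.sqrt_nonneg _)

lemma condE_dW {i : ℕ} (hi : i < π.n) (ω : Sample π Q ξ₀) :
    condE π Q ξ₀ i (dW π Q ξ₀ i) ω = 0 := by
  have h : dW π Q ξ₀ i = fun ω => (fun _ b => √(π.h i) • Q.w b : Sample π Q ξ₀ → Fin Q.m → E d) ω
    (ω.2 ⟨i, hi⟩) := funext fun ω => dW_eq hi ω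
  rw [h, condE_noise hi (F := fun _ b => √(π.h i) • Q.w b) (fun _ _ _ _ => rfl)]
  simp_rw [smul_comm (Q.q _)]
  rw [← Finset.smul_sum, Q.centered, smul_zero]

/-- Bessel's inequality for one increment. -/
lemma bessel {i : ℕ} (hi : i < π.n) (hh : 0 ≤ π.h i) (V : Sample π Q ξ₀ → ℝ)
    (ω : Sample π Q ξ₀) :
    (|condE π Q ξ₀ i V ω| + L * ‖condE π Q ξ₀ i (fun ω => V ω • dW π Q ξ₀ i ω) ω‖) ^ 2
      ≤ (1 + L ^ 2 * π.h i) * condE π Q ξ₀ i (fun ω => V ω ^ 2) ω := by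
  set w : Sample π Q ξ₀ → E d := fun ω => Q.w (ω.2 ⟨i, hi⟩) with hw
  set a := condE π Q ξ₀ i V ω with ha
  set v := condE π Q ξ₀ i (fun ω => V ω • w ω) ω with hv
  have e1 : condE π Q ξ₀ i (fun ω => V ω • dW π Q ξ₀ i ω) ω = √(π.h i) • v := by
    have : (fun ω => V ω • dW π Q ξ₀ i ω) = fun ω => √(π.h i) • (V ω • w ω) := by
      funext ω; rw [dW_eq hi, smul_comm]
    rw [this, condE_smul_adapted (f := fun _ => √(π.h i)) (fun _ _ _ _ => rfl)]
  have e2 : condE π Q ξ₀ i (fun ω => inner ℝ v (w ω)) ω = 0 := by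
    rw [condE_noise hi (F := fun _ b => inner ℝ v (Q.w b)) (fun _ _ _ _ => rfl)]
    exact Q.sum_inner v
  have e3 : condE π Q ξ₀ i (fun ω => inner ℝ v (w ω) * inner ℝ v (w ω)) ω = ‖v‖ ^ 2 := by
    rw [condE_noise hi (F := fun _ b => inner ℝ v (Q.w b) * inner ℝ v (Q.w b))
      (fun _ _ _ _ => rfl)]
    rw [← real_inner_self_eq_norm_sq]
    exact Q.sum_inner_mul_inner v v
  have e4 : condE π Q ξ₀ i (fun ω => inner ℝ v (V ω • w ω)) ω = ‖v‖ ^ 2 := by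
    rw [condE_inner_adapted (u := fun _ => v) (fun _ _ _ _ => rfl)]
    exact real_inner_self_eq_norm_sq v
  -- The constant 1 and the coordinates of the noise are orthonormal for the conditional
  -- expectation. Expanding the squared distance from V to its projection gives a² + ‖v‖² ≤ 𝔼ᵢ[V²].
  have e5 : 0 ≤ condE π Q ξ₀ i (fun ω => (V ω - a - inner ℝ v (w ω)) ^ 2) ω := by
    have := condE_mono i (fun ω => sq_nonneg (V ω - a - inner ℝ v (w ω))) ω
    rwa [condE_const] at this
  have e6 : (fun ω => (V ω - a - inner ℝ v (w ω)) ^ 2) = fun ω => (V ω ^ 2 + a ^ 2)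
      + (inner ℝ v (w ω) * inner ℝ v (w ω) + ((2 * a) * inner ℝ v (w ω)))
      - ((2 * a) * V ω + 2 * inner ℝ v (V ω • w ω)) := by
    funext ω; rw [inner_smul_right]; ring
  have hc : ∀ x : ℝ, Adapted (π := π) (Q := Q) (ξ₀ := ξ₀) i fun _ => x := fun _ _ _ _ _ => rfl
  rw [e6, condE_sub, condE_add, condE_add, condE_add, condE_add, condE_mul_adapted (hc _),
    condE_mul_adapted (hc _), condE_mul_adapted (hc _), condE_const] at e5
  simp only at e5
  rw [e2, e3, e4, ← ha] at e5
  have key : a ^ 2 + ‖v‖ ^ 2 ≤ condE π Q ξ₀ i (fun ω => V ω ^ 2) ω := by linarith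
  rw [e1, norm_smul, Real.norm_of_nonneg (Real.sqrt_nonneg _)]
  refine le_trans ?_ (mul_le_mul_of_nonneg_left key (by positivity))
  have hs := Real.sq_sqrt hh
  -- Cauchy–Schwarz for the vectors (1, L√h) and (|a|, ‖v‖).
  have k2 : (|a| + L * (√(π.h i) * ‖v‖)) ^ 2
      ≤ (1 + L ^ 2 * √(π.h i) ^ 2) * (|a| ^ 2 + ‖v‖ ^ 2) := by
    nlinarith [sq_nonneg (L * √(π.h i) * |a| - ‖v‖)]
  rwa [hs, sq_abs] at k2

/-- The driver is L-Lipschitz in Z, and hZ is the conditional mean of Y'ΔW̄. The sum on the left is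
therefore what a backward step has to bound, and its growth factor is only 1 + O(h). -/
lemma n2_bessel_le {i : ℕ} (hi : i < π.n) (hh : 0 ≤ π.h i) {w : Sample π Q ξ₀ → ℝ} (hw : Wt i w)
    (V : Sample π Q ξ₀ → ℝ) :
    n2 w (fun ω => |condE π Q ξ₀ i V ω|
      + L * ‖condE π Q ξ₀ i (fun ω => V ω • dW π Q ξ₀ i ω) ω‖)
      ≤ (1 + L ^ 2 * π.h i) * n2 w V := by
  have h0 : 0 ≤ L ^ 2 * π.h i := by positivity
  refine le_of_sq_le_sq ?_ (mul_nonneg (by linarith) n2_nonneg)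
  rw [mul_pow, n2_sq hw.nonneg, n2_sq hw.nonneg]
  have : ∑ ω, w ω * (|condE π Q ξ₀ i V ω|
      + L * ‖condE π Q ξ₀ i (fun ω => V ω • dW π Q ξ₀ i ω) ω‖) ^ 2
      ≤ (1 + L ^ 2 * π.h i) * ∑ ω, w ω * condE π Q ξ₀ i (fun ω => V ω ^ 2) ω := by
    rw [Finset.mul_sum]
    refine Finset.sum_le_sum fun ω _ => ?_
    have := mul_le_mul_of_nonneg_left (bessel (L := L) hi hh V ω) (hw.nonneg ω)
    linarith
  refine this.trans ?_
  rw [hw.inv i le_rfl]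
  refine mul_le_mul_of_nonneg_right (by nlinarith) ?_
  exact Finset.sum_nonneg fun ω _ => mul_nonneg (hw.nonneg ω) (sq_nonneg _)

/-- An increment with adapted diffusion coefficient is orthogonal to the past. -/
lemma condE_norm_add_sq_le (hQ : ∀ a, ‖Q.w a‖ ≤ L) {i : ℕ} (hi : i < π.n) (hh : 0 ≤ π.h i)
    {u : Sample π Q ξ₀ → E d} (hu : Adapted i u) {A : Sample π Q ξ₀ → E d →L[ℝ] E d}
    (hA : Adapted i A) (ω : Sample π Q ξ₀) :
    condE π Q ξ₀ i (fun ω => ‖u ω + A ω (dW π Q ξ₀ i ω)‖ ^ 2) ω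
      ≤ ‖u ω‖ ^ 2 + L ^ 2 * π.h i * ‖A ω‖ ^ 2 := by
  have e : (fun ω => ‖u ω + A ω (dW π Q ξ₀ i ω)‖ ^ 2) = fun ω => (‖u ω‖ ^ 2
      + 2 * inner ℝ (ContinuousLinearMap.adjoint (A ω) (u ω)) (dW π Q ξ₀ i ω))
      + ‖A ω (dW π Q ξ₀ i ω)‖ ^ 2 := by
    funext ω; rw [norm_add_sq_real, ContinuousLinearMap.adjoint_inner_left]
  have hc : Adapted (π := π) (Q := Q) (ξ₀ := ξ₀) i fun _ => (2 : ℝ) := fun _ _ _ _ => rfl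
  rw [e, condE_add, condE_add, condE_mul_adapted hc, condE_inner_adapted
    (hA.comp₂ hu fun A u => ContinuousLinearMap.adjoint A u),
    condE_of_adapted (hu.comp fun u => ‖u‖ ^ 2)]
  simp only
  rw [condE_dW hi, inner_zero_right, mul_zero, add_zero]
  refine add_le_add le_rfl ?_
  have hb : ∀ ω, ‖A ω (dW π Q ξ₀ i ω)‖ ^ 2 ≤ L ^ 2 * π.h i * ‖A ω‖ ^ 2 := by
    intro ω
    have h1 := (A ω).le_opNorm (dW π Q ξ₀ i ω)
    have h2 := mul_le_mul_of_nonneg_left (norm_dW_le hQ hi ω) (norm_nonneg (A ω))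
    have h3 := pow_le_pow_left₀ (norm_nonneg _) (h1.trans h2) 2
    refine h3.trans (le_of_eq ?_)
    rw [mul_pow, mul_pow, Real.sq_sqrt hh]; ring
  refine (condE_mono i hb ω).trans (le_of_eq ?_)
  rw [condE_of_adapted (hA.comp fun A => L ^ 2 * π.h i * ‖A‖ ^ 2)]

end tree

end MKV

namespace MKV

/-! ### The time grid -/

section grid
variable {T : ℝ} {N : ℕ} (π : Grid T N)

lemma Grid.t_mono {i k : ℕ} (h : i ≤ k) (hk : k ≤ π.n) : π.t i ≤ π.t k := by
  induction k, h using Nat.le_induction with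
  | base => exact le_rfl
  | succ k _ ih => exact (ih (by omega)).trans (π.t_lt k (by omega)).le

lemma Grid.t_nonneg {i : ℕ} (hi : i ≤ π.n) : 0 ≤ π.t i := by
  have := π.t_mono (Nat.zero_le i) hi
  rwa [π.t_zero] at this

lemma Grid.t_le {i : ℕ} (hi : i ≤ π.n) : π.t i ≤ T := by
  have := π.t_mono hi le_rfl
  rwa [π.t_last] at this

lemma Grid.h_pos {i : ℕ} (hi : i < π.n) : 0 < π.h i := sub_pos.2 (π.t_lt i hi)

lemma Grid.t_add_h (i : ℕ) : π.t i + π.h i = π.t (i + 1) := by simp [Grid.h]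

lemma Grid.h_le_mesh {i : ℕ} (hi : i < π.n) : π.h i ≤ π.mesh :=
  le_ciSup (f := fun i : Fin π.n => π.h i) (Finite.bddAbove_range _) ⟨i, hi⟩

lemma Grid.j_lt (hT : 0 < T) {k : ℕ} (hk : k < N) : π.j k < π.j (k + 1) := by
  by_contra hcon
  have h := π.t_mono (not_lt.1 hcon) (π.j_le k hk.le)
  rw [π.t_j k hk.le, π.t_j (k + 1) hk] at h
  have hN : (0 : ℝ) < N := by exact_mod_cast (Nat.zero_le k).trans_lt hk
  have : 0 < T / N := by positivity
  push_cast at h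
  linarith

lemma Grid.t_sub_le {k : ℕ} (hk : k < N) {i l : ℕ} (hi : π.j k ≤ i) (hil : i ≤ l)
    (hl : l ≤ π.j (k + 1)) : π.t l - π.t i ≤ T / N := by
  have a := π.t_mono hl (π.j_le (k + 1) hk)
  have b := π.t_mono hi (hil.trans (hl.trans (π.j_le (k + 1) hk)))
  rw [π.t_j (k + 1) hk] at a
  rw [π.t_j k hk.le] at b
  push_cast at a
  linarith

lemma Grid.h_le {k : ℕ} (hk : k < N) {i : ℕ} (hi : π.j k ≤ i) (hl : i < π.j (k + 1)) :
    π.h i ≤ T / N := π.t_sub_le hk hi (Nat.le_succ i) hl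

end grid

/-! ### Discrete Gronwall inequalities -/

section gronwall

lemma one_add_mul_exp_le {x y : ℝ} : (1 + x) * (Real.exp y) ≤ Real.exp (x + y) := by
  rw [Real.exp_add]
  exact mul_le_mul_of_nonneg_right (by linarith [Real.add_one_le_exp x]) (Real.exp_pos _).le

/-- The monotonicity of `t` is carried by the induction because the remaining length must be
nonnegative. -/
lemma gronwall_backward {t a : ℕ → ℝ} {K s : ℝ} (hK : 0 ≤ K) (hs : 0 ≤ s) {i₀ i₁ : ℕ}
    (ht : ∀ i, i₀ ≤ i → i < i₁ → t i ≤ t (i + 1))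
    (ha₁ : 0 ≤ a i₁)
    (h : ∀ i, i₀ ≤ i → i < i₁ → a i ≤ (1 + K * (t (i + 1) - t i)) * a (i + 1)
      + (t (i + 1) - t i) * s) :
    ∀ i, i₀ ≤ i → i ≤ i₁ →
      t i ≤ t i₁ ∧ a i ≤ Real.exp (K * (t i₁ - t i)) * (a i₁ + (t i₁ - t i) * s) := by
  intro i hi hi1
  induction hm : i₁ - i generalizing i with
  | zero =>
    have : i = i₁ := by omega
    subst this
    simp
  | succ m ih =>
    have hlt : i < i₁ := by omega
    obtain ⟨h1, h2⟩ := ih (i + 1) (by omega) hlt (by omega)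
    have h3 := ht i hi hlt
    refine ⟨h3.trans h1, (h i hi hlt).trans ?_⟩
    set d := t (i + 1) - t i with hd
    have hd0 : 0 ≤ d := by linarith
    set e := t i₁ - t (i + 1) with he
    have he0 : 0 ≤ e := by linarith
    have hde : t i₁ - t i = d + e := by rw [hd, he]; ring
    rw [hde]
    have hX : 0 ≤ a i₁ + e * s := by positivity
    have k1 : (1 + K * d) * a (i + 1) ≤ Real.exp (K * (d + e)) * (a i₁ + e * s) := by
      calc (1 + K * d) * a (i + 1) ≤ (1 + K * d) * (Real.exp (K * e) * (a i₁ + e * s)) :=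
            mul_le_mul_of_nonneg_left h2 (by positivity)
        _ = ((1 + K * d) * Real.exp (K * e)) * (a i₁ + e * s) := by ring
        _ ≤ Real.exp (K * d + K * e) * (a i₁ + e * s) :=
            mul_le_mul_of_nonneg_right one_add_mul_exp_le hX
        _ = _ := by rw [mul_add K d e]
    have k2 : d * s ≤ Real.exp (K * (d + e)) * (d * s) := by
      have : 1 ≤ Real.exp (K * (d + e)) := Real.one_le_exp (by positivity)
      nlinarith [mul_nonneg hd0 hs]
    calc _ ≤ _ := add_le_add k1 k2
      _ = _ := by ring

lemma gronwall_forward {t a : ℕ → ℝ} {K s : ℝ} (hK : 0 ≤ K) (hs : 0 ≤ s) {i₀ i₁ : ℕ}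
    (ht : ∀ i, i₀ ≤ i → i < i₁ → t i ≤ t (i + 1)) (ha₁ : 0 ≤ a i₀)
    (h : ∀ i, i₀ ≤ i → i < i₁ → a (i + 1) ≤ (1 + K * (t (i + 1) - t i)) * a i
      + (t (i + 1) - t i) * s) :
    ∀ i, i₀ ≤ i → i ≤ i₁ →
      t i₀ ≤ t i ∧ a i ≤ Real.exp (K * (t i - t i₀)) * (a i₀ + (t i - t i₀) * s) := by
  intro i hi
  induction i, hi using Nat.le_induction with
  | base => intro _; simp
  | succ i hi ih =>
    intro hi1
    obtain ⟨h1, h2⟩ := ih (by omega)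
    have h3 := ht i hi hi1
    refine ⟨h1.trans h3, (h i hi hi1).trans ?_⟩
    set d := t (i + 1) - t i with hd
    have hd0 : 0 ≤ d := by linarith
    set e := t i - t i₀ with he
    have he0 : 0 ≤ e := by linarith
    have hde : t (i + 1) - t i₀ = d + e := by rw [hd, he]; ring
    rw [hde]
    have hX : 0 ≤ a i₀ + e * s := by positivity
    have k1 : (1 + K * d) * a i ≤ Real.exp (K * (d + e)) * (a i₀ + e * s) := by
      calc (1 + K * d) * a i ≤ (1 + K * d) * (Real.exp (K * e) * (a i₀ + e * s)) :=
            mul_le_mul_of_nonneg_left h2 (by positivity)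
        _ = ((1 + K * d) * Real.exp (K * e)) * (a i₀ + e * s) := by ring
        _ ≤ Real.exp (K * d + K * e) * (a i₀ + e * s) :=
            mul_le_mul_of_nonneg_right one_add_mul_exp_le hX
        _ = _ := by rw [mul_add K d e]
    have k2 : d * s ≤ Real.exp (K * (d + e)) * (d * s) := by
      have : 1 ≤ Real.exp (K * (d + e)) := Real.one_le_exp (by positivity)
      nlinarith [mul_nonneg hd0 hs]
    calc _ ≤ _ := add_le_add k1 k2
      _ = _ := by ring

lemma exp_le_one_add_two_mul {x : ℝ} (h0 : 0 ≤ x) (h1 : x ≤ 1) : Real.exp x ≤ 1 + 2 * x := by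
  have h := Real.abs_exp_sub_one_sub_id_le (x := x) (by rwa [abs_of_nonneg h0])
  have := (abs_le.1 h).2
  nlinarith

/-- A step inequality which is implicit in the new value. -/
lemma implicit_step {x y K h s : ℝ} (hK : 0 ≤ K) (hh : 0 ≤ h) (hKh : K * h ≤ 1 / 2)
    (hs : 0 ≤ s) (hy : 0 ≤ y) (hle : x ≤ (1 + K * h) * y + K * h * x + h * s) :
    x ≤ (1 + 4 * K * h) * y + h * (2 * s) := by
  have h1 : 0 ≤ K * h := mul_nonneg hK hh
  have h2 : (1 - K * h) * x ≤ (1 + K * h) * y + h * s := by linarith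
  -- For Kh ≤ 1/2 one has (1 + Kh)/(1 - Kh) ≤ 1 + 4Kh and 1/(1 - Kh) ≤ 2.
  have h3 : (1 - K * h) * ((1 + 4 * K * h) * y + h * (2 * s)) ≥ (1 + K * h) * y + h * s := by
    have e1 : (1 - K * h) * (1 + 4 * K * h) ≥ 1 + K * h := by nlinarith
    have e2 : (1 - K * h) * (h * (2 * s)) ≥ h * s := by
      have : 0 ≤ h * s := mul_nonneg hh hs
      nlinarith
    nlinarith [mul_le_mul_of_nonneg_right e1 hy]
  exact le_of_mul_le_mul_left (h2.trans h3) (by linarith)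

end gronwall

/-! ### One step of the forward and of the backward schemes -/

section step
lemma div_mul_sqrt (x h : ℝ) : x / h * √h = x / √h := by
  rw [div_mul_eq_mul_div, mul_div_assoc, Real.sqrt_div_self', mul_one_div]

variable {d : ℕ} {T : ℝ} {N : ℕ} {Λ α L R : ℝ} {π : Grid T N} {Q : Quantization d Λ}
  {ξ₀ : InitialLaw d} {c : Coeffs d} {U : ℝ → E d → Measure (E d) → ℝ} {D : Derivs d}

lemma law_eq_flaw {S : Type} [MeasurableSpace S] (V : Sample π Q ξ₀ → S) :
    law π Q ξ₀ V = flaw (prob π Q ξ₀) V := rfl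

/-- One step of the Euler scheme on the forest, as a step on a finite probability space. -/
noncomputable def treeStep (X b : Sample π Q ξ₀ → E d) : EulerStep (d := d) Λ (Sample π Q ξ₀) where
  p := prob π Q ξ₀
  hp := fprob_prob π Q ξ₀
  X := X
  b := b
  Q := Q

/-- `X'` is obtained from `X` by one step of the Euler scheme with drift `b`. -/
def IsStep (c : Coeffs d) (i : ℕ) (X b X' : Sample π Q ξ₀ → E d) : Prop :=
  ∀ ω, X' ω = X ω + π.h i • b ω + c.σ (X ω) (law π Q ξ₀ X) (dW π Q ξ₀ i ω)

variable {i : ℕ} {X b X' : Sample π Q ξ₀ → E d}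

lemma IsStep.eq_pos (hX' : IsStep c i X b X') (hi : i < π.n) (ω : Sample π Q ξ₀) :
    X' ω = (treeStep X b).pos c (π.h i) (ω, ω.2 ⟨i, hi⟩) := by
  rw [hX' ω, dW_eq hi, map_smul]
  rfl

lemma adapted_pos (hX : Adapted i X) (hb : Adapted i b) (s : ℝ) :
    Adapted i fun ω a => (treeStep X b).pos c s (ω, a) := by
  intro ω ω' h1 h2
  have e1 : (treeStep X b).X ω = (treeStep X b).X ω' := hX ω ω' h1 h2
  have e2 : (treeStep X b).b ω = (treeStep X b).b ω' := hb ω ω' h1 h2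
  funext a
  simp only [EulerStep.pos, EulerStep.S, e1, e2]

/-- On the forest the noise of the step is an entry of the branch, whereas `EulerStep` uses an
independent copy; the laws agree because the entry is independent of the adapted data. -/
lemma IsStep.law_eq (hX' : IsStep c i X b X') (hi : i < π.n) (hX : Adapted i X)
    (hb : Adapted i b) : law π Q ξ₀ X' = (treeStep X b).lawAt c (π.h i) := by
  have : X' = fun ω => (fun ω a => (treeStep X b).pos c (π.h i) (ω, a)) ω (ω.2 ⟨i, hi⟩) :=
    funext fun ω => hX'.eq_pos hi ω
  rw [this, law_noise hi (F := fun ω a => (treeStep X b).pos c (π.h i) (ω, a))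
    (adapted_pos hX hb _)]
  rfl

lemma IsStep.adapted (hX' : IsStep c i X b X') (hX : Adapted i X) (hb : Adapted i b) :
    Adapted (i + 1) X' := by
  intro ω ω' h1 h2
  have h2' : ∀ s : Fin π.n, (s : ℕ) < i → ω.2 s = ω'.2 s := fun s hs => h2 s (by omega)
  rw [hX' ω, hX' ω', hX ω ω' h1 h2', hb ω ω' h1 h2', adapted_dW i ω ω' h1 h2]

/-- The decoupling field along a process. -/
noncomputable def field (U : ℝ → E d → Measure (E d) → ℝ) (t : ℝ) (X : Sample π Q ξ₀ → E d)
    (ω : Sample π Q ξ₀) : ℝ := U t (X ω) (law π Q ξ₀ X)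

/-- The rotated gradient of the decoupling field along a process. -/
noncomputable def fieldZ (c : Coeffs d) (D : Derivs d) (t : ℝ) (X : Sample π Q ξ₀ → E d)
    (ω : Sample π Q ξ₀) : E d :=
  ContinuousLinearMap.adjoint (c.σ (X ω) (law π Q ξ₀ X)) (D.dx t (X ω) (law π Q ξ₀ X))

/-- The drift of a process `X` coupled with `Y`. -/
noncomputable def drift (c : Coeffs d) (X : Sample π Q ξ₀ → E d) (Y : Sample π Q ξ₀ → ℝ)
    (ω : Sample π Q ξ₀) : E d :=
  c.b (X ω) (Y ω) (law π Q ξ₀ fun ω' => pair (X ω') (Y ω'))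

lemma Adapted.field {t : ℝ} (hX : Adapted i X) : Adapted i (field U t X) :=
  hX.comp fun x => U t x (law π Q ξ₀ X)

lemma Adapted.drift (hX : Adapted i X) {Y : Sample π Q ξ₀ → ℝ} (hY : Adapted i Y) :
    Adapted i (drift c X Y) :=
  hX.comp₂ hY fun x y => c.b x y (law π Q ξ₀ fun ω' => pair (X ω') (Y ω'))

lemma isP2_law {S : Type} [NormedAddCommGroup S] [MeasurableSpace S] [MeasurableSingletonClass S]
    (V : Sample π Q ξ₀ → S) : IsP2 (law π Q ξ₀ V) := isP2_flaw (fprob_prob π Q ξ₀) V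

lemma norm_drift_sub_le (h0 : H0 L c) (X X' : Sample π Q ξ₀ → E d) (Y Y' : Sample π Q ξ₀ → ℝ)
    (ω : Sample π Q ξ₀) :
    ‖drift c X Y ω - drift c X' Y' ω‖ ≤ L * (‖X ω - X' ω‖ + |Y ω - Y' ω|
      + (n2 (prob π Q ξ₀) (fun ω => ‖X ω - X' ω‖) + n2 (prob π Q ξ₀) fun ω => Y ω - Y' ω))
    := by
  refine (h0.lip_b _ _ _ _ _ _ (isP2_law _) (isP2_law _)).trans ?_
  have hW := W2_pair_le (fprob_prob π Q ξ₀) X X' Y Y'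
  have hb := h0.lip_b 0 0 0 1 _ _ (isP2_law fun ω => pair (X ω) (Y ω))
    (isP2_law fun ω => pair (X ω) (Y ω))
  have hL : 0 ≤ L := by
    have := h0.bdd_σ 0 _ (isP2_law X)
    exact (norm_nonneg _).trans this
  exact mul_le_mul_of_nonneg_left (add_le_add le_rfl hW) hL

section ito
variable (hQ : ∀ a, ‖Q.w a‖ ≤ L) (hL : 1 ≤ L) (hR : 1 ≤ R) (h0 : H0 L c)
  (h1 : H1 L α T c U D) (hT : 0 < T)

include hQ hL hR h0 h1 hT in
/-- The weak expansion of the decoupling field along one step of the scheme. -/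
lemma IsStep.expansion (hX' : IsStep c i X b X') (hi : i < π.n) (hh1 : π.h i ≤ 1) (hX : Adapted i X)
    (hb : Adapted i b) (hα : 0 ≤ α) (ω : Sample π Q ξ₀) :
    |condE π Q ξ₀ i (field U (π.t (i + 1)) X') ω - field U (π.t i) X ω
      + π.h i * c.f (X ω) (field U (π.t i) X ω) (fieldZ c D (π.t i) X ω)
        (law π Q ξ₀ fun ω' => pair (X ω') (field U (π.t i) X ω'))|
    ≤ π.h i * (L * (‖b ω - drift c X (field U (π.t i) X) ω‖
        + n2 (prob π Q ξ₀) fun ω => ‖b ω - drift c X (field U (π.t i) X) ω‖))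
      + π.h i * (EulerStep.itoC d L α * √(π.h i) * EulerStep.H R (treeStep X b) α ω) := by
  have ht := π.t_nonneg hi.le
  have hth : π.t i + π.h i ≤ T := by rw [π.t_add_h]; exact π.t_le hi
  have key := EulerStep.abs_expansion_le (k := treeStep X b) (R := R) hQ hL hR h0 h1 hT hα ht
    (π.h_pos hi) hh1 hth ω
  have e1 : condE π Q ξ₀ i (field U (π.t (i + 1)) X') ω
      = ∑ a, Q.q a * U (π.t i + π.h i) ((treeStep X b).pos c (π.h i) (ω, a))
        ((treeStep X b).lawAt c (π.h i)) := by
    have : field U (π.t (i + 1)) X' = fun ω => (fun ω a => U (π.t i + π.h i)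
        ((treeStep X b).pos c (π.h i) (ω, a)) ((treeStep X b).lawAt c (π.h i))) ω
        (ω.2 ⟨i, hi⟩) := by
      funext ω
      rw [field, hX'.law_eq hi hX hb, hX'.eq_pos hi, π.t_add_h]
    rw [this, condE_noise hi (F := fun ω a => U (π.t i + π.h i)
        ((treeStep X b).pos c (π.h i) (ω, a)) ((treeStep X b).lawAt c (π.h i)))
        ((adapted_pos hX hb _).comp fun g a => U (π.t i + π.h i) (g a)
          ((treeStep X b).lawAt c (π.h i)))]
    rfl
  have e2 : imageLaw U (π.t i) (law π Q ξ₀ X)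
      = law π Q ξ₀ fun ω' => pair (X ω') (field U (π.t i) X ω') :=
    h1.imageLaw_flaw ⟨ht, π.t_le hi.le⟩ (fprob_prob π Q ξ₀) X
  rw [e1]
  have e3 : ∀ ω, (treeStep X b).drift₀ c U (π.t i) ω = drift c X (field U (π.t i) X) ω := by
    intro ω
    have : (treeStep X b).drift₀ c U (π.t i) ω = c.b (X ω) (U (π.t i) (X ω) (law π Q ξ₀ X))
      (imageLaw U (π.t i) (law π Q ξ₀ X)) := rfl
    rw [this, e2]; rfl
  have e4 : (treeStep X b).driver₀ c U D (π.t i) ω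
      = c.f (X ω) (field U (π.t i) X ω) (fieldZ c D (π.t i) X ω)
        (law π Q ξ₀ fun ω' => pair (X ω') (field U (π.t i) X ω')) := by
    rw [← e2]; rfl
  simp only [e3, e4] at key
  exact key

include hQ hL hR h0 h1 hT in
lemma IsStep.Z_expansion (hX' : IsStep c i X b X') (hi : i < π.n) (hh1 : π.h i ≤ 1)
    (hX : Adapted i X) (hb : Adapted i b) (ω : Sample π Q ξ₀) :
    ‖condE π Q ξ₀ i (fun ω => (field U (π.t (i + 1)) X' ω / π.h i) • dW π Q ξ₀ i ω) ω
      - fieldZ c D (π.t i) X ω‖ ≤ 7 * L ^ 7 * √(π.h i) * (treeStep X b).G R ω := by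
  have ht := π.t_nonneg hi.le
  have hth : π.t i + π.h i ≤ T := by rw [π.t_add_h]; exact π.t_le hi
  have key := EulerStep.norm_Z_expansion_le (k := treeStep X b) (R := R) hQ hL hR h0 h1 hT ht
    (π.h_pos hi) hh1 hth ω
  have e1 : condE π Q ξ₀ i (fun ω => (field U (π.t (i + 1)) X' ω / π.h i) • dW π Q ξ₀ i ω) ω
      = ∑ a, (Q.q a * (U (π.t i + π.h i) ((treeStep X b).pos c (π.h i) (ω, a))
        ((treeStep X b).lawAt c (π.h i)) / √(π.h i))) • Q.w a := by
    have : (fun ω => (field U (π.t (i + 1)) X' ω / π.h i) • dW π Q ξ₀ i ω)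
        = fun ω => (fun ω a => (U (π.t i + π.h i)
        ((treeStep X b).pos c (π.h i) (ω, a)) ((treeStep X b).lawAt c (π.h i)) / √(π.h i))
          • Q.w a) ω (ω.2 ⟨i, hi⟩) := by
      funext ω
      rw [field, hX'.law_eq hi hX hb, hX'.eq_pos hi, π.t_add_h, dW_eq hi, smul_smul]
      congr 1
      exact div_mul_sqrt _ _
    rw [this, condE_noise hi (F := fun ω a => (U (π.t i + π.h i)
        ((treeStep X b).pos c (π.h i) (ω, a)) ((treeStep X b).lawAt c (π.h i)) / √(π.h i))
          • Q.w a) ((adapted_pos hX hb _).comp fun g a => (U (π.t i + π.h i) (g a)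
          ((treeStep X b).lawAt c (π.h i)) / √(π.h i)) • Q.w a)]
    exact Finset.sum_congr rfl fun a _ => smul_smul _ _ _
  rw [e1]
  exact key

end ito

end step

end MKV

namespace MKV

section n2add
variable {Θ : Type} [Fintype Θ] {p : Θ → ℝ}

lemma n2_le_add₃ (hp : ∀ θ, 0 ≤ p θ) {F A B C : Θ → ℝ} (h : ∀ θ, |F θ| ≤ A θ + B θ + C θ) :
    n2 p F ≤ n2 p A + n2 p B + n2 p C :=
  (n2_le_add hp (V := fun θ => A θ + B θ) h).trans (add_le_add (n2_add_le hp) le_rfl)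

lemma n2_le_add₄ (hp : ∀ θ, 0 ≤ p θ) {F A B C G : Θ → ℝ}
    (h : ∀ θ, |F θ| ≤ A θ + B θ + C θ + G θ) :
    n2 p F ≤ n2 p A + n2 p B + n2 p C + n2 p G :=
  (n2_le_add hp (V := fun θ => A θ + B θ + C θ) h).trans (add_le_add ((n2_add_le hp
    (V := fun θ => A θ + B θ)).trans (add_le_add (n2_add_le hp) le_rfl)) le_rfl)

lemma flaw_const {S : Type} [MeasurableSpace S] (hp : FProb p) (x : S) :
    flaw p (fun _ => x) = Measure.dirac x := by
  unfold flaw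
  rw [← Finset.sum_smul, ← ENNReal.ofReal_sum_of_nonneg fun θ _ => hp.nonneg θ, hp.sum]
  simp

end n2add

/-- A constant which dominates the data at the origin. -/
structure BigR {d : ℕ} (R T : ℝ) (c : Coeffs d) (U : ℝ → E d → Measure (E d) → ℝ) : Prop where
  one_le : 1 ≤ R
  b_zero : ‖c.b 0 0 (Measure.dirac (pair 0 0))‖ ≤ R
  f_zero : |c.f 0 0 0 (Measure.dirac (pair 0 0))| ≤ R
  U_zero : ∀ t ∈ Icc 0 T, |U t 0 (Measure.dirac 0)| ≤ R

/-! ### Growth, stability and error of one step on the forest. -/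

section step
variable {d : ℕ} {T : ℝ} {N : ℕ} {Λ α L R : ℝ} {π : Grid T N} {Q : Quantization d Λ}
  {ξ₀ : InitialLaw d} {c : Coeffs d} {U : ℝ → E d → Measure (E d) → ℝ} {D : Derivs d}
  {i : ℕ} {w : Sample π Q ξ₀ → ℝ} {X X' b : Sample π Q ξ₀ → E d} {Y : Sample π Q ξ₀ → ℝ}

/-- The quadratic mean of a process with respect to the weights `w`, shifted by `R`. -/
noncomputable def vw (R : ℝ) (w : Sample π Q ξ₀ → ℝ) (X : Sample π Q ξ₀ → E d) : ℝ :=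
  n2 w fun ω => √(R ^ 2 + ‖X ω‖ ^ 2)

lemma vw_nonneg : 0 ≤ vw R w X := n2_nonneg

lemma vw_sq (hw : ∀ ω, 0 ≤ w ω) : vw R w X ^ 2 = ∑ ω, w ω * (R ^ 2 + ‖X ω‖ ^ 2) := by
  rw [vw, n2_sq hw]
  exact Finset.sum_congr rfl fun ω _ => by rw [Real.sq_sqrt (by positivity)]

lemma n2_norm_le_vw (hw : ∀ ω, 0 ≤ w ω) : n2 w (fun ω => ‖X ω‖) ≤ vw R w X :=
  n2_mono hw fun ω => by
    rw [abs_norm]; exact Real.le_sqrt_of_sq_le (by nlinarith [sq_nonneg R])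

lemma n2_const_le_vw (hw : ∀ ω, 0 ≤ w ω) (hR : 0 ≤ R) : n2 w (fun _ => R) ≤ vw R w X :=
  n2_mono hw fun ω => by
    rw [abs_of_nonneg hR]; exact Real.le_sqrt_of_sq_le (by nlinarith [sq_nonneg ‖X ω‖])

/-- A mean-field term is constant on the forest. Since the weights dominate the probability and have
mass at most 2, it is absorbed by the weighted norm of the same variable. -/
lemma Wt.n2_n2_le (hw : Wt i w) (V : Sample π Q ξ₀ → ℝ) :
    n2 w (fun _ => n2 (prob π Q ξ₀) V) ≤ 2 * n2 w V :=
  (hw.n2_const_le n2_nonneg).trans (by linarith [hw.n2_prob_le V])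

lemma Wt.n2_mul_n2_le (hw : Wt i w) {x : ℝ} (hx : 0 ≤ x) (V : Sample π Q ξ₀ → ℝ) :
    n2 w (fun _ => x * n2 (prob π Q ξ₀) V) ≤ x * (2 * n2 w V) := by
  rw [n2_const_mul x hx]
  exact mul_le_mul_of_nonneg_left (hw.n2_n2_le V) hx

lemma norm_drift_le (h0 : H0 L c) (hR : BigR R T c U) (X : Sample π Q ξ₀ → E d)
    (Y : Sample π Q ξ₀ → ℝ) (ω : Sample π Q ξ₀) :
    ‖drift c X Y ω‖ ≤ R + L * (‖X ω‖ + |Y ω| + (n2 (prob π Q ξ₀) (fun ω => ‖X ω‖)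
      + n2 (prob π Q ξ₀) Y)) := by
  have h := norm_drift_sub_le h0 X (fun _ => 0) Y (fun _ => 0) ω
  have e : drift c (fun _ : Sample π Q ξ₀ => (0 : E d)) (fun _ => 0) ω
      = c.b 0 0 (Measure.dirac (pair 0 0)) := by
    rw [drift, law_eq_flaw, flaw_const (fprob_prob π Q ξ₀)]
  rw [e] at h
  simp only [sub_zero] at h
  have := norm_le_norm_add_norm_sub' (drift c X Y ω) (c.b 0 0 (Measure.dirac (pair 0 0)))
  linarith [hR.b_zero]

lemma abs_field_sub_le (h1 : H1 L α T c U D) (hL : 0 ≤ L) {t : ℝ} (ht : t ∈ Icc 0 T)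
    (X X' : Sample π Q ξ₀ → E d) (ω : Sample π Q ξ₀) :
    |field U t X ω - field U t X' ω| ≤ L * ‖X ω - X' ω‖
      + L * n2 (prob π Q ξ₀) (fun ω => ‖X ω - X' ω‖) :=
  (h1.U_sub_le hL ht _ _ (isP2_law X) (isP2_law X')).trans (add_le_add le_rfl
    (mul_le_mul_of_nonneg_left (W2_flaw_le (fprob_prob π Q ξ₀) X X') hL))

lemma abs_field_le (h1 : H1 L α T c U D) (hL : 0 ≤ L) (hR : BigR R T c U) {t : ℝ}
    (ht : t ∈ Icc 0 T) (X : Sample π Q ξ₀ → E d) (ω : Sample π Q ξ₀) :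
    |field U t X ω| ≤ R + L * ‖X ω‖ + L * n2 (prob π Q ξ₀) (fun ω => ‖X ω‖) := by
  have h := abs_field_sub_le h1 hL ht X (fun _ => 0) ω
  have e : field U t (fun _ : Sample π Q ξ₀ => (0 : E d)) ω = U t 0 (Measure.dirac 0) := by
    rw [field, law_eq_flaw, flaw_const (fprob_prob π Q ξ₀)]
  rw [e] at h
  simp only [sub_zero] at h
  have h2 := hR.U_zero t ht
  have := abs_add_le (field U t X ω - U t 0 (Measure.dirac 0)) (U t 0 (Measure.dirac 0))
  rw [sub_add_cancel] at this
  linarith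

lemma n2_field_sub_le (h1 : H1 L α T c U D) (hL : 0 ≤ L) {t : ℝ} (ht : t ∈ Icc 0 T) (hw : Wt i w)
    (X X' : Sample π Q ξ₀ → E d) :
    n2 w (fun ω => field U t X ω - field U t X' ω) ≤ 3 * L * n2 w fun ω => ‖X ω - X' ω‖ := by
  have h := n2_le_add hw.nonneg (abs_field_sub_le h1 hL ht X X')
  have h2 := hw.n2_mul_n2_le hL fun ω => ‖X ω - X' ω‖
  rw [n2_const_mul L hL] at h
  linarith

lemma n2_field_le (h1 : H1 L α T c U D) (hL : 1 ≤ L) (hR : BigR R T c U) {t : ℝ}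
    (ht : t ∈ Icc 0 T) (hw : Wt i w) (X : Sample π Q ξ₀ → E d) :
    n2 w (field U t X) ≤ 4 * L * vw R w X := by
  have hL0 : 0 ≤ L := by linarith
  have hR0 : 0 ≤ R := by linarith [hR.one_le]
  have h := n2_le_add₃ hw.nonneg (abs_field_le h1 hL0 hR ht X)
  have h2 := hw.n2_mul_n2_le hL0 fun ω => ‖X ω‖
  have h3 := n2_norm_le_vw (R := R) (X := X) hw.nonneg
  have h4 := n2_const_le_vw (X := X) hw.nonneg hR0
  rw [n2_const_mul L hL0] at h
  nlinarith [vw_nonneg (R := R) (w := w) (X := X)]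

lemma n2_drift_le (h0 : H0 L c) (hL : 1 ≤ L) (hR : BigR R T c U) (hw : Wt i w)
    (X : Sample π Q ξ₀ → E d) (Y : Sample π Q ξ₀ → ℝ) :
    n2 w (fun ω => ‖drift c X Y ω‖) ≤ 4 * L * vw R w X + 3 * L * n2 w Y := by
  have hL0 : 0 ≤ L := by linarith
  have hR0 : 0 ≤ R := by linarith [hR.one_le]
  have h := n2_le_add₃ hw.nonneg (F := fun ω => ‖drift c X Y ω‖) (A := fun _ => R)
    (B := fun ω => L * (‖X ω‖ + |Y ω|)) (C := fun _ => L * (n2 (prob π Q ξ₀) (fun ω => ‖X ω‖)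
      + n2 (prob π Q ξ₀) Y)) fun ω => by
        rw [abs_norm]; exact (norm_drift_le h0 hR X Y ω).trans (le_of_eq (by ring))
  rw [n2_const_mul L hL0, n2_const_mul L hL0] at h
  have h2 := n2_add_le (p := w) (V := fun ω => ‖X ω‖) (W := fun ω => |Y ω|) hw.nonneg
  have h3 := n2_add_le (p := w) (V := fun _ => n2 (prob π Q ξ₀) (fun ω => ‖X ω‖))
    (W := fun _ => n2 (prob π Q ξ₀) Y) hw.nonneg
  have h4 := hw.n2_n2_le fun ω => ‖X ω‖
  have h5 := hw.n2_n2_le Y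
  have h6 := n2_norm_le_vw (R := R) (X := X) hw.nonneg
  have h7 := n2_const_le_vw (X := X) hw.nonneg hR0
  rw [n2_abs] at h2
  have h8 := mul_le_mul_of_nonneg_left h2 hL0
  have h9 := mul_le_mul_of_nonneg_left h3 hL0
  have hv := vw_nonneg (R := R) (w := w) (X := X)
  have h10 := mul_le_mul_of_nonneg_left h4 hL0
  have h11 := mul_le_mul_of_nonneg_left h5 hL0
  have h12 := mul_le_mul_of_nonneg_left h6 hL0
  have h13 := mul_le_mul_of_nonneg_right hL hv
  linarith

/-! #### The forward component -/

/-- Growth of the quadratic mean over one step of the Euler scheme. -/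
lemma IsStep.vw_sq_le (hX' : IsStep c i X b X') (hQ : ∀ a, ‖Q.w a‖ ≤ L) (hL : 1 ≤ L)
    (h0 : H0 L c) (hR : 1 ≤ R)
    (hi : i < π.n) (hh1 : π.h i ≤ 1) (hX : Adapted i X) (hb : Adapted i b) (hw : Wt i w) :
    vw R w X' ^ 2 ≤ (1 + 2 * L ^ 4 * π.h i) * vw R w X ^ 2
      + 2 * π.h i * n2 w (fun ω => ‖b ω‖) ^ 2 := by
  have hh := (π.h_pos hi).le
  -- Invariance of the weights replaces X' by its conditional second moment, where the noise is
  -- orthogonal to the past. Hence a growth of 1 + O(h) and not 1 + O(√h).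
  rw [vw_sq hw.nonneg, vw_sq hw.nonneg, n2_sq hw.nonneg, ← hw.inv i le_rfl, Finset.mul_sum,
    Finset.mul_sum, ← Finset.sum_add_distrib]
  refine Finset.sum_le_sum fun ω _ => ?_
  have e : (fun ω => R ^ 2 + ‖X' ω‖ ^ 2) = fun ω => R ^ 2
      + ‖(X ω + π.h i • b ω) + c.σ (X ω) (law π Q ξ₀ X) (dW π Q ξ₀ i ω)‖ ^ 2 := by
    funext ω; rw [hX' ω]
  have hu : Adapted i fun ω => X ω + π.h i • b ω := hX.comp₂ hb fun x b => x + π.h i • b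
  have hA : Adapted i fun ω => c.σ (X ω) (law π Q ξ₀ X) := hX.comp fun x => c.σ x (law π Q ξ₀ X)
  rw [e, condE_add, condE_const]
  simp only
  have k := condE_norm_add_sq_le (ξ₀ := ξ₀) hQ hi hh hu hA ω
  have hs : ‖c.σ (X ω) (law π Q ξ₀ X)‖ ^ 2 ≤ L ^ 2 :=
    pow_le_pow_left₀ (norm_nonneg _) (h0.bdd_σ _ _ (isP2_law X)) 2
  have hs' : L ^ 2 * π.h i * ‖c.σ (X ω) (law π Q ξ₀ X)‖ ^ 2 ≤ L ^ 4 * π.h i := by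
    calc _ ≤ L ^ 2 * π.h i * L ^ 2 := by gcongr
      _ = _ := by ring
  have hsq : ‖X ω + π.h i • b ω‖ ^ 2 ≤ (1 + π.h i) * ‖X ω‖ ^ 2 + 2 * π.h i * ‖b ω‖ ^ 2 := by
    have h1 : ‖X ω + π.h i • b ω‖ ≤ ‖X ω‖ + π.h i * ‖b ω‖ := by
      refine (norm_add_le _ _).trans ?_
      rw [norm_smul, Real.norm_of_nonneg hh]
    have h2 := pow_le_pow_left₀ (norm_nonneg _) h1 2
    have h3 : π.h i ^ 2 * ‖b ω‖ ^ 2 ≤ π.h i * ‖b ω‖ ^ 2 :=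
      mul_le_mul_of_nonneg_right (by nlinarith) (sq_nonneg _)
    nlinarith [mul_nonneg hh (sq_nonneg (‖X ω‖ - ‖b ω‖))]
  have h4 : 1 ≤ L ^ 4 := one_le_pow₀ hL
  have h5 : π.h i * ‖X ω‖ ^ 2 ≤ L ^ 4 * π.h i * ‖X ω‖ ^ 2 := by
    have : 0 ≤ π.h i * ‖X ω‖ ^ 2 := by positivity
    nlinarith
  have h6 : L ^ 4 * π.h i ≤ L ^ 4 * π.h i * R ^ 2 := by
    have : 1 ≤ R ^ 2 := one_le_pow₀ hR
    have : 0 ≤ L ^ 4 * π.h i := by positivity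
    nlinarith
  have h7 : 0 ≤ L ^ 4 * π.h i * R ^ 2 := by positivity
  have h8 : 0 ≤ L ^ 4 * π.h i * ‖X ω‖ ^ 2 := by positivity
  calc w ω * _ ≤ w ω * (R ^ 2 + (‖X ω + π.h i • b ω‖ ^ 2
        + L ^ 2 * π.h i * ‖c.σ (X ω) (law π Q ξ₀ X)‖ ^ 2)) :=
        mul_le_mul_of_nonneg_left (add_le_add le_rfl k) (hw.nonneg ω)
    _ ≤ w ω * ((1 + 2 * L ^ 4 * π.h i) * (R ^ 2 + ‖X ω‖ ^ 2) + 2 * π.h i * ‖b ω‖ ^ 2) :=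
        mul_le_mul_of_nonneg_left (by linarith) (hw.nonneg ω)
    _ = _ := by ring

lemma IsStep.vw_sq_le_drift (hX' : IsStep c i X (drift c X Y) X') (hQ : ∀ a, ‖Q.w a‖ ≤ L)
    (hL : 1 ≤ L) (h0 : H0 L c) (hR : BigR R T c U)
    (hi : i < π.n) (hh1 : π.h i ≤ 1) (hX : Adapted i X) (hY : Adapted i Y) (hw : Wt i w) :
    vw R w X' ^ 2 ≤ (1 + 100 * L ^ 4 * π.h i) * vw R w X ^ 2
      + π.h i * (100 * L ^ 4 * n2 w Y ^ 2) := by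
  have hh := (π.h_pos hi).le
  refine (hX'.vw_sq_le hQ hL h0 hR.one_le hi hh1 hX (hX.drift hY) hw).trans ?_
  have h := n2_drift_le h0 hL hR hw X Y
  have h2 := pow_le_pow_left₀ n2_nonneg h 2
  set v := vw R w X
  set y := n2 w Y
  have h3 : (4 * L * v + 3 * L * y) ^ 2 ≤ 32 * L ^ 2 * v ^ 2 + 18 * L ^ 2 * y ^ 2 := by
    nlinarith [sq_nonneg (4 * L * v - 3 * L * y)]
  have h4 : L ^ 2 ≤ L ^ 4 := pow_le_pow_right₀ hL (by norm_num)
  have h5 : 32 * L ^ 2 * v ^ 2 + 18 * L ^ 2 * y ^ 2 ≤ 32 * L ^ 4 * v ^ 2 + 18 * L ^ 4 * y ^ 2 := by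
    gcongr
  have h6 := mul_le_mul_of_nonneg_left (h2.trans (h3.trans h5)) (by linarith : 0 ≤ 2 * π.h i)
  have h7 : 0 ≤ π.h i * (L ^ 4 * y ^ 2) := by positivity
  have h8 : 0 ≤ π.h i * (L ^ 4 * v ^ 2) := by positivity
  linarith

/-- Stability of one step of the Euler scheme. -/
lemma IsStep.n2_sub_le {X₁ X₁' : Sample π Q ξ₀ → E d} {Y₁ : Sample π Q ξ₀ → ℝ}
    (hX' : IsStep c i X (drift c X Y) X') (hX₁' : IsStep c i X₁ (drift c X₁ Y₁) X₁')
    (hQ : ∀ a, ‖Q.w a‖ ≤ L) (hL : 1 ≤ L) (h0 : H0 L c)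
    (hi : i < π.n) (hX : Adapted i X) (hY : Adapted i Y)
    (hX₁ : Adapted i X₁) (hY₁ : Adapted i Y₁) (hw : Wt i w) :
    n2 w (fun ω => ‖X' ω - X₁' ω‖) ≤ (1 + 12 * L ^ 4 * π.h i) * n2 w (fun ω => ‖X ω - X₁ ω‖)
      + π.h i * (3 * L * n2 w fun ω => Y ω - Y₁ ω) := by
  have hh := (π.h_pos hi).le
  have hL0 : 0 ≤ L := by linarith
  set x := n2 w (fun ω => ‖X ω - X₁ ω‖) with hx
  set y := n2 w (fun ω => Y ω - Y₁ ω) with hy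
  have hx0 : 0 ≤ x := n2_nonneg
  have hy0 : 0 ≤ y := n2_nonneg
  -- The difference of the two steps is an adapted vector plus an adapted matrix applied to the
  -- increment; their squares add up without cross term.
  set u : Sample π Q ξ₀ → E d := fun ω => (X ω - X₁ ω) + π.h i • (drift c X Y ω - drift c X₁ Y₁ ω)
    with hu
  set A : Sample π Q ξ₀ → E d →L[ℝ] E d := fun ω => c.σ (X ω) (law π Q ξ₀ X)
    - c.σ (X₁ ω) (law π Q ξ₀ X₁) with hA
  have hua : Adapted i u := (hX.comp₂ hX₁ fun x y => x - y).comp₂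
    ((hX.drift hY).comp₂ (hX₁.drift hY₁) fun x y => x - y) fun x y => x + π.h i • y
  have hAa : Adapted i A := hX.comp₂ hX₁ fun x y => c.σ x (law π Q ξ₀ X) - c.σ y (law π Q ξ₀ X₁)
  have e : ∀ ω, X' ω - X₁' ω = u ω + A ω (dW π Q ξ₀ i ω) := by
    intro ω
    rw [hX' ω, hX₁' ω, hu, hA]
    simp only [sub_apply, smul_sub]
    abel
  have b1 : n2 w (fun ω => ‖X' ω - X₁' ω‖) ^ 2
      ≤ n2 w (fun ω => ‖u ω‖) ^ 2 + L ^ 2 * π.h i * n2 w (fun ω => ‖A ω‖) ^ 2 := by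
    simp_rw [e]
    rw [n2_sq hw.nonneg, n2_sq hw.nonneg, n2_sq hw.nonneg, ← hw.inv i le_rfl, Finset.mul_sum,
      ← Finset.sum_add_distrib]
    refine Finset.sum_le_sum fun ω _ => ?_
    have := mul_le_mul_of_nonneg_left (condE_norm_add_sq_le (ξ₀ := ξ₀) hQ hi hh hua hAa ω)
      (hw.nonneg ω)
    linarith
  have b2 : n2 w (fun ω => ‖A ω‖) ≤ 3 * L * x := by
    have h := n2_le_add hw.nonneg (F := fun ω => ‖A ω‖) (V := fun ω => L * ‖X ω - X₁ ω‖)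
      (W := fun _ => L * n2 (prob π Q ξ₀) (fun ω => ‖X ω - X₁ ω‖)) fun ω => by
        rw [abs_norm, ← mul_add]
        exact (h0.lip_σ _ _ _ _ (isP2_law X) (isP2_law X₁)).trans
          (mul_le_mul_of_nonneg_left (add_le_add le_rfl
            (W2_flaw_le (fprob_prob π Q ξ₀) X X₁)) hL0)
    have h2 := hw.n2_mul_n2_le hL0 fun ω => ‖X ω - X₁ ω‖
    rw [n2_const_mul L hL0] at h
    linarith
  have b3 : n2 w (fun ω => ‖u ω‖) ≤ x + π.h i * (3 * L * x + 3 * L * y) := by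
    have h := n2_le_add₃ hw.nonneg (F := fun ω => ‖u ω‖) (A := fun ω => ‖X ω - X₁ ω‖)
      (B := fun ω => π.h i * L * (‖X ω - X₁ ω‖ + |Y ω - Y₁ ω|))
      (C := fun _ => π.h i * L * (n2 (prob π Q ξ₀) (fun ω => ‖X ω - X₁ ω‖)
        + n2 (prob π Q ξ₀) fun ω => Y ω - Y₁ ω)) fun ω => by
          rw [abs_norm, hu]
          refine (norm_add_le _ _).trans ?_
          rw [norm_smul, Real.norm_of_nonneg hh]
          have := mul_le_mul_of_nonneg_left (norm_drift_sub_le h0 X X₁ Y Y₁ ω) hh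
          linarith
    have hhL : 0 ≤ π.h i * L := by positivity
    rw [n2_const_mul _ hhL, n2_const_mul _ hhL] at h
    have h2 := n2_add_le (p := w) (V := fun ω => ‖X ω - X₁ ω‖) (W := fun ω => |Y ω - Y₁ ω|)
      hw.nonneg
    rw [n2_abs] at h2
    have h3 := n2_add_le (p := w) (V := fun _ => n2 (prob π Q ξ₀) (fun ω => ‖X ω - X₁ ω‖))
      (W := fun _ => n2 (prob π Q ξ₀) fun ω => Y ω - Y₁ ω) hw.nonneg
    have h4 := hw.n2_n2_le fun ω => ‖X ω - X₁ ω‖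
    have h5 := hw.n2_n2_le fun ω => Y ω - Y₁ ω
    have h6 := mul_le_mul_of_nonneg_left h2 hhL
    have h7 := mul_le_mul_of_nonneg_left (h3.trans (add_le_add h4 h5)) hhL
    linarith
  refine le_of_sq_le_sq (b1.trans ?_) (by positivity)
  have b4 := pow_le_pow_left₀ n2_nonneg b3 2
  have b5 := pow_le_pow_left₀ n2_nonneg b2 2
  have b6 := mul_le_mul_of_nonneg_left b5 (by positivity : 0 ≤ L ^ 2 * π.h i)
  have hL4 : L ≤ L ^ 4 := le_self_pow₀ hL (by norm_num)
  set B := (1 + 3 * L * π.h i) * x + π.h i * (3 * L * y) with hB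
  have hxB : x ≤ B := by
    have : 0 ≤ 3 * L * π.h i * x + π.h i * (3 * L * y) := by positivity
    linarith
  have e1 : x + π.h i * (3 * L * x + 3 * L * y) = B := by rw [hB]; ring
  rw [e1] at b4
  have e2 : L ^ 2 * π.h i * (3 * L * x) ^ 2 = 9 * L ^ 4 * π.h i * (x * x) := by ring
  rw [e2] at b6
  have e3 : B + 9 * L ^ 4 * π.h i * x ≤ (1 + 12 * L ^ 4 * π.h i) * x + π.h i * (3 * L * y) := by
    have : L * (π.h i * x) ≤ L ^ 4 * (π.h i * x) :=
      mul_le_mul_of_nonneg_right hL4 (by positivity)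
    linarith
  have hB0 : 0 ≤ B := hx0.trans hxB
  have hq : 0 ≤ 9 * L ^ 4 * π.h i := by positivity
  -- With q = 9L⁴h, x ≤ B gives B² + q x² ≤ (B + q x)².
  calc _ ≤ B ^ 2 + 9 * L ^ 4 * π.h i * (x * x) := add_le_add b4 b6
    _ ≤ (B + 9 * L ^ 4 * π.h i * x) ^ 2 := by
      nlinarith [mul_le_mul_of_nonneg_left hxB (mul_nonneg hq hx0), mul_nonneg hq hx0,
        mul_nonneg (mul_nonneg hq hx0) hB0, sq_nonneg (9 * L ^ 4 * π.h i * x)]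
    _ ≤ _ := pow_le_pow_left₀ (by positivity) e3 2

/-! #### The backward component -/

/-- `(Y, Z)` is obtained from `Y'` by one backward step with forward component `X`. -/
structure IsBackStep (c : Coeffs d) (i : ℕ) (X : Sample π Q ξ₀ → E d)
    (Y' Y : Sample π Q ξ₀ → ℝ) (Z : Sample π Q ξ₀ → E d) : Prop where
  Y_eq : Y = condE π Q ξ₀ i fun ω => Y' ω +
    π.h i * c.f (X ω) (Y ω) (Z ω) (law π Q ξ₀ fun ω' => pair (X ω') (Y ω'))
  Z_eq : Z = condE π Q ξ₀ i fun ω => (Y' ω / π.h i) • dW π Q ξ₀ i ω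

variable {Y' : Sample π Q ξ₀ → ℝ} {Z : Sample π Q ξ₀ → E d}

lemma IsBackStep.adapted_Y (h : IsBackStep c i X Y' Y Z) : Adapted i Y := by
  rw [h.Y_eq]; exact adapted_condE _ _

lemma IsBackStep.adapted_Z (h : IsBackStep c i X Y' Y Z) : Adapted i Z := by
  rw [h.Z_eq]; exact adapted_condE _ _

lemma IsBackStep.eq (h : IsBackStep c i X Y' Y Z) (hX : Adapted i X) (ω : Sample π Q ξ₀) :
    Y ω = condE π Q ξ₀ i Y' ω
      + π.h i * c.f (X ω) (Y ω) (Z ω) (law π Q ξ₀ fun ω' => pair (X ω') (Y ω')) := by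
  have ha : Adapted i fun ω => π.h i * c.f (X ω) (Y ω) (Z ω)
      (law π Q ξ₀ fun ω' => pair (X ω') (Y ω')) := by
    intro ω ω' h1 h2
    simp only [hX ω ω' h1 h2, h.adapted_Y ω ω' h1 h2, h.adapted_Z ω ω' h1 h2]
  conv_lhs => rw [h.Y_eq]
  rw [condE_add, condE_of_adapted ha]

lemma h_mul_norm_condE_div {V : Sample π Q ξ₀ → ℝ} (hh : 0 < π.h i) (ω : Sample π Q ξ₀) :
    π.h i * ‖condE π Q ξ₀ i (fun ω => (V ω / π.h i) • dW π Q ξ₀ i ω) ω‖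
      = ‖condE π Q ξ₀ i (fun ω => V ω • dW π Q ξ₀ i ω) ω‖ := by
  have : (fun ω => (V ω / π.h i) • dW π Q ξ₀ i ω)
      = fun ω => (π.h i)⁻¹ • (V ω • dW π Q ξ₀ i ω) := by
    funext ω; rw [smul_smul]; congr 1; ring
  rw [this, condE_smul_adapted (f := fun _ => (π.h i)⁻¹) (fun _ _ _ _ => rfl), norm_smul,
    Real.norm_of_nonneg (by positivity)]
  field_simp

lemma abs_f_sub_le (h0 : H0 L c) (hL : 0 ≤ L) (X : Sample π Q ξ₀ → E d)
    (Y Y₁ : Sample π Q ξ₀ → ℝ) (x : E d) (y y₁ : ℝ) (z z₁ : E d) :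
    |c.f x y z (law π Q ξ₀ fun ω' => pair (X ω') (Y ω'))
      - c.f x y₁ z₁ (law π Q ξ₀ fun ω' => pair (X ω') (Y₁ ω'))|
      ≤ L * (|y - y₁| + ‖z - z₁‖ + n2 (prob π Q ξ₀) fun ω => Y ω - Y₁ ω) := by
  refine (h0.lip_f x x y y₁ z z₁ _ _ (isP2_law _) (isP2_law _)).trans ?_
  have h := W2_pair_le (fprob_prob π Q ξ₀) X X Y Y₁
  simp only [sub_self, norm_zero] at h
  rw [n2_const_prob (fprob_prob π Q ξ₀).sum 0 le_rfl, zero_add] at h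
  rw [sub_self, norm_zero, zero_add]
  exact mul_le_mul_of_nonneg_left (add_le_add le_rfl h) hL

/-- The size of the backward component over one step. -/
lemma IsBackStep.abs_le (h : IsBackStep c i X Y' Y Z) (h0 : H0 L c) (hL : 0 ≤ L) (hi : i < π.n)
    (hX : Adapted i X) (ω : Sample π Q ξ₀) :
    |Y ω| ≤ (|condE π Q ξ₀ i Y' ω| + L * ‖condE π Q ξ₀ i (fun ω => Y' ω • dW π Q ξ₀ i ω) ω‖)
      + π.h i * L * |Y ω| + π.h i * L * n2 (prob π Q ξ₀) Y
      + π.h i * |c.f (X ω) 0 0 (law π Q ξ₀ fun ω' => pair (X ω') 0)| := by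
  have hh := π.h_pos hi
  have e := h.eq hX ω
  have hf := abs_f_sub_le h0 hL X Y (fun _ => 0) (X ω) (Y ω) 0 (Z ω) 0
  simp only [sub_zero] at hf
  have hz := h_mul_norm_condE_div (V := Y') hh ω
  rw [← h.Z_eq] at hz
  have t1 := abs_sub_abs_le_abs_sub (c.f (X ω) (Y ω) (Z ω)
    (law π Q ξ₀ fun ω' => pair (X ω') (Y ω'))) (c.f (X ω) 0 0 (law π Q ξ₀ fun ω' => pair (X ω') 0))
  have t2 := abs_add_le (condE π Q ξ₀ i Y' ω) (π.h i * c.f (X ω) (Y ω) (Z ω)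
    (law π Q ξ₀ fun ω' => pair (X ω') (Y ω')))
  rw [← e, abs_mul, abs_of_pos hh] at t2
  have t3 := mul_le_mul_of_nonneg_left (t1.trans hf) hh.le
  rw [← hz]
  linarith

lemma IsBackStep.n2_le (h : IsBackStep c i X Y' Y Z) (h0 : H0 L c) (hL : 0 ≤ L) (hi : i < π.n)
    (hX : Adapted i X) (hw : Wt i w) {F : Sample π Q ξ₀ → ℝ}
    (hF : ∀ ω, |c.f (X ω) 0 0 (law π Q ξ₀ fun ω' => pair (X ω') 0)| ≤ F ω) :
    n2 w Y ≤ (1 + L ^ 2 * π.h i) * n2 w Y' + 3 * L * π.h i * n2 w Y + π.h i * n2 w F := by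
  have hh := (π.h_pos hi).le
  have hhL : 0 ≤ π.h i * L := by positivity
  have k := n2_le_add₄ hw.nonneg (F := Y) (A := fun ω => |condE π Q ξ₀ i Y' ω|
      + L * ‖condE π Q ξ₀ i (fun ω => Y' ω • dW π Q ξ₀ i ω) ω‖)
    (B := fun ω => π.h i * L * |Y ω|) (C := fun _ => π.h i * L * n2 (prob π Q ξ₀) Y)
    (G := fun ω => π.h i * F ω) fun ω => (h.abs_le h0 hL hi hX ω).trans
      (add_le_add le_rfl (mul_le_mul_of_nonneg_left (hF ω) hh))
  rw [n2_const_mul _ hhL, n2_const_mul _ hh, n2_abs] at k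
  have k2 := n2_bessel_le (L := L) hi hh hw Y'
  have k3 := hw.n2_mul_n2_le hhL Y
  linarith

/-- The constant of the local error. -/
noncomputable def locC (d : ℕ) (L α : ℝ) : ℝ := EulerStep.itoC d L α + 7 * L ^ 8

lemma locC_nonneg (hL : 0 ≤ L) : 0 ≤ locC d L α := by
  have : 0 ≤ (L ^ 2) ^ α := Real.rpow_nonneg (by positivity) _
  unfold locC EulerStep.itoC
  positivity

/-- The error of the backward component over one step. -/
lemma IsBackStep.n2_error_le {Yd : Sample π Q ξ₀ → ℝ} (h : IsBackStep c i X Y' Y Z)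
    (hX' : IsStep c i X (drift c X Yd) X') (hQ : ∀ a, ‖Q.w a‖ ≤ L) (hL : 1 ≤ L) (hR : 1 ≤ R)
    (h0 : H0 L c) (h1 : H1 L α T c U D) (hT : 0 < T) (hα : 0 ≤ α) (hi : i < π.n)
    (hh1 : π.h i ≤ 1) (hX : Adapted i X) (hYd : Adapted i Yd) (hw : Wt i w) :
    n2 w (fun ω => Y ω - field U (π.t i) X ω)
      ≤ (1 + L ^ 2 * π.h i) * n2 w (fun ω => Y' ω - field U (π.t (i + 1)) X' ω)
        + 3 * L * π.h i * n2 w (fun ω => Y ω - field U (π.t i) X ω)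
        + π.h i * (7 * L ^ 2 * n2 w (fun ω => Yd ω - field U (π.t i) X ω)
          + locC d L α * √(π.h i)
            * n2 w (EulerStep.H R (treeStep X (drift c X Yd)) α)) := by
  have hL0 : 0 ≤ L := by linarith
  have hh := π.h_pos hi
  set u := field U (π.t i) X with hu
  set u' := field U (π.t (i + 1)) X' with hu'
  set b := drift c X Yd with hb
  have hba : Adapted i b := hX.drift hYd
  set Hh := EulerStep.H R (treeStep X b) α with hH
  set γ : Sample π Q ξ₀ → ℝ := fun ω => Yd ω - u ω with hγ
  set Δ : Sample π Q ξ₀ → ℝ := fun ω => Y ω - u ω with hΔ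
  set δ : Sample π Q ξ₀ → ℝ := fun ω => Y' ω - u' ω with hδ
  have hG : ∀ ω, 0 ≤ (treeStep X b).G R ω := EulerStep.G_nonneg hR
  have hGH : ∀ ω, (treeStep X b).G R ω ≤ Hh ω := fun ω => by
    have h2 : 0 ≤ n2 (treeStep X b).p ((treeStep X b).G R) := n2_nonneg
    have h3 : 0 ≤ ∑ ω, (treeStep X b).p ω * (treeStep X b).G R ω ^ α :=
      Finset.sum_nonneg fun ω _ => mul_nonneg ((treeStep X b).hp.nonneg ω)
        (Real.rpow_nonneg (hG ω) _)
    rw [hH, EulerStep.H]; linarith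
  -- The forward step is driven by `Yd`, not by the decoupling field; the gap `γ` enters the
  -- expansion through the drift, with a factor h.
  have hg : ∀ ω, ‖b ω - drift c X u ω‖ ≤ L * (|γ ω| + n2 (prob π Q ξ₀) γ) := fun ω => by
    have := norm_drift_sub_le h0 X X Yd u ω
    simp only [sub_self, norm_zero] at this
    rwa [n2_const_prob (fprob_prob π Q ξ₀).sum 0 le_rfl, zero_add, zero_add] at this
  have hg2 : n2 (prob π Q ξ₀) (fun ω => ‖b ω - drift c X u ω‖) ≤ L * (2 * n2 (prob π Q ξ₀) γ) := by
    have := n2_mono (p := prob π Q ξ₀) (V := fun ω => ‖b ω - drift c X u ω‖)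
      (W := fun ω => L * (|γ ω| + n2 (prob π Q ξ₀) γ)) (fprob_prob π Q ξ₀).nonneg
      fun ω => by rw [abs_norm]; exact hg ω
    rw [n2_const_mul L hL0] at this
    have h2 := n2_add_le (p := prob π Q ξ₀) (V := fun ω => |γ ω|)
      (W := fun _ => n2 (prob π Q ξ₀) γ) (fprob_prob π Q ξ₀).nonneg
    rw [n2_abs, n2_const_prob (fprob_prob π Q ξ₀).sum _ n2_nonneg] at h2
    have := mul_le_mul_of_nonneg_left h2 hL0
    linarith
  have pt : ∀ ω, |Δ ω| ≤ (|condE π Q ξ₀ i δ ω|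
        + L * ‖condE π Q ξ₀ i (fun ω => δ ω • dW π Q ξ₀ i ω) ω‖)
      + π.h i * L * (|Δ ω| + n2 (prob π Q ξ₀) Δ)
      + π.h i * L ^ 2 * (|γ ω| + 3 * n2 (prob π Q ξ₀) γ)
      + π.h i * (locC d L α * √(π.h i)) * Hh ω := by
    intro ω
    have e := h.eq hX ω
    have x1 := hX'.expansion (R := R) hQ hL hR h0 h1 hT hi hh1 hX hba hα ω
    have x2 := hX'.Z_expansion (R := R) hQ hL hR h0 h1 hT hi hh1 hX hba ω
    rw [← hu, ← hu'] at x1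
    rw [← hu'] at x2
    set z := fieldZ c D (π.t i) X ω with hz
    set f₀ := c.f (X ω) (u ω) z (law π Q ξ₀ fun ω' => pair (X ω') (u ω')) with hf₀
    have hf := abs_f_sub_le h0 hL0 X Y u (X ω) (Y ω) (u ω) (Z ω) z
    -- The error on Z splits into the weighted propagated error, left to Bessel's inequality, and
    -- the consistency error of the weight.
    have ez : Z ω - z = condE π Q ξ₀ i (fun ω => (δ ω / π.h i) • dW π Q ξ₀ i ω) ω
        + (condE π Q ξ₀ i (fun ω => (u' ω / π.h i) • dW π Q ξ₀ i ω) ω - z) := by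
      rw [← add_sub_assoc]
      congr 1
      have : (fun ω => (Y' ω / π.h i) • dW π Q ξ₀ i ω) = fun ω =>
          (δ ω / π.h i) • dW π Q ξ₀ i ω + (u' ω / π.h i) • dW π Q ξ₀ i ω := by
        funext ω; rw [← add_smul, hδ]; congr 1; ring
      rw [h.Z_eq, this, condE_add]
    have hzb : π.h i * ‖Z ω - z‖ ≤ ‖condE π Q ξ₀ i (fun ω => δ ω • dW π Q ξ₀ i ω) ω‖
        + π.h i * (7 * L ^ 7 * √(π.h i) * Hh ω) := by
      rw [← h_mul_norm_condE_div hh, ez, ← mul_add]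
      refine mul_le_mul_of_nonneg_left ((norm_add_le _ _).trans (add_le_add le_rfl
        (x2.trans (mul_le_mul_of_nonneg_left (hGH ω) (by positivity))))) hh.le
    have eδ : condE π Q ξ₀ i δ ω = condE π Q ξ₀ i Y' ω - condE π Q ξ₀ i u' ω := by
      rw [hδ, condE_sub]
    -- Exact decomposition into propagated error, consistency error and difference of the drivers.
    have eΔ : Δ ω = condE π Q ξ₀ i δ ω + (condE π Q ξ₀ i u' ω - u ω + π.h i * f₀)
        + π.h i * (c.f (X ω) (Y ω) (Z ω) (law π Q ξ₀ fun ω' => pair (X ω') (Y ω')) - f₀) := by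
      rw [eδ]
      simp only [hΔ]
      linarith
    have a1 := abs_add_le (condE π Q ξ₀ i δ ω + (condE π Q ξ₀ i u' ω - u ω + π.h i * f₀))
      (π.h i * (c.f (X ω) (Y ω) (Z ω) (law π Q ξ₀ fun ω' => pair (X ω') (Y ω')) - f₀))
    have a2 := abs_add_le (condE π Q ξ₀ i δ ω) (condE π Q ξ₀ i u' ω - u ω + π.h i * f₀)
    rw [← eΔ, abs_mul, abs_of_pos hh] at a1
    have a3 := mul_le_mul_of_nonneg_left hf hh.le
    have a4 := mul_le_mul_of_nonneg_left hzb hL0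
    have a5 := mul_le_mul_of_nonneg_left (hg ω) hL0
    have a6 := mul_le_mul_of_nonneg_left hg2 hL0
    have a7 := mul_le_mul_of_nonneg_left (add_le_add a5 a6) hh.le
    have ec : locC d L α = EulerStep.itoC d L α + 7 * L ^ 8 := rfl
    rw [ec]
    have eh : EulerStep.H R (treeStep X b) α ω = Hh ω := rfl
    rw [eh] at x1
    linarith
  have k := n2_le_add₄ hw.nonneg pt
  have hhL : 0 ≤ π.h i * L := by positivity
  have hhL2 : 0 ≤ π.h i * L ^ 2 := by positivity
  have hc : 0 ≤ π.h i * (locC d L α * √(π.h i)) :=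
    mul_nonneg hh.le (mul_nonneg (locC_nonneg hL0) (Real.sqrt_nonneg _))
  rw [n2_const_mul _ hhL, n2_const_mul _ hhL2, n2_const_mul _ hc] at k
  have k2 := n2_bessel_le (L := L) hi hh.le hw δ
  have k3 := n2_add_le (p := w) (V := fun ω => |Δ ω|) (W := fun _ => n2 (prob π Q ξ₀) Δ) hw.nonneg
  have k4 := n2_add_le (p := w) (V := fun ω => |γ ω|) (W := fun _ => 3 * n2 (prob π Q ξ₀) γ)
    hw.nonneg
  rw [n2_abs] at k3 k4
  have k5 := hw.n2_n2_le Δ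
  have k6 := hw.n2_mul_n2_le (by norm_num : (0 : ℝ) ≤ 3) γ
  have k7 := mul_le_mul_of_nonneg_left (k3.trans (add_le_add le_rfl k5)) hhL
  have k8 := mul_le_mul_of_nonneg_left (k4.trans (add_le_add le_rfl k6)) hhL2
  linarith

end step

end MKV

namespace MKV

lemma n2_le_add_abs {Θ : Type} [Fintype Θ] {p : Θ → ℝ} (hp : ∀ θ, 0 ≤ p θ) {F V W : Θ → ℝ}
    (h : ∀ θ, |F θ| ≤ |V θ| + |W θ|) : n2 p F ≤ n2 p V + n2 p W := by
  have := n2_le_add hp (V := fun θ => |V θ|) (W := fun θ => |W θ|) h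
  rwa [n2_abs, n2_abs] at this

/-! ### The Picard iterations on one period -/

section period
variable {d : ℕ} {T : ℝ} {N : ℕ} {Λ α L R : ℝ} {π : Grid T N} {Q : Quantization d Λ}
  {ξ₀ : InitialLaw d} {c : Coeffs d} {U : ℝ → E d → Measure (E d) → ℝ} {D : Derivs d}

/-- The standing assumptions, with a constant `L` which dominates `Λ` and a constant `R` which
dominates the data at the origin. -/
structure Standing (L α R T : ℝ) (c : Coeffs d) (U : ℝ → E d → Measure (E d) → ℝ) (D : Derivs d)
    (Q : Quantization d Λ) : Prop where
  one_le_L : 1 ≤ L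
  one_le_α : 1 ≤ α
  T_pos : 0 < T
  noise : ∀ a, ‖Q.w a‖ ≤ L
  h0 : H0 L c
  h1 : H1 L α T c U D
  hR : BigR R T c U

/-- The processes generated by `J` Picard iterations on the period `[r_k, r_{k+1}]`, started from
the random variable `ξ`. -/
structure IsPeriod (c : Coeffs d) (J k : ℕ) (ξ : Sample π Q ξ₀ → E d)
    (X : ℕ → ℕ → Sample π Q ξ₀ → E d) (Y : ℕ → ℕ → Sample π Q ξ₀ → ℝ) : Prop where
  lt : k < N
  first : ∀ j ≤ J, X j (π.j k) = ξ
  adapted_X : ∀ j ≤ J, ∀ i, π.j k ≤ i → i ≤ π.j (k + 1) → Adapted i (X j i)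
  adapted_Y : ∀ j ≤ J, ∀ i, π.j k ≤ i → i < π.j (k + 1) → Adapted i (Y j i)
  step : ∀ j ≤ J, ∀ i, π.j k ≤ i → i < π.j (k + 1) →
    IsStep c i (X j i) (drift c (X j i) (Y j i)) (X j (i + 1))
  back : ∀ j < J, ∀ i, π.j k ≤ i → i < π.j (k + 1) →
    ∃ Z, IsBackStep c i (X j i) (Y (j + 1) (i + 1)) (Y (j + 1) i) Z
  zero : ∀ i, π.j k ≤ i → i ≤ π.j (k + 1) → Y 0 i = 0

lemma IsLocalOutput.isStep {k : ℕ} {X' X Z : ℕ → Sample π Q ξ₀ → E d} {η : Sample π Q ξ₀ → ℝ}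
    {f : E d → ℝ → E d → Measure (EY d) → ℝ} {Y : ℕ → Sample π Q ξ₀ → ℝ}
    (h : IsLocalOutput π Q ξ₀ c k X' η f X Y Z) {i : ℕ} (hi : π.j k ≤ i) (hi' : i < π.j (k + 1)) :
    IsStep c i (X i) (drift c (X i) (Y i)) (X (i + 1)) := h.X_step i hi hi'

lemma IsLocalOutput.adapted_Y {k : ℕ} {X' X Z : ℕ → Sample π Q ξ₀ → E d} {η : Sample π Q ξ₀ → ℝ}
    {f : E d → ℝ → E d → Measure (EY d) → ℝ} {Y : ℕ → Sample π Q ξ₀ → ℝ}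
    (h : IsLocalOutput π Q ξ₀ c k X' η f X Y Z) {i : ℕ} (hi : π.j k ≤ i) (hi' : i < π.j (k + 1)) :
    Adapted i (Y i) := by
  rw [h.Y_step i hi hi']; exact adapted_condE _ _

lemma IsLocalOutput.adapted_X {k : ℕ} {X' X Z : ℕ → Sample π Q ξ₀ → E d} {η : Sample π Q ξ₀ → ℝ}
    {f : E d → ℝ → E d → Measure (EY d) → ℝ} {Y : ℕ → Sample π Q ξ₀ → ℝ}
    (h : IsLocalOutput π Q ξ₀ c k X' η f X Y Z) (hξ : Adapted (π.j k) (X (π.j k))) {i : ℕ}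
    (hi : π.j k ≤ i) : i ≤ π.j (k + 1) → Adapted i (X i) := by
  induction i, hi using Nat.le_induction with
  | base => exact fun _ => hξ
  | succ i hi ih =>
    intro hi'
    exact (h.isStep hi hi').adapted (ih (by omega)) ((ih (by omega)).drift (h.adapted_Y hi hi'))

lemma isPeriod_of_localOutput {J k : ℕ} (hk : k < N) {ξ : Sample π Q ξ₀ → E d}
    (hξ : Adapted (π.j k) ξ)
    {X Z : ℕ → ℕ → Sample π Q ξ₀ → E d} {Y : ℕ → ℕ → Sample π Q ξ₀ → ℝ}
    (init : IsLocalOutput π Q ξ₀ c k (fun _ => ξ) 0 (fun _ _ _ _ => 0) (X 0) (Y 0) (Z 0))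
    (picard : ∀ i < J, IsLocalOutput π Q ξ₀ c k (X i) (Y (i + 1) (π.j (k + 1))) c.f
        (X (i + 1)) (Y (i + 1)) (Z (i + 1))) : IsPeriod c J k ξ X Y := by
  have first : ∀ j ≤ J, X j (π.j k) = ξ := by
    intro j
    induction j with
    | zero => exact fun _ => init.X_first
    | succ j ih => exact fun hj => (picard j hj).X_first.trans (ih (by omega))
  have out : ∀ j ≤ J, ∃ X' η f, IsLocalOutput π Q ξ₀ c k X' η f (X j) (Y j) (Z j) := by
    rintro (_ | j) hj
    exacts [⟨_, _, _, init⟩, ⟨_, _, _, picard j hj⟩]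
  refine ⟨hk, first, fun j hj i hi hi' => ?_, fun j hj i hi hi' => ?_, fun j hj i hi hi' => ?_,
    fun j hj i hi hi' => ⟨Z (j + 1) i, (picard j hj).Y_step i hi hi',
      (picard j hj).Z_step i hi hi'⟩, fun i hi hi' => ?_⟩
  · obtain ⟨_, _, _, h⟩ := out j hj
    exact h.adapted_X (by rwa [first j hj]) hi hi'
  · obtain ⟨_, _, _, h⟩ := out j hj
    exact h.adapted_Y hi hi'
  · obtain ⟨_, _, _, h⟩ := out j hj
    exact h.isStep hi hi'
  -- With zero terminal value and zero driver the first backward component vanishes on the period.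
  · induction hm : π.j (k + 1) - i generalizing i with
    | zero =>
      have : i = π.j (k + 1) := by omega
      rw [this, init.Y_last]
    | succ m ih =>
      rw [init.Y_step i hi (by omega), ih (i + 1) (by omega) (by omega) (by omega)]
      simp only [Pi.zero_apply, mul_zero, add_zero]
      exact condE_const i 0

/-- The constant of the Picard iterations. -/
noncomputable def picC (L : ℝ) : ℝ := 200 * L ^ 4

variable {J k : ℕ} {ξ : Sample π Q ξ₀ → E d} {X : ℕ → ℕ → Sample π Q ξ₀ → E d}
  {Y : ℕ → ℕ → Sample π Q ξ₀ → ℝ} {w : Sample π Q ξ₀ → ℝ}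

lemma IsPeriod.lt_n (hP : IsPeriod c J k ξ X Y) {i : ℕ} (hi : i < π.j (k + 1)) : i < π.n :=
  hi.trans_le (π.j_le (k + 1) hP.lt)

lemma IsPeriod.exp_le (hP : IsPeriod c J k ξ X Y) {K : ℝ} (hK : 0 ≤ K) (hKδ : K * (T / N) ≤ 1)
    {i l : ℕ} (hi : π.j k ≤ i) (hil : i ≤ l) (hl : l ≤ π.j (k + 1)) :
    Real.exp (K * (π.t l - π.t i)) ≤ 1 + 2 * (K * (T / N)) := by
  have h1 := mul_le_mul_of_nonneg_left (π.t_sub_le hP.lt hi hil hl) hK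
  have h2 := π.t_mono hil (hl.trans (π.j_le (k + 1) hP.lt))
  exact (exp_le_one_add_two_mul (mul_nonneg hK (by linarith)) (h1.trans hKδ)).trans (by linarith)

/-- Error of the backward component of one Picard iteration. -/
lemma IsPeriod.n2_back_error_le (hS : Standing L α R T c U D Q) (hP : IsPeriod c J k ξ X Y)
    (hδ : picC L * (T / N) ≤ 1) (hw : Wt (π.j k) w) {j : ℕ} (hj : j < J) {e γ ℓ : ℝ}
    (he : n2 w (fun ω => Y (j + 1) (π.j (k + 1)) ω
      - field U (π.t (π.j (k + 1))) (X j (π.j (k + 1))) ω) ≤ e)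
    (hγ : ∀ i, π.j k ≤ i → i < π.j (k + 1) →
      n2 w (fun ω => Y j i ω - field U (π.t i) (X j i) ω) ≤ γ)
    (hℓ : ∀ i, π.j k ≤ i → i < π.j (k + 1) →
      n2 w (EulerStep.H R (treeStep (X j i) (drift c (X j i) (Y j i))) α) ≤ ℓ)
    {i : ℕ} (hi : π.j k ≤ i) (hi' : i ≤ π.j (k + 1)) :
    n2 w (fun ω => Y (j + 1) i ω - field U (π.t i) (X j i) ω)
      ≤ (1 + 24 * L ^ 2 * (T / N)) * e + (T / N) * (42 * L ^ 2 * γ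
        + 6 * locC d L α * √π.mesh * ℓ) := by
  have hL := hS.one_le_L
  have hL0 : 0 ≤ L := by linarith
  have hδ0 : 0 ≤ T / N := div_nonneg hS.T_pos.le (Nat.cast_nonneg N)
  have hL24 : L ^ 2 ≤ L ^ 4 := pow_le_pow_right₀ hL (by norm_num)
  have hL1 : 1 ≤ L ^ 4 := one_le_pow₀ hL
  have hLL2 : L ≤ L ^ 2 := le_self_pow₀ hL (by norm_num)
  rw [picC] at hδ
  have hm1 : L ^ 2 * (T / N) ≤ L ^ 4 * (T / N) := mul_le_mul_of_nonneg_right hL24 hδ0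
  have hm2 : T / N ≤ L ^ 4 * (T / N) := by nlinarith
  have hlt := π.j_lt hS.T_pos hP.lt
  have hγ0 : 0 ≤ γ := n2_nonneg.trans (hγ _ le_rfl hlt)
  have hℓ0 : 0 ≤ ℓ := n2_nonneg.trans (hℓ _ le_rfl hlt)
  have hc0 := locC_nonneg (d := d) (α := α) hL0
  set s := 7 * L ^ 2 * γ + locC d L α * √π.mesh * ℓ with hs
  have hs0 : 0 ≤ s := by positivity
  set a : ℕ → ℝ := fun i => n2 w fun ω => Y (j + 1) i ω - field U (π.t i) (X j i) ω with ha
  have hstep : ∀ i, π.j k ≤ i → i < π.j (k + 1) →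
      a i ≤ (1 + 12 * L ^ 2 * (π.t (i + 1) - π.t i)) * a (i + 1)
        + (π.t (i + 1) - π.t i) * (2 * s) := by
    intro i hi hi'
    have hin := hP.lt_n hi'
    have hh := π.h_pos hin
    have hhδ := π.h_le hP.lt hi hi'
    obtain ⟨Z, hb⟩ := hP.back j hj i hi hi'
    have key := hb.n2_error_le (hP.step j hj.le i hi hi') hS.noise hL hS.hR.one_le hS.h0 hS.h1
      hS.T_pos (zero_le_one.trans hS.one_le_α) hin (by linarith) (hP.adapted_X j hj.le i hi hi'.le)
      (hP.adapted_Y j hj.le i hi hi') (hw.mono hi)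
    have k1 := hγ i hi hi'
    have k2 := hℓ i hi hi'
    set x := a i
    set y := a (i + 1)
    have hx0 : 0 ≤ x := n2_nonneg
    have hy0 : 0 ≤ y := n2_nonneg
    have k3 : locC d L α * √(π.h i) * n2 w (EulerStep.H R (treeStep (X j i)
        (drift c (X j i) (Y j i))) α) ≤ locC d L α * √π.mesh * ℓ := by
      have := n2_nonneg (p := w) (V := EulerStep.H R (treeStep (X j i)
        (drift c (X j i) (Y j i))) α)
      gcongr
      exact π.h_le_mesh hin
    have k4 : 7 * L ^ 2 * n2 w (fun ω => Y j i ω - field U (π.t i) (X j i) ω)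
        ≤ 7 * L ^ 2 * γ := mul_le_mul_of_nonneg_left k1 (by positivity)
    have k5 := mul_le_mul_of_nonneg_left (add_le_add k4 k3) hh.le
    have hq : 3 * L ^ 2 * π.h i ≤ 1 / 2 := by
      have : L ^ 2 * π.h i ≤ L ^ 2 * (T / N) := mul_le_mul_of_nonneg_left hhδ (by positivity)
      linarith
    have := implicit_step (x := x) (y := y) (K := 3 * L ^ 2) (h := π.h i) (s := s) (by positivity)
      hh.le hq hs0 hy0 (key.trans (by
        have t1 : L ^ 2 * π.h i * y ≤ 3 * L ^ 2 * π.h i * y := by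
          have : 0 ≤ L ^ 2 * π.h i * y := by positivity
          linarith
        have t2 : 3 * L * π.h i * x ≤ 3 * L ^ 2 * π.h i * x := by
          have : L * (π.h i * x) ≤ L ^ 2 * (π.h i * x) :=
            mul_le_mul_of_nonneg_right hLL2 (by positivity)
          linarith
        linarith))
    calc _ ≤ _ := this
      _ = _ := by rw [Grid.h]; ring
  have g := (gronwall_backward (t := π.t) (a := a) (K := 12 * L ^ 2) (s := 2 * s) (by positivity)
    (by positivity) (fun i _ hi' => (π.t_lt i (hP.lt_n hi')).le) n2_nonneg hstep i hi hi').2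
  have hx := hP.exp_le (K := 12 * L ^ 2) (by positivity) (by linarith) hi hi' le_rfl
  have hd := π.t_sub_le hP.lt hi hi' le_rfl
  have hd0 := π.t_mono hi' (π.j_le (k + 1) hP.lt)
  have he0 : 0 ≤ e := n2_nonneg.trans he
  calc n2 w (fun ω => Y (j + 1) i ω - field U (π.t i) (X j i) ω) ≤ _ := g
    _ ≤ (1 + 2 * (12 * L ^ 2 * (T / N))) * (e + (T / N) * (2 * s)) := by
      have : 0 ≤ a (π.j (k + 1)) := n2_nonneg
      have : 0 ≤ (π.t (π.j (k + 1)) - π.t i) * (2 * s) :=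
        mul_nonneg (by linarith) (by linarith)
      gcongr
    _ ≤ (1 + 24 * L ^ 2 * (T / N)) * e + (T / N) * (6 * s) := by
      have : (24 * (L ^ 2 * (T / N))) * ((T / N) * s) ≤ 2 * ((T / N) * s) :=
        mul_le_mul_of_nonneg_right (by linarith) (by positivity)
      linarith
    _ = _ := by rw [hs]; ring

/-- Distance between two successive Picard iterates. -/
lemma IsPeriod.n2_sub_le (hS : Standing L α R T c U D Q) (hP : IsPeriod c J k ξ X Y)
    (hδ : picC L * (T / N) ≤ 1) (hw : Wt (π.j k) w) {j : ℕ} (hj : j < J) {y : ℝ}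
    (hy : ∀ i, π.j k ≤ i → i < π.j (k + 1) → n2 w (fun ω => Y (j + 1) i ω - Y j i ω) ≤ y)
    {i : ℕ} (hi : π.j k ≤ i) (hi' : i ≤ π.j (k + 1)) :
    n2 w (fun ω => ‖X (j + 1) i ω - X j i ω‖) ≤ (T / N) * (9 * L * y) := by
  have hL := hS.one_le_L
  have hL0 : 0 ≤ L := by linarith
  have hδ0 : 0 ≤ T / N := div_nonneg hS.T_pos.le (Nat.cast_nonneg N)
  have hlt := π.j_lt hS.T_pos hP.lt
  have hy0 : 0 ≤ y := n2_nonneg.trans (hy _ le_rfl hlt)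
  rw [picC] at hδ
  set a : ℕ → ℝ := fun i => n2 w fun ω => ‖X (j + 1) i ω - X j i ω‖ with ha
  -- All forward iterates start from the same ξ, so their distance comes from the drifts alone and
  -- is of order δ.
  have ha0 : a (π.j k) = 0 := by
    simp only [ha, hP.first (j + 1) hj, hP.first j hj.le, sub_self, norm_zero]
    simp [n2]
  have hstep : ∀ i, π.j k ≤ i → i < π.j (k + 1) →
      a (i + 1) ≤ (1 + 12 * L ^ 4 * (π.t (i + 1) - π.t i)) * a i
        + (π.t (i + 1) - π.t i) * (3 * L * y) := by
    intro i hi hi'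
    have hin := hP.lt_n hi'
    have hh := (π.h_pos hin).le
    refine ((hP.step (j + 1) hj i hi hi').n2_sub_le (hP.step j hj.le i hi hi') hS.noise hL hS.h0
      hin (hP.adapted_X (j + 1) hj i hi hi'.le) (hP.adapted_Y (j + 1) hj i hi hi')
      (hP.adapted_X j hj.le i hi hi'.le) (hP.adapted_Y j hj.le i hi hi') (hw.mono hi)).trans ?_
    have := hy i hi hi'
    change _ ≤ (1 + 12 * L ^ 4 * π.h i) * a i + π.h i * (3 * L * y)
    gcongr
  have g := (gronwall_forward (t := π.t) (a := a) (K := 12 * L ^ 4) (s := 3 * L * y) (by positivity)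
    (by positivity) (fun i _ hi' => (π.t_lt i (hP.lt_n hi')).le) n2_nonneg hstep i hi hi').2
  have hx := hP.exp_le (K := 12 * L ^ 4) (by positivity) (by linarith) le_rfl hi hi'
  have hd := π.t_sub_le hP.lt le_rfl hi hi'
  have hd0 := π.t_mono hi (hi'.trans (π.j_le (k + 1) hP.lt))
  rw [ha0, zero_add] at g
  calc n2 w (fun ω => ‖X (j + 1) i ω - X j i ω‖) ≤ _ := g
    _ ≤ 3 * ((T / N) * (3 * L * y)) := by
      gcongr
      linarith
    _ = _ := by ring

/-- Convergence of the Picard iterations on one period. -/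
lemma IsPeriod.picard_error_le (hS : Standing L α R T c U D Q) (hP : IsPeriod c J k ξ X Y)
    (hδ : picC L * (T / N) ≤ 1 / 4) (hw : Wt (π.j k) w) {e G₀ ℓ : ℝ} (he0 : 0 ≤ e)
    (he : ∀ j < J, n2 w (fun ω => Y (j + 1) (π.j (k + 1)) ω
      - field U (π.t (π.j (k + 1))) (X j (π.j (k + 1))) ω) ≤ e)
    (hG : ∀ i, π.j k ≤ i → i < π.j (k + 1) → n2 w (field U (π.t i) (X 0 i)) ≤ G₀)
    (hℓ0 : 0 ≤ ℓ)
    (hℓ : ∀ j < J, ∀ i, π.j k ≤ i → i < π.j (k + 1) →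
      n2 w (EulerStep.H R (treeStep (X j i) (drift c (X j i) (Y j i))) α) ≤ ℓ)
    {j : ℕ} (hj : j < J) :
    n2 w (fun ω => Y (j + 1) (π.j k) ω - field U (π.t (π.j k)) ξ ω)
      ≤ (1 + 4 * (picC L * (T / N))) * e + 24 * locC d L α * ((T / N) * (√π.mesh * ℓ))
        + (picC L * (T / N)) ^ (j + 1) * G₀ := by
  have hL := hS.one_le_L
  have hL0 : 0 ≤ L := by linarith
  have hδ0 : 0 ≤ T / N := div_nonneg hS.T_pos.le (Nat.cast_nonneg N)
  have hL24 : L ^ 2 ≤ L ^ 4 := pow_le_pow_right₀ hL (by norm_num)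
  have hlt := π.j_lt hS.T_pos hP.lt
  have hG0 : 0 ≤ G₀ := n2_nonneg.trans (hG _ le_rfl hlt)
  have hc0 := locC_nonneg (d := d) (α := α) hL0
  set q := picC L * (T / N) with hq
  have hqL : 200 * (L ^ 2 * (T / N)) ≤ q := by
    have := mul_le_mul_of_nonneg_right hL24 hδ0
    rw [hq, picC]; linarith
  have hLδ : 0 ≤ L ^ 2 * (T / N) := by positivity
  have hq0 : 0 ≤ q := by linarith
  set m := locC d L α * ((T / N) * (√π.mesh * ℓ)) with hm
  have hm0 : 0 ≤ m := by positivity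
  set x := L ^ 2 * (T / N) with hx
  -- Ansatz for the gap between the `j`-th backward iterate and U along the `j`-th forward iterate:
  -- a part which the recursion preserves since q ≤ 1/4, and a part contracted by q. `G₀` is the gap
  -- of the zero guess.
  set γ : ℕ → ℝ := fun j => (1 + 4 * q) * e + 24 * m + q ^ j * G₀ with hγd
  have hγ0 : ∀ j, 0 ≤ γ j := fun j => by positivity
  -- Passage from the error along the `j`-th forward iterate to the error along the next one; 27 is
  -- the product of 3, from the Lipschitz bound 3L of the field, and 9, from the distance bound of
  -- `IsPeriod.n2_sub_le`.
  have rec1 : ∀ j, (1 + 27 * x) * ((1 + 24 * x) * e + 42 * x * γ j + 6 * m) + 27 * x * γ j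
      ≤ γ (j + 1) := by
    intro j
    have h1 : (1 + 27 * x) * ((1 + 24 * x) * e + 42 * x * γ j + 6 * m) + 27 * x * γ j
        ≤ (1 + q) * e + q * γ j + 12 * m := by
      have a1 : (1 + 27 * x) * (1 + 24 * x) ≤ 1 + q := by nlinarith
      have a2 : (1 + 27 * x) * (42 * x) + 27 * x ≤ q := by nlinarith
      have a3 : (1 + 27 * x) * 6 ≤ 12 := by linarith
      have := mul_le_mul_of_nonneg_right a1 he0
      have := mul_le_mul_of_nonneg_right a2 (hγ0 j)
      have := mul_le_mul_of_nonneg_right a3 hm0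
      linarith
    refine h1.trans ?_
    have e1 : q * γ j = q * (1 + 4 * q) * e + 24 * q * m + q ^ (j + 1) * G₀ := by
      simp only [hγd]; ring
    rw [e1]
    have a1 : (1 + q) + q * (1 + 4 * q) ≤ 1 + 4 * q := by nlinarith
    have := mul_le_mul_of_nonneg_right a1 he0
    have a2 : 24 * q * m ≤ 12 * m := mul_le_mul_of_nonneg_right (by linarith) hm0
    simp only [hγd]
    linarith
  have base : ∀ j < J, (∀ i, π.j k ≤ i → i < π.j (k + 1) →
      n2 w (fun ω => Y j i ω - field U (π.t i) (X j i) ω) ≤ γ j) →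
      ∀ i, π.j k ≤ i → i ≤ π.j (k + 1) →
        n2 w (fun ω => Y (j + 1) i ω - field U (π.t i) (X j i) ω)
          ≤ (1 + 24 * x) * e + 42 * x * γ j + 6 * m := by
    intro j hj h i hi hi'
    refine (hP.n2_back_error_le hS (by linarith) hw hj (he j hj) h (hℓ j hj) hi hi').trans
      (le_of_eq ?_)
    rw [hm, hx]; ring
  have ind : ∀ j ≤ J, ∀ i, π.j k ≤ i → i < π.j (k + 1) →
      n2 w (fun ω => Y j i ω - field U (π.t i) (X j i) ω) ≤ γ j := by
    intro j
    induction j with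
    | zero =>
      intro _ i hi hi'
      have h1 := hG i hi hi'
      have h2 : n2 w (fun ω => Y 0 i ω - field U (π.t i) (X 0 i) ω)
          = n2 w (field U (π.t i) (X 0 i)) := by
        rw [← n2_abs, ← n2_abs (V := field U (π.t i) (X 0 i))]
        simp only [hP.zero i hi hi'.le, Pi.zero_apply, zero_sub, abs_neg]
      simp only [hγd, pow_zero, one_mul]
      have : 0 ≤ (1 + 4 * q) * e := by positivity
      linarith
    | succ j ih =>
      intro hj i hi hi'
      have hγj := ih (by omega)
      have hB := base j hj hγj
      set B := (1 + 24 * x) * e + 42 * x * γ j + 6 * m with hBd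
      have hD := hP.n2_sub_le hS (by linarith) hw hj (y := B + γ j) (fun i hi hi' => by
        refine (n2_le_add_abs hw.nonneg (V := fun ω => Y (j + 1) i ω - field U (π.t i) (X j i) ω)
          (W := fun ω => Y j i ω - field U (π.t i) (X j i) ω) fun ω => ?_).trans
          (add_le_add (hB i hi hi'.le) (hγj i hi hi'))
        refine (le_of_eq ?_).trans (abs_sub _ _)
        congr 1
        ring) hi hi'.le
      have hF := n2_field_sub_le hS.h1 hL0 ⟨π.t_nonneg (hP.lt_n hi').le, π.t_le (hP.lt_n hi').le⟩ hw
        (X (j + 1) i) (X j i)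
      have hE : n2 w (fun ω => Y (j + 1) i ω - field U (π.t i) (X (j + 1) i) ω)
          ≤ B + 3 * L * ((T / N) * (9 * L * (B + γ j))) := by
        refine (n2_le_add_abs hw.nonneg (V := fun ω => Y (j + 1) i ω - field U (π.t i) (X j i) ω)
          (W := fun ω => field U (π.t i) (X (j + 1) i) ω - field U (π.t i) (X j i) ω)
          fun ω => ?_).trans
          (add_le_add (hB i hi hi'.le) (hF.trans (mul_le_mul_of_nonneg_left hD (by positivity))))
        refine (le_of_eq ?_).trans (abs_sub _ _)
        congr 1
        ring
      refine hE.trans ((le_of_eq ?_).trans (rec1 j))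
      rw [hx]; ring
  -- At the left end all forward iterates equal ξ, so no change of forward iterate is needed and the
  -- estimate is already the one at rank j + 1.
  have h1 := base j hj (ind j hj.le) (π.j k) le_rfl hlt.le
  rw [hP.first j hj.le] at h1
  have h2 := rec1 j
  have h3 : 0 ≤ 27 * x * ((1 + 24 * x) * e + 42 * x * γ j + 6 * m) + 27 * x * γ j := by
    have := hγ0 j
    positivity
  have h4 : γ (j + 1) = (1 + 4 * q) * e + 24 * locC d L α * ((T / N) * (√π.mesh * ℓ))
      + q ^ (j + 1) * G₀ := by simp only [hγd, hm]; ring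
  rw [← h4]
  linarith

end period

end MKV

namespace MKV

/-! ### Moments on one period -/

section moments
variable {d : ℕ} {T : ℝ} {N : ℕ} {Λ α L R : ℝ} {π : Grid T N} {Q : Quantization d Λ}
  {ξ₀ : InitialLaw d} {c : Coeffs d} {U : ℝ → E d → Measure (E d) → ℝ} {D : Derivs d}
  {J k : ℕ} {ξ : Sample π Q ξ₀ → E d} {X : ℕ → ℕ → Sample π Q ξ₀ → E d}
  {Y : ℕ → ℕ → Sample π Q ξ₀ → ℝ} {w : Sample π Q ξ₀ → ℝ}

lemma n2_driver_zero_le (h0 : H0 L c) (hL : 1 ≤ L) (hR : BigR R T c U) {i : ℕ} (hw : Wt i w)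
    (X : Sample π Q ξ₀ → E d) :
    n2 w (fun ω => |c.f (X ω) 0 0 (law π Q ξ₀ fun ω' => pair (X ω') 0)|) ≤ 4 * L * vw R w X := by
  have hL0 : 0 ≤ L := by linarith
  have hR0 : 0 ≤ R := by linarith [hR.one_le]
  have e : law π Q ξ₀ (fun _ => pair (0 : E d) 0) = Measure.dirac (pair 0 0) := by
    rw [law_eq_flaw, flaw_const (fprob_prob π Q ξ₀)]
  have hW := W2_pair_le (fprob_prob π Q ξ₀) X (fun _ => 0) (fun _ => 0) (fun _ => 0)
  simp only [sub_zero] at hW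
  rw [n2_const_prob (fprob_prob π Q ξ₀).sum 0 le_rfl, add_zero] at hW
  have h := n2_le_add₃ hw.nonneg
    (F := fun ω => |c.f (X ω) 0 0 (law π Q ξ₀ fun ω' => pair (X ω') 0)|) (A := fun _ => R)
    (B := fun ω => L * ‖X ω‖) (C := fun _ => L * n2 (prob π Q ξ₀) fun ω => ‖X ω‖) fun ω => by
      rw [abs_abs]
      have h1 := h0.lip_f (X ω) 0 0 0 0 0 _ _ (isP2_law (ξ₀ := ξ₀) (Q := Q) (π := π)
        fun ω' => pair (X ω') 0) (isP2_law (ξ₀ := ξ₀) (Q := Q) (π := π) fun _ => pair 0 0)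
      have h2 := hR.f_zero
      rw [← e] at h2
      simp only [sub_zero, norm_zero, abs_zero, add_zero] at h1
      have h3 := abs_add_le (c.f (X ω) 0 0 (law π Q ξ₀ fun ω' => pair (X ω') 0)
        - c.f 0 0 0 (law π Q ξ₀ fun _ => pair 0 0)) (c.f 0 0 0 (law π Q ξ₀ fun _ => pair 0 0))
      rw [sub_add_cancel] at h3
      have h4 : L * (‖X ω‖ + W2 (law π Q ξ₀ fun ω' => pair (X ω') 0)
        (law π Q ξ₀ fun _ => pair 0 0)) ≤ L * (‖X ω‖ + n2 (prob π Q ξ₀) fun ω => ‖X ω‖) :=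
        mul_le_mul_of_nonneg_left (add_le_add le_rfl hW) hL0
      linarith
  rw [n2_const_mul L hL0] at h
  have h2 := hw.n2_mul_n2_le hL0 fun ω => ‖X ω‖
  have h3 := mul_le_mul_of_nonneg_left (n2_norm_le_vw (R := R) (X := X) hw.nonneg) hL0
  have h4 := n2_const_le_vw (X := X) hw.nonneg hR0
  have h5 : vw R w X ≤ L * vw R w X := le_mul_of_one_le_left vw_nonneg hL
  linarith

/-- The size of the backward component of one Picard iteration. -/
lemma IsPeriod.n2_back_le (hS : Standing L α R T c U D Q) (hP : IsPeriod c J k ξ X Y)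
    (hδ : picC L * (T / N) ≤ 1) (hw : Wt (π.j k) w) {j : ℕ} (hj : j < J) {y V : ℝ}
    (hy : n2 w (Y (j + 1) (π.j (k + 1))) ≤ y)
    (hV : ∀ i, π.j k ≤ i → i < π.j (k + 1) → vw R w (X j i) ≤ V)
    {i : ℕ} (hi : π.j k ≤ i) (hi' : i ≤ π.j (k + 1)) : n2 w (Y (j + 1) i) ≤ 3 * y + V := by
  have hL := hS.one_le_L
  have hL0 : 0 ≤ L := by linarith
  have hδ0 : 0 ≤ T / N := div_nonneg hS.T_pos.le (Nat.cast_nonneg N)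
  have hlt := π.j_lt hS.T_pos hP.lt
  have hV0 : 0 ≤ V := vw_nonneg.trans (hV _ le_rfl hlt)
  have hL24 : L ^ 2 ≤ L ^ 4 := pow_le_pow_right₀ hL (by norm_num)
  have hLL2 : L ≤ L ^ 2 := le_self_pow₀ hL (by norm_num)
  have hm1 : L ^ 2 * (T / N) ≤ L ^ 4 * (T / N) := mul_le_mul_of_nonneg_right hL24 hδ0
  have hm2 : L * (T / N) ≤ L ^ 2 * (T / N) := mul_le_mul_of_nonneg_right hLL2 hδ0
  rw [picC] at hδ
  set a : ℕ → ℝ := fun i => n2 w (Y (j + 1) i) with ha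
  have hstep : ∀ i, π.j k ≤ i → i < π.j (k + 1) →
      a i ≤ (1 + 12 * L ^ 2 * (π.t (i + 1) - π.t i)) * a (i + 1)
        + (π.t (i + 1) - π.t i) * (2 * (4 * L * V)) := by
    intro i hi hi'
    have hin := hP.lt_n hi'
    have hh := π.h_pos hin
    have hhδ := π.h_le hP.lt hi hi'
    obtain ⟨Z, hb⟩ := hP.back j hj i hi hi'
    have key := hb.n2_le hS.h0 hL0 hin (hP.adapted_X j hj.le i hi hi'.le) (hw.mono hi)
      (F := fun ω => |c.f (X j i ω) 0 0 (law π Q ξ₀ fun ω' => pair (X j i ω') 0)|) fun ω => le_rfl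
    have k1 := (n2_driver_zero_le hS.h0 hL hS.hR (hw.mono hi) (X j i)).trans
      (mul_le_mul_of_nonneg_left (hV i hi hi') (by positivity))
    set x := a i
    set y := a (i + 1)
    have hx0 : 0 ≤ x := n2_nonneg
    have hy0 : 0 ≤ y := n2_nonneg
    have hq : 3 * L ^ 2 * π.h i ≤ 1 / 2 := by
      have : L ^ 2 * π.h i ≤ L ^ 2 * (T / N) := mul_le_mul_of_nonneg_left hhδ (by positivity)
      linarith
    have := implicit_step (x := x) (y := y) (K := 3 * L ^ 2) (h := π.h i) (s := 4 * L * V)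
      (by positivity) hh.le hq (by positivity) hy0 (key.trans (by
        have t1 : L ^ 2 * π.h i * y ≤ 3 * L ^ 2 * π.h i * y := by
          have : 0 ≤ L ^ 2 * π.h i * y := by positivity
          linarith
        have t2 : 3 * L * π.h i * x ≤ 3 * L ^ 2 * π.h i * x := by
          have : L * (π.h i * x) ≤ L ^ 2 * (π.h i * x) :=
            mul_le_mul_of_nonneg_right hLL2 (by positivity)
          linarith
        have t3 := mul_le_mul_of_nonneg_left k1 hh.le
        linarith))
    calc _ ≤ _ := this
      _ = _ := by rw [Grid.h]; ring
  have g := (gronwall_backward (t := π.t) (a := a) (K := 12 * L ^ 2) (s := 2 * (4 * L * V))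
    (by positivity) (by positivity) (fun i _ hi' => (π.t_lt i (hP.lt_n hi')).le) n2_nonneg hstep
    i hi hi').2
  have hx := hP.exp_le (K := 12 * L ^ 2) (by positivity) (by linarith) hi hi' le_rfl
  have hd := π.t_sub_le hP.lt hi hi' le_rfl
  have hd0 := π.t_mono hi' (π.j_le (k + 1) hP.lt)
  have hy0 : 0 ≤ y := n2_nonneg.trans hy
  calc n2 w (Y (j + 1) i) ≤ _ := g
    _ ≤ 3 * (y + (T / N) * (2 * (4 * L * V))) := by
      have : 0 ≤ a (π.j (k + 1)) := n2_nonneg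
      have : 0 ≤ (π.t (π.j (k + 1)) - π.t i) * (2 * (4 * L * V)) :=
        mul_nonneg (by linarith) (by positivity)
      gcongr
      linarith
    _ ≤ _ := by
      have : (L * (T / N)) * V ≤ (1 / 200) * V := mul_le_mul_of_nonneg_right (by linarith) hV0
      linarith

/-- The growth of the forward component on one period. -/
lemma IsPeriod.vw_sq_le (hS : Standing L α R T c U D Q) (hP : IsPeriod c J k ξ X Y)
    (hδ : picC L * (T / N) ≤ 1) (hw : Wt (π.j k) w) {j : ℕ} (hj : j ≤ J) {y : ℝ}
    (hy : ∀ i, π.j k ≤ i → i < π.j (k + 1) → n2 w (Y j i) ≤ y)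
    {i : ℕ} (hi : π.j k ≤ i) (hi' : i ≤ π.j (k + 1)) :
    vw R w (X j i) ^ 2 ≤ (1 + picC L * (T / N))
      * (vw R w ξ ^ 2 + (T / N) * (100 * L ^ 4 * y ^ 2)) := by
  have hL := hS.one_le_L
  have hL0 : 0 ≤ L := by linarith
  have hδ0 : 0 ≤ T / N := div_nonneg hS.T_pos.le (Nat.cast_nonneg N)
  have hL1 : 1 ≤ L ^ 4 := one_le_pow₀ hL
  have hm2 : T / N ≤ L ^ 4 * (T / N) := by nlinarith
  rw [picC] at hδ
  have hlt := π.j_lt hS.T_pos hP.lt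
  have hy0 : 0 ≤ y := n2_nonneg.trans (hy _ le_rfl hlt)
  set a : ℕ → ℝ := fun i => vw R w (X j i) ^ 2 with ha
  have hstep : ∀ i, π.j k ≤ i → i < π.j (k + 1) →
      a (i + 1) ≤ (1 + 100 * L ^ 4 * (π.t (i + 1) - π.t i)) * a i
        + (π.t (i + 1) - π.t i) * (100 * L ^ 4 * y ^ 2) := by
    intro i hi hi'
    have hin := hP.lt_n hi'
    have hh := (π.h_pos hin).le
    have hhδ := π.h_le hP.lt hi hi'
    refine ((hP.step j hj i hi hi').vw_sq_le_drift hS.noise hL hS.h0 hS.hR hin (by linarith)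
      (hP.adapted_X j hj i hi hi'.le) (hP.adapted_Y j hj i hi hi') (hw.mono hi)).trans ?_
    have := hy i hi hi'
    have := n2_nonneg (p := w) (V := Y j i)
    change _ ≤ (1 + 100 * L ^ 4 * π.h i) * a i + π.h i * (100 * L ^ 4 * y ^ 2)
    gcongr
  have g := (gronwall_forward (t := π.t) (a := a) (K := 100 * L ^ 4) (s := 100 * L ^ 4 * y ^ 2)
    (by positivity) (by positivity) (fun i _ hi' => (π.t_lt i (hP.lt_n hi')).le) (sq_nonneg _)
    hstep i hi hi').2
  have hx := hP.exp_le (K := 100 * L ^ 4) (by positivity) (by linarith) le_rfl hi hi'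
  have hd := π.t_sub_le hP.lt le_rfl hi hi'
  have hd0 := π.t_mono hi (hi'.trans (π.j_le (k + 1) hP.lt))
  have e : a (π.j k) = vw R w ξ ^ 2 := by simp only [ha, hP.first j hj]
  rw [e] at g
  calc vw R w (X j i) ^ 2 ≤ _ := g
    _ ≤ (1 + 2 * (100 * L ^ 4 * (T / N)))
      * (vw R w ξ ^ 2 + (T / N) * (100 * L ^ 4 * y ^ 2)) := by
      have : 0 ≤ (π.t i - π.t (π.j k)) * (100 * L ^ 4 * y ^ 2) :=
        mul_nonneg (by linarith) (by positivity)
      gcongr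
    _ = _ := by rw [picC]; ring

/-- The growth constant of the quadratic means when the terminal values have linear growth. -/
noncomputable def momC (L : ℝ) : ℝ := 200000 * L ^ 6

lemma picC_le_momC (hL : 1 ≤ L) : 1000 * picC L ≤ momC L := by
  have : L ^ 4 ≤ L ^ 6 := pow_le_pow_right₀ hL (by norm_num)
  rw [picC, momC]
  linarith

lemma picC_nonneg (hL : 1 ≤ L) : 0 ≤ picC L := by
  rw [picC]
  positivity

/-- The quadratic means of the Picard iterates, when the terminal values have linear growth. -/
lemma IsPeriod.moment_of_linear_growth (hS : Standing L α R T c U D Q)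
    (hP : IsPeriod c J k ξ X Y) (hδ : momC L * (T / N) ≤ 1) (hw : Wt (π.j k) w)
    (hY : J = 1 ∨ ∀ j < J, n2 w (Y (j + 1) (π.j (k + 1)))
      ≤ (4 * L + 1) * vw R w (X j (π.j (k + 1)))) :
    ∀ j < J, (∀ i, π.j k ≤ i → i ≤ π.j (k + 1) →
        vw R w (X j i) ≤ (1 + momC L * (T / N)) * vw R w ξ)
      ∧ ∀ i, π.j k ≤ i → i < π.j (k + 1) → n2 w (Y j i) ≤ 32 * L * vw R w ξ := by
  have hL := hS.one_le_L
  have hL0 : 0 ≤ L := by linarith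
  have hδ0 : 0 ≤ T / N := div_nonneg hS.T_pos.le (Nat.cast_nonneg N)
  have hpic : picC L * (T / N) ≤ 1 := by
    have := mul_le_mul_of_nonneg_right (picC_le_momC hL) hδ0
    have := mul_nonneg (picC_nonneg hL) hδ0
    linarith
  have hL46 : L ^ 4 ≤ L ^ 6 := pow_le_pow_right₀ hL (by norm_num)
  have hv : 0 ≤ vw R w ξ := vw_nonneg
  set v := vw R w ξ with hvd
  have hp : picC L * (T / N) = 200 * (L ^ 4 * (T / N)) := by rw [picC]; ring
  have hmo : momC L * (T / N) = 200000 * (L ^ 6 * (T / N)) := by rw [momC]; ring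
  have hx : L ^ 4 * (T / N) ≤ L ^ 6 * (T / N) := mul_le_mul_of_nonneg_right hL46 hδ0
  have hx0 : 0 ≤ L ^ 4 * (T / N) := by positivity
  -- A backward component of size O(1) times `v` changes the moment by a factor 1 + O(δ) only, which
  -- remains bounded after N periods.
  have concl : ∀ j ≤ J, ∀ y, y ≤ 32 * L * v → (∀ i, π.j k ≤ i → i < π.j (k + 1) →
      n2 w (Y j i) ≤ y) → ∀ i, π.j k ≤ i → i ≤ π.j (k + 1) →
        vw R w (X j i) ≤ (1 + momC L * (T / N)) * v := by
    intro j hj y hy hYj i hi hi'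
    have h := hP.vw_sq_le hS hpic hw hj (y := 32 * L * v)
      (fun i hi hi' => (hYj i hi hi').trans hy) hi hi'
    have hm0 : 0 ≤ momC L * (T / N) := by rw [hmo]; positivity
    refine le_of_sq_le_sq (h.trans ?_) (by positivity)
    rw [← hvd, hp, hmo]
    have e1 : v ^ 2 + (T / N) * (100 * L ^ 4 * (32 * L * v) ^ 2)
        = (1 + 102400 * (L ^ 6 * (T / N))) * v ^ 2 := by ring
    rw [e1, ← mul_assoc, mul_pow]
    refine mul_le_mul_of_nonneg_right ?_ (sq_nonneg v)
    rw [hmo] at hδ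
    nlinarith
  intro j
  induction j with
  | zero =>
    intro _
    have h0 : ∀ i, π.j k ≤ i → i < π.j (k + 1) → n2 w (Y 0 i) ≤ 0 := fun i hi hi' => by
      rw [hP.zero i hi hi'.le]
      simp [n2]
    exact ⟨concl 0 (Nat.zero_le _) 0 (by positivity) h0,
      fun i hi hi' => (h0 i hi hi').trans (by positivity)⟩
  | succ j ih =>
    intro hj
    obtain ⟨ih1, -⟩ := ih (by omega)
    -- Here j + 1 < J excludes J = 1.
    have hY' := (hY.resolve_left (by omega)) j (by omega)
    have hend := ih1 _ (π.j_lt hS.T_pos hP.lt).le le_rfl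
    have h2 : (1 + momC L * (T / N)) * v ≤ 2 * v := mul_le_mul_of_nonneg_right (by linarith) hv
    -- The bound does not deteriorate with `j`, as 3(4L + 1)·2 + 2 = 24L + 8 ≤ 32L.
    have hb : ∀ i, π.j k ≤ i → i < π.j (k + 1) → n2 w (Y (j + 1) i) ≤ 32 * L * v := by
      intro i hi hi'
      refine (hP.n2_back_le hS hpic hw (by omega) (y := (4 * L + 1) * (2 * v)) (V := 2 * v)
        (hY'.trans (mul_le_mul_of_nonneg_left (hend.trans h2) (by positivity)))
        (fun i hi hi' => (ih1 i hi hi'.le).trans h2) hi hi'.le).trans ?_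
      have : v ≤ L * v := le_mul_of_one_le_left hv hL
      linarith
    exact ⟨concl (j + 1) hj.le _ le_rfl hb, hb⟩

/-- For α = 1 the mean of G^α is at most the quadratic mean of G, so moments of order two suffice.
-/
lemma n2_H_one_le (hS : Standing L α R T c U D Q) {i : ℕ} (hw : Wt i w)
    (X : Sample π Q ξ₀ → E d) (Y : Sample π Q ξ₀ → ℝ) :
    n2 w (EulerStep.H R (treeStep X (drift c X Y)) 1)
      ≤ 80 * L * vw R w X + 45 * L * n2 w Y := by
  have hL := hS.one_le_L
  have hR0 : 0 ≤ R := by linarith [hS.hR.one_le]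
  set k := treeStep X (drift c X Y) with hk
  have hG0 : ∀ ω, 0 ≤ k.G R ω := EulerStep.G_nonneg hS.hR.one_le
  have hv : 0 ≤ vw R w X := vw_nonneg
  have hG : n2 w (k.G R) ≤ 16 * L * vw R w X + 9 * L * n2 w Y := by
    have h1 := n2_le_add₄ hw.nonneg (F := k.G R) (A := fun ω => R + ‖X ω‖)
      (B := fun ω => ‖drift c X Y ω‖) (C := fun _ => n2 (prob π Q ξ₀) fun ω => ‖X ω‖)
      (G := fun _ => n2 (prob π Q ξ₀) fun ω => ‖drift c X Y ω‖) fun ω => by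
        rw [abs_of_nonneg (hG0 ω)]; exact le_rfl
    have h2 := n2_add_le (p := w) (V := fun _ => R) (W := fun ω => ‖X ω‖) hw.nonneg
    have h3 := hw.n2_n2_le fun ω => ‖X ω‖
    have h4 := hw.n2_n2_le fun ω => ‖drift c X Y ω‖
    have h5 := n2_drift_le hS.h0 hL hS.hR hw X Y
    have h6 := n2_norm_le_vw (R := R) (X := X) hw.nonneg
    have h7 := n2_const_le_vw (X := X) hw.nonneg hR0
    have : vw R w X ≤ L * vw R w X := le_mul_of_one_le_left hv hL
    linarith
  have h1 := n2_le_add₃ hw.nonneg (F := EulerStep.H R k 1) (A := k.G R)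
    (B := fun _ => n2 (prob π Q ξ₀) (k.G R)) (C := fun _ => n2 (prob π Q ξ₀) (k.G R)) fun ω => by
      have h2 : ∑ ω, k.p ω * k.G R ω ^ (1 : ℝ) ≤ n2 (prob π Q ξ₀) (k.G R) := by
        simp only [Real.rpow_one]
        exact sum_mul_le_n2 (fprob_prob π Q ξ₀).nonneg (fprob_prob π Q ξ₀).sum
      have h3 : 0 ≤ EulerStep.H R k 1 ω := by
        have : 0 ≤ n2 k.p (k.G R) := n2_nonneg
        have : 0 ≤ ∑ ω, k.p ω * k.G R ω ^ (1 : ℝ) :=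
          Finset.sum_nonneg fun ω _ => mul_nonneg (k.hp.nonneg ω) (Real.rpow_nonneg (hG0 ω) _)
        have := hG0 ω
        rw [EulerStep.H]; linarith
      rw [abs_of_nonneg h3]
      exact add_le_add le_rfl h2
  have h2 := hw.n2_n2_le (k.G R)
  linarith

end moments

/-! ### Accumulation of the errors -/

/-- The solution of `u_{n+1} = (1 + a) u_n + r` with `u_0 = 0`. -/
noncomputable def acc (a r : ℝ) : ℕ → ℝ
  | 0 => 0
  | n + 1 => (1 + a) * acc a r n + r

lemma acc_nonneg {a r : ℝ} (ha : 0 ≤ a) (hr : 0 ≤ r) (n : ℕ) : 0 ≤ acc a r n := by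
  induction n with
  | zero => exact le_rfl
  | succ n ih => rw [acc]; positivity

lemma acc_mono {a r : ℝ} (ha : 0 ≤ a) (hr : 0 ≤ r) : Monotone (acc a r) :=
  monotone_nat_of_le_succ fun n => by
    rw [acc]; nlinarith [mul_nonneg ha (acc_nonneg ha hr n)]

/-- For a rate proportional to T/N and n ≤ N the exponential is bounded: the errors of the periods
add up, with a constant factor. -/
lemma acc_le {a r : ℝ} (ha : 0 ≤ a) (hr : 0 ≤ r) (n : ℕ) :
    acc a r n ≤ n * r * Real.exp (a * n) := by
  induction n with
  | zero => simp [acc]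
  | succ n ih =>
    rw [acc]
    have h1 : (1 + a) * acc a r n ≤ (1 + a) * (n * r * Real.exp (a * n)) :=
      mul_le_mul_of_nonneg_left ih (by positivity)
    have h2 : (1 + a) * Real.exp (a * n) ≤ Real.exp (a * (n + 1 : ℕ)) := by
      refine one_add_mul_exp_le.trans (le_of_eq ?_)
      push_cast
      ring_nf
    have h3 : 1 ≤ Real.exp (a * (n + 1 : ℕ)) := Real.one_le_exp (by positivity)
    have h4 := mul_le_mul_of_nonneg_left h2 (by positivity : 0 ≤ n * r)
    have h5 := mul_le_mul_of_nonneg_left h3 hr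
    push_cast at *
    linarith

/-! ### The error of the solver for coefficients with linear growth -/

section linear
variable {d : ℕ} {T : ℝ} {N : ℕ} {Λ α L R : ℝ} {π : Grid T N} {Q : Quantization d Λ}
  {ξ₀ : InitialLaw d} {c : Coeffs d} {U : ℝ → E d → Measure (E d) → ℝ} {D : Derivs d} {J : ℕ}

/-- The growth rate of the error from one level to the previous one. -/
noncomputable def rateC (L : ℝ) : ℝ := 8 * picC L + momC L

/-- The error produced on one period. -/
noncomputable def linErr (d J : ℕ) (L δ m : ℝ) : ℝ :=
  38400 * L ^ 2 * locC d L 1 * δ * √m + 8 * L * (picC L * δ) ^ J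

lemma Grid.t_j_last (π : Grid T N) (hN : 1 ≤ N) : π.t (π.j N) = T := by
  rw [π.t_j N le_rfl]
  have : (N : ℝ) ≠ 0 := by positivity
  field_simp

lemma solver_last_eq (hS : Standing L α R T c U D Q) (hN : 1 ≤ N) (ξ : Sample π Q ξ₀ → E d) :
    (fun ω => c.g (ξ ω) (law π Q ξ₀ ξ)) = field U (π.t (π.j N)) ξ := by
  funext ω
  rw [field, π.t_j_last hN, hS.h1.classical.terminal _ _ (isP2_law ξ)]

/-- Induction over the calls, starting from the terminal level. The bound is proportional to the
moment at the start of the period, which grows by 1 + O(δ). Moment control requires linear growth of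
the terminal values with constant 4L + 1: 4L from the field and 1 from the error of the next level,
which `hstab` keeps below one. For J = 1 only the first forward iterate, driven by Y = 0, occurs. -/
theorem solver_error_linear (hS : Standing L 1 R T c U D Q) (hJ : 1 ≤ J) (hN : 1 ≤ N)
    (hδ : momC L * (T / N) ≤ 1)
    (hstab : J = 1 ∨ acc (rateC L * (T / N)) (linErr d J L (T / N) π.mesh) N ≤ 1)
    {k : ℕ} {ξ : Sample π Q ξ₀ → E d} {y : Sample π Q ξ₀ → ℝ}
    (h : IsSolverOutput π Q ξ₀ c J k ξ y) (hξ : Adapted (π.j k) ξ) :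
    ∀ w, Wt (π.j k) w → n2 w (fun ω => y ω - field U (π.t (π.j k)) ξ ω)
      ≤ acc (rateC L * (T / N)) (linErr d J L (T / N) π.mesh) (N - k) * vw R w ξ := by
  have hL := hS.one_le_L
  have hL0 : 0 ≤ L := by linarith
  have hδ0 : 0 ≤ T / N := div_nonneg hS.T_pos.le (Nat.cast_nonneg N)
  have hpm := mul_le_mul_of_nonneg_right (picC_le_momC hL) hδ0
  have hp0 : 0 ≤ picC L * (T / N) := mul_nonneg (picC_nonneg hL) hδ0
  have hm0 : 0 ≤ momC L * (T / N) := by linarith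
  have hc0 := locC_nonneg (d := d) (α := 1) hL0
  set a := rateC L * (T / N) with ha
  have ha' : a = 8 * (picC L * (T / N)) + momC L * (T / N) := by rw [ha, rateC]; ring
  set r := linErr d J L (T / N) π.mesh with hr
  have ha0 : 0 ≤ a := by linarith
  have hr0 : 0 ≤ r := by rw [hr, linErr]; positivity
  induction h with
  | last ξ =>
    intro w hw
    rw [solver_last_eq hS hN ξ]
    simp [n2, acc]
  | level k hk ξ X Y Z init call picard ih =>
    intro w hw
    have hP := isPeriod_of_localOutput hk hξ init picard
    have hlt := π.j_lt hS.T_pos hk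
    have hv : 0 ≤ vw R w ξ := vw_nonneg
    set ε := acc a r (N - (k + 1)) with hε
    have hε0 : 0 ≤ ε := acc_nonneg ha0 hr0 _
    have hrec : acc a r (N - k) = (1 + a) * ε + r := by
      rw [hε, ← acc]; congr 1; omega
    have hih : ∀ j < J, n2 w (fun ω => Y (j + 1) (π.j (k + 1)) ω
        - field U (π.t (π.j (k + 1))) (X j (π.j (k + 1))) ω) ≤ ε * vw R w (X j (π.j (k + 1))) :=
      fun j hj => ih j hj (hP.adapted_X j hj.le _ hlt.le le_rfl) w (hw.mono hlt.le)
    have hmom := hP.moment_of_linear_growth hS hδ hw (hstab.imp_right fun hs j hj => by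
      have h1 : ε ≤ 1 := (acc_mono ha0 hr0 (Nat.sub_le _ _)).trans hs
      have h2 := n2_field_le hS.h1 hL hS.hR ⟨π.t_nonneg (π.j_le _ hk), π.t_le (π.j_le _ hk)⟩
        hw (X j (π.j (k + 1)))
      have h3 := mul_le_mul_of_nonneg_right h1
        (vw_nonneg (R := R) (w := w) (X := X j (π.j (k + 1))))
      have h4 := n2_le_add_abs hw.nonneg (F := Y (j + 1) (π.j (k + 1)))
        (V := fun ω => Y (j + 1) (π.j (k + 1)) ω
          - field U (π.t (π.j (k + 1))) (X j (π.j (k + 1))) ω)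
        (W := field U (π.t (π.j (k + 1))) (X j (π.j (k + 1)))) fun ω => by
          refine (le_of_eq ?_).trans (abs_add_le _ _)
          rw [sub_add_cancel]
      linarith [hih j hj])
    have hx2 : (1 + momC L * (T / N)) * vw R w ξ ≤ 2 * vw R w ξ :=
      mul_le_mul_of_nonneg_right (by linarith) hv
    -- In units of the moment of ξ: 8L is 4L times 2, and 80L·2 + 45L·32L ≤ 1600L². The returned
    -- value is iterate J, hence j = J - 1.
    have key := hP.picard_error_le hS (by linarith) hw
      (e := ε * ((1 + momC L * (T / N)) * vw R w ξ))
      (G₀ := 8 * L * vw R w ξ) (ℓ := 1600 * L ^ 2 * vw R w ξ) (by positivity)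
      (fun j hj => (hih j hj).trans (mul_le_mul_of_nonneg_left
        ((hmom j hj).1 _ hlt.le le_rfl) hε0))
      (fun i hi hi' => by
        have h1 := n2_field_le hS.h1 hL hS.hR ⟨π.t_nonneg (hP.lt_n hi').le,
          π.t_le (hP.lt_n hi').le⟩ hw (X 0 i)
        have h2 := mul_le_mul_of_nonneg_left (((hmom 0 hJ).1 i hi hi'.le).trans hx2)
          (by positivity : 0 ≤ 4 * L)
        linarith)
      (by positivity)
      (fun j hj i hi hi' => by
        have h1 := n2_H_one_le hS hw (X j i) (Y j i)
        have h2 := mul_le_mul_of_nonneg_left (((hmom j hj).1 i hi hi'.le).trans hx2)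
          (by positivity : 0 ≤ 80 * L)
        have h3 := mul_le_mul_of_nonneg_left ((hmom j hj).2 i hi hi')
          (by positivity : 0 ≤ 45 * L)
        have h4 : L * vw R w ξ ≤ L ^ 2 * vw R w ξ :=
          mul_le_mul_of_nonneg_right (le_self_pow₀ hL (by norm_num)) hv
        linarith) (j := J - 1) (by omega)
    rw [Nat.sub_add_cancel hJ] at key
    refine key.trans ?_
    rw [hrec]
    have h1 : (1 + 4 * (picC L * (T / N))) * (1 + momC L * (T / N)) ≤ 1 + a := by
      rw [ha']
      nlinarith
    have h2 := mul_le_mul_of_nonneg_right h1 (mul_nonneg hε0 hv)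
    have h3 : r = 38400 * L ^ 2 * locC d L 1 * (T / N) * √π.mesh
      + 8 * L * (picC L * (T / N)) ^ J := hr
    rw [h3]
    linarith

/-- A crude growth constant of the solver, `n` levels below the terminal one. -/
noncomputable def crudeC (L : ℝ) (J : ℕ) : ℕ → ℝ
  | 0 => 4 * L
  | n + 1 => (6 * crudeC L J n + 4) ^ (J + 1)

lemma crudeC_nonneg (hL : 0 ≤ L) (J n : ℕ) : 0 ≤ crudeC L J n := by
  induction n with
  | zero => rw [crudeC]; positivity
  | succ n ih => rw [crudeC]; positivity

/-- A backward sweep costs a factor 3K + 1 and a forward sweep gives 2v + 2y, so each Picard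
iteration multiplies the size by at most 6K + 4. -/
lemma IsPeriod.n2_le_crude {k : ℕ} {ξ : Sample π Q ξ₀ → E d} {X : ℕ → ℕ → Sample π Q ξ₀ → E d}
    {Y : ℕ → ℕ → Sample π Q ξ₀ → ℝ} {w : Sample π Q ξ₀ → ℝ} (hS : Standing L α R T c U D Q)
    (hP : IsPeriod c J k ξ X Y) (hδ : picC L * (T / N) ≤ 1) (hw : Wt (π.j k) w) {K : ℝ}
    (hK : 0 ≤ K) (hJ : 1 ≤ J)
    (hY : ∀ j < J, n2 w (Y (j + 1) (π.j (k + 1))) ≤ K * vw R w (X j (π.j (k + 1)))) :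
    n2 w (Y J (π.j k)) ≤ (6 * K + 4) ^ (J + 1) * vw R w ξ := by
  have hL := hS.one_le_L
  have hδ0 : 0 ≤ T / N := div_nonneg hS.T_pos.le (Nat.cast_nonneg N)
  have hlt := π.j_lt hS.T_pos hP.lt
  have hv : 0 ≤ vw R w ξ := vw_nonneg
  set v := vw R w ξ with hvd
  have hback : ∀ j < J, ∀ V, (∀ i, π.j k ≤ i → i ≤ π.j (k + 1) → vw R w (X j i) ≤ V) →
      ∀ i, π.j k ≤ i → i ≤ π.j (k + 1) → n2 w (Y (j + 1) i) ≤ (3 * K + 1) * V := by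
    intro j hj V hV i hi hi'
    refine (hP.n2_back_le hS hδ hw hj ((hY j hj).trans (mul_le_mul_of_nonneg_left
      (hV _ hlt.le le_rfl) hK)) (fun i hi hi' => hV i hi hi'.le) hi hi').trans (le_of_eq ?_)
    ring
  have hforw : ∀ j ≤ J, ∀ y, 0 ≤ y → (∀ i, π.j k ≤ i → i < π.j (k + 1) → n2 w (Y j i) ≤ y) →
      ∀ i, π.j k ≤ i → i ≤ π.j (k + 1) → vw R w (X j i) ≤ 2 * v + 2 * y := by
    intro j hj y hy0 hy i hi hi'
    have h := hP.vw_sq_le hS hδ hw hj hy hi hi'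
    refine le_of_sq_le_sq (h.trans ?_) (by positivity)
    rw [← hvd]
    have h1 : (T / N) * (100 * L ^ 4 * y ^ 2) ≤ y ^ 2 := by
      rw [picC] at hδ
      have : (100 * (L ^ 4 * (T / N))) * y ^ 2 ≤ 1 * y ^ 2 :=
        mul_le_mul_of_nonneg_right (by nlinarith [pow_pos (zero_lt_one.trans_le hL) 4])
          (sq_nonneg y)
      linarith
    calc _ ≤ (1 + 1) * (v ^ 2 + y ^ 2) := by
          have := mul_nonneg (picC_nonneg hL) hδ0
          gcongr
      _ ≤ _ := by nlinarith [mul_nonneg hv hy0, sq_nonneg v, sq_nonneg y]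
  have hV : ∀ j < J, ∀ i, π.j k ≤ i → i ≤ π.j (k + 1) →
      vw R w (X j i) ≤ (6 * K + 4) ^ (j + 1) * v := by
    intro j
    induction j with
    | zero =>
      intro _ i hi hi'
      have h0 := hforw 0 (Nat.zero_le _) 0 le_rfl (fun i hi hi' => by
        rw [hP.zero i hi hi'.le]
        simp [n2]) i hi hi'
      rw [zero_add, pow_one]
      nlinarith [mul_nonneg hK hv]
    | succ j ih =>
      intro hj i hi hi'
      have hb := hback j (by omega) _ (ih (by omega))
      have h0 := hforw (j + 1) hj.le _ (by positivity) (fun i hi hi' => hb i hi hi'.le) i hi hi'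
      refine h0.trans ?_
      have h1 : 1 ≤ (6 * K + 4) ^ (j + 1) := one_le_pow₀ (by linarith)
      have h2 := mul_le_mul_of_nonneg_right h1 hv
      have e : (6 * K + 4) ^ (j + 1 + 1) * v = (6 * K + 4) * ((6 * K + 4) ^ (j + 1) * v) := by ring
      rw [e]
      linarith
  have h := hback (J - 1) (by omega) _ (hV (J - 1) (by omega)) (π.j k) le_rfl hlt.le
  rw [Nat.sub_add_cancel hJ] at h
  refine h.trans ?_
  have e : (6 * K + 4) ^ (J + 1) * v = (6 * K + 4) * ((6 * K + 4) ^ J * v) := by ring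
  rw [e]
  exact mul_le_mul_of_nonneg_right (by linarith) (by positivity)

/-- Serves when N and J are confined to a finite set, where the size of the constant is irrelevant.
-/
theorem solver_le_crude (hS : Standing L α R T c U D Q) (hJ : 1 ≤ J) (hN : 1 ≤ N)
    (hδ : picC L * (T / N) ≤ 1) {k : ℕ} {ξ : Sample π Q ξ₀ → E d} {y : Sample π Q ξ₀ → ℝ}
    (h : IsSolverOutput π Q ξ₀ c J k ξ y) (hξ : Adapted (π.j k) ξ) :
    ∀ w, Wt (π.j k) w → n2 w y ≤ crudeC L J (N - k) * vw R w ξ := by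
  have hL := hS.one_le_L
  induction h with
  | last ξ =>
    intro w hw
    rw [solver_last_eq hS hN ξ, Nat.sub_self, crudeC]
    exact n2_field_le hS.h1 hL hS.hR ⟨π.t_nonneg (π.j_le _ le_rfl), π.t_le (π.j_le _ le_rfl)⟩ hw ξ
  | level k hk ξ X Y Z init call picard ih =>
    intro w hw
    have hP := isPeriod_of_localOutput hk hξ init picard
    have hlt := π.j_lt hS.T_pos hk
    have e : N - k = N - (k + 1) + 1 := by omega
    rw [e, crudeC]
    exact hP.n2_le_crude hS hδ hw (crudeC_nonneg (by linarith) _ _) hJ fun j hj =>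
      ih j hj (hP.adapted_X j hj.le _ hlt.le le_rfl) w (hw.mono hlt.le)

end linear

end MKV

namespace MKV

/-! ### Higher moments -/

section higher
variable {d : ℕ} {T : ℝ} {N : ℕ} {Λ α L R κ : ℝ} {π : Grid T N} {Q : Quantization d Λ}
  {ξ₀ : InitialLaw d} {c : Coeffs d} {U : ℝ → E d → Measure (E d) → ℝ} {D : Derivs d}
  {i : ℕ} {w : Sample π Q ξ₀ → ℝ} {X b X' : Sample π Q ξ₀ → E d}

/-- The pointwise size of a process, shifted by `R` and by its quadratic mean. -/
noncomputable def rt (R : ℝ) (X : Sample π Q ξ₀ → E d) (ω : Sample π Q ξ₀) : ℝ :=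
  √(R ^ 2 + ‖X ω‖ ^ 2 + n2 (prob π Q ξ₀) (fun ω => ‖X ω‖) ^ 2)

lemma rt_nonneg (ω : Sample π Q ξ₀) : 0 ≤ rt R X ω := Real.sqrt_nonneg _

lemma rt_sq (ω : Sample π Q ξ₀) :
    rt R X ω ^ 2 = R ^ 2 + ‖X ω‖ ^ 2 + n2 (prob π Q ξ₀) (fun ω => ‖X ω‖) ^ 2 :=
  Real.sq_sqrt (by positivity)

lemma le_rt (ω : Sample π Q ξ₀) : R ≤ rt R X ω :=
  Real.le_sqrt_of_sq_le (by
    nlinarith [sq_nonneg (‖X ω‖), sq_nonneg (n2 (prob π Q ξ₀) fun ω => ‖X ω‖)])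

lemma norm_le_rt (ω : Sample π Q ξ₀) : ‖X ω‖ ≤ rt R X ω :=
  Real.le_sqrt_of_sq_le (by
    nlinarith [sq_nonneg R, sq_nonneg (n2 (prob π Q ξ₀) fun ω => ‖X ω‖)])

lemma n2_norm_le_rt (ω : Sample π Q ξ₀) : n2 (prob π Q ξ₀) (fun ω => ‖X ω‖) ≤ rt R X ω :=
  Real.le_sqrt_of_sq_le (by nlinarith [sq_nonneg R, sq_nonneg ‖X ω‖])

lemma Adapted.rt (hX : Adapted i X) : Adapted i (rt R X) :=
  hX.comp fun x => √(R ^ 2 + ‖x‖ ^ 2 + n2 (prob π Q ξ₀) (fun ω => ‖X ω‖) ^ 2)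

/-- The mean square of `rt` is R² plus twice the second moment of X, hence at most 4 rt² at every
point. This allows mean-field terms to be estimated pointwise by `rt`. -/
lemma n2_prob_rt_le (ω : Sample π Q ξ₀) : n2 (prob π Q ξ₀) (rt R X) ≤ 2 * rt R X ω := by
  have hp := fprob_prob π Q ξ₀
  refine le_of_sq_le_sq ?_ (mul_nonneg zero_le_two (rt_nonneg ω))
  rw [n2_sq hp.nonneg, mul_pow, rt_sq]
  simp only [rt_sq]
  have : ∑ ω, prob π Q ξ₀ ω * (R ^ 2 + ‖X ω‖ ^ 2 + n2 (prob π Q ξ₀) (fun ω => ‖X ω‖) ^ 2)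
      = R ^ 2 + 2 * n2 (prob π Q ξ₀) (fun ω => ‖X ω‖) ^ 2 := by
    simp only [mul_add, Finset.sum_add_distrib]
    rw [← n2_sq hp.nonneg (V := fun ω => ‖X ω‖), ← Finset.sum_mul, ← Finset.sum_mul, hp.sum]
    ring
  rw [this]
  nlinarith [sq_nonneg R, sq_nonneg ‖X ω‖, sq_nonneg (n2 (prob π Q ξ₀) fun ω => ‖X ω‖)]

lemma n2_rt_le (hw : Wt i w) : n2 w (rt R X) ≤ 3 * vw R w X := by
  have h := n2_le_add hw.nonneg (F := rt R X) (V := fun ω => √(R ^ 2 + ‖X ω‖ ^ 2))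
    (W := fun _ => n2 (prob π Q ξ₀) fun ω => ‖X ω‖) fun ω => by
      rw [abs_of_nonneg (rt_nonneg ω), rt]
      refine (Real.sqrt_le_left (add_nonneg (Real.sqrt_nonneg _) n2_nonneg)).2 ?_
      have h1 := Real.sq_sqrt (by positivity : 0 ≤ R ^ 2 + ‖X ω‖ ^ 2)
      have h2 := mul_nonneg (Real.sqrt_nonneg (R ^ 2 + ‖X ω‖ ^ 2))
        (n2_nonneg (p := prob π Q ξ₀) (V := fun ω => ‖X ω‖))
      nlinarith
  have h2 := hw.n2_n2_le fun ω => ‖X ω‖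
  have h3 := n2_norm_le_vw (R := R) (X := X) hw.nonneg
  have h4 : n2 w (fun ω => √(R ^ 2 + ‖X ω‖ ^ 2)) = vw R w X := rfl
  linarith

lemma n2_prob_norm_le_rt (hκ : 0 ≤ κ) (hb : ∀ ω, ‖b ω‖ ≤ κ * rt R X ω) (ω : Sample π Q ξ₀) :
    n2 (prob π Q ξ₀) (fun ω => ‖b ω‖) ≤ κ * (2 * rt R X ω) := by
  have h := n2_mono (p := prob π Q ξ₀) (V := fun ω => ‖b ω‖) (W := fun ω => κ * rt R X ω)
    (fprob_prob π Q ξ₀).nonneg fun ω => by rw [abs_norm]; exact hb ω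
  rw [n2_const_mul κ hκ] at h
  exact h.trans (mul_le_mul_of_nonneg_left (n2_prob_rt_le ω) hκ)

/-- The mean of order `2α`, to the power `α`. -/
noncomputable def qm (R α : ℝ) (X : Sample π Q ξ₀ → E d) : ℝ :=
  n2 (prob π Q ξ₀) fun ω => rt R X ω ^ α

/-- The growth constant of the sizes of the data in one step. -/
noncomputable def hC (κ α : ℝ) : ℝ := 27 * (1 + κ) + 2 * (3 + 3 * κ) ^ α

lemma hC_nonneg (hκ : 0 ≤ κ) : 0 ≤ hC κ α := by
  have := Real.rpow_nonneg (by positivity : 0 ≤ 3 + 3 * κ) α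
  rw [hC]
  positivity

lemma n2_H_le (hR : 1 ≤ R) (hα : 0 ≤ α) (hκ : 0 ≤ κ) (hw : Wt i w)
    (hb : ∀ ω, ‖b ω‖ ≤ κ * rt R X ω) :
    n2 w (EulerStep.H R (treeStep X b) α) ≤ hC κ α * (vw R w X + qm R α X) := by
  have hp := fprob_prob π Q ξ₀
  set k := treeStep X b with hk
  have hG0 : ∀ ω, 0 ≤ k.G R ω := EulerStep.G_nonneg hR
  have hG : ∀ ω, k.G R ω ≤ (3 + 3 * κ) * rt R X ω := by
    intro ω
    have h1 := le_rt (R := R) (X := X) ω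
    have h2 := norm_le_rt (R := R) (X := X) ω
    have h3 := n2_norm_le_rt (R := R) (X := X) ω
    have h4 := hb ω
    have h5 := n2_prob_norm_le_rt hκ hb ω
    have e : k.G R ω = R + ‖X ω‖ + ‖b ω‖ + n2 (prob π Q ξ₀) (fun ω => ‖X ω‖)
      + n2 (prob π Q ξ₀) fun ω => ‖b ω‖ := rfl
    rw [e]; linarith
  have hκ3 : 0 ≤ 3 + 3 * κ := by positivity
  have hGn : n2 w (k.G R) ≤ (3 + 3 * κ) * (3 * vw R w X) := by
    have h := n2_mono (p := w) hw.nonneg (V := k.G R)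
      (W := fun ω => (3 + 3 * κ) * rt R X ω) fun ω => by rw [abs_of_nonneg (hG0 ω)]; exact hG ω
    rw [n2_const_mul _ hκ3] at h
    exact h.trans (mul_le_mul_of_nonneg_left (n2_rt_le hw) hκ3)
  set S := ∑ ω, k.p ω * k.G R ω ^ α with hS
  have hS0 : 0 ≤ S :=
    Finset.sum_nonneg fun ω _ => mul_nonneg (k.hp.nonneg ω) (Real.rpow_nonneg (hG0 ω) _)
  have hSq : S ≤ (3 + 3 * κ) ^ α * qm R α X := by
    have h1 : S ≤ ∑ ω, prob π Q ξ₀ ω * ((3 + 3 * κ) ^ α * rt R X ω ^ α) :=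
      Finset.sum_le_sum fun ω _ => mul_le_mul_of_nonneg_left (by
        rw [← Real.mul_rpow hκ3 (rt_nonneg ω)]
        exact Real.rpow_le_rpow (hG0 ω) (hG ω) hα) (hp.nonneg ω)
    refine h1.trans ((sum_mul_le_n2 hp.nonneg hp.sum).trans (le_of_eq ?_))
    rw [n2_const_mul _ (Real.rpow_nonneg hκ3 _), qm]
  have h1 := n2_le_add₃ hw.nonneg (F := EulerStep.H R k α) (A := k.G R)
    (B := fun _ => n2 (prob π Q ξ₀) (k.G R)) (C := fun _ => S) fun ω => by
      have h3 : 0 ≤ EulerStep.H R k α ω := by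
        have : 0 ≤ n2 k.p (k.G R) := n2_nonneg
        have := hG0 ω
        rw [EulerStep.H]; linarith
      rw [abs_of_nonneg h3]
      exact le_rfl
  have h2 := hw.n2_n2_le (k.G R)
  have h3 := hw.n2_const_le hS0
  have h4 : 0 ≤ vw R w X := vw_nonneg
  have h5 : 0 ≤ qm R α X := n2_nonneg
  have h6 : 0 ≤ (3 + 3 * κ) ^ α := Real.rpow_nonneg hκ3 _
  have h7 := mul_nonneg h6 h4
  have h8 := mul_nonneg hκ h5
  rw [hC]
  linarith

/-- Second-order Taylor estimate of the complex exponential, restricted to the real line. -/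
lemma exp_le_quadratic {x s : ℝ} (hx : |x| ≤ s) :
    Real.exp x ≤ 1 + x + x ^ 2 * Real.exp s := by
  have h := Complex.norm_exp_sub_sum_le_norm_mul_exp x 2
  have e : Complex.exp x - ∑ m ∈ Finset.range 2, (x : ℂ) ^ m / m.factorial
      = ((Real.exp x - 1 - x : ℝ) : ℂ) := by
    simp [Finset.sum_range_succ]
    ring
  rw [e, Complex.norm_real, Complex.norm_real, Real.norm_eq_abs, Real.norm_eq_abs, sq_abs] at h
  have h2 := mul_le_mul_of_nonneg_left (Real.exp_le_exp.2 hx) (sq_nonneg x)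
  linarith [le_abs_self (Real.exp x - 1 - x)]

/-- The growth rate of the higher moments. -/
noncomputable def qC (L κ α : ℝ) : ℝ :=
  α * (2 * κ + 10 * κ ^ 2 + 4 * L ^ 4) + 4 * α ^ 2 * L ^ 4 * Real.exp (2 * α * L ^ 2)

lemma qC_nonneg (hκ : 0 ≤ κ) (hα : 0 ≤ α) : 0 ≤ qC L κ α := by
  rw [qC]
  positivity

/-- Over one step rt² is multiplied by at most 1 + r + C₂h, with r linear in the centred noise and
|r| ≤ 2L²√h. Bounding this by exp(r + C₂h) makes the power α harmless, integer or not. A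
second-order expansion of exp(αr) then leaves 1 + O(h), because the conditional mean of r vanishes.
-/
lemma IsStep.qm_sq_le (hX' : IsStep c i X b X') (hQ : ∀ a, ‖Q.w a‖ ≤ L) (hL : 1 ≤ L)
    (h0 : H0 L c) (hR : 1 ≤ R) (hα : 0 ≤ α) (hκ : 0 ≤ κ) (hi : i < π.n) (hh1 : π.h i ≤ 1)
    (hX : Adapted i X) (hba : Adapted i b) (hb : ∀ ω, ‖b ω‖ ≤ κ * rt R X ω) :
    qm R α X' ^ 2 ≤ Real.exp (qC L κ α * π.h i) * qm R α X ^ 2 := by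
  have hp := fprob_prob π Q ξ₀
  have hh := (π.h_pos hi).le
  set h := π.h i with hhd
  set s := n2 (prob π Q ξ₀) fun ω => ‖X ω‖ with hs
  set s' := n2 (prob π Q ξ₀) fun ω => ‖X' ω‖ with hs'
  set A : Sample π Q ξ₀ → ℝ := fun ω => rt R X ω ^ 2 with hA
  have hA1 : ∀ ω, 1 ≤ A ω := fun ω =>
    one_le_pow₀ (hR.trans (le_rt ω))
  -- The mean-field part of `rt` evolves by the quadratic estimate for the probability itself.
  have hss : s' ^ 2 ≤ s ^ 2 + 2 * L ^ 4 * h * (R ^ 2 + s ^ 2)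
      + 2 * h * n2 (prob π Q ξ₀) (fun ω => ‖b ω‖) ^ 2 := by
    have k := hX'.vw_sq_le hQ hL h0 hR hi hh1 hX hba (wt_prob i)
    have e : ∀ V : Sample π Q ξ₀ → E d, vw R (prob π Q ξ₀) V ^ 2
        = R ^ 2 + n2 (prob π Q ξ₀) (fun ω => ‖V ω‖) ^ 2 := fun V => by
      rw [vw_sq hp.nonneg, n2_sq hp.nonneg]
      simp only [mul_add, Finset.sum_add_distrib]
      rw [← Finset.sum_mul, hp.sum, one_mul]
    rw [e, e] at k
    linarith
  set C₂ := 2 * κ + 10 * κ ^ 2 + 4 * L ^ 4 with hC₂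
  -- Coefficient of the increment in the relative growth of rt²: it comes from the cross term 2⟨X,
  -- σΔW̄⟩ divided by A.
  set u : Sample π Q ξ₀ → E d := fun ω =>
    (2 * (A ω)⁻¹) • ContinuousLinearMap.adjoint (c.σ (X ω) (law π Q ξ₀ X)) (X ω) with hu
  set r : Sample π Q ξ₀ → ℝ := fun ω => inner ℝ (u ω) (dW π Q ξ₀ i ω) with hr
  have hua : Adapted i u := (hX.rt (R := R)).comp₂ hX fun a x => (2 * (a ^ 2)⁻¹) •
    ContinuousLinearMap.adjoint (c.σ x (law π Q ξ₀ X)) x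
  have hσ : ∀ ω, ‖c.σ (X ω) (law π Q ξ₀ X)‖ ≤ L := fun ω => h0.bdd_σ _ _ (isP2_law X)
  have hdW : ∀ ω, ‖dW π Q ξ₀ i ω‖ ≤ L * √h := fun ω => norm_dW_le hQ hi ω
  have hXA : ∀ ω, ‖X ω‖ ≤ A ω := fun ω => (norm_le_rt (R := R) ω).trans
    (le_self_pow₀ (hR.trans (le_rt ω)) (by norm_num))
  have hrb : ∀ ω, |r ω| ≤ 2 * L ^ 2 * √h := by
    intro ω
    have hA0 : 0 < A ω := by linarith [hA1 ω]
    have k1 := abs_real_inner_le_norm (u ω) (dW π Q ξ₀ i ω)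
    have k2 : ‖u ω‖ ≤ 2 * L := by
      rw [hu]
      simp only
      rw [norm_smul, Real.norm_of_nonneg (by positivity)]
      have k3 := (ContinuousLinearMap.adjoint (c.σ (X ω) (law π Q ξ₀ X))).le_opNorm (X ω)
      rw [LinearIsometryEquiv.norm_map] at k3
      have k4 : ‖c.σ (X ω) (law π Q ξ₀ X)‖ * ‖X ω‖ ≤ L * A ω :=
        mul_le_mul (hσ ω) (hXA ω) (norm_nonneg _) (by linarith)
      calc _ ≤ 2 * (A ω)⁻¹ * (L * A ω) :=
            mul_le_mul_of_nonneg_left (k3.trans k4) (by positivity)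
        _ = 2 * L := by field_simp
    calc |r ω| ≤ ‖u ω‖ * ‖dW π Q ξ₀ i ω‖ := k1
      _ ≤ (2 * L) * (L * √h) := mul_le_mul k2 (hdW ω) (norm_nonneg _) (by linarith)
      _ = _ := by ring
  have hAr : ∀ ω, rt R X' ω ^ 2 ≤ A ω * (1 + (r ω + C₂ * h)) := by
    intro ω
    have hA0 : 0 < A ω := by linarith [hA1 ω]
    set S := c.σ (X ω) (law π Q ξ₀ X) (dW π Q ξ₀ i ω) with hSd
    have hS : ‖S‖ ^ 2 ≤ L ^ 4 * h := by
      have k1 : ‖S‖ ≤ L * (L * √h) := ((c.σ (X ω) (law π Q ξ₀ X)).le_opNorm _).trans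
        (mul_le_mul (hσ ω) (hdW ω) (norm_nonneg _) (by linarith))
      refine (pow_le_pow_left₀ (norm_nonneg _) k1 2).trans (le_of_eq ?_)
      rw [mul_pow, mul_pow, Real.sq_sqrt hh]; ring
    have hAr : A ω * r ω = 2 * inner ℝ (X ω) S := by
      rw [hr, hu]
      simp only
      rw [real_inner_smul_left, ContinuousLinearMap.adjoint_inner_left, ← hSd]
      field_simp
    have hX2 : ‖X' ω‖ ^ 2 ≤ ‖X ω‖ ^ 2 + 2 * inner ℝ (X ω) S + 2 * h * (‖X ω‖ * ‖b ω‖)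
        + 2 * h ^ 2 * ‖b ω‖ ^ 2 + 2 * ‖S‖ ^ 2 := by
      have e : X' ω = X ω + (h • b ω + S) := by rw [hX' ω, add_assoc]
      rw [e, norm_add_sq_real, inner_add_right, real_inner_smul_right]
      have k1 := real_inner_le_norm (X ω) (b ω)
      have k2 := mul_le_mul_of_nonneg_left k1 hh
      have k3 : ‖h • b ω + S‖ ^ 2 ≤ 2 * (h ^ 2 * ‖b ω‖ ^ 2) + 2 * ‖S‖ ^ 2 := by
        have k4 := pow_le_pow_left₀ (norm_nonneg _) (norm_add_le (h • b ω) S) 2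
        rw [norm_smul, Real.norm_of_nonneg hh] at k4
        nlinarith [sq_nonneg (h * ‖b ω‖ - ‖S‖)]
      linarith
    have hbr := hb ω
    have hrt := norm_le_rt (R := R) (X := X) ω
    have hrt0 := rt_nonneg (R := R) (X := X) ω
    have hAd : A ω = rt R X ω ^ 2 := rfl
    have k1 : ‖X ω‖ * ‖b ω‖ ≤ κ * A ω := by
      calc _ ≤ rt R X ω * (κ * rt R X ω) := mul_le_mul hrt hbr (norm_nonneg _) hrt0
        _ = _ := by rw [hAd]; ring
    have k2 : ‖b ω‖ ^ 2 ≤ κ ^ 2 * A ω :=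
      (pow_le_pow_left₀ (norm_nonneg _) hbr 2).trans (le_of_eq (by rw [hAd]; ring))
    have k3 : n2 (prob π Q ξ₀) (fun ω => ‖b ω‖) ^ 2 ≤ 4 * κ ^ 2 * A ω :=
      (pow_le_pow_left₀ n2_nonneg (n2_prob_norm_le_rt hκ hb ω) 2).trans
        (le_of_eq (by rw [hAd]; ring))
    have k4 : R ^ 2 + s ^ 2 ≤ A ω := by
      rw [hAd, rt_sq]; linarith [sq_nonneg ‖X ω‖]
    have k5 : A ω = R ^ 2 + ‖X ω‖ ^ 2 + s ^ 2 := rt_sq ω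
    have k6 : rt R X' ω ^ 2 = R ^ 2 + ‖X' ω‖ ^ 2 + s' ^ 2 := rt_sq ω
    have m1 := mul_le_mul_of_nonneg_left k1 (by positivity : 0 ≤ 2 * h)
    have hh2 : h ^ 2 ≤ h := by nlinarith
    have m2 : 2 * h ^ 2 * ‖b ω‖ ^ 2 ≤ 2 * h * (κ ^ 2 * A ω) :=
      mul_le_mul (by linarith) k2 (sq_nonneg _) (by positivity)
    have m3 := mul_le_mul_of_nonneg_left k3 (by positivity : 0 ≤ 2 * h)
    have m4 := mul_le_mul_of_nonneg_left k4 (by positivity : 0 ≤ 2 * L ^ 4 * h)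
    have m5 : L ^ 4 * h ≤ L ^ 4 * h * A ω := le_mul_of_one_le_right (by positivity) (hA1 ω)
    rw [k6, mul_add, mul_add, hAr, mul_one, hC₂]
    linarith
  have hpow : ∀ ω, (rt R X' ω ^ α) ^ 2 ≤ A ω ^ α * Real.exp (α * (C₂ * h))
      * ((1 + 4 * α ^ 2 * L ^ 4 * Real.exp (2 * α * L ^ 2) * h) + α * r ω) := by
    intro ω
    have hA0 : 0 < A ω := by linarith [hA1 ω]
    rw [Real.rpow_pow_comm (rt_nonneg ω)]
    have k1 : rt R X' ω ^ 2 ≤ A ω * Real.exp (r ω + C₂ * h) :=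
      (hAr ω).trans (mul_le_mul_of_nonneg_left (by linarith [Real.add_one_le_exp (r ω + C₂ * h)])
        hA0.le)
    have k2 := Real.rpow_le_rpow (sq_nonneg _) k1 hα
    rw [Real.mul_rpow hA0.le (Real.exp_pos _).le, ← Real.exp_mul] at k2
    refine k2.trans ?_
    have e : (r ω + C₂ * h) * α = α * (C₂ * h) + α * r ω := by ring
    rw [e, Real.exp_add, mul_assoc (A ω ^ α)]
    refine mul_le_mul_of_nonneg_left (mul_le_mul_of_nonneg_left ?_ (Real.exp_pos _).le)
      (Real.rpow_nonneg hA0.le _)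
    have hsq : √h ≤ 1 := Real.sqrt_le_one.2 hh1
    have k3 : |α * r ω| ≤ 2 * α * L ^ 2 := by
      rw [abs_mul, abs_of_nonneg hα]
      have := mul_le_mul_of_nonneg_left ((hrb ω).trans
        (mul_le_mul_of_nonneg_left hsq (by positivity : 0 ≤ 2 * L ^ 2))) hα
      linarith
    have k4 : (α * r ω) ^ 2 ≤ 4 * α ^ 2 * L ^ 4 * h := by
      rw [mul_pow, ← sq_abs (r ω)]
      have := mul_le_mul_of_nonneg_left (pow_le_pow_left₀ (abs_nonneg _) (hrb ω) 2) (sq_nonneg α)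
      refine this.trans (le_of_eq ?_)
      rw [mul_pow, Real.sq_sqrt hh]; ring
    have k5 := mul_le_mul_of_nonneg_right k4 (Real.exp_pos (2 * α * L ^ 2)).le
    have k6 := exp_le_quadratic k3
    linarith
  have hAα : Adapted i fun ω => A ω ^ α * Real.exp (α * (C₂ * h)) :=
    (hX.rt (R := R)).comp fun a => (a ^ 2) ^ α * Real.exp (α * (C₂ * h))
  set C₃ := 4 * α ^ 2 * L ^ 4 * Real.exp (2 * α * L ^ 2) with hC₃
  have hE : ∀ ω, condE π Q ξ₀ i (fun ω => A ω ^ α * Real.exp (α * (C₂ * h))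
      * ((1 + C₃ * h) + α * r ω)) ω = A ω ^ α * Real.exp (α * (C₂ * h)) * (1 + C₃ * h) := by
    intro ω
    rw [condE_mul_adapted hAα, condE_add, condE_const,
      condE_mul_adapted (f := fun _ => α) (fun _ _ _ _ => rfl), hr, condE_inner_adapted hua]
    simp only
    rw [condE_dW hi, inner_zero_right, mul_zero, add_zero]
  rw [qm, qm, n2_sq hp.nonneg, n2_sq hp.nonneg, ← sum_prob_condE i, Finset.mul_sum]
  refine Finset.sum_le_sum fun ω _ => ?_
  have k := (condE_mono i hpow ω).trans (le_of_eq (hE ω))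
  have hA0 : 0 < A ω := by linarith [hA1 ω]
  have e1 : (rt R X ω ^ α) ^ 2 = A ω ^ α := Real.rpow_pow_comm (rt_nonneg ω) _ _
  have e2 : Real.exp (α * (C₂ * h)) * (1 + C₃ * h) ≤ Real.exp (qC L κ α * h) := by
    have e3 : qC L κ α * h = C₃ * h + α * (C₂ * h) := by rw [qC, hC₂, hC₃]; ring
    rw [e3, mul_comm]
    exact one_add_mul_exp_le
  rw [e1]
  calc _ ≤ prob π Q ξ₀ ω * (A ω ^ α * Real.exp (α * (C₂ * h)) * (1 + C₃ * h)) :=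
        mul_le_mul_of_nonneg_left k (hp.nonneg ω)
    _ ≤ prob π Q ξ₀ ω * (A ω ^ α * Real.exp (qC L κ α * h)) := by
        rw [mul_assoc (A ω ^ α)]
        exact mul_le_mul_of_nonneg_left (mul_le_mul_of_nonneg_left e2
          (Real.rpow_nonneg hA0.le _)) (hp.nonneg ω)
    _ = _ := by ring

/-- The sum of the quadratic mean and of the mean of order `2α`. -/
noncomputable def vq (R α : ℝ) (w : Sample π Q ξ₀ → ℝ) (X : Sample π Q ξ₀ → E d) : ℝ :=
  vw R w X + qm R α X

lemma vq_nonneg : 0 ≤ vq R α w X := add_nonneg vw_nonneg n2_nonneg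

/-- The growth rate of all the moments. -/
noncomputable def gC (L κ α : ℝ) : ℝ := qC L κ α + L ^ 4 + 9 * κ ^ 2

lemma gC_nonneg (hκ : 0 ≤ κ) (hα : 0 ≤ α) : 0 ≤ gC L κ α := by
  have := qC_nonneg (L := L) hκ hα
  rw [gC]
  positivity

lemma IsStep.vq_le (hX' : IsStep c i X b X') (hQ : ∀ a, ‖Q.w a‖ ≤ L) (hL : 1 ≤ L)
    (h0 : H0 L c) (hR : 1 ≤ R) (hα : 0 ≤ α) (hκ : 0 ≤ κ) (hi : i < π.n) (hh1 : π.h i ≤ 1)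
    (hX : Adapted i X) (hba : Adapted i b) (hb : ∀ ω, ‖b ω‖ ≤ κ * rt R X ω) (hw : Wt i w) :
    vq R α w X' ≤ Real.exp (gC L κ α * π.h i) * vq R α w X := by
  have hh := (π.h_pos hi).le
  have hq0 := qC_nonneg (L := L) hκ hα
  have h1 : qm R α X' ≤ Real.exp (gC L κ α * π.h i) * qm R α X := by
    refine le_of_sq_le_sq ((hX'.qm_sq_le hQ hL h0 hR hα hκ hi hh1 hX hba hb).trans ?_)
      (mul_nonneg (Real.exp_pos _).le n2_nonneg)
    rw [mul_pow, ← Real.exp_nat_mul]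
    refine mul_le_mul_of_nonneg_right (Real.exp_le_exp.2 ?_) (sq_nonneg _)
    have : qC L κ α * π.h i ≤ gC L κ α * π.h i :=
      mul_le_mul_of_nonneg_right (by rw [gC]; nlinarith [sq_nonneg κ, sq_nonneg (L ^ 2)]) hh
    have h2 := mul_nonneg (gC_nonneg (L := L) hκ hα) hh
    push_cast
    linarith
  have h2 : vw R w X' ≤ Real.exp (gC L κ α * π.h i) * vw R w X := by
    have hv : 0 ≤ vw R w X := vw_nonneg
    have hbn : n2 w (fun ω => ‖b ω‖) ≤ κ * (3 * vw R w X) := by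
      have := n2_mono (p := w) hw.nonneg (V := fun ω => ‖b ω‖) (W := fun ω => κ * rt R X ω)
        fun ω => by rw [abs_norm]; exact hb ω
      rw [n2_const_mul κ hκ] at this
      exact this.trans (mul_le_mul_of_nonneg_left (n2_rt_le hw) hκ)
    have k := hX'.vw_sq_le hQ hL h0 hR hi hh1 hX hba hw
    have k2 : 2 * π.h i * n2 w (fun ω => ‖b ω‖) ^ 2 ≤ 2 * π.h i * (κ * (3 * vw R w X)) ^ 2 :=
      mul_le_mul_of_nonneg_left (pow_le_pow_left₀ n2_nonneg hbn 2) (by positivity)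
    refine le_of_sq_le_sq (k.trans ((add_le_add le_rfl k2).trans ?_))
      (mul_nonneg (Real.exp_pos _).le hv)
    rw [mul_pow (Real.exp _), ← Real.exp_nat_mul]
    have e : (1 + 2 * L ^ 4 * π.h i) * vw R w X ^ 2 + 2 * π.h i * (κ * (3 * vw R w X)) ^ 2
        = (2 * (L ^ 4 + 9 * κ ^ 2) * π.h i + 1) * vw R w X ^ 2 := by ring
    rw [e]
    refine mul_le_mul_of_nonneg_right ?_ (sq_nonneg _)
    refine (Real.add_one_le_exp _).trans (Real.exp_le_exp.2 ?_)
    have : (L ^ 4 + 9 * κ ^ 2) * π.h i ≤ gC L κ α * π.h i :=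
      mul_le_mul_of_nonneg_right (by rw [gC]; linarith) hh
    push_cast
    linarith
  rw [vq, vq, mul_add]
  exact add_le_add h2 h1

end higher

end MKV

namespace MKV

/-! ### The error of the solver for bounded data -/

section bounded
variable {d : ℕ} {T : ℝ} {N : ℕ} {Λ α L R K : ℝ} {π : Grid T N} {Q : Quantization d Λ}
  {ξ₀ : InitialLaw d} {c : Coeffs d} {U : ℝ → E d → Measure (E d) → ℝ} {D : Derivs d}
  {J k i : ℕ} {ξ X X' : Sample π Q ξ₀ → E d} {Y Y' : Sample π Q ξ₀ → ℝ} {Z : Sample π Q ξ₀ → E d}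
  {w : Sample π Q ξ₀ → ℝ}

/-- `K` bounds `g` and `f(·, 0, 0, [·, 0])`. -/
structure DataBound (K : ℝ) (c : Coeffs d) : Prop where
  nonneg : 0 ≤ K
  g : ∀ x μ, IsP2 μ → |c.g x μ| ≤ K
  f : ∀ x μ, IsP2 μ → |c.f x 0 0 (μ.map fun v => pair v 0)| ≤ K

lemma DataBound.abs_f_le (hK : DataBound K c) (X : Sample π Q ξ₀ → E d) (x : E d) :
    |c.f x 0 0 (law π Q ξ₀ fun ω' => pair (X ω') 0)| ≤ K := by
  have h := hK.f x (law π Q ξ₀ X) (isP2_law X)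
  have hm : Measurable fun v : E d => pair v 0 :=
    (continuous_pair.comp (Continuous.prodMk_left (0 : ℝ))).measurable
  rwa [law_eq_flaw, flaw_map X hm] at h

instance nonempty_sample : Nonempty (Sample π Q ξ₀) := by
  by_contra h
  have := (fprob_prob π Q ξ₀).sum
  rw [not_nonempty_iff] at h
  simp at this

/-- The uniform norm of a random variable on the forest. -/
noncomputable def supN (V : Sample π Q ξ₀ → ℝ) : ℝ := ⨆ ω, |V ω|

lemma le_supN (V : Sample π Q ξ₀ → ℝ) (ω : Sample π Q ξ₀) : |V ω| ≤ supN V :=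
  le_ciSup (f := fun ω => |V ω|) (Finite.bddAbove_range _) ω

lemma supN_le {V : Sample π Q ξ₀ → ℝ} {x : ℝ} (h : ∀ ω, |V ω| ≤ x) : supN V ≤ x := ciSup_le h

lemma supN_nonneg (V : Sample π Q ξ₀ → ℝ) : 0 ≤ supN V :=
  (abs_nonneg _).trans (le_supN V (Classical.arbitrary _))

lemma n2_prob_le_supN (V : Sample π Q ξ₀ → ℝ) : n2 (prob π Q ξ₀) V ≤ supN V :=
  (n2_mono (fprob_prob π Q ξ₀).nonneg (le_supN V)).trans
    (n2_const_prob (fprob_prob π Q ξ₀).sum _ (supN_nonneg V)).le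

lemma abs_condE_add_le_supN (hi : i < π.n) (V : Sample π Q ξ₀ → ℝ) (ω : Sample π Q ξ₀) :
    |condE π Q ξ₀ i V ω| + L * ‖condE π Q ξ₀ i (fun ω => V ω • dW π Q ξ₀ i ω) ω‖
      ≤ (1 + L ^ 2 * π.h i) * supN V := by
  have hh := (π.h_pos hi).le
  have h1 := bessel (L := L) hi hh V ω
  have h2 : condE π Q ξ₀ i (fun ω => V ω ^ 2) ω ≤ supN V ^ 2 := by
    have := condE_mono i (V := fun ω => V ω ^ 2) (W := fun _ => supN V ^ 2) (fun ω => by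
      rw [← sq_abs]; exact pow_le_pow_left₀ (abs_nonneg _) (le_supN V ω) 2) ω
    rwa [condE_const] at this
  have h3 : 0 ≤ L ^ 2 * π.h i := by positivity
  refine le_of_sq_le_sq (h1.trans ?_) (mul_nonneg (by linarith) (supN_nonneg V))
  rw [mul_pow]
  exact mul_le_mul (by nlinarith) h2 (by
    have := condE_mono i (V := fun _ => 0) (W := fun ω => V ω ^ 2) (fun ω => sq_nonneg _) ω
    rwa [condE_const] at this) (sq_nonneg _)

/-- Bessel's inequality is pointwise in the conditioning, so the uniform norm satisfies the same
recursion as the L² norm, with the bound of the data as source instead of a moment. -/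
lemma IsBackStep.supN_le (h : IsBackStep c i X Y' Y Z) (hK : DataBound K c) (h0 : H0 L c)
    (hL : 1 ≤ L) (hi : i < π.n) (hX : Adapted i X) (hh : 3 * L ^ 2 * π.h i ≤ 1 / 2) :
    supN Y ≤ (1 + 12 * L ^ 2 * π.h i) * supN Y' + π.h i * (2 * K) := by
  have hL0 : 0 ≤ L := by linarith
  have hh0 := (π.h_pos hi).le
  have hLL2 : L ≤ L ^ 2 := le_self_pow₀ hL (by norm_num)
  have key : supN Y ≤ (1 + 3 * L ^ 2 * π.h i) * supN Y' + 3 * L ^ 2 * π.h i * supN Y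
      + π.h i * K := by
    refine MKV.supN_le fun ω => (h.abs_le h0 hL0 hi hX ω).trans ?_
    have h1 := abs_condE_add_le_supN (L := L) hi Y' ω
    have h2 := mul_le_mul_of_nonneg_left (le_supN Y ω) (by positivity : 0 ≤ π.h i * L)
    have h3 := mul_le_mul_of_nonneg_left (n2_prob_le_supN Y) (by positivity : 0 ≤ π.h i * L)
    have h4 := mul_le_mul_of_nonneg_left (hK.abs_f_le X (X ω)) hh0
    have h5 : L * (π.h i * supN Y) ≤ L ^ 2 * (π.h i * supN Y) :=
      mul_le_mul_of_nonneg_right hLL2 (mul_nonneg hh0 (supN_nonneg Y))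
    have h6 : 0 ≤ L ^ 2 * (π.h i * supN Y) :=
      mul_nonneg (by positivity) (mul_nonneg hh0 (supN_nonneg Y))
    have h7 : 0 ≤ L ^ 2 * (π.h i * supN Y') :=
      mul_nonneg (by positivity) (mul_nonneg hh0 (supN_nonneg Y'))
    linarith
  refine (implicit_step (K := 3 * L ^ 2) (by positivity) hh0 hh hK.nonneg (supN_nonneg Y')
    key).trans (le_of_eq ?_)
  ring

lemma IsPeriod.supN_le {X : ℕ → ℕ → Sample π Q ξ₀ → E d} {Y : ℕ → ℕ → Sample π Q ξ₀ → ℝ}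
    (hS : Standing L α R T c U D Q) (hP : IsPeriod c J k ξ X Y)
    (hδ : picC L * (T / N) ≤ 1) (hK : DataBound K c) {j : ℕ} (hj : j < J)
    {i : ℕ} (hi : π.j k ≤ i) (hi' : i ≤ π.j (k + 1)) :
    supN (Y (j + 1) i) ≤ (1 + 24 * L ^ 2 * (T / N)) * supN (Y (j + 1) (π.j (k + 1)))
      + 6 * K * (T / N) := by
  have hL := hS.one_le_L
  have hδ0 : 0 ≤ T / N := div_nonneg hS.T_pos.le (Nat.cast_nonneg N)
  have hL24 : L ^ 2 ≤ L ^ 4 := pow_le_pow_right₀ hL (by norm_num)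
  have hm1 : L ^ 2 * (T / N) ≤ L ^ 4 * (T / N) := mul_le_mul_of_nonneg_right hL24 hδ0
  have hK0 := hK.nonneg
  rw [picC] at hδ
  have g := (gronwall_backward (t := π.t) (a := fun i => supN (Y (j + 1) i)) (K := 12 * L ^ 2)
    (s := 2 * K) (by positivity) (by positivity) (fun i _ hi' => (π.t_lt i (hP.lt_n hi')).le)
    (supN_nonneg _) (fun i hi hi' => by
      obtain ⟨Z, hb⟩ := hP.back j hj i hi hi'
      refine hb.supN_le hK hS.h0 hL (hP.lt_n hi') (hP.adapted_X j hj.le i hi hi'.le) ?_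
      have : L ^ 2 * π.h i ≤ L ^ 2 * (T / N) :=
        mul_le_mul_of_nonneg_left (π.h_le hP.lt hi hi') (by positivity)
      linarith) i hi hi').2
  have hx := hP.exp_le (K := 12 * L ^ 2) (by positivity) (by linarith) hi hi' le_rfl
  have hd := π.t_sub_le hP.lt hi hi' le_rfl
  have hd0 := π.t_mono hi' (π.j_le (k + 1) hP.lt)
  have hs := supN_nonneg (Y (j + 1) (π.j (k + 1)))
  calc supN (Y (j + 1) i) ≤ _ := g
    _ ≤ (1 + 2 * (12 * L ^ 2 * (T / N)))
        * (supN (Y (j + 1) (π.j (k + 1))) + (T / N) * (2 * K)) := by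
      have : 0 ≤ (π.t (π.j (k + 1)) - π.t i) * (2 * K) := mul_nonneg (by linarith) (by positivity)
      gcongr
    _ ≤ _ := by
      have : (24 * (L ^ 2 * (T / N))) * ((T / N) * K) ≤ 2 * ((T / N) * K) :=
        mul_le_mul_of_nonneg_right (by linarith) (by positivity)
      linarith

/-- The uniform bound of the output of the solver, `n` levels below the terminal one. -/
noncomputable def supB (K L δ : ℝ) (n : ℕ) : ℝ :=
  K + acc (24 * L ^ 2 * δ) (6 * K * δ + 24 * L ^ 2 * δ * K) n

lemma supB_mono (hK : 0 ≤ K) {δ : ℝ} (hδ : 0 ≤ δ) : Monotone (supB K L δ) := fun _ _ h =>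
  add_le_add le_rfl (acc_mono (by positivity) (by positivity) h)

lemma IsPeriod.supN_le_supB {X : ℕ → ℕ → Sample π Q ξ₀ → E d} {Y : ℕ → ℕ → Sample π Q ξ₀ → ℝ}
    (hS : Standing L α R T c U D Q) (hP : IsPeriod c J k ξ X Y)
    (hδ : picC L * (T / N) ≤ 1) (hK : DataBound K c)
    (hend : ∀ j < J, supN (Y (j + 1) (π.j (k + 1))) ≤ supB K L (T / N) (N - (k + 1)))
    {j : ℕ} (hj : j ≤ J) {i : ℕ} (hi : π.j k ≤ i) (hi' : i ≤ π.j (k + 1)) :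
    supN (Y j i) ≤ supB K L (T / N) (N - k) := by
  have hδ0 : 0 ≤ T / N := div_nonneg hS.T_pos.le (Nat.cast_nonneg N)
  have hK0 := hK.nonneg
  have e : N - k = N - (k + 1) + 1 := by have := hP.lt; omega
  have ha := acc_nonneg (a := 24 * L ^ 2 * (T / N))
    (r := 6 * K * (T / N) + 24 * L ^ 2 * (T / N) * K)
    (by positivity) (by positivity)
  rcases j with _ | j
  · rw [hP.zero i hi hi']
    refine MKV.supN_le fun ω => ?_
    have := ha (N - k)
    rw [Pi.zero_apply, abs_zero, supB]
    positivity
  · refine (hP.supN_le hS hδ hK hj hi hi').trans ?_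
    have h := mul_le_mul_of_nonneg_left (hend j hj)
      (by positivity : 0 ≤ 1 + 24 * L ^ 2 * (T / N))
    rw [e, supB, acc]
    rw [supB] at h
    linarith

/-- The bound does not involve the forward components, so it is available before any control of
moments and without a bound on the error. -/
lemma solver_supN_le (hS : Standing L α R T c U D Q)
    (hδ : picC L * (T / N) ≤ 1) (hK : DataBound K c) {y : Sample π Q ξ₀ → ℝ}
    (h : IsSolverOutput π Q ξ₀ c J k ξ y) (hξ : Adapted (π.j k) ξ) :
    supN y ≤ supB K L (T / N) (N - k) := by
  induction h with
  | last ξ =>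
    rw [Nat.sub_self, supB, acc, add_zero]
    exact MKV.supN_le fun ω => hK.g _ _ (isP2_law ξ)
  | level k hk ξ X Y Z init call picard ih =>
    have hP := isPeriod_of_localOutput hk hξ init picard
    have hlt := π.j_lt hS.T_pos hk
    exact hP.supN_le_supB hS hδ hK (fun j hj => ih j hj (hP.adapted_X j hj.le _ hlt.le le_rfl))
      le_rfl le_rfl hlt.le

/-! #### Growth of the drift and of the decoupling field -/

/-- The growth constant of the drift. -/
noncomputable def kapC (L : ℝ) : ℝ := 12 * L ^ 2

lemma kapC_nonneg : 0 ≤ kapC L := by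
  rw [kapC]
  positivity

lemma norm_drift_le_rt (hS : Standing L α R T c U D Q)
    (hY : ∀ ω, |Y ω| ≤ (1 + 2 * L) * rt R X ω) (ω : Sample π Q ξ₀) :
    ‖drift c X Y ω‖ ≤ kapC L * rt R X ω := by
  have hL := hS.one_le_L
  have hL0 : 0 ≤ L := by linarith
  have h := norm_drift_le hS.h0 hS.hR X Y ω
  have h1 := le_rt (R := R) (X := X) ω
  have h2 := norm_le_rt (R := R) (X := X) ω
  have h3 := n2_norm_le_rt (R := R) (X := X) ω
  have h4 := hY ω
  have h5 : n2 (prob π Q ξ₀) Y ≤ (1 + 2 * L) * (2 * rt R X ω) := by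
    have h := n2_mono (p := prob π Q ξ₀) (V := Y) (W := fun ω => (1 + 2 * L) * rt R X ω)
      (fprob_prob π Q ξ₀).nonneg hY
    rw [n2_const_mul _ (by linarith)] at h
    exact h.trans (mul_le_mul_of_nonneg_left (n2_prob_rt_le ω) (by linarith))
  have h6 := mul_le_mul_of_nonneg_left (add_le_add (add_le_add h2 h4) (add_le_add h3 h5)) hL0
  have hr := rt_nonneg (R := R) (X := X) ω
  have h7 : 1 * rt R X ω ≤ L ^ 2 * rt R X ω := mul_le_mul_of_nonneg_right (one_le_pow₀ hL) hr
  have h8 : L * rt R X ω ≤ L ^ 2 * rt R X ω :=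
    mul_le_mul_of_nonneg_right (le_self_pow₀ hL (by norm_num)) hr
  rw [kapC]
  linarith

lemma abs_field_le_rt (hS : Standing L α R T c U D Q) {t : ℝ} (ht : t ∈ Icc 0 T)
    (X : Sample π Q ξ₀ → E d) (ω : Sample π Q ξ₀) :
    |field U t X ω| ≤ (1 + 2 * L) * rt R X ω := by
  have hL0 : 0 ≤ L := by linarith [hS.one_le_L]
  have h := abs_field_le hS.h1 hL0 hS.hR ht X ω
  have h1 := le_rt (R := R) (X := X) ω
  have h2 := mul_le_mul_of_nonneg_left (norm_le_rt (R := R) (X := X) ω) hL0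
  have h3 := mul_le_mul_of_nonneg_left (n2_norm_le_rt (R := R) (X := X) ω) hL0
  linarith

/-- The growth rate of the moments for bounded data. -/
noncomputable def groC (L α : ℝ) : ℝ := gC L (kapC L) α

/-- The growth rate of the decoupling field for bounded data. -/
noncomputable def fieldRate (L α : ℝ) : ℝ := 12 * L ^ 2 + groC L α

/-- The size of the terms of the expansion of the decoupling field. -/
noncomputable def fieldErr (d : ℕ) (L α : ℝ) : ℝ := 2 * EulerStep.itoC d L α * hC (kapC L) α

lemma groC_nonneg (hα : 0 ≤ α) : 0 ≤ groC L α := gC_nonneg kapC_nonneg hα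

lemma fieldErr_nonneg (hL : 0 ≤ L) : 0 ≤ fieldErr d L α := by
  have h1 := hC_nonneg (κ := kapC L) (α := α) kapC_nonneg
  have h2 : 0 ≤ EulerStep.itoC d L α := by
    have : 0 ≤ (L ^ 2) ^ α := Real.rpow_nonneg (by positivity) _
    unfold EulerStep.itoC
    positivity
  rw [fieldErr]
  positivity

/-- The decoupling field of bounded data, up to an error of the order of the mesh. -/
lemma n2_field_le_of_dataBound (hS : Standing L α R T c U D Q) (hK : DataBound K c)
    (hh : ∀ i < π.n, π.h i ≤ T / N) (hδ : picC L * (T / N) ≤ 1) :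
    ∀ m ≤ π.n, ∀ i, i + m = π.n → ∀ X : Sample π Q ξ₀ → E d, Adapted i X → ∀ w, Wt i w →
      n2 w (field U (π.t i) X) ≤ Real.exp (fieldRate L α * (T - π.t i))
        * (2 * K + (T - π.t i) * (4 * (K + L ^ 3))
          + (T - π.t i) * (fieldErr d L α * (√π.mesh * vq R α w X))) := by
  have hL := hS.one_le_L
  have hL0 : 0 ≤ L := by linarith
  have hR := hS.hR.one_le
  have hα : 0 ≤ α := zero_le_one.trans hS.one_le_α
  have hδ0 : 0 ≤ T / N := div_nonneg hS.T_pos.le (Nat.cast_nonneg N)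
  have hL24 : L ^ 2 ≤ L ^ 4 := pow_le_pow_right₀ hL (by norm_num)
  have hL1 : 1 ≤ L ^ 4 := one_le_pow₀ hL
  have hLL2 : L ≤ L ^ 2 := le_self_pow₀ hL (by norm_num)
  have hm1 : L ^ 2 * (T / N) ≤ L ^ 4 * (T / N) := mul_le_mul_of_nonneg_right hL24 hδ0
  have hm2 : T / N ≤ L ^ 4 * (T / N) := by nlinarith
  have hK0 := hK.nonneg
  have hg0 : 0 ≤ groC L α := groC_nonneg hα
  have hf0 : 0 ≤ fieldErr d L α := fieldErr_nonneg hL0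
  rw [picC] at hδ
  -- Backward induction on the number `m` of remaining grid steps. The variable X stays quantified
  -- because the step passes to another variable X'.
  intro m
  induction m with
  | zero =>
    intro _ i hi X hX w hw
    have : i = π.n := hi
    subst this
    rw [π.t_last]
    simp only [sub_self, mul_zero, Real.exp_zero, zero_mul, add_zero, one_mul]
    refine (n2_mono hw.nonneg (W := fun _ => K) fun ω => ?_).trans (hw.n2_const_le hK0)
    rw [field, hS.h1.classical.terminal _ _ (isP2_law X)]
    exact hK.g _ _ (isP2_law X)
  | succ m ih =>
    intro hm i hi X hX w hw
    have hin : i < π.n := by omega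
    have hh0 := (π.h_pos hin).le
    have hhδ := hh i hin
    have hti : π.t i ∈ Icc 0 T := ⟨π.t_nonneg hin.le, π.t_le hin.le⟩
    set u := field U (π.t i) X with hu
    set b := drift c X u with hb
    -- The field is represented along the Euler step whose drift is built from the field itself, so
    -- the drift gap in the expansion is zero and only the consistency error remains.
    set X' : Sample π Q ξ₀ → E d := fun ω =>
      X ω + π.h i • b ω + c.σ (X ω) (law π Q ξ₀ X) (dW π Q ξ₀ i ω) with hX'
    have hst : IsStep c i X b X' := fun ω => rfl
    have hba : Adapted i b := hX.drift hX.field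
    have hbb : ∀ ω, ‖b ω‖ ≤ kapC L * rt R X ω := norm_drift_le_rt hS (abs_field_le_rt hS hti X)
    have hvq := hst.vq_le hS.noise hL hS.h0 hR hα kapC_nonneg hin (by linarith) hX hba hbb hw
    have hH := n2_H_le hR hα kapC_nonneg hw hbb
    set u' := field U (π.t (i + 1)) X' with hu'
    have hih := ih (by omega) (i + 1) (by omega) X' (hst.adapted hX hba) w (hw.mono (Nat.le_succ i))
    set Hh := EulerStep.H R (treeStep X b) α with hHd
    have pt : ∀ ω, |u ω| ≤ (|condE π Q ξ₀ i u' ω|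
          + L * ‖condE π Q ξ₀ i (fun ω => u' ω • dW π Q ξ₀ i ω) ω‖)
        + π.h i * L * (|u ω| + n2 (prob π Q ξ₀) u) + π.h i * (K + L ^ 3)
        + π.h i * (EulerStep.itoC d L α * √(π.h i)) * Hh ω := by
      intro ω
      have x1 := hst.expansion (R := R) hS.noise hL hR hS.h0 hS.h1 hS.T_pos hin (by linarith) hX hba
        hα ω
      rw [← hu, ← hu', ← hb] at x1
      simp only [sub_self, norm_zero] at x1
      rw [n2_const_prob (fprob_prob π Q ξ₀).sum 0 le_rfl, add_zero, mul_zero, mul_zero,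
        zero_add] at x1
      set z := fieldZ c D (π.t i) X ω with hz
      set f₀ := c.f (X ω) (u ω) z (law π Q ξ₀ fun ω' => pair (X ω') (u ω')) with hf₀
      have hzL : ‖z‖ ≤ L * L := by
        rw [hz, fieldZ]
        refine (ContinuousLinearMap.le_opNorm _ _).trans ?_
        rw [LinearIsometryEquiv.norm_map]
        exact mul_le_mul (hS.h0.bdd_σ _ _ (isP2_law X)) (hS.h1.norm_dx_le hL0 hti _ (isP2_law X))
          (norm_nonneg _) hL0
      have hf := abs_f_sub_le hS.h0 hL0 X u (fun _ => 0) (X ω) (u ω) 0 z 0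
      simp only [sub_zero] at hf
      have hf2 := hK.abs_f_le X (X ω)
      have t1 := abs_sub_abs_le_abs_sub f₀ (c.f (X ω) 0 0 (law π Q ξ₀ fun ω' => pair (X ω') 0))
      -- L³ arises from the Lipschitz constant L in z and |σ†∂ₓU| ≤ L².
      have t2 : |f₀| ≤ K + L ^ 3 + L * (|u ω| + n2 (prob π Q ξ₀) u) := by
        have := mul_le_mul_of_nonneg_left hzL hL0
        linarith
      have t3 := mul_le_mul_of_nonneg_left t2 hh0
      have t4 : |u ω| ≤ |condE π Q ξ₀ i u' ω| + π.h i * |f₀|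
          + |condE π Q ξ₀ i u' ω - u ω + π.h i * f₀| := by
        have e : u ω = condE π Q ξ₀ i u' ω + π.h i * f₀
          - (condE π Q ξ₀ i u' ω - u ω + π.h i * f₀) := by ring
        have a1 := abs_sub (condE π Q ξ₀ i u' ω + π.h i * f₀)
          (condE π Q ξ₀ i u' ω - u ω + π.h i * f₀)
        have a2 := abs_add_le (condE π Q ξ₀ i u' ω) (π.h i * f₀)
        rw [← e] at a1
        rw [abs_mul, abs_of_nonneg hh0] at a2
        linarith
      have t5 : 0 ≤ L * ‖condE π Q ξ₀ i (fun ω => u' ω • dW π Q ξ₀ i ω) ω‖ := by positivity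
      linarith
    have key := n2_le_add₄ hw.nonneg pt
    have hhL : 0 ≤ π.h i * L := by positivity
    have hito : 0 ≤ EulerStep.itoC d L α := by
      have : 0 ≤ (L ^ 2) ^ α := Real.rpow_nonneg (by positivity) _
      unfold EulerStep.itoC
      positivity
    have hc : 0 ≤ π.h i * (EulerStep.itoC d L α * √(π.h i)) := by positivity
    rw [n2_const_mul _ hhL, n2_const_mul _ hc] at key
    have k2 := n2_bessel_le (L := L) hin hh0 hw u'
    have k3 := n2_add_le (p := w) (V := fun ω => |u ω|) (W := fun _ => n2 (prob π Q ξ₀) u) hw.nonneg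
    rw [n2_abs] at k3
    have k4 := hw.n2_n2_le u
    have k5 := mul_le_mul_of_nonneg_left (k3.trans (add_le_add le_rfl k4)) hhL
    have k6 := hw.n2_const_le (x := π.h i * (K + L ^ 3)) (by positivity)
    have hv0 : 0 ≤ vq R α w X := vq_nonneg
    have k7 : π.h i * (EulerStep.itoC d L α * √(π.h i)) * n2 w Hh
        ≤ π.h i * ((1 / 2) * (fieldErr d L α * (√π.mesh * vq R α w X))) := by
      have e : fieldErr d L α = 2 * EulerStep.itoC d L α * hC (kapC L) α := rfl
      have := n2_nonneg (p := w) (V := Hh)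
      calc _ ≤ π.h i * (EulerStep.itoC d L α * √π.mesh) * (hC (kapC L) α * vq R α w X) := by
            gcongr
            · exact π.h_le_mesh hin
            · exact hH
        _ = _ := by rw [e]; ring
    set x := n2 w u with hx
    set y := n2 w u' with hy
    have hx0 : 0 ≤ x := n2_nonneg
    have hy0 : 0 ≤ y := n2_nonneg
    set E₁ := fieldErr d L α * (√π.mesh * vq R α w X) with hE₁
    have hE₁0 : 0 ≤ E₁ := by positivity
    have hq : 3 * L ^ 2 * π.h i ≤ 1 / 2 := by
      have : L ^ 2 * π.h i ≤ L ^ 2 * (T / N) := mul_le_mul_of_nonneg_left hhδ (by positivity)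
      linarith
    have hstep := implicit_step (x := x) (y := y) (K := 3 * L ^ 2) (h := π.h i)
      (s := 2 * (K + L ^ 3) + (1 / 2) * E₁) (by positivity) hh0 hq (by positivity) hy0 (by
        have t1 : L ^ 2 * π.h i * y ≤ 3 * L ^ 2 * π.h i * y := by
          have : 0 ≤ L ^ 2 * π.h i * y := by positivity
          linarith
        have t2 : 3 * L * π.h i * x ≤ 3 * L ^ 2 * π.h i * x := by
          have : L * (π.h i * x) ≤ L ^ 2 * (π.h i * x) :=
            mul_le_mul_of_nonneg_right hLL2 (by positivity)
          linarith
        linarith)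
    set τ := T - π.t (i + 1) with hτ
    have hτ0 : 0 ≤ τ := by linarith [π.t_le (i := i + 1) (by omega)]
    have eτ : T - π.t i = π.h i + τ := by rw [hτ, Grid.h]; ring
    rw [eτ]
    set G := groC L α with hG
    have hF : fieldRate L α = 12 * L ^ 2 + G := rfl
    set F := fieldRate L α with hFd
    have hF0 : 0 ≤ F := by rw [hF]; positivity
    set M := 2 * K + τ * (4 * (K + L ^ 3)) with hM
    have hM0 : 0 ≤ M := by positivity
    have hy1 : y ≤ Real.exp (F * τ) * (Real.exp (G * π.h i) * (M + τ * E₁)) := by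
      refine hih.trans (mul_le_mul_of_nonneg_left ?_ (Real.exp_pos _).le)
      have e1 : 1 ≤ Real.exp (G * π.h i) := Real.one_le_exp (by positivity)
      have e2 := mul_le_mul_of_nonneg_right e1 hM0
      have e3 := mul_le_mul_of_nonneg_left hvq (by positivity : 0 ≤ τ * (fieldErr d L α * √π.mesh))
      have e4 : Real.exp (gC L (kapC L) α * π.h i) = Real.exp (G * π.h i) := rfl
      rw [e4] at e3
      rw [hE₁]
      linarith
    have hexp : (1 + 4 * (3 * L ^ 2) * π.h i) * (Real.exp (F * τ) * Real.exp (G * π.h i))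
        ≤ Real.exp (F * (π.h i + τ)) := by
      rw [← Real.exp_add]
      refine one_add_mul_exp_le.trans (le_of_eq ?_)
      congr 1
      rw [hF]; ring
    have hexp1 : 1 ≤ Real.exp (F * (π.h i + τ)) := Real.one_le_exp (by positivity)
    have s1 := mul_le_mul_of_nonneg_left hy1 (by positivity : 0 ≤ 1 + 4 * (3 * L ^ 2) * π.h i)
    have s2 := mul_le_mul_of_nonneg_right hexp (by positivity : 0 ≤ M + τ * E₁)
    have s3 := mul_le_mul_of_nonneg_right hexp1
      (by positivity : 0 ≤ π.h i * (2 * (2 * (K + L ^ 3) + (1 / 2) * E₁)))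
    rw [hM] at s1 s2
    linarith

/-- Since R dominates the uniform bound of Y, one has |Y| ≤ rt; the drift is then dominated
pointwise by `rt`, as the moment estimate requires. -/
lemma IsPeriod.vq_le {X : ℕ → ℕ → Sample π Q ξ₀ → E d} {Y : ℕ → ℕ → Sample π Q ξ₀ → ℝ}
    (hS : Standing L α R T c U D Q) (hP : IsPeriod c J k ξ X Y)
    (hδ : picC L * (T / N) ≤ 1) (hδg : groC L α * (T / N) ≤ 1) (hw : Wt (π.j k) w) {j : ℕ}
    (hj : j ≤ J) (hY : ∀ i, π.j k ≤ i → i < π.j (k + 1) → supN (Y j i) ≤ R)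
    (hi : π.j k ≤ i) (hi' : i ≤ π.j (k + 1)) :
    vq R α w (X j i) ≤ (1 + 2 * (groC L α * (T / N))) * vq R α w ξ := by
  have hL := hS.one_le_L
  have hα : 0 ≤ α := zero_le_one.trans hS.one_le_α
  have hδ0 : 0 ≤ T / N := div_nonneg hS.T_pos.le (Nat.cast_nonneg N)
  have hL1 : 1 ≤ L ^ 4 := one_le_pow₀ hL
  have hm2 : T / N ≤ L ^ 4 * (T / N) := by nlinarith
  rw [picC] at hδ
  have ind : ∀ i, π.j k ≤ i → i ≤ π.j (k + 1) →
      vq R α w (X j i) ≤ Real.exp (groC L α * (π.t i - π.t (π.j k))) * vq R α w ξ := by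
    intro i hi
    induction i, hi using Nat.le_induction with
    | base => intro _; rw [hP.first j hj]; simp
    | succ i hi ih =>
      intro hi'
      have hin := hP.lt_n hi'
      refine ((hP.step j hj i hi hi').vq_le hS.noise hL hS.h0 hS.hR.one_le hα kapC_nonneg hin
        (by linarith [π.h_le hP.lt hi hi']) (hP.adapted_X j hj i hi (by omega))
        ((hP.adapted_X j hj i hi (by omega)).drift (hP.adapted_Y j hj i hi hi'))
        (norm_drift_le_rt hS fun ω => ?_) (hw.mono hi)).trans ?_
      · have h1 := (le_supN _ ω).trans (hY i hi hi')
        have h2 := le_rt (R := R) (X := X j i) ω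
        have h3 := mul_nonneg (by linarith : 0 ≤ 2 * L) (rt_nonneg (R := R) (X := X j i) ω)
        linarith
      · have h1 := mul_le_mul_of_nonneg_left (ih (by omega))
          (Real.exp_pos (gC L (kapC L) α * π.h i)).le
        refine h1.trans (le_of_eq ?_)
        rw [← mul_assoc, ← Real.exp_add]
        congr 2
        rw [groC, Grid.h]
        ring
  exact (ind i hi hi').trans (mul_le_mul_of_nonneg_right
    (hP.exp_le (groC_nonneg hα) hδg le_rfl hi hi') vq_nonneg)

/-- The growth rate of the error from one level to the previous one, for bounded data. -/
noncomputable def bddRate (L α : ℝ) : ℝ := 12 * picC L + 2 * groC L α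

/-- The bound of the decoupling field, for bounded data. -/
noncomputable def bddField (K L α T : ℝ) : ℝ :=
  Real.exp (fieldRate L α * T) * (2 * K + T * (4 * (K + L ^ 3)))

/-- The error of order `√|π|` produced on one period, for bounded data. -/
noncomputable def bddErr (d : ℕ) (L α T : ℝ) : ℝ :=
  72 * locC d L α * hC (kapC L) α
    + 3 * picC L * (Real.exp (fieldRate L α * T) * (T * fieldErr d L α))

/-- Two errors are accumulated separately. The Picard error carries no moment of ξ, because the gap
of the zero guess is U, bounded up to O(√|π|). The discretization error carries `vq`. Moments are
controlled through the uniform bound of Y, so the error need not be small. -/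
theorem solver_error_bounded (hS : Standing L α R T c U D Q) (hJ : 1 ≤ J) (hN : 1 ≤ N)
    (hK : DataBound K c) (hKR : supB K L (T / N) N ≤ R) (hh : ∀ i < π.n, π.h i ≤ T / N)
    (hδ : picC L * (T / N) ≤ 1 / 4) (hδg : groC L α * (T / N) ≤ 1) {y : Sample π Q ξ₀ → ℝ}
    (h : IsSolverOutput π Q ξ₀ c J k ξ y) (hξ : Adapted (π.j k) ξ) :
    ∀ w, Wt (π.j k) w → n2 w (fun ω => y ω - field U (π.t (π.j k)) ξ ω)
      ≤ acc (bddRate L α * (T / N)) ((picC L * (T / N)) ^ J * bddField K L α T) (N - k)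
        + acc (bddRate L α * (T / N)) (bddErr d L α T * (T / N) * √π.mesh) (N - k)
          * vq R α w ξ := by
  have hL := hS.one_le_L
  have hL0 : 0 ≤ L := by linarith
  have hT := hS.T_pos
  have hK0 := hK.nonneg
  have hα : 0 ≤ α := zero_le_one.trans hS.one_le_α
  have hδ0 : 0 ≤ T / N := div_nonneg hS.T_pos.le (Nat.cast_nonneg N)
  have hp0 : 0 ≤ picC L * (T / N) := mul_nonneg (picC_nonneg hL) hδ0
  have hg0 : 0 ≤ groC L α * (T / N) := mul_nonneg (groC_nonneg hα) hδ0
  have hc0 := locC_nonneg (d := d) (α := α) hL0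
  have hf0 : 0 ≤ fieldErr d L α := fieldErr_nonneg hL0
  have hC0 := hC_nonneg (κ := kapC L) (α := α) kapC_nonneg
  have hpc := picC_nonneg hL
  set a := bddRate L α * (T / N) with ha
  have ha' : a = 12 * (picC L * (T / N)) + 2 * (groC L α * (T / N)) := by rw [ha, bddRate]; ring
  have ha0 : 0 ≤ a := by linarith
  set rA := (picC L * (T / N)) ^ J * bddField K L α T with hrA
  set rB := bddErr d L α T * (T / N) * √π.mesh with hrB
  have hMF : 0 ≤ bddField K L α T := by rw [bddField]; positivity
  have hrA0 : 0 ≤ rA := by positivity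
  have hrB0 : 0 ≤ rB := by rw [hrB, bddErr]; positivity
  induction h with
  | last ξ =>
    intro w hw
    rw [solver_last_eq hS hN ξ]
    simp [n2, acc]
  | level k hk ξ X Y Z init call picard ih =>
    intro w hw
    have hP := isPeriod_of_localOutput hk hξ init picard
    have hlt := π.j_lt hS.T_pos hk
    have hv : 0 ≤ vq R α w ξ := vq_nonneg
    set v := vq R α w ξ with hvd
    have hrec : ∀ r, acc a r (N - k) = (1 + a) * acc a r (N - (k + 1)) + r := by
      intro r
      rw [← acc]; congr 1; omega
    set εA := acc a rA (N - (k + 1)) with hεA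
    set εB := acc a rB (N - (k + 1)) with hεB
    have hεA0 : 0 ≤ εA := acc_nonneg ha0 hrA0 _
    have hεB0 : 0 ≤ εB := acc_nonneg ha0 hrB0 _
    have hYR : ∀ j ≤ J, ∀ i, π.j k ≤ i → i < π.j (k + 1) → supN (Y j i) ≤ R :=
      fun j hj i hi hi' => (hP.supN_le_supB hS (by linarith) hK (fun j hj => solver_supN_le hS
        (by linarith) hK (call j hj) (hP.adapted_X j hj.le _ hlt.le le_rfl)) hj hi hi'.le).trans
        ((supB_mono hK0 hδ0 (Nat.sub_le _ _)).trans hKR)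
    have hvq : ∀ j ≤ J, ∀ i, π.j k ≤ i → i ≤ π.j (k + 1) →
        vq R α w (X j i) ≤ (1 + 2 * (groC L α * (T / N))) * v := fun j hj i hi hi' =>
      hP.vq_le hS (by linarith) hδg hw hj (hYR j hj) hi hi'
    have hx3 : (1 + 2 * (groC L α * (T / N))) * v ≤ 3 * v :=
      mul_le_mul_of_nonneg_right (by linarith) hv
    have hih : ∀ j < J, n2 w (fun ω => Y (j + 1) (π.j (k + 1)) ω
        - field U (π.t (π.j (k + 1))) (X j (π.j (k + 1))) ω)
        ≤ εA + εB * ((1 + 2 * (groC L α * (T / N))) * v) := fun j hj =>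
      (ih j hj (hP.adapted_X j hj.le _ hlt.le le_rfl) w (hw.mono hlt.le)).trans
        (add_le_add le_rfl (mul_le_mul_of_nonneg_left (hvq j hj.le _ hlt.le le_rfl) hεB0))
    have hm0 : 0 ≤ √π.mesh := Real.sqrt_nonneg _
    set Φ := Real.exp (fieldRate L α * T) * (T * fieldErr d L α) with hΦ
    have hΦ0 : 0 ≤ Φ := by positivity
    have key := hP.picard_error_le hS hδ hw (e := εA + εB * ((1 + 2 * (groC L α * (T / N))) * v))
      (G₀ := bddField K L α T + 3 * Φ * (√π.mesh * v)) (ℓ := 3 * hC (kapC L) α * v)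
      (by positivity) hih
      (fun i hi hi' => by
        have hin := hP.lt_n hi'
        refine (n2_field_le_of_dataBound hS hK hh (by linarith) (π.n - i) (by omega) i (by omega)
          (X 0 i) (hP.adapted_X 0 (Nat.zero_le _) i hi hi'.le) w (hw.mono hi)).trans ?_
        have ht0 := π.t_nonneg hin.le
        have hτ0 : 0 ≤ T - π.t i := by linarith [π.t_le hin.le]
        have hτT : T - π.t i ≤ T := by linarith
        have hF0 : 0 ≤ fieldRate L α := by
          have := groC_nonneg (L := L) hα
          rw [fieldRate]; positivity
        have h1 := (hvq 0 (Nat.zero_le _) i hi hi'.le).trans hx3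
        have hv0 : 0 ≤ vq R α w (X 0 i) := vq_nonneg
        calc _ ≤ Real.exp (fieldRate L α * T) * (2 * K + T * (4 * (K + L ^ 3))
              + T * (fieldErr d L α * (√π.mesh * (3 * v)))) := by
              have : Real.exp (fieldRate L α * (T - π.t i)) ≤ Real.exp (fieldRate L α * T) :=
                Real.exp_le_exp.2 (mul_le_mul_of_nonneg_left hτT hF0)
              gcongr
          _ = _ := by rw [bddField, hΦ]; ring)
      (by positivity)
      (fun j hj i hi hi' => by
        refine (n2_H_le hS.hR.one_le hα kapC_nonneg hw (norm_drift_le_rt hS fun ω => ?_)).trans ?_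
        · have h1 := (le_supN _ ω).trans (hYR j hj.le i hi hi')
          have h2 := le_rt (R := R) (X := X j i) ω
          have h3 := mul_nonneg (by linarith : 0 ≤ 2 * L) (rt_nonneg (R := R) (X := X j i) ω)
          linarith
        · have h1 := mul_le_mul_of_nonneg_left ((hvq j hj.le i hi hi'.le).trans hx3) hC0
          have e : vw R w (X j i) + qm R α (X j i) = vq R α w (X j i) := rfl
          rw [e]
          linarith) (j := J - 1) (by omega)
    rw [Nat.sub_add_cancel hJ] at key
    refine key.trans ?_
    rw [hrec, hrec, ← hεA, ← hεB]
    have h1 : (1 + 4 * (picC L * (T / N))) * (1 + 2 * (groC L α * (T / N))) ≤ 1 + a := by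
      rw [ha']
      nlinarith
    have h2 := mul_le_mul_of_nonneg_right h1 (mul_nonneg hεB0 hv)
    have h3 : (1 + 4 * (picC L * (T / N))) * εA ≤ (1 + a) * εA :=
      mul_le_mul_of_nonneg_right (by linarith) hεA0
    -- The part of size √|π| in the bound of U is contracted by q^J ≤ q, hence is of order δ√|π|
    -- like the other discretization errors.
    have h4 : (picC L * (T / N)) ^ J * (3 * Φ * (√π.mesh * v))
        ≤ (picC L * (T / N)) * (3 * Φ * (√π.mesh * v)) :=
      mul_le_mul_of_nonneg_right (pow_le_of_le_one hp0 (by linarith) (by omega)) (by positivity)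
    have h5 : rB * v
        = (72 * locC d L α * hC (kapC L) α + 3 * picC L * Φ) * (T / N) * √π.mesh * v := by
      rw [hrB, bddErr]
    linarith

end bounded

end MKV

namespace MKV

/-! ### Well-posedness of the algorithm -/

section grid
variable {T : ℝ} {N : ℕ} (π : Grid T N)

lemma Grid.t_lt_t {i k : ℕ} (h : i < k) (hk : k ≤ π.n) : π.t i < π.t k :=
  (π.t_lt i (h.trans_le hk)).trans_le (π.t_mono h hk)

lemma Grid.t_j_zero : π.t (π.j 0) = 0 := by
  rw [π.t_j 0 (Nat.zero_le N)]
  simp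

lemma Grid.j_zero : π.j 0 = 0 := by
  by_contra h
  have := π.t_lt_t (Nat.pos_of_ne_zero h) (π.j_le 0 (Nat.zero_le N))
  rw [π.t_zero, π.t_j_zero] at this
  exact lt_irrefl _ this

lemma Grid.j_last (hN : 1 ≤ N) : π.j N = π.n := by
  by_contra h
  have := π.t_lt_t (lt_of_le_of_ne (π.j_le N le_rfl) h) le_rfl
  rw [π.t_last, π.t_j_last hN] at this
  exact lt_irrefl _ this

/-- The grid contains all r_k, so each of its intervals lies in one period. -/
lemma Grid.h_le_of_lt (hN : 1 ≤ N) : ∀ i < π.n, π.h i ≤ T / N := by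
  have : ∀ K ≤ N, ∀ i < π.j K, π.h i ≤ T / N := by
    intro K
    induction K with
    | zero => intro _ i hi; rw [π.j_zero] at hi; omega
    | succ K ih =>
      intro hK i hi
      by_cases h : i < π.j K
      · exact ih (by omega) i h
      · exact π.h_le hK (not_lt.1 h) hi
  intro i hi
  exact this N le_rfl i (by rwa [π.j_last hN])

end grid

section sequences
variable {S : Type}

lemma exists_backward {F : ℕ → S → S → Prop} (hF : ∀ i s, ∃ s', F i s s') (b : ℕ) (η : S) :
    ∃ Y : ℕ → S, Y b = η ∧ ∀ i < b, F i (Y (i + 1)) (Y i) := by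
  choose g hg using hF
  -- The index `i` is reached from `b` after b - i steps; beyond `b` the truncated subtraction
  -- returns `η`.
  refine ⟨fun i => Nat.rec η (fun m s => g (b - (m + 1)) s) (b - i), by simp, fun i hi => ?_⟩
  have e : b - i = b - (i + 1) + 1 := by omega
  have e2 : b - (b - (i + 1) + 1) = i := by omega
  simp only [e, e2]
  exact hg i _

lemma exists_forward (G : ℕ → S → S) (a : ℕ) (x : S) :
    ∃ X : ℕ → S, X a = x ∧ ∀ i, a ≤ i → X (i + 1) = G i (X i) := by
  refine ⟨fun i => Nat.rec x (fun m s => G (a + m) s) (i - a), by simp, fun i hi => ?_⟩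
  have e : i + 1 - a = i - a + 1 := by omega
  have e2 : a + (i - a) = i := by omega
  simp only [e, e2]

end sequences

section wellposed
variable {d : ℕ} {T : ℝ} {N : ℕ} {Λ L : ℝ} {π : Grid T N} {Q : Quantization d Λ}
  {ξ₀ : InitialLaw d} {c : Coeffs d} {J k i : ℕ}
  {f : E d → ℝ → E d → Measure (EY d) → ℝ}

variable (π Q ξ₀) in
/-- `f` is `L`-Lipschitz continuous in `y` and in the joint law. -/
def DriverLip (L : ℝ) (f : E d → ℝ → E d → Measure (EY d) → ℝ) : Prop :=
  ∀ (X : Sample π Q ξ₀ → E d) (Y Y₁ : Sample π Q ξ₀ → ℝ) (x : E d) (y y₁ : ℝ) (z : E d),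
    |f x y z (law π Q ξ₀ fun ω' => pair (X ω') (Y ω'))
      - f x y₁ z (law π Q ξ₀ fun ω' => pair (X ω') (Y₁ ω'))|
      ≤ L * (|y - y₁| + n2 (prob π Q ξ₀) fun ω => Y ω - Y₁ ω)

lemma driverLip_zero (hL : 0 ≤ L) : DriverLip π Q ξ₀ L fun _ _ _ _ => 0 := by
  intro X Y Y₁ x y y₁ z
  rw [sub_self, abs_zero]
  exact mul_nonneg hL (add_nonneg (abs_nonneg _) n2_nonneg)

lemma driverLip_f (h0 : H0 L c) (hL : 0 ≤ L) : DriverLip π Q ξ₀ L c.f := by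
  intro X Y Y₁ x y y₁ z
  refine (abs_f_sub_le h0 hL X Y Y₁ x y y₁ z z).trans (le_of_eq ?_)
  rw [sub_self, norm_zero, add_zero]

lemma n2_prob_le_dist (Y Y₁ : Sample π Q ξ₀ → ℝ) :
    n2 (prob π Q ξ₀) (fun ω => Y ω - Y₁ ω) ≤ dist Y Y₁ :=
  (n2_mono (fprob_prob π Q ξ₀).nonneg fun ω => dist_le_pi_dist Y Y₁ ω).trans
    (n2_const_prob (fprob_prob π Q ξ₀).sum _ dist_nonneg).le

/-- The implicit step of the backward component has exactly one solution. -/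
lemma existsUnique_implicit (hf : DriverLip π Q ξ₀ L f) (hL : 0 ≤ L) (hh0 : 0 ≤ π.h i)
    (hh : 2 * L * π.h i < 1) (X Z : Sample π Q ξ₀ → E d) (V : Sample π Q ξ₀ → ℝ) :
    ∃! Y : Sample π Q ξ₀ → ℝ, Y = condE π Q ξ₀ i fun ω => V ω +
      π.h i * f (X ω) (Y ω) (Z ω) (law π Q ξ₀ fun ω' => pair (X ω') (Y ω')) := by
  set Φ : (Sample π Q ξ₀ → ℝ) → Sample π Q ξ₀ → ℝ := fun Y => condE π Q ξ₀ i fun ω => V ω +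
      π.h i * f (X ω) (Y ω) (Z ω) (law π Q ξ₀ fun ω' => pair (X ω') (Y ω')) with hΦ
  -- The factor 2 counts the dependence of the driver on the value of Y and on its law.
  have hLip : ∀ Y Y₁, dist (Φ Y) (Φ Y₁) ≤ 2 * L * π.h i * dist Y Y₁ := by
    intro Y Y₁
    have hD : 0 ≤ 2 * L * π.h i * dist Y Y₁ := by positivity
    have pt : ∀ ω, |(V ω + π.h i * f (X ω) (Y ω) (Z ω) (law π Q ξ₀ fun ω' => pair (X ω') (Y ω')))
        - (V ω + π.h i * f (X ω) (Y₁ ω) (Z ω) (law π Q ξ₀ fun ω' => pair (X ω') (Y₁ ω')))|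
        ≤ 2 * L * π.h i * dist Y Y₁ := by
      intro ω
      have h1 := hf X Y Y₁ (X ω) (Y ω) (Y₁ ω) (Z ω)
      have h2 : |Y ω - Y₁ ω| ≤ dist Y Y₁ := dist_le_pi_dist Y Y₁ ω
      have h3 := n2_prob_le_dist Y Y₁
      have h4 := mul_le_mul_of_nonneg_left (h1.trans (mul_le_mul_of_nonneg_left
        (add_le_add h2 h3) hL)) hh0
      rw [add_sub_add_left_eq_sub, ← mul_sub, abs_mul, abs_of_nonneg hh0]
      linarith
    refine (dist_pi_le_iff hD).2 fun ω => ?_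
    rw [Real.dist_eq, hΦ]
    simp only
    have e := congrFun (condE_sub (π := π) (Q := Q) (ξ₀ := ξ₀) i
      (fun ω => V ω + π.h i * f (X ω) (Y ω) (Z ω) (law π Q ξ₀ fun ω' => pair (X ω') (Y ω')))
      (fun ω => V ω + π.h i * f (X ω) (Y₁ ω) (Z ω) (law π Q ξ₀ fun ω' => pair (X ω') (Y₁ ω')))) ω
    rw [← e]
    refine abs_le.2 ⟨?_, ?_⟩
    · have := condE_mono i (fun ω => (abs_le.1 (pt ω)).1) ω
      rwa [condE_const] at this
    · have := condE_mono i (fun ω => (abs_le.1 (pt ω)).2) ω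
      rwa [condE_const] at this
  have hC : ContractingWith (Real.toNNReal (2 * L * π.h i)) Φ :=
    ⟨by rw [← NNReal.coe_lt_coe, Real.coe_toNNReal _ (by positivity)]; exact_mod_cast hh,
      LipschitzWith.of_dist_le_mul fun Y Y₁ => by
        rw [Real.coe_toNNReal _ (by positivity)]; exact hLip Y Y₁⟩
  exact ⟨hC.fixedPoint Φ, hC.fixedPoint_isFixedPt.symm, fun Y hY =>
    hC.fixedPoint_unique hY.symm⟩

lemma exists_localOutput (hf : DriverLip π Q ξ₀ L f) (hL : 0 ≤ L) (hk : k < N)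
    (hh : ∀ i < π.n, 2 * L * π.h i < 1) (X' : ℕ → Sample π Q ξ₀ → E d) (η : Sample π Q ξ₀ → ℝ) :
    ∃ X Y Z, IsLocalOutput π Q ξ₀ c k X' η f X Y Z := by
  have hn := π.j_le (k + 1) hk
  -- The guard restricts the implicit equation to indices of the grid, where the step size is known
  -- to be small.
  obtain ⟨Y, hY, hYs⟩ := exists_backward (F := fun i V Y => i < π.j (k + 1) →
    Y = condE π Q ξ₀ i fun ω => V ω + π.h i * f (X' i ω) (Y ω)
      (condE π Q ξ₀ i (fun ω => (V ω / π.h i) • dW π Q ξ₀ i ω) ω)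
      (law π Q ξ₀ fun ω' => pair (X' i ω') (Y ω'))) (fun i V => by
      by_cases hi : i < π.j (k + 1)
      · obtain ⟨Y, hY, -⟩ := existsUnique_implicit hf hL (π.h_pos (hi.trans_le hn)).le
          (hh i (hi.trans_le hn)) (X' i)
          (condE π Q ξ₀ i (fun ω => (V ω / π.h i) • dW π Q ξ₀ i ω)) V
        exact ⟨Y, fun _ => hY⟩
      · exact ⟨0, fun h => absurd h hi⟩) (π.j (k + 1)) η
  obtain ⟨X, hX, hXs⟩ := exists_forward (fun i (X : Sample π Q ξ₀ → E d) ω => X ω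
      + π.h i • c.b (X ω) (Y i ω) (law π Q ξ₀ fun ω' => pair (X ω') (Y i ω'))
      + c.σ (X ω) (law π Q ξ₀ X) (dW π Q ξ₀ i ω)) (π.j k) (X' (π.j k))
  refine ⟨X, Y, fun i => if i = π.j (k + 1) then 0 else
    condE π Q ξ₀ i fun ω => (Y (i + 1) ω / π.h i) • dW π Q ξ₀ i ω, hY, by simp,
    fun i _ hi' => ?_, fun i _ hi' => ?_, hX, fun i hi _ ω => ?_⟩
  · rw [if_neg hi'.ne]
    exact hYs i hi' hi'
  · rw [if_neg hi'.ne]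
  · rw [hXs i hi]

/-- The defining relations leave the indices outside the period free, so uniqueness is claimed on
the period only; this is all that the solver reads. -/
lemma localOutput_unique (hf : DriverLip π Q ξ₀ L f) (hL : 0 ≤ L) (hk : k < N)
    (hh : ∀ i < π.n, 2 * L * π.h i < 1) (hlt : π.j k < π.j (k + 1))
    {X' X₁' X X₁ Z Z₁ : ℕ → Sample π Q ξ₀ → E d} {Y Y₁ : ℕ → Sample π Q ξ₀ → ℝ}
    {η : Sample π Q ξ₀ → ℝ} (h : IsLocalOutput π Q ξ₀ c k X' η f X Y Z)
    (h₁ : IsLocalOutput π Q ξ₀ c k X₁' η f X₁ Y₁ Z₁)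
    (hX' : ∀ i, π.j k ≤ i → i ≤ π.j (k + 1) → X' i = X₁' i) :
    ∀ i, π.j k ≤ i → i ≤ π.j (k + 1) → X i = X₁ i ∧ Y i = Y₁ i := by
  have hn := π.j_le (k + 1) hk
  have hY : ∀ i, π.j k ≤ i → i ≤ π.j (k + 1) → Y i = Y₁ i := by
    intro i hi hi'
    induction hm : π.j (k + 1) - i generalizing i with
    | zero =>
      have : i = π.j (k + 1) := by omega
      rw [this, h.Y_last, h₁.Y_last]
    | succ m ih =>
      have hlt : i < π.j (k + 1) := by omega
      have e := ih (i + 1) (by omega) hlt (by omega)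
      have eZ : Z i = Z₁ i := by rw [h.Z_step i hi hlt, h₁.Z_step i hi hlt, e]
      have s := h.Y_step i hi hlt
      have s₁ := h₁.Y_step i hi hlt
      rw [← e, ← eZ, ← hX' i hi hi'] at s₁
      exact (existsUnique_implicit hf hL (π.h_pos (hlt.trans_le hn)).le (hh i (hlt.trans_le hn))
        (X' i) (Z i) (Y (i + 1))).unique s s₁
  intro i hi
  induction i, hi using Nat.le_induction with
  | base =>
    intro hi'
    exact ⟨by rw [h.X_first, h₁.X_first, hX' _ le_rfl hlt.le], hY _ le_rfl hi'⟩
  | succ i hi ih =>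
    intro hi'
    have e := (ih (by omega)).1
    refine ⟨funext fun ω => ?_, hY _ (by omega) hi'⟩
    rw [h.X_step i hi hi', h₁.X_step i hi hi', e, hY i hi (by omega)]

/-- The solver is well posed at every level. -/
theorem solver_wellPosed (h0 : H0 L c) (hL : 0 ≤ L) (hT : 0 < T)
    (hh : ∀ i < π.n, 2 * L * π.h i < 1) : ∀ m ≤ N, ∀ k, k + m = N → ∀ ξ : Sample π Q ξ₀ → E d,
      ∃ y, ∀ Y, IsSolverOutput π Q ξ₀ c J k ξ Y ↔ Y = y := by
  intro m
  induction m with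
  | zero =>
    intro _ k hk ξ
    have : k = N := hk
    subst this
    refine ⟨fun ω => c.g (ξ ω) (law π Q ξ₀ ξ), fun Y => ⟨fun h => ?_, fun h => h ▸ .last ξ⟩⟩
    cases h with
    | last => rfl
    | level _ hk => exact absurd hk (lt_irrefl _)
  | succ m ih =>
    intro hm k hk ξ
    have hkN : k < N := by omega
    have hlt := π.j_lt hT hkN
    choose sol hsol using ih (by omega) (k + 1) (by omega)
    have hf : DriverLip π Q ξ₀ L c.f := driverLip_f h0 hL
    have hz : DriverLip π Q ξ₀ L fun _ _ _ _ => 0 := driverLip_zero hL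
    obtain ⟨X₀, Y₀, Z₀, init⟩ := exists_localOutput (c := c) hz hL hkN hh (fun _ => ξ) 0
    have next : ∀ X' : ℕ → Sample π Q ξ₀ → E d, ∃ S : (ℕ → Sample π Q ξ₀ → E d) ×
        (ℕ → Sample π Q ξ₀ → ℝ) × (ℕ → Sample π Q ξ₀ → E d),
        S.2.1 (π.j (k + 1)) = sol (X' (π.j (k + 1))) ∧
        IsLocalOutput π Q ξ₀ c k X' (S.2.1 (π.j (k + 1))) c.f S.1 S.2.1 S.2.2 := by
      intro X'
      obtain ⟨X, Y, Z, h⟩ := exists_localOutput (c := c) hf hL hkN hh X' (sol (X' (π.j (k + 1))))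
      have e := h.Y_last
      rw [← e] at h
      exact ⟨(X, Y, Z), e, h⟩
    choose nx hnx using next
    -- The Picard iterates form a recursion: `nx` calls the solver of the next level on the current
    -- forward component and then runs the local solver.
    obtain ⟨S, hS0, hS⟩ := exists_forward (fun (_ : ℕ) (S : (ℕ → Sample π Q ξ₀ → E d) ×
        (ℕ → Sample π Q ξ₀ → ℝ) × (ℕ → Sample π Q ξ₀ → E d)) => nx S.1) 0 (X₀, Y₀, Z₀)
    have hS0' : (S 0).1 = X₀ ∧ (S 0).2.1 = Y₀ ∧ (S 0).2.2 = Z₀ := by rw [hS0]; exact ⟨rfl, rfl, rfl⟩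
    have hend : ∀ j, (S (j + 1)).2.1 (π.j (k + 1)) = sol ((S j).1 (π.j (k + 1))) := fun j => by
      rw [hS j (Nat.zero_le j)]; exact (hnx _).1
    have hloc : ∀ j, IsLocalOutput π Q ξ₀ c k (S j).1 ((S (j + 1)).2.1 (π.j (k + 1))) c.f
        (S (j + 1)).1 (S (j + 1)).2.1 (S (j + 1)).2.2 := fun j => by
      rw [hS j (Nat.zero_le j)]; exact (hnx _).2
    have hinit : IsLocalOutput π Q ξ₀ c k (fun _ => ξ) 0 (fun _ _ _ _ => 0)
        (S 0).1 (S 0).2.1 (S 0).2.2 := by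
      rw [hS0'.1, hS0'.2.1, hS0'.2.2]; exact init
    refine ⟨(S J).2.1 (π.j k), fun Y => ⟨fun h => ?_, fun h => ?_⟩⟩
    · cases h with
      | last => exact absurd hkN (lt_irrefl _)
      | level _ _ _ X Y Z init call picard =>
        -- Any other run agrees iterate by iterate: the induction on levels fixes the values of the
        -- calls, and local outputs are unique.
        have ind : ∀ j ≤ J, ∀ i, π.j k ≤ i → i ≤ π.j (k + 1) →
            X j i = (S j).1 i ∧ Y j i = (S j).2.1 i := by
          intro j
          induction j with
          | zero =>
            intro _
            exact localOutput_unique hz hL hkN hh hlt init hinit fun _ _ _ => rfl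
          | succ j ih =>
            intro hj
            have hX := ih (by omega)
            have e : Y (j + 1) (π.j (k + 1)) = (S (j + 1)).2.1 (π.j (k + 1)) := by
              rw [(hsol _ _).1 (call j hj), hend j, (hX _ hlt.le le_rfl).1]
            have hp := picard j hj
            rw [e] at hp
            exact localOutput_unique hf hL hkN hh hlt hp (hloc j) fun i hi hi' => (hX i hi hi').1
        exact (ind J le_rfl _ le_rfl hlt.le).2
    · rw [h]
      exact .level k hkN ξ (fun j => (S j).1) (fun j => (S j).2.1) (fun j => (S j).2.2) hinit
        (fun j _ => (hsol _ _).2 (hend j)) fun j _ => hloc j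

/-- The output of the solver at the initial time is constant on each tree. -/
lemma adapted_solver_zero (hT : 0 < T) (hN : 1 ≤ N) (hJ : 1 ≤ J) {ξ : Sample π Q ξ₀ → E d}
    {y : Sample π Q ξ₀ → ℝ} (h : IsSolverOutput π Q ξ₀ c J 0 ξ y) : Adapted 0 y := by
  cases h with
  | last => omega
  | level _ hk _ X Y Z init call picard =>
    obtain ⟨j, rfl⟩ : ∃ j, J = j + 1 := ⟨J - 1, by omega⟩
    have := (picard j (Nat.lt_succ_self j)).adapted_Y le_rfl (π.j_lt hT hk)
    rwa [π.j_zero] at this ⊢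

end wellposed

end MKV

namespace MKV

/-! ### Enlarged constants. -/

section final
variable {d : ℕ} {T : ℝ} {N : ℕ} {Λ α L R K : ℝ} {π : Grid T N} {Q : Quantization d Λ}
  {c : Coeffs d} {U : ℝ → E d → Measure (E d) → ℝ} {D : Derivs d} {J : ℕ}

/-- Allows Λ to be replaced by some L ≥ 1, for which powers of L are comparable. -/
lemma H0.mono (h : H0 Λ c) (hL : Λ ≤ L) : H0 L c where
  lip_b x x' y y' ν ν' hν hν' := (h.lip_b x x' y y' ν ν' hν hν').trans
    (mul_le_mul_of_nonneg_right hL (by have := W2_nonneg ν ν'; positivity))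
  lip_σ x x' μ μ' hμ hμ' := (h.lip_σ x x' μ μ' hμ hμ').trans
    (mul_le_mul_of_nonneg_right hL (by have := W2_nonneg μ μ'; positivity))
  lip_f x x' y y' z z' ν ν' hν hν' := (h.lip_f x x' y y' z z' ν ν' hν hν').trans
    (mul_le_mul_of_nonneg_right hL (by have := W2_nonneg ν ν'; positivity))
  lip_g x x' μ μ' hμ hμ' := (h.lip_g x x' μ μ' hμ hμ').trans
    (mul_le_mul_of_nonneg_right hL (by have := W2_nonneg μ μ'; positivity))
  bdd_σ x μ hμ := (h.bdd_σ x μ hμ).trans hL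

lemma H1.mono (h : H1 Λ α T c U D) (hL : Λ ≤ L) : H1 L α T c U D where
  classical := h.classical
  lip_μ t ht x μ μ' hμ hμ' := (h.lip_μ t ht x μ μ' hμ hμ').trans
    (mul_le_mul_of_nonneg_right hL (W2_nonneg μ μ'))
  bdd_first t ht x μ hμ := (h.bdd_first t ht x μ hμ).trans (ENNReal.ofReal_le_ofReal hL)
  bdd_second t ht x μ hμ := (h.bdd_second t ht x μ hμ).trans (ENNReal.ofReal_le_ofReal hL)
  lip_xx t ht x x' μ hμ := (h.lip_xx t ht x x' μ hμ).trans
    (mul_le_mul_of_nonneg_right hL (norm_nonneg _))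
  holder_t s hs t ht x μ hμ := (h.holder_t s hs t ht x μ hμ).trans (by
    have := m2_nonneg (μ := μ)
    have := Real.rpow_nonneg hs.1 (1 / 2)
    gcongr)
  lip_v t ht x μ hμ v v' := (h.lip_v t ht x μ hμ v v').trans (by
    have := m2_nonneg (μ := μ)
    gcongr)

lemma isP2_dirac {S : Type} [NormedAddCommGroup S] [MeasurableSpace S]
    [MeasurableSingletonClass S] (x : S) : IsP2 (Measure.dirac x) where
  prob := inferInstance
  moment := by
    rw [lintegral_dirac]
    exact ENNReal.pow_lt_top enorm_lt_top

/-- The value of U at the origin stays bounded in time by Hölder continuity. The prescribed lower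
bound `K` lets R also dominate the uniform bound of the solver. -/
lemma exists_bigR (h1 : H1 L α T c U D) (hT : 0 < T) (hL : 0 ≤ L) (K : ℝ) :
    ∃ R, K ≤ R ∧ BigR R T c U := by
  set a := ‖c.b 0 0 (Measure.dirac (pair 0 0))‖ with ha
  set b := |c.f 0 0 0 (Measure.dirac (pair 0 0))| with hb
  set e := |U 0 0 (Measure.dirac 0)| + 2 * L * √T * (1 + ‖(0 : E d)‖ + m2 (Measure.dirac (0 : E d)))
    with he
  have ha0 : 0 ≤ a := norm_nonneg _
  have hb0 : 0 ≤ b := abs_nonneg _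
  have hm := m2_nonneg (μ := Measure.dirac (0 : E d))
  have he0 : 0 ≤ e := by positivity
  refine ⟨|K| + 1 + a + b + e, by linarith [le_abs_self K], by linarith [abs_nonneg K],
    by linarith [abs_nonneg K], by linarith [abs_nonneg K], fun t ht => ?_⟩
  have h := h1.holder_time hT hL le_rfl ht.1 ht.2 0 (isP2_dirac 0)
  rw [sub_zero] at h
  have h2 := abs_add_le (U t 0 (Measure.dirac 0) - U 0 0 (Measure.dirac 0))
    (U 0 0 (Measure.dirac 0))
  rw [sub_add_cancel] at h2
  have h3 : 2 * L * √t * (1 + ‖(0 : E d)‖ + m2 (Measure.dirac (0 : E d)))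
      ≤ 2 * L * √T * (1 + ‖(0 : E d)‖ + m2 (Measure.dirac (0 : E d))) := by
    have := Real.sqrt_le_sqrt ht.2
    gcongr
  linarith [abs_nonneg K, norm_nonneg (D.dx t 0 (Measure.dirac 0) - D.dx 0 0 (Measure.dirac 0))]

/-! ### The initial condition -/

section initial
variable (π Q) (ξ : InitialLaw d)

/-- The initial condition, as a random variable on the forest. -/
def root (ω : Sample π Q ξ) : E d := ξ.x ω.1

variable {π Q ξ}

lemma adapted_root (i : ℕ) : Adapted i (root π Q ξ) := fun _ _ h _ => congrArg ξ.x h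

lemma sum_prob_root (F : Fin ξ.M → ℝ) :
    ∑ ω : Sample π Q ξ, prob π Q ξ ω * F ω.1 = ∑ l, ξ.p l * F l := by
  simp only [prob_eq, Fintype.sum_prod_type]
  refine Finset.sum_congr rfl fun l _ => ?_
  simp only [mul_right_comm _ _ (F l)]
  rw [← Finset.mul_sum, sum_pw, mul_one]

lemma law_root : law π Q ξ (root π Q ξ) = ξ.measure := by
  simp only [law, root, InitialLaw.measure, Fintype.sum_prod_type]
  refine Finset.sum_congr rfl fun l _ => ?_
  rw [← Finset.sum_smul, ← ENNReal.ofReal_sum_of_nonneg fun a _ =>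
    (fprob_prob π Q ξ).nonneg (l, a)]
  simp only [prob_eq]
  rw [← Finset.mul_sum, sum_pw, mul_one]

lemma n2_norm_root_rpow : n2 (prob π Q ξ) (fun ω => ‖root π Q ξ ω‖ ^ α)
    = (∑ l, ξ.p l * ‖ξ.x l‖ ^ (2 * α)) ^ (1 / 2 : ℝ) := by
  rw [n2, ← Real.sqrt_eq_rpow]
  congr 1
  have e : ∀ ω : Sample π Q ξ, (‖root π Q ξ ω‖ ^ α) ^ 2 = ‖ξ.x ω.1‖ ^ (2 * α) := fun ω => by
    rw [← Real.rpow_natCast, ← Real.rpow_mul (norm_nonneg _), mul_comm]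
    rfl
  simp only [e]
  exact sum_prob_root fun l => ‖ξ.x l‖ ^ (2 * α)

lemma n2_norm_root : n2 (prob π Q ξ) (fun ω => ‖root π Q ξ ω‖) = ξ.norm (2 * 1) := by
  have h := n2_norm_root_rpow (π := π) (Q := Q) (ξ := ξ) (α := 1)
  simp only [Real.rpow_one] at h
  rw [h, InitialLaw.norm, mul_one]

lemma norm_rpow_eq (hα : 1 ≤ α) :
    n2 (prob π Q ξ) (fun ω => ‖root π Q ξ ω‖ ^ α) = ξ.norm (2 * α) ^ α := by
  have h0 : 0 ≤ ∑ l, ξ.p l * ‖ξ.x l‖ ^ (2 * α) := Finset.sum_nonneg fun l _ =>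
    mul_nonneg (ξ.p_pos l).le (Real.rpow_nonneg (norm_nonneg _) _)
  rw [n2_norm_root_rpow, InitialLaw.norm, ← Real.rpow_mul h0]
  congr 1
  field_simp

/-- Monotonicity of the means. -/
lemma n2_rpow_le (hα : 1 ≤ α) (X : Sample π Q ξ → E d) :
    n2 (prob π Q ξ) (fun ω => ‖X ω‖) ^ α ≤ n2 (prob π Q ξ) fun ω => ‖X ω‖ ^ α := by
  have hp := fprob_prob π Q ξ
  refine le_of_sq_le_sq ?_ n2_nonneg
  rw [Real.rpow_pow_comm n2_nonneg, n2_sq hp.nonneg, n2_sq hp.nonneg]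
  refine (Real.rpow_arith_mean_le_arith_mean_rpow Finset.univ _ _ (fun ω _ => hp.nonneg ω) hp.sum
    (fun ω _ => sq_nonneg _) hα).trans (le_of_eq ?_)
  exact Finset.sum_congr rfl fun ω _ => by rw [Real.rpow_pow_comm (norm_nonneg _)]

/-- The weights on the branch add the value at the root to the quadratic mean, whence the term |x_ℓ|
in the final estimates. -/
lemma vw_root_le (hR : 1 ≤ R) (ω₀ : Sample π Q ξ) :
    vw R (condW 0 ω₀) (root π Q ξ)
      ≤ 2 * R * (1 + ‖ξ.x ω₀.1‖ + n2 (prob π Q ξ) fun ω => ‖root π Q ξ ω‖) := by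
  have hp := fprob_prob π Q ξ
  have hs : ∀ ω, √(R ^ 2 + ‖root π Q ξ ω‖ ^ 2) ≤ R + ‖root π Q ξ ω‖ := fun ω => by
    refine (Real.sqrt_le_left (by positivity)).2 ?_
    nlinarith [mul_nonneg (by linarith : 0 ≤ R) (norm_nonneg (root π Q ξ ω))]
  have h1 := n2_condW_le ω₀ (V := fun ω => √(R ^ 2 + ‖root π Q ξ ω‖ ^ 2))
    ((adapted_root 0).comp fun x => √(R ^ 2 + ‖x‖ ^ 2))
  have h2 : n2 (prob π Q ξ) (fun ω => √(R ^ 2 + ‖root π Q ξ ω‖ ^ 2))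
      ≤ R + n2 (prob π Q ξ) fun ω => ‖root π Q ξ ω‖ := by
    have := n2_le_add hp.nonneg (F := fun ω => √(R ^ 2 + ‖root π Q ξ ω‖ ^ 2)) (V := fun _ => R)
      (W := fun ω => ‖root π Q ξ ω‖) fun ω => by
        rw [abs_of_nonneg (Real.sqrt_nonneg _)]; exact hs ω
    rwa [n2_const_prob hp.sum R (by linarith)] at this
  have h3 := hs ω₀
  rw [abs_of_nonneg (Real.sqrt_nonneg _)] at h1
  have h4 : 0 ≤ n2 (prob π Q ξ) fun ω => ‖root π Q ξ ω‖ := n2_nonneg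
  have h5 : ‖root π Q ξ ω₀‖ = ‖ξ.x ω₀.1‖ := rfl
  have h6 := norm_nonneg (ξ.x ω₀.1)
  rw [vw]
  nlinarith

/-- `rt` is at most three times the largest of its three entries, and a power of a maximum is at
most the sum of the powers. -/
lemma rt_rpow_le (hα : 1 ≤ α) (hR : 1 ≤ R) (X : Sample π Q ξ → E d) (ω : Sample π Q ξ) :
    rt R X ω ^ α ≤ 3 ^ α * (R ^ α + ‖X ω‖ ^ α + n2 (prob π Q ξ) (fun ω => ‖X ω‖) ^ α) := by
  have hα0 : 0 ≤ α := by linarith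
  set m := n2 (prob π Q ξ) fun ω => ‖X ω‖ with hm
  have hm0 : 0 ≤ m := n2_nonneg
  have hx0 := norm_nonneg (X ω)
  have hR0 : 0 ≤ R := by linarith
  set M := max R (max ‖X ω‖ m) with hM
  have h1 : rt R X ω ≤ 3 * M := by
    rw [rt, ← hm]
    have a1 : R ≤ M := le_max_left _ _
    have a2 : ‖X ω‖ ≤ M := (le_max_left _ _).trans (le_max_right _ _)
    have a3 : m ≤ M := (le_max_right _ _).trans (le_max_right _ _)
    refine (Real.sqrt_le_left (by linarith)).2 ?_
    nlinarith [pow_le_pow_left₀ hR0 a1 2, pow_le_pow_left₀ hx0 a2 2, pow_le_pow_left₀ hm0 a3 2]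
  have hM0 : 0 ≤ M := hR0.trans (le_max_left _ _)
  have h2 := Real.rpow_le_rpow (rt_nonneg ω) h1 hα0
  rw [Real.mul_rpow (by norm_num) hM0] at h2
  refine h2.trans (mul_le_mul_of_nonneg_left ?_ (Real.rpow_nonneg (by norm_num) _))
  have b1 := Real.rpow_nonneg hR0 α
  have b2 := Real.rpow_nonneg hx0 α
  have b3 := Real.rpow_nonneg hm0 α
  rcases max_choice R (max ‖X ω‖ m) with h | h
  · rw [hM, h]; linarith
  · rw [hM, h]
    rcases max_choice ‖X ω‖ m with h | h <;> rw [h] <;> linarith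

/-- The constant of the moments of the initial condition. -/
noncomputable def iniC (R α : ℝ) : ℝ := 4 * R + 3 ^ α * (R ^ α + 2)

lemma vq_root_le (hα : 1 ≤ α) (hR : 1 ≤ R) (ω₀ : Sample π Q ξ) :
    vq R α (condW 0 ω₀) (root π Q ξ) ≤ iniC R α * (1 + ‖ξ.x ω₀.1‖ + ξ.norm (2 * α) ^ α) := by
  have hp := fprob_prob π Q ξ
  have hR0 : 0 ≤ R := by linarith
  have hα0 : 0 ≤ α := by linarith
  rw [← norm_rpow_eq (π := π) (Q := Q) hα]
  set m := n2 (prob π Q ξ) fun ω => ‖root π Q ξ ω‖ with hm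
  set V := n2 (prob π Q ξ) fun ω => ‖root π Q ξ ω‖ ^ α with hV
  have hm0 : 0 ≤ m := n2_nonneg
  have hV0 : 0 ≤ V := n2_nonneg
  have hmV : m ^ α ≤ V := n2_rpow_le hα _
  -- A mean above one is at most its power α, so the moment of order 2α controls the quadratic mean
  -- as well.
  have hm1 : m ≤ 1 + V := by
    rcases le_total m 1 with h | h
    · linarith
    · linarith [Real.self_le_rpow_of_one_le h hα]
  have h1 := vw_root_le hR ω₀
  rw [← hm] at h1
  have h3 : 0 ≤ (3 : ℝ) ^ α := Real.rpow_nonneg (by norm_num) _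
  have h4 : 0 ≤ R ^ α := Real.rpow_nonneg hR0 _
  have h2 : qm R α (root π Q ξ) ≤ 3 ^ α * (R ^ α + 2 * V) := by
    have k1 := n2_mono (p := prob π Q ξ) hp.nonneg (V := fun ω => rt R (root π Q ξ) ω ^ α)
      (W := fun ω => 3 ^ α * (R ^ α + ‖root π Q ξ ω‖ ^ α + m ^ α)) fun ω => by
        rw [abs_of_nonneg (Real.rpow_nonneg (rt_nonneg ω) _)]
        exact rt_rpow_le hα hR _ ω
    rw [n2_const_mul _ h3] at k1
    have k2 := n2_le_add₃ hp.nonneg (F := fun ω => R ^ α + ‖root π Q ξ ω‖ ^ α + m ^ α)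
      (A := fun _ => R ^ α) (B := fun ω => ‖root π Q ξ ω‖ ^ α) (C := fun _ => m ^ α) fun ω => by
        rw [abs_of_nonneg (add_nonneg (add_nonneg h4 (Real.rpow_nonneg (norm_nonneg _) _))
          (Real.rpow_nonneg hm0 _))]
    rw [n2_const_prob hp.sum _ h4, n2_const_prob hp.sum _ (Real.rpow_nonneg hm0 _)] at k2
    exact k1.trans (mul_le_mul_of_nonneg_left (by linarith) h3)
  have h5 := norm_nonneg (ξ.x ω₀.1)
  rw [vq, iniC]
  have h6 : 2 * R * (1 + ‖ξ.x ω₀.1‖ + m) ≤ 4 * R * (1 + ‖ξ.x ω₀.1‖ + V) := by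
    have := mul_le_mul_of_nonneg_left hm1 (by linarith : 0 ≤ 2 * R)
    nlinarith [mul_nonneg hR0 h5, mul_nonneg hR0 hV0]
  have h7 : 3 ^ α * (R ^ α + 2 * V) ≤ 3 ^ α * (R ^ α + 2) * (1 + ‖ξ.x ω₀.1‖ + V) := by
    rw [mul_assoc]
    refine mul_le_mul_of_nonneg_left ?_ h3
    nlinarith [mul_nonneg h4 h5, mul_nonneg h4 hV0]
  linarith

/-- The error at a root is controlled by the weighted error. -/
lemma abs_error_root_le {y : Sample π Q ξ → ℝ} (hy : Adapted 0 y) (ω₀ : Sample π Q ξ) :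
    |y ω₀ - U 0 (ξ.x ω₀.1) ξ.measure|
      ≤ n2 (condW 0 ω₀) fun ω => y ω - field U (π.t (π.j 0)) (root π Q ξ) ω := by
  have h := abs_le_n2_condW ω₀ (V := fun ω => y ω - field U (π.t (π.j 0)) (root π Q ξ) ω)
    (hy.comp₂ (adapted_root 0).field fun a b => a - b)
  have e : field U (π.t (π.j 0)) (root π Q ξ) ω₀ = U 0 (ξ.x ω₀.1) ξ.measure := by
    rw [field, law_root, π.t_j_zero]
    rfl
  rwa [e] at h

end initial

end final

end MKV

namespace MKV

/-! ### Constants which do not depend on the discretization. -/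

section constants
variable {d : ℕ} {T : ℝ} {Λ α L R K : ℝ}
  {c : Coeffs d} {U : ℝ → E d → Measure (E d) → ℝ} {D : Derivs d}

/-- The bound of the error at the initial time for coefficients with linear growth, for all the
discretizations which are fine enough. -/
def LinearBound (Λ L T : ℝ) (c : Coeffs d) (U : ℝ → E d → Measure (E d) → ℝ) (C : ℝ) : Prop :=
  ∀ (N J : ℕ), 1 ≤ N → 1 ≤ J → ∀ (π : Grid T N) (Q : Quantization d Λ) (ξ : InitialLaw d),
    momC L * (T / N) ≤ 1 → (J = 1 ∨ C * √π.mesh ≤ 1) →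
    ∀ y, IsSolverOutput π Q ξ c J 0 (root π Q ξ) y → ∀ ω₀ : Sample π Q ξ,
      |y ω₀ - U 0 (ξ.x ω₀.1) ξ.measure| ≤ C * ((C * (T / N)) ^ (J - 1) + √π.mesh * (T / N)⁻¹)
        * (1 + ‖ξ.x ω₀.1‖ + ξ.norm (2 * 1))

/-- The bound of the error at the initial time for bounded data, for all the discretizations
which are fine enough. -/
def BoundedBound (Λ L α T : ℝ) (c : Coeffs d) (U : ℝ → E d → Measure (E d) → ℝ) (C : ℝ) : Prop :=
  ∀ (N J : ℕ), 1 ≤ N → 1 ≤ J → ∀ (π : Grid T N) (Q : Quantization d Λ) (ξ : InitialLaw d),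
    picC L * (T / N) ≤ 1 / 4 → groC L α * (T / N) ≤ 1 →
    ∀ y, IsSolverOutput π Q ξ c J 0 (root π Q ξ) y → ∀ ω₀ : Sample π Q ξ,
      |y ω₀ - U 0 (ξ.x ω₀.1) ξ.measure| ≤ C * ((C * (T / N)) ^ (J - 1) + √π.mesh * (T / N)⁻¹
        * (1 + ‖ξ.x ω₀.1‖ + ξ.norm (2 * α) ^ α))

/-- The accumulated discretization error is O(√|π|); as δ ≤ T, it fits into the order √|π|/δ of the
statement. -/
lemma sqrt_mesh_le {δ : ℝ} (hδ : 0 < δ) (hδT : δ ≤ T) (m : ℝ) : √m ≤ T * (√m * δ⁻¹) := by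
  have h : 1 ≤ T * δ⁻¹ := by
    rw [← div_eq_mul_inv]
    exact (one_le_div hδ).2 hδT
  calc √m = 1 * √m := (one_mul _).symm
    _ ≤ (T * δ⁻¹) * √m := mul_le_mul_of_nonneg_right h (Real.sqrt_nonneg m)
    _ = _ := by ring

/-- Summation over T/δ periods costs one power of δ, which turns the exponent J into J - 1. -/
lemma mul_pow_eq {n δ p : ℝ} (hn : n * δ = T) {J : ℕ} (hJ : 1 ≤ J) :
    n * (p * δ) ^ J = p * T * (p * δ) ^ (J - 1) := by
  obtain ⟨j, rfl⟩ : ∃ j, J = j + 1 := ⟨J - 1, by omega⟩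
  rw [pow_succ, Nat.add_sub_cancel, ← hn]
  ring

/-- If J = 1 or κq^(J-1) ≤ 1/2, the mesh condition keeps the accumulated error below one whenever J
> 1, and `solver_error_linear` applies. Otherwise q is bounded from below, which bounds N, and J is
bounded since q ≤ 1/1000; the crude growth constants of the finitely many remaining pairs then
suffice. -/
theorem exists_linearBound (h0 : H0 L c) (h1 : H1 L 1 T c U D) (hR : BigR R T c U) (hL : 1 ≤ L)
    (hΛ : Λ ≤ L) (hT : 0 < T) : ∃ C₀ > 0, ∀ C ≥ C₀, LinearBound Λ L T c U C := by
  have hL0 : 0 ≤ L := by linarith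
  have hR0 : 0 ≤ R := by linarith [hR.one_le]
  have hc0 := locC_nonneg (d := d) (α := 1) hL0
  have hp0 := picC_nonneg hL
  have hpm := picC_le_momC hL
  set S := Real.exp (rateC L * T) with hS
  have hS0 : 0 < S := Real.exp_pos _
  set c₁ := 38400 * L ^ 2 * locC d L 1 with hc₁
  have hc₁0 : 0 ≤ c₁ := by positivity
  set κ := 8 * L * picC L * T * S with hκ
  have hκ0 : 0 ≤ κ := by positivity
  -- Dominates the crude constants of all pairs (N, J) that can occur in the second case.
  set Ks := ∑ n ∈ Finset.range (⌈2 * κ * picC L * T⌉₊ + 1),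
    ∑ j ∈ Finset.range (⌈2 * κ⌉₊ + 2), crudeC L j n with hKs
  have hKs0 : 0 ≤ Ks := Finset.sum_nonneg fun n _ => Finset.sum_nonneg fun j _ =>
    crudeC_nonneg hL0 j n
  have hz1 : 0 ≤ S * c₁ * T := by positivity
  have hz2 : 0 ≤ 2 * R * (S * c₁ * T ^ 2) := by positivity
  have hz3 : 0 ≤ 2 * R * κ := by positivity
  have hz4 : 0 ≤ 2 * R * (Ks + 4 * L) := by positivity
  have hz5 : 0 ≤ 2 * κ * picC L := by positivity
  refine ⟨1 + picC L + 2 * (S * c₁ * T) + 2 * R * (S * c₁ * T ^ 2) + 2 * R * κ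
    + 2 * R * (Ks + 4 * L) + 2 * κ * picC L, by linarith, ?_⟩
  intro C hC N J hN hJ π Q ξ hδ hmesh y hy ω₀
  have hSt : Standing L 1 R T c U D Q :=
    ⟨hL, le_rfl, hT, fun a => (Q.bdd a).trans hΛ, h0, h1, hR⟩
  have hNpos : (1 : ℝ) ≤ N := by exact_mod_cast hN
  set δ := T / N with hδd
  have hδ0 : 0 < δ := by positivity
  have hNδ : (N : ℝ) * δ = T := by rw [hδd]; field_simp
  have hδT : δ ≤ T := by nlinarith
  set q := picC L * δ with hq
  have hq0 : 0 ≤ q := by positivity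
  have hq1 : q ≤ 1 / 1000 := by
    have := mul_le_mul_of_nonneg_right hpm hδ0.le
    rw [hq]; linarith
  have hC0 : 0 ≤ C := by linarith
  have hqC : q ^ (J - 1) ≤ (C * δ) ^ (J - 1) :=
    pow_le_pow_left₀ hq0 (mul_le_mul_of_nonneg_right (by linarith) hδ0.le) _
  have hm0 := Real.sqrt_nonneg π.mesh
  have hsm := sqrt_mesh_le hδ0 hδT π.mesh
  have hmd : 0 ≤ √π.mesh * δ⁻¹ := by positivity
  have hCJ : 0 ≤ (C * δ) ^ (J - 1) := by positivity
  have hadj := adapted_solver_zero hT hN hJ hy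
  have herr := abs_error_root_le (U := U) hadj ω₀
  have hvw := vw_root_le (R := R) hR.one_le ω₀
  rw [n2_norm_root] at hvw
  set W := 1 + ‖ξ.x ω₀.1‖ + ξ.norm (2 * 1) with hW
  have hW0 : 0 ≤ W := by
    have h : 0 ≤ vw R (condW 0 ω₀) (root π Q ξ) := vw_nonneg
    have : 0 < 2 * R := by linarith [hR.one_le]
    exact nonneg_of_mul_nonneg_right (h.trans hvw) this
  have hr0 : 0 ≤ rateC L := by rw [rateC]; linarith
  have hacc : acc (rateC L * δ) (linErr d J L δ π.mesh) N
      ≤ S * c₁ * T * √π.mesh + κ * q ^ (J - 1) := by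
    refine (acc_le (by positivity) (by rw [linErr]; positivity) N).trans (le_of_eq ?_)
    have e1 : rateC L * δ * N = rateC L * T := by rw [← hNδ]; ring
    have e2 : (N : ℝ) * linErr d J L δ π.mesh
        = c₁ * (N * δ) * √π.mesh + 8 * L * (N * (picC L * δ) ^ J) := by rw [linErr]; ring
    rw [e1, e2, mul_pow_eq hNδ hJ, hNδ, hκ]
    ring
  have finish : ∀ e, 0 ≤ e →
      n2 (condW 0 ω₀) (fun ω => y ω - field U (π.t (π.j 0)) (root π Q ξ) ω)
        ≤ e * vw R (condW 0 ω₀) (root π Q ξ) →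
      2 * R * e ≤ C * ((C * δ) ^ (J - 1) + √π.mesh * δ⁻¹) →
      |y ω₀ - U 0 (ξ.x ω₀.1) ξ.measure| ≤ C * ((C * δ) ^ (J - 1) + √π.mesh * δ⁻¹) * W := by
    intro e he hn hle
    calc _ ≤ e * vw R (condW 0 ω₀) (root π Q ξ) := herr.trans hn
      _ ≤ e * (2 * R * W) := mul_le_mul_of_nonneg_left hvw he
      _ = 2 * R * e * W := by ring
      _ ≤ _ := mul_le_mul_of_nonneg_right hle hW0
  have hadr : Adapted (π.j 0) (root π Q ξ) := adapted_root _
  have hwt : Wt (π.j 0) (condW 0 ω₀) := by rw [π.j_zero]; exact wt_condW 0 ω₀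
  by_cases hst : J = 1 ∨ κ * q ^ (J - 1) ≤ 1 / 2
  · have hstab : J = 1 ∨ acc (rateC L * δ) (linErr d J L δ π.mesh) N ≤ 1 := by
      rcases hst with h | h
      · exact .inl h
      · rcases hmesh with h' | h'
        · exact .inl h'
        · refine .inr (hacc.trans ?_)
          have : 2 * (S * c₁ * T) * √π.mesh ≤ C * √π.mesh :=
            mul_le_mul_of_nonneg_right (by linarith) hm0
          linarith
    refine finish _ (acc_nonneg (mul_nonneg hr0 hδ0.le) (by rw [linErr]; positivity) N)
      (solver_error_linear hSt hJ hN hδ hstab hy hadr _ hwt) ?_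
    have k1 := mul_le_mul_of_nonneg_left hacc (by linarith : 0 ≤ 2 * R)
    have k2 := mul_le_mul_of_nonneg_left hsm hz1
    have k3 := mul_le_mul_of_nonneg_left k2 (by linarith : 0 ≤ 2 * R)
    have k4 := mul_le_mul_of_nonneg_left hqC hz3
    have k5 : 2 * R * (S * c₁ * T ^ 2) * (√π.mesh * δ⁻¹) ≤ C * (√π.mesh * δ⁻¹) :=
      mul_le_mul_of_nonneg_right (by linarith) hmd
    have k6 : 2 * R * κ * (C * δ) ^ (J - 1) ≤ C * (C * δ) ^ (J - 1) :=
      mul_le_mul_of_nonneg_right (by linarith) hCJ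
    linarith
  · obtain ⟨hJ1, hκq⟩ := not_or.1 hst
    rw [not_le] at hκq
    have hqq : q ^ (J - 1) ≤ q := pow_le_of_le_one hq0 (by linarith) (by omega)
    have hκ1 : 1 ≤ 2 * κ * q := by
      have := mul_le_mul_of_nonneg_left hqq hκ0
      linarith
    have hN0 : N < ⌈2 * κ * picC L * T⌉₊ + 1 := by
      rw [Nat.lt_succ_iff]
      have : (N : ℝ) ≤ 2 * κ * picC L * T := by
        have h := mul_le_mul_of_nonneg_left hκ1 (by linarith : 0 ≤ (N : ℝ))
        have e : N * (2 * κ * q) = 2 * κ * picC L * (N * δ) := by rw [hq]; ring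
        rw [e, hNδ] at h
        linarith
      exact_mod_cast this.trans (Nat.le_ceil _)
    have hJ0 : J < ⌈2 * κ⌉₊ + 2 := by
      have h1 : κ * q ^ (J - 1) ≤ κ * (1 / 2) ^ (J - 1) :=
        mul_le_mul_of_nonneg_left (pow_le_pow_left₀ hq0 (by linarith) _) hκ0
      have h2 : (0 : ℝ) < 2 ^ (J - 1) := by positivity
      have h3 : (2 : ℝ) ^ (J - 1) ≤ 2 * κ := by
        have h4 : 1 / 2 * 2 ^ (J - 1) ≤ κ * (1 / 2) ^ (J - 1) * 2 ^ (J - 1) :=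
          mul_le_mul_of_nonneg_right (by linarith) h2.le
        rw [mul_assoc κ, ← mul_pow] at h4
        norm_num at h4
        linarith
      have h5 : ((J - 1 : ℕ) : ℝ) ≤ 2 ^ (J - 1) := by
        exact_mod_cast (Nat.lt_two_pow_self (n := J - 1)).le
      have h6 : J - 1 ≤ ⌈2 * κ⌉₊ := by exact_mod_cast (h5.trans h3).trans (Nat.le_ceil _)
      omega
    have hcr : crudeC L J N ≤ Ks :=
      (Finset.single_le_sum (f := fun j => crudeC L j N) (fun j _ => crudeC_nonneg hL0 j N)
        (Finset.mem_range.2 hJ0)).trans (Finset.single_le_sum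
          (f := fun n => ∑ j ∈ Finset.range (⌈2 * κ⌉₊ + 2), crudeC L j n)
          (fun n _ => Finset.sum_nonneg fun j _ => crudeC_nonneg hL0 j n) (Finset.mem_range.2 hN0))
    have hv : 0 ≤ vw R (condW 0 ω₀) (root π Q ξ) := vw_nonneg
    refine finish (Ks + 4 * L) (by positivity) ?_ ?_
    · have k1 := solver_le_crude hSt hJ hN (by linarith) hy hadr _ hwt
      have k2 := n2_field_le h1 hL hR ⟨π.t_nonneg (π.j_le 0 (Nat.zero_le _)),
        π.t_le (π.j_le 0 (Nat.zero_le _))⟩ hwt (root π Q ξ)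
      have k3 := n2_le_add_abs hwt.nonneg
        (F := fun ω => y ω - field U (π.t (π.j 0)) (root π Q ξ) ω) (V := y)
        (W := field U (π.t (π.j 0)) (root π Q ξ)) fun ω => abs_sub _ _
      rw [Nat.sub_zero] at k1
      have k4 := mul_le_mul_of_nonneg_right hcr hv
      linarith
    -- In the second case 1 ≤ 2κq ≤ Cδ, so the Picard term of the right-hand side is already at
    -- least C.
    · have hCδ : 1 ≤ C * δ := by
        have : 2 * κ * picC L * δ ≤ C * δ := mul_le_mul_of_nonneg_right (by linarith) hδ0.le
        linarith
      have k1 : C * 1 ≤ C * (C * δ) ^ (J - 1) := mul_le_mul_of_nonneg_left (one_le_pow₀ hCδ) hC0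
      have k2 : 0 ≤ C * (√π.mesh * δ⁻¹) := mul_nonneg hC0 hmd
      linarith

/-- The uniform bound of the output of the solver over the whole time interval. -/
noncomputable def supM (K L T : ℝ) : ℝ :=
  K + T * (6 * K + 24 * L ^ 2 * K) * Real.exp (24 * L ^ 2 * T)

lemma supB_le_supM (hK : 0 ≤ K) (hT : 0 < T) {N : ℕ} (hN : 1 ≤ N) :
    supB K L (T / N) N ≤ supM K L T := by
  have hNpos : (1 : ℝ) ≤ N := by exact_mod_cast hN
  have hNδ : (N : ℝ) * (T / N) = T := by field_simp
  refine add_le_add le_rfl ((acc_le (by positivity) (by positivity) N).trans (le_of_eq ?_))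
  have e1 : 24 * L ^ 2 * (T / N) * N = 24 * L ^ 2 * (N * (T / N)) := by ring
  have e2 : (N : ℝ) * (6 * K * (T / N) + 24 * L ^ 2 * (T / N) * K)
    = N * (T / N) * (6 * K + 24 * L ^ 2 * K) := by ring
  rw [e1, e2, hNδ]

theorem exists_boundedBound (h0 : H0 L c) (h1 : H1 L α T c U D) (hR : BigR R T c U) (hL : 1 ≤ L)
    (hΛ : Λ ≤ L) (hT : 0 < T) (hα : 1 ≤ α) (hK : DataBound K c) (hKR : supM K L T ≤ R) :
    ∃ C₀ > 0, ∀ C ≥ C₀, BoundedBound Λ L α T c U C := by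
  have hL0 : 0 ≤ L := by linarith
  have hα0 : 0 ≤ α := by linarith
  have hR0 : 0 ≤ R := by linarith [hR.one_le]
  have hK0 := hK.nonneg
  have hp0 := picC_nonneg hL
  have hc0 := locC_nonneg (d := d) (α := α) hL0
  have hf0 : 0 ≤ fieldErr d L α := fieldErr_nonneg hL0
  have hC0 := hC_nonneg (κ := kapC L) (α := α) kapC_nonneg
  have hr0 : 0 ≤ bddRate L α := by
    have := groC_nonneg (L := L) hα0
    rw [bddRate]; positivity
  have hMF : 0 ≤ bddField K L α T := by rw [bddField]; positivity
  have hBE : 0 ≤ bddErr d L α T := by rw [bddErr]; positivity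
  have hI0 : 0 ≤ iniC R α := by
    have h3 : 0 ≤ (3 : ℝ) ^ α := Real.rpow_nonneg (by norm_num) _
    have h4 : 0 ≤ R ^ α := Real.rpow_nonneg hR0 _
    rw [iniC]; positivity
  set S := Real.exp (bddRate L α * T) with hS
  have hS0 : 0 < S := Real.exp_pos _
  set A := S * (picC L * T * bddField K L α T) with hA
  set B := S * (bddErr d L α T * T ^ 2) * iniC R α with hB
  have hA0 : 0 ≤ A := by positivity
  have hB0 : 0 ≤ B := by positivity
  refine ⟨1 + picC L + A + B, by linarith, ?_⟩
  intro C hC N J hN hJ π Q ξ hδ hδg y hy ω₀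
  have hSt : Standing L α R T c U D Q :=
    ⟨hL, hα, hT, fun a => (Q.bdd a).trans hΛ, h0, h1, hR⟩
  have hNpos : (1 : ℝ) ≤ N := by exact_mod_cast hN
  have hadj := adapted_solver_zero hT hN hJ hy
  have herr := abs_error_root_le (U := U) hadj ω₀
  have hvq := vq_root_le (R := R) hα hR.one_le ω₀
  have hadr : Adapted (π.j 0) (root π Q ξ) := adapted_root _
  have hwt : Wt (π.j 0) (condW 0 ω₀) := by rw [π.j_zero]; exact wt_condW 0 ω₀
  have hmain := solver_error_bounded hSt hJ hN hK ((supB_le_supM hK0 hT hN).trans hKR)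
    (π.h_le_of_lt hN) hδ hδg hy hadr _ hwt
  rw [Nat.sub_zero] at hmain
  set δ := T / N with hδd
  have hδ0 : 0 < δ := by positivity
  have hNδ : (N : ℝ) * δ = T := by rw [hδd]; field_simp
  have hδT : δ ≤ T := by nlinarith
  set q := picC L * δ with hq
  have hq0 : 0 ≤ q := by positivity
  have hqC : q ^ (J - 1) ≤ (C * δ) ^ (J - 1) :=
    pow_le_pow_left₀ hq0 (mul_le_mul_of_nonneg_right (by linarith) hδ0.le) _
  have hm0 := Real.sqrt_nonneg π.mesh
  have hsm := sqrt_mesh_le hδ0 hδT π.mesh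
  have hmd : 0 ≤ √π.mesh * δ⁻¹ := by positivity
  have hCpos : 0 ≤ C := by linarith
  have hCJ : 0 ≤ (C * δ) ^ (J - 1) := by positivity
  set W := 1 + ‖ξ.x ω₀.1‖ + ξ.norm (2 * α) ^ α with hW
  have hW0 : 0 ≤ W := by
    have : 0 ≤ n2 (prob π Q ξ) fun ω => ‖root π Q ξ ω‖ ^ α := n2_nonneg
    rw [norm_rpow_eq hα] at this
    positivity
  have e1 : bddRate L α * δ * N = bddRate L α * T := by rw [← hNδ]; ring
  have hacA : acc (bddRate L α * δ) (q ^ J * bddField K L α T) N ≤ A * q ^ (J - 1) := by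
    refine (acc_le (by positivity) (by positivity) N).trans (le_of_eq ?_)
    rw [e1, ← mul_assoc (N : ℝ), hq, mul_pow_eq hNδ hJ, hA]
    ring
  have hacB : acc (bddRate L α * δ) (bddErr d L α T * δ * √π.mesh) N
      ≤ S * (bddErr d L α T * T) * √π.mesh := by
    refine (acc_le (by positivity) (by positivity) N).trans (le_of_eq ?_)
    have e2 : (N : ℝ) * (bddErr d L α T * δ * √π.mesh)
        = bddErr d L α T * (N * δ) * √π.mesh := by ring
    rw [e1, e2, hNδ]
    ring
  have hvq0 : 0 ≤ vq R α (condW 0 ω₀) (root π Q ξ) := vq_nonneg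
  have k1 : acc (bddRate L α * δ) (bddErr d L α T * δ * √π.mesh) N
      * vq R α (condW 0 ω₀) (root π Q ξ) ≤ B * (√π.mesh * δ⁻¹ * W) := by
    calc _ ≤ S * (bddErr d L α T * T) * (T * (√π.mesh * δ⁻¹)) * (iniC R α * W) :=
          mul_le_mul (hacB.trans (mul_le_mul_of_nonneg_left hsm (by positivity))) hvq hvq0
            (by positivity)
      _ = _ := by rw [hB]; ring
  have k2 : B * (√π.mesh * δ⁻¹ * W) ≤ C * (√π.mesh * δ⁻¹ * W) :=
    mul_le_mul_of_nonneg_right (by linarith) (by positivity)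
  have k3 : A * q ^ (J - 1) ≤ C * (C * δ) ^ (J - 1) :=
    mul_le_mul (by linarith) hqC (by positivity) hCpos
  linarith

/-- The condition on the mesh which the stability condition contains. -/
lemma mesh_le_of_stability {N J : ℕ} (hN : 1 ≤ N) (hJ : 1 ≤ J) {C CΛ β m : ℝ} (hT : 0 < T)
    (hΛ : 0 ≤ Λ) (hCΛ : 0 < CΛ) (hC : 0 ≤ C) (hβ : 0 < β) (hm : 0 ≤ m)
    (h : ((J : ℝ) - 1) * (Λ * (CΛ * (T / N)) ^ J + Real.exp (β * (CΛ * (T / N))) * (C * m)) *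
      (Real.exp (β * CΛ * T) / (Real.exp (β * (CΛ * (T / N))) - 1)) ≤ 1) :
    J = 1 ∨ C * m ≤ 1 := by
  rcases eq_or_ne J 1 with hJ1 | hJ1
  · exact .inl hJ1
  refine .inr (le_trans ?_ h)
  have hNpos : (1 : ℝ) ≤ N := by exact_mod_cast hN
  have hδ0 : 0 < T / N := by positivity
  have hδT : T / N ≤ T := div_le_self hT.le hNpos
  have hJ2 : (1 : ℝ) ≤ (J : ℝ) - 1 := by
    have : (2 : ℝ) ≤ J := by exact_mod_cast (by omega : 2 ≤ J)
    linarith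
  have hx : 1 < Real.exp (β * (CΛ * (T / N))) := Real.one_lt_exp_iff.2 (by positivity)
  set x := Real.exp (β * (CΛ * (T / N))) with hxd
  have hz : x ≤ Real.exp (β * CΛ * T) := Real.exp_le_exp.2 (by
    rw [mul_assoc]
    exact mul_le_mul_of_nonneg_left (mul_le_mul_of_nonneg_left hδT hCΛ.le) hβ.le)
  -- δ ≤ T makes the last quotient at least one; the factors J - 1 and exp(βC_Λδ) are at least one
  -- too, so C√|π| is bounded by the whole expression.
  have hratio : 1 ≤ Real.exp (β * CΛ * T) / (x - 1) := (one_le_div (by linarith)).2 (by linarith)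
  have hCm : 0 ≤ C * m := mul_nonneg hC hm
  have h1 : C * m ≤ Λ * (CΛ * (T / N)) ^ J + x * (C * m) := by
    have : 0 ≤ Λ * (CΛ * (T / N)) ^ J := by positivity
    nlinarith
  have h2 : C * m ≤ ((J : ℝ) - 1) * (Λ * (CΛ * (T / N)) ^ J + x * (C * m)) :=
    h1.trans (le_mul_of_one_le_left (hCm.trans h1) hJ2)
  exact h2.trans (le_mul_of_one_le_right (hCm.trans h2) hratio)

end constants

end MKV
-- Assembly of the theorem.
theorem mainTheorem5 (d : ℕ) (Λ α : ℝ) (hα : 1 ≤ α) :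
    ∃ CΛ > 0, ∃ cΛ > 0, ∃ B : ℝ → ℝ,
      ContinuousOn B (Ici 0) ∧ MonotoneOn B (Ici 0) ∧ B 0 = 0 ∧
      ∀ (T : ℝ), 0 < T → ∀ (c : Coeffs d) (U : ℝ → E d → Measure (E d) → ℝ) (D : Derivs d),
        H0 Λ c → H1 Λ α T c U D → (α = 1 ∨ BoundedData c) →
        ∃ C > 0,
          ∀ (N J : ℕ), 1 ≤ N → 1 ≤ J →
          ∀ (π : Grid T N) (Q : Quantization d Λ) (ξ : InitialLaw d) (β : ℝ),
            CΛ * (T / N) < min cΛ 1 →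
            0 < β → B (CΛ * (T / N)) ≤ β →
            ((J : ℝ) - 1) *
                (Λ * (CΛ * (T / N)) ^ J + Real.exp (β * (CΛ * (T / N))) * (C * √π.mesh)) *
                (Real.exp (β * CΛ * T) / (Real.exp (β * (CΛ * (T / N))) - 1)) ≤ 1 →
            ∃ y : Fin ξ.M → ℝ,
              (∀ Y, IsSolverOutput π Q ξ c J 0 (fun ω => ξ.x ω.1) Y ↔ Y = fun ω => y ω.1) ∧
              ∀ (x : E d) (μ : Measure (E d)), IsP2 μ →
              ∀ l : Fin ξ.M, (∀ l', ‖ξ.x l - x‖ ≤ ‖ξ.x l' - x‖) →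
                |U 0 x μ - U 0 (ξ.x l) ξ.measure| ≤
                  C * ((⨅ l', ‖ξ.x l' - x‖) + W2 ξ.measure μ) ∧
                |U 0 x μ - y l| ≤
                  C * ((⨅ l', ‖ξ.x l' - x‖) + W2 ξ.measure μ)
                    + |y l - U 0 (ξ.x l) ξ.measure| ∧
                (α = 1 → |y l - U 0 (ξ.x l) ξ.measure| ≤
                  C * ((C * (T / N)) ^ (J - 1) + √π.mesh * (T / N)⁻¹)
                    * (1 + ‖ξ.x l‖ + ξ.norm (2 * α))) ∧
                (BoundedData c → |y l - U 0 (ξ.x l) ξ.measure| ≤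
                  C * ((C * (T / N)) ^ (J - 1) + √π.mesh * (T / N)⁻¹
                    * (1 + ‖ξ.x l‖ + ξ.norm (2 * α) ^ α))) := by
  set L := 1 + |Λ| with hLd
  have hL : 1 ≤ L := by linarith [abs_nonneg Λ]
  have hL0 : 0 ≤ L := by linarith
  have hΛL : Λ ≤ L := by linarith [le_abs_self Λ]
  have hp0 := picC_nonneg hL
  have hpm := picC_le_momC hL
  have hg0 := groC_nonneg (L := L) (zero_le_one.trans hα)
  have hm0 : 0 ≤ momC L := by linarith
  -- This C_Λ makes both growth rates times δ at most one as soon as δ̄ < 1. The stability condition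
  -- is needed only through C√|π| ≤ 1 when J > 1, which it implies for every β > 0; the zero
  -- function is therefore admissible.
  refine ⟨momC L + groC L α + 1, by linarith, 1, one_pos, fun _ => 0, continuousOn_const,
    fun _ _ _ _ _ => le_rfl, rfl, ?_⟩
  intro T hT c U D h0Λ h1Λ _
  have hΛ0 : 0 ≤ Λ := (norm_nonneg _).trans (h0Λ.bdd_σ 0 _ (isP2_dirac 0))
  have h0 := h0Λ.mono hΛL
  have h1 := h1Λ.mono hΛL
  -- Both bounds are stated for all constants above a threshold, so that a single C serves both
  -- cases and the stability condition, in which C also appears.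
  obtain ⟨C₁, hC₁, H₁⟩ : ∃ C₁ > 0, α = 1 → ∀ C ≥ C₁, LinearBound Λ L T c U C := by
    by_cases h : α = 1
    · subst h
      obtain ⟨R, -, hR⟩ := exists_bigR h1 hT hL0 0
      obtain ⟨C₁, hC₁, H₁⟩ := exists_linearBound h0 h1 hR hL hΛL hT
      exact ⟨C₁, hC₁, fun _ => H₁⟩
    · exact ⟨1, one_pos, fun h' => absurd h' h⟩
  obtain ⟨C₂, hC₂, H₂⟩ : ∃ C₂ > 0, BoundedData c → ∀ C ≥ C₂, BoundedBound Λ L α T c U C := by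
    by_cases h : BoundedData c
    · obtain ⟨K, hg, hf⟩ := h
      have hK : DataBound K c := ⟨(abs_nonneg _).trans (hg 0 _ (isP2_dirac 0)), hg, hf⟩
      obtain ⟨R, hKR, hR⟩ := exists_bigR h1 hT hL0 (supM K L T)
      obtain ⟨C₂, hC₂, H₂⟩ := exists_boundedBound h0 h1 hR hL hΛL hT hα hK hKR
      exact ⟨C₂, hC₂, fun _ => H₂⟩
    · exact ⟨1, one_pos, fun h' => absurd h' h⟩
  -- The summand L covers the Lipschitz constant of U in ℰ₁.
  refine ⟨C₁ + C₂ + L, by linarith, ?_⟩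
  set C := C₁ + C₂ + L with hC
  intro N J hN hJ π Q ξ β hδ hβ _ hstab
  have hNpos : (1 : ℝ) ≤ N := by exact_mod_cast hN
  have hδ0 : 0 < T / N := by positivity
  rw [min_self] at hδ
  have hmδ : momC L * (T / N) ≤ 1 := by
    have := mul_nonneg hg0 hδ0.le
    linarith
  have hgδ : groC L α * (T / N) ≤ 1 := by
    have := mul_nonneg hm0 hδ0.le
    linarith
  have hpδ : picC L * (T / N) ≤ 1 / 1000 := by
    have := mul_le_mul_of_nonneg_right hpm hδ0.le
    linarith
  have hmesh := mesh_le_of_stability hN hJ hT hΛ0 (by linarith) (by linarith) hβ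
    (Real.sqrt_nonneg _) hstab
  have hh : ∀ i < π.n, 2 * L * π.h i < 1 := fun i hi => by
    have h2 : L * π.h i ≤ L * (T / N) := mul_le_mul_of_nonneg_left (π.h_le_of_lt hN i hi) hL0
    have h3 : L * (T / N) ≤ L ^ 4 * (T / N) :=
      mul_le_mul_of_nonneg_right (le_self_pow₀ hL (by norm_num)) hδ0.le
    rw [picC] at hpδ
    linarith
  obtain ⟨Y₀, hY₀⟩ := solver_wellPosed (Q := Q) (J := J) h0 hL0 hT hh N le_rfl 0 (zero_add N)
    (root π Q ξ)
  have hsol := (hY₀ Y₀).2 rfl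
  have hadj := adapted_solver_zero hT hN hJ hsol
  -- The output is constant on each tree and may be read on an arbitrary branch.
  let a₀ : Fin π.n → Fin Q.m := (Classical.arbitrary (Sample π Q ξ)).2
  have hconst : Y₀ = fun ω => Y₀ (ω.1, a₀) :=
    funext fun ω => hadj _ _ rfl fun s hs => absurd hs (Nat.not_lt_zero _)
  refine ⟨fun l => Y₀ (l, a₀), fun Y => ?_, ?_⟩
  · rw [← hconst]
    exact hY₀ Y
  intro x μ hμ l hl
  have hinf : ‖ξ.x l - x‖ ≤ ⨅ l', ‖ξ.x l' - x‖ := by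
    have : Nonempty (Fin ξ.M) := ⟨l⟩
    exact le_ciInf hl
  have hξ : IsP2 ξ.measure := by
    rw [← law_root (π := π) (Q := Q)]
    exact isP2_law _
  have e1 : |U 0 x μ - U 0 (ξ.x l) ξ.measure| ≤
      C * ((⨅ l', ‖ξ.x l' - x‖) + W2 ξ.measure μ) := by
    rw [abs_sub_comm]
    refine (h1.U_sub_le hL0 ⟨le_rfl, hT.le⟩ _ _ hξ hμ).trans ?_
    rw [← mul_add]
    have hW := W2_nonneg ξ.measure μ
    exact mul_le_mul (by linarith) (add_le_add hinf le_rfl)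
      (add_nonneg (norm_nonneg _) hW) (by linarith)
  refine ⟨e1, ?_, fun h => ?_, fun h => ?_⟩
  · have := abs_sub_le (U 0 x μ) (U 0 (ξ.x l) ξ.measure) (Y₀ (l, a₀))
    rw [abs_sub_comm (U 0 (ξ.x l) ξ.measure)] at this
    linarith
  · have := H₁ h C (by linarith) N J hN hJ π Q ξ hmδ hmesh Y₀ hsol (l, a₀)
    rw [h]
    exact this
  · exact H₂ h C (by linarith) N J hN hJ π Q ξ (by linarith) hgδ Y₀ hsol (l, a₀)
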